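/- Let $T\in C^2(\mathbb R^d)$ be real-valued, let $\Lambda_c(T)=\{T(\xi):\nabla T(\xi)=0\}$ be its set of critical values, and let $T(D)$ be the self-adjoint Fourier multiplier with symbol $T$ on $L^2(\mathbb R^d)$, with resolvent $R_0(z)=(T(D)-z)^{-1}$. Let $K$ be a compact subset of $\mathbb C\setminus\Lambda_c(T)$, and assume that for every $\lambda\in K\cap\mathbb R$ the Gaussian curvature (the determinant of the shape operator) of the level set $S_\lambda=\{\xi\in\mathbb R^d: T(\xi)=\lambda\}$ vanishes nowhere on $S_\lambda$. Let $\chi\in C_c^\infty(\mathbb R^d;\mathbb C)$, let $1\le p\le 2(d+1)/(d+3)$ and $1/p+1/p'=1$. Then there is a constant $C$, depending only on $d,p,K,T,\chi$, such that $$\|\chi(D)R_0(z)\|_{L^p\to L^{p'}}\le C\qquad\text{for all } z\in K .$$ Here, for $z\in K$ outside the spectrum $\sigma(T(D))=\overline{T(\mathbb R^d)}$, the estimate means $\|\chi(D)R_0(z)f\|_{L^{p'}}\le C\|f\|_{L^p}$ for all $f\in L^2\cap L^p$. For real $z=\lambda\in K$ it means that, for both signs and all $f\in L^2\cap L^p$,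 the limit $\chi(D)R_0(\lambda\pm i0)f=\lim_{\varepsilon\downarrow0}\chi(D)R_0(\lambda\pm i\varepsilon)f$ exists in the sense of tempered distributions, belongs to $L^{p'}$, and satisfies $\|\chi(D)R_0(\lambda\pm i0)f\|_{L^{p'}}\le C\|f\|_{L^p}$, with the same constant $C$. -/

import Mathlib

open MeasureTheory Filter Topology FourierTransform
open scoped ENNReal NNReal SchwartzMap ContDiff

noncomputable section

/-- The set of critical values of a real function `T` on `ℝ^d`. -/
def criticalValues {d : ℕ} (T : EuclideanSpace ℝ (Fin d) → ℝ) : Set ℝ :=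
  {t | ∃ ξ, T ξ = t ∧ fderiv ℝ T ξ = 0}

/-- The unit normal field `∇T / |∇T|` of the level sets of `T` (the Gauss map). It is meaningful at
the points where `∇T` does not vanish. -/
def unitNormal {d : ℕ} (T : EuclideanSpace ℝ (Fin d) → ℝ) (ξ : EuclideanSpace ℝ (Fin d)) :
    EuclideanSpace ℝ (Fin d) :=
  ‖gradient T ξ‖⁻¹ • gradient T ξ

/-- The tangent space at `ξ` of the level set of `T` through a regular point `ξ`: the orthogonal
complement of the gradient. -/
def levelTangent {d : ℕ} (T : EuclideanSpace ℝ (Fin d) → ℝ) (ξ : EuclideanSpace ℝ (Fin d)) :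
    Submodule ℝ (EuclideanSpace ℝ (Fin d)) :=
  (Submodule.span ℝ {gradient T ξ})ᗮ

/-- The shape operator (Weingarten map) at `ξ` of the level set of `T` through `ξ`: minus the
differential of the unit normal field, as an endomorphism of the tangent space. -/
def shapeOperator {d : ℕ} (T : EuclideanSpace ℝ (Fin d) → ℝ) (ξ : EuclideanSpace ℝ (Fin d)) :
    levelTangent T ξ →ₗ[ℝ] levelTangent T ξ :=
  -(((levelTangent T ξ).orthogonalProjectionOnto ∘L fderiv ℝ (unitNormal T) ξ ∘L
    (levelTangent T ξ).subtypeL : levelTangent T ξ →L[ℝ] levelTangent T ξ) :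
      levelTangent T ξ →ₗ[ℝ] levelTangent T ξ)

/-- The Gaussian curvature at `ξ` of the level set of `T` through a regular point `ξ`: the
determinant of the shape operator, i.e. the product of the `d - 1` principal curvatures. -/
def gaussianCurvature {d : ℕ} (T : EuclideanSpace ℝ (Fin d) → ℝ)
    (ξ : EuclideanSpace ℝ (Fin d)) : ℝ :=
  LinearMap.det (shapeOperator T ξ)

open Classical in
/-- The Fourier multiplier `m(D)` on `L²(ℝ^d)`: it sends `f` to the inverse Fourier transform of
`m · 𝓕 f`. The default value `0` is used only where `f` is not in the domain of `m(D)`, that is,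
where `m · 𝓕 f` is not in `L²`; for a bounded measurable symbol `m` this never happens. -/
def fourierMultiplier {d : ℕ} (m : EuclideanSpace ℝ (Fin d) → ℂ)
    (f : Lp ℂ 2 (volume : Measure (EuclideanSpace ℝ (Fin d)))) :
    Lp ℂ 2 (volume : Measure (EuclideanSpace ℝ (Fin d))) :=
  if h : MemLp (fun ξ => m ξ * (𝓕 f : Lp ℂ 2 (volume : Measure (EuclideanSpace ℝ (Fin d)))) ξ) 2
      volume then 𝓕⁻ (h.toLp _)
  else 0

/-- The spectrum of the self-adjoint operator `T(D)` on `L²(ℝ^d)` (for continuous real `T`): the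
closure of the range of the symbol. -/
def multiplierSpectrum {d : ℕ} (T : EuclideanSpace ℝ (Fin d) → ℝ) : Set ℂ :=
  closure (Set.range fun ξ => (T ξ : ℂ))

/-- The resolvent `R₀(z) = (T(D) - z)⁻¹` on `L²(ℝ^d)`, for `z` outside the spectrum of `T(D)`. -/
def freeResolvent {d : ℕ} (T : EuclideanSpace ℝ (Fin d) → ℝ) (z : ℂ)
    (f : Lp ℂ 2 (volume : Measure (EuclideanSpace ℝ (Fin d)))) :
    Lp ℂ 2 (volume : Measure (EuclideanSpace ℝ (Fin d))) :=
  fourierMultiplier (fun ξ => ((T ξ : ℂ) - z)⁻¹) f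

/-- The frequency-localised resolvent `χ(D) R₀(z)` on `L²(ℝ^d)`. -/
def localizedResolvent {d : ℕ} (χ : EuclideanSpace ℝ (Fin d) → ℂ)
    (T : EuclideanSpace ℝ (Fin d) → ℝ) (z : ℂ)
    (f : Lp ℂ 2 (volume : Measure (EuclideanSpace ℝ (Fin d)))) :
    Lp ℂ 2 (volume : Measure (EuclideanSpace ℝ (Fin d))) :=
  fourierMultiplier χ (freeResolvent T z f)

/-- The `L^p → L^q` norm of an operator `S` defined on `L²(ℝ^d)` is at most `C`: the inequality
`‖S f‖_q ≤ C ‖f‖_p` holds on `L² ∩ L^p` (a dense subspace of `L^p` if `p < ∞`). -/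
def LpLqNormLE {d : ℕ}
    (S : Lp ℂ 2 (volume : Measure (EuclideanSpace ℝ (Fin d))) →
      Lp ℂ 2 (volume : Measure (EuclideanSpace ℝ (Fin d))))
    (p q : ℝ≥0∞) (C : ℝ≥0) : Prop :=
  ∀ f : Lp ℂ 2 (volume : Measure (EuclideanSpace ℝ (Fin d))), MemLp f p volume →
    eLpNorm (S f) q volume ≤ C * eLpNorm f p volume

/-- `g` is the boundary value `χ(D) R₀(t + i σ 0) f`, where `σ = 1` or `σ = -1`: the limit of
`χ(D) R₀(t + i σ ε) f` as `ε ↓ 0` in the sense of tempered distributions. -/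
def IsBoundaryValue {d : ℕ} (χ : EuclideanSpace ℝ (Fin d) → ℂ)
    (T : EuclideanSpace ℝ (Fin d) → ℝ) (t σ : ℝ)
    (f : Lp ℂ 2 (volume : Measure (EuclideanSpace ℝ (Fin d))))
    (g : EuclideanSpace ℝ (Fin d) → ℂ) : Prop :=
  ∀ φ : 𝓢(EuclideanSpace ℝ (Fin d), ℂ),
    Tendsto (fun ε : ℝ => ∫ x, localizedResolvent χ T (t + σ * ε * Complex.I) f x * φ x)
      (𝓝[>] 0) (𝓝 (∫ x, g x * φ x))

end

/-! ### Oscillatory integrals with linear phase, and sums over unit windows. -/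

section Oscillatory

/-! By duality the estimate is a bound for the form `multiplierForm (cutoffResolvent χ T z) f g` by
`C ‖f‖_p ‖g‖_p`, uniform over nonreal `z`. A partition of unity localises it to small balls. Around
a point with `T ξ₀ ∉ K` the symbol is bounded for all relevant `z`. Around a point with `T ξ₀ ∈ K`
the gradient and the curvature do not vanish, and there the estimate holds for every nonreal `z`
(`exists_resolventBounded`).

In dimension `d ≥ 2` the local estimate comes from writing `1/(T - l - iε)` as `i ∫ exp(-is(T - l) -
εs) ds` over `s > 0` and cutting the integral at times `s ~ N = 2^j`. The kernel of a piece is `N`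
times an oscillatory integral in time and frequency jointly, with phase `N σ (T ξ - l)`. The Hessian
in `(σ, ξ)` is the bordered Hessian of `T`, which is nondegenerate at a regular point of
nonvanishing curvature (`exists_nondegenerateOn_ball`), so one expects kernel size `N ·
N^(-(d+1)/2)`. Together with the `L²` size `N` this singles out the Stein–Tomas exponent. Cutting
`f` and `g` into level sets and applying a Schur test to the double scale (time, height) makes the
sum over `N` converge at the endpoint itself.

As `T` is only `C²`, the expected kernel bound is not proved for `T` directly. Instead `T` is
averaged at scale `N^(-1/2) L⁻¹`. The averaged symbol obeys the kernel bound up to a factor `L^m`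
(`exists_norm_dyadic_kernel_le`), and the error of the replacement is `L⁻²` times a weight
controlled by the imaginary part of the resolvent, i.e. by a quantity of the kind to be estimated.
Hence a bound `X` for the imaginary part yields the bound `C (1 + X^(1-1/d) B^(m/d) + X B⁻²)` for
the resolvent, with `B` free (`exists_norm_resolventForm_le_of_poissonBounded`). For large `B` this
is at most `X/2 + K'`; iterating from the trivial bound `O(1/ε)` removes the dependence on `ε`
(`exists_norm_resolventForm_le_of_two_le`).

In dimension one the endpoint exponent is `1`, curvature plays no role, and the kernel is bounded by
comparing `T` with an affine function (`exists_norm_resolventForm_le_of_injective`). Exponents below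
the endpoint follow because all symbols live in a fixed compact set of frequencies
(`exists_formBound_of_le`).

For boundary values, integration by parts across the level sets shows that, for smooth data, the
derivative in `ε` is `O(ε^(-1/2))`, so the limits exist (`exists_tendsto_integral_mul_inv`). Density
and the uniform bound extend this to `L² ∩ L^p`. Since the outputs are band-limited they converge
pointwise, and Fatou's lemma transfers the norm bound (`exists_isBoundaryValue`). -/

theorem HasCompactSupport.fderiv_apply_const {V : Type*} [NormedAddCommGroup V]
    [NormedSpace ℝ V] {g : V → ℂ} (hc : HasCompactSupport g) (e : V) :
    HasCompactSupport fun u => fderiv ℝ g u e :=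
  (hc.fderiv (𝕜 := ℝ)).comp_left (g := fun A : V →L[ℝ] ℂ => A e) rfl

variable {V : Type*} [NormedAddCommGroup V] [NormedSpace ℝ V] [FiniteDimensional ℝ V]
  [MeasurableSpace V] [BorelSpace V]

/-- Repeated integration by parts against a linear phase. -/
theorem pow_mul_norm_integral_exp_mul_le {μ : Measure V} [μ.IsAddHaarMeasure] (ℓ : V →L[ℝ] ℝ)
    (e : V) (k : ℕ) {g : V → ℂ} (hg : ContDiff ℝ ∞ g) (hc : HasCompactSupport g) :
    |ℓ e| ^ k * ‖∫ u, Complex.exp (Complex.I * (ℓ u : ℂ)) * g u ∂μ‖ ≤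
      ‖e‖ ^ k * ∫ u, ‖iteratedFDeriv ℝ k g u‖ ∂μ := by
  induction k generalizing g with
  | zero =>
    simp only [pow_zero, one_mul, norm_iteratedFDeriv_zero]
    refine (norm_integral_le_integral_norm _).trans (le_of_eq ?_)
    congr 1 with u
    rw [norm_mul, mul_comm Complex.I, Complex.norm_exp_ofReal_mul_I, one_mul]
  | succ k ih =>
    have hcg := hg.continuous
    have hg1 : ContDiff ℝ ∞ fun u => fderiv ℝ g u e :=
      (hg.fderiv_right (m := ∞) (by simp)).clm_apply contDiff_const
    have hc1 := hc.fderiv_apply_const e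
    have hexp : ∀ u, HasFDerivAt (fun u => Complex.exp (Complex.I * (ℓ u : ℂ)))
        (Complex.exp (Complex.I * (ℓ u : ℂ)) • (Complex.I • (Complex.ofRealCLM.comp ℓ))) u := by
      intro u
      have h1 : HasFDerivAt (fun u => (ℓ u : ℂ)) (Complex.ofRealCLM.comp ℓ) u :=
        (Complex.ofRealCLM.comp ℓ).hasFDerivAt
      exact (h1.const_mul Complex.I).cexp
    have hcexp : Continuous fun u => Complex.exp (Complex.I * (ℓ u : ℂ)) := by fun_prop
    have hd : ∀ u, fderiv ℝ (fun u => Complex.exp (Complex.I * (ℓ u : ℂ))) u e =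
        Complex.I * (ℓ e : ℂ) * Complex.exp (Complex.I * (ℓ u : ℂ)) := by
      intro u
      rw [(hexp u).fderiv]
      simp [mul_comm, mul_assoc]
    have key : ∫ u, Complex.exp (Complex.I * (ℓ u : ℂ)) * fderiv ℝ g u e ∂μ =
        -(Complex.I * (ℓ e : ℂ) * ∫ u, Complex.exp (Complex.I * (ℓ u : ℂ)) * g u ∂μ) := by
      rw [integral_mul_fderiv_eq_neg_fderiv_mul_of_integrable]
      · simp_rw [hd, mul_assoc]
        rw [integral_const_mul, integral_const_mul]
      · simp_rw [hd]
        exact Continuous.integrable_of_hasCompactSupport (by fun_prop) (hc.mul_left)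
      · exact (hcexp.mul hg1.continuous).integrable_of_hasCompactSupport hc1.mul_left
      · exact (hcexp.mul hcg).integrable_of_hasCompactSupport hc.mul_left
      · exact fun u _ => (hexp u).differentiableAt
      · exact fun u _ => (hg.differentiable (by simp)) u
    have h2 := ih hg1 hc1
    rw [key, norm_neg, norm_mul, norm_mul, Complex.norm_I, one_mul, Complex.norm_real,
      Real.norm_eq_abs] at h2
    calc |ℓ e| ^ (k + 1) * ‖∫ u, Complex.exp (Complex.I * (ℓ u : ℂ)) * g u ∂μ‖
        = |ℓ e| ^ k * (|ℓ e| * ‖∫ u, Complex.exp (Complex.I * (ℓ u : ℂ)) * g u ∂μ‖) := by ring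
      _ ≤ ‖e‖ ^ k * ∫ u, ‖iteratedFDeriv ℝ k (fun u => fderiv ℝ g u e) u‖ ∂μ := h2
      _ ≤ ‖e‖ ^ k * ∫ u, ‖e‖ * ‖iteratedFDeriv ℝ (k + 1) g u‖ ∂μ := by
          refine mul_le_mul_of_nonneg_left (integral_mono_of_nonneg
            (Eventually.of_forall fun _ => norm_nonneg _) ?_ (Eventually.of_forall fun u => ?_))
            (by positivity)
          · refine (Continuous.integrable_of_hasCompactSupport ?_ ?_).const_mul _
            · exact (hg.continuous_iteratedFDeriv (by exact_mod_cast le_top)).norm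
            · exact (hc.iteratedFDeriv (𝕜 := ℝ) (k + 1)).norm
          · change ‖iteratedFDeriv ℝ k (fun u => fderiv ℝ g u e) u‖ ≤ _
            beta_reduce
            rw [← norm_iteratedFDeriv_fderiv]
            exact norm_iteratedFDeriv_clm_apply_const
              ((hg.fderiv_right (m := ∞) (by simp)).contDiffAt) (by exact_mod_cast le_top)
      _ = ‖e‖ ^ (k + 1) * ∫ u, ‖iteratedFDeriv ℝ (k + 1) g u‖ ∂μ := by
          rw [integral_const_mul]; ring

/-- If the integral `I` is nonzero, the directional estimate reads `|ℓ e| ≤ (J / I)^(1/k) ‖e‖` for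
every `e`, which bounds the operator norm of `ℓ` without a norm-attaining vector. -/
theorem norm_pow_mul_norm_integral_exp_mul_le {μ : Measure V} [μ.IsAddHaarMeasure]
    (ℓ : V →L[ℝ] ℝ) {k : ℕ} (hk : k ≠ 0) {g : V → ℂ} (hg : ContDiff ℝ ∞ g)
    (hc : HasCompactSupport g) :
    ‖ℓ‖ ^ k * ‖∫ u, Complex.exp (Complex.I * (ℓ u : ℂ)) * g u ∂μ‖ ≤
      ∫ u, ‖iteratedFDeriv ℝ k g u‖ ∂μ := by
  set I := ‖∫ u, Complex.exp (Complex.I * (ℓ u : ℂ)) * g u ∂μ‖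
  set J := ∫ u, ‖iteratedFDeriv ℝ k g u‖ ∂μ
  have hJ : 0 ≤ J := integral_nonneg fun _ => norm_nonneg _
  have hI : 0 ≤ I := norm_nonneg _
  rcases hI.eq_or_lt with h0 | h0
  · rw [← h0]; simpa using hJ
  have h : ‖ℓ‖ ≤ (J / I) ^ ((k : ℝ)⁻¹) := by
    refine ℓ.opNorm_le_bound (by positivity) fun e => ?_
    have h1 : |ℓ e| ^ k ≤ ((J / I) ^ ((k : ℝ)⁻¹) * ‖e‖) ^ k := by
      rw [mul_pow, Real.rpow_inv_natCast_pow (by positivity) hk, div_mul_eq_mul_div,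
        le_div_iff₀ h0, mul_comm J]
      exact pow_mul_norm_integral_exp_mul_le ℓ e k hg hc
    exact le_of_pow_le_pow_left₀ hk (by positivity) h1
  calc ‖ℓ‖ ^ k * I ≤ ((J / I) ^ ((k : ℝ)⁻¹)) ^ k * I := by gcongr
    _ = J := by
      rw [Real.rpow_inv_natCast_pow (by positivity) hk]; field_simp

/-- Decay of an oscillatory integral with linear phase and amplitude supported in the unit ball. -/
theorem one_add_norm_pow_mul_norm_integral_exp_mul_le (μ : Measure V) [μ.IsAddHaarMeasure]
    {k : ℕ} (hk : k ≠ 0) (ℓ : V →L[ℝ] ℝ) {g : V → ℂ} (hg : ContDiff ℝ ∞ g)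
    (hs : ∀ u, 1 < ‖u‖ → g u = 0) {B : ℝ}
    (hB : ∀ i ≤ k, ∀ u, ‖iteratedFDeriv ℝ i g u‖ ≤ B) :
    ‖∫ u, Complex.exp (Complex.I * (ℓ u : ℂ)) * g u ∂μ‖ ≤
      2 ^ k * μ.real (Metric.closedBall 0 1) * B * (1 + ‖ℓ‖) ^ (-(k : ℝ)) := by
  have hsupp : Function.support g ⊆ Metric.closedBall 0 1 := by
    intro u hu
    by_contra h
    exact hu (hs u (by simpa using h))
  have hc : HasCompactSupport g :=
    HasCompactSupport.of_support_subset_isCompact (isCompact_closedBall 0 1) hsupp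
  have hts : tsupport g ⊆ Metric.closedBall 0 1 :=
    closure_minimal hsupp Metric.isClosed_closedBall
  have hint : ∀ i ≤ k, ∫ u, ‖iteratedFDeriv ℝ i g u‖ ∂μ ≤ μ.real (Metric.closedBall 0 1) * B := by
    intro i hi
    have h0 : ∀ u, u ∉ Metric.closedBall (0 : V) 1 → ‖iteratedFDeriv ℝ i g u‖ = 0 := by
      intro u hu
      rw [norm_eq_zero]
      by_contra h
      exact hu (hts (support_iteratedFDeriv_subset i h))
    rw [← setIntegral_eq_integral_of_forall_compl_eq_zero h0]
    have := norm_setIntegral_le_of_norm_le_const (μ := μ) (s := Metric.closedBall (0 : V) 1)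
      (f := fun u => ‖iteratedFDeriv ℝ i g u‖) (C := B) measure_closedBall_lt_top
      (fun u _ => by rw [norm_norm]; exact hB i hi u)
    rw [mul_comm]
    exact (Real.le_norm_self _).trans this
  set I := ‖∫ u, Complex.exp (Complex.I * (ℓ u : ℂ)) * g u ∂μ‖ with hI
  have h1 : I ≤ μ.real (Metric.closedBall 0 1) * B := by
    have := pow_mul_norm_integral_exp_mul_le (μ := μ) ℓ 0 0 hg hc
    simp only [pow_zero, one_mul] at this
    exact this.trans (hint 0 (Nat.zero_le _))
  have h2 : ‖ℓ‖ ^ k * I ≤ μ.real (Metric.closedBall 0 1) * B :=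
    (norm_pow_mul_norm_integral_exp_mul_le ℓ hk hg hc).trans (hint k le_rfl)
  have h3 : (1 + ‖ℓ‖) ^ k ≤ 2 ^ (k - 1) * (1 ^ k + ‖ℓ‖ ^ k) :=
    add_pow_le zero_le_one (norm_nonneg _) k
  rw [Real.rpow_neg (by positivity), Real.rpow_natCast, ← div_eq_mul_inv,
    le_div_iff₀ (by positivity)]
  have hI0 : 0 ≤ I := norm_nonneg _
  calc I * (1 + ‖ℓ‖) ^ k ≤ I * (2 ^ (k - 1) * (1 ^ k + ‖ℓ‖ ^ k)) := by gcongr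
    _ = 2 ^ (k - 1) * (I + ‖ℓ‖ ^ k * I) := by ring
    _ ≤ 2 ^ (k - 1) * (μ.real (Metric.closedBall 0 1) * B + μ.real (Metric.closedBall 0 1) * B) := by
        gcongr
    _ = 2 ^ (k - 1 + 1) * μ.real (Metric.closedBall 0 1) * B := by ring
    _ = _ := by rw [Nat.sub_add_cancel (Nat.pos_of_ne_zero hk)]

/-- An integral decomposed into unit windows, each of which is an oscillatory integral with a linear
phase; the phases at different windows are quantitatively different. -/
theorem norm_integral_le_of_windows (μ : Measure V) [μ.IsAddHaarMeasure] {k : ℕ}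
    (hk : Module.finrank ℝ V < k) {κ : ℝ} (hκ : 0 < κ) :
    ∃ C : ℝ, 0 ≤ C ∧ ∀ (F : V → ℂ) (η : V → ℝ) (c : V → ℂ) (ℓ : V → (V →L[ℝ] ℝ)) (g : V → V → ℂ)
      (S : Set V) (B : ℝ), 0 ≤ B → Continuous F → HasCompactSupport F → Continuous η →
      HasCompactSupport η → ∫ u, η u ∂μ = 1 →
      (∀ z u, F (z + u) * η u = c z * Complex.exp (Complex.I * (ℓ z u : ℂ)) * g z u) →
      (∀ z, ‖c z‖ ≤ 1) → (∀ z ∈ S, ContDiff ℝ ∞ (g z)) → (∀ z u, 1 < ‖u‖ → g z u = 0) →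
      (∀ z ∉ S, ∀ u, F (z + u) * η u = 0) →
      (∀ z ∈ S, ∀ i ≤ k, ∀ u, ‖iteratedFDeriv ℝ i (g z) u‖ ≤ B) →
      (∀ z ∈ S, ∀ z' ∈ S, κ * ‖z - z'‖ ≤ ‖ℓ z - ℓ z'‖) → ‖∫ u, F u ∂μ‖ ≤ C * B := by
  have hk0 : k ≠ 0 := by omega
  set c1 : ℝ := 2 ^ k * μ.real (Metric.closedBall 0 1)
  -- From `κ ‖z - z0‖ ≤ ‖ℓ z‖ + ‖ℓ z0‖ ≤ 2 ‖ℓ z‖ + 1` this choice gives `κ' (1 + ‖z - z0‖) ≤ 1 + ‖ℓ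
  -- z‖`.
  set κ' : ℝ := min (1 / 2) (κ / 3)
  have hκ' : 0 < κ' := by positivity
  have hinti : Integrable (fun z : V => (1 + ‖z‖) ^ (-(k : ℝ))) μ :=
    integrable_one_add_norm (by exact_mod_cast hk)
  refine ⟨c1 * κ' ^ (-(k : ℝ)) * ∫ z : V, (1 + ‖z‖) ^ (-(k : ℝ)) ∂μ, by positivity, ?_⟩
  intro F η c ℓ g S B hB hF hFc hη hηc hη1 hfac hc hg hgs hS hgB hND
  have hFi : Integrable F μ := hF.integrable_of_hasCompactSupport hFc
  -- the window decomposition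
  have hconv : ∫ u, F u ∂μ = ∫ z, ∫ u, F (z + u) * η u ∂μ ∂μ := by
    have hη' : Integrable (fun u => (η (-u) : ℂ)) μ := by
      have : Integrable (fun u => (η u : ℂ)) μ :=
        (hη.integrable_of_hasCompactSupport hηc).ofReal
      exact this.comp_neg
    have := integral_convolution (μ := μ) (ν := μ) (ContinuousLinearMap.mul ℝ ℂ) hη' hFi
    have h1 : ∫ u, (η (-u) : ℂ) ∂μ = 1 := by
      rw [integral_neg_eq_self (fun u => (η u : ℂ)) μ, integral_complex_ofReal, hη1]; simp
    rw [h1] at this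
    simp only [ContinuousLinearMap.mul_apply', one_mul] at this
    rw [← this]
    congr 1 with z
    rw [convolution_def, ← integral_neg_eq_self]
    congr 1 with u
    simp [mul_comm]
  by_cases hSe : S.Nonempty
  swap
  · rw [hconv]
    have : ∀ z, ∫ u, F (z + u) * η u ∂μ = 0 := by
      intro z
      rw [integral_congr_ae (Eventually.of_forall (hS z fun h => hSe ⟨z, h⟩)), integral_zero]
    simp only [this, integral_zero, norm_zero]
    positivity
  -- A window whose frequency is minimal up to `1`. Separation of the frequencies then becomes
  -- growth of `‖ℓ z‖` away from `z0`, so the window integrals decay like `(1 + ‖z - z0‖)^(-k)` and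
  -- are integrable in `z`.
  obtain ⟨z0, hz0, hmin⟩ : ∃ z0 ∈ S, ∀ z ∈ S, ‖ℓ z0‖ ≤ ‖ℓ z‖ + 1 := by
    have hne : ((fun z => ‖ℓ z‖) '' S).Nonempty := hSe.image _
    have hbd : BddBelow ((fun z => ‖ℓ z‖) '' S) := ⟨0, by rintro _ ⟨z, _, rfl⟩; exact norm_nonneg _⟩
    obtain ⟨_, ⟨z0, hz0, rfl⟩, h⟩ := Real.lt_sInf_add_pos hne one_pos
    exact ⟨z0, hz0, fun z hz => h.le.trans (by
      have := csInf_le hbd ⟨z, hz, rfl⟩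
      simp only at this ⊢; linarith)⟩
  have hlow : ∀ z ∈ S, κ' * (1 + ‖z - z0‖) ≤ 1 + ‖ℓ z‖ := by
    intro z hz
    have h1 := hND z hz z0 hz0
    have h2 := hmin z hz
    have h3 : ‖ℓ z - ℓ z0‖ ≤ ‖ℓ z‖ + ‖ℓ z0‖ := norm_sub_le _ _
    have h4 : κ' ≤ 1 / 2 := min_le_left _ _
    have h5 : κ' * ‖z - z0‖ ≤ κ / 3 * ‖z - z0‖ := by gcongr; exact min_le_right _ _
    have h6 := norm_nonneg (ℓ z)
    nlinarith
  have hpt : ∀ z, ‖∫ u, F (z + u) * η u ∂μ‖ ≤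
      c1 * B * κ' ^ (-(k : ℝ)) * (1 + ‖z - z0‖) ^ (-(k : ℝ)) := by
    intro z
    by_cases hz : z ∈ S
    · have h1 : ∫ u, F (z + u) * η u ∂μ =
          c z * ∫ u, Complex.exp (Complex.I * (ℓ z u : ℂ)) * g z u ∂μ := by
        simp_rw [hfac, mul_assoc]
        rw [integral_const_mul]
      rw [h1, norm_mul]
      have h2 := one_add_norm_pow_mul_norm_integral_exp_mul_le μ hk0 (ℓ z) (hg z hz) (hgs z)
        (hgB z hz)
      have h3 : (1 + ‖ℓ z‖) ^ (-(k : ℝ)) ≤ (κ' * (1 + ‖z - z0‖)) ^ (-(k : ℝ)) :=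
        Real.rpow_le_rpow_of_nonpos (by positivity) (hlow z hz) (by simp)
      rw [Real.mul_rpow (by positivity) (by positivity)] at h3
      calc _ ≤ 1 * (c1 * B * (1 + ‖ℓ z‖) ^ (-(k : ℝ))) := by gcongr; exact hc z
        _ ≤ 1 * (c1 * B * (κ' ^ (-(k : ℝ)) * (1 + ‖z - z0‖) ^ (-(k : ℝ)))) := by gcongr
        _ = _ := by ring
    · rw [integral_congr_ae (Eventually.of_forall (hS z hz)), integral_zero, norm_zero]
      positivity
  rw [hconv]
  calc ‖∫ z, ∫ u, F (z + u) * η u ∂μ ∂μ‖ ≤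
        ∫ z, c1 * B * κ' ^ (-(k : ℝ)) * (1 + ‖z - z0‖) ^ (-(k : ℝ)) ∂μ :=
        norm_integral_le_of_norm_le ((hinti.comp_sub_right z0).const_mul _)
          (Eventually.of_forall hpt)
    _ = c1 * B * κ' ^ (-(k : ℝ)) * ∫ z : V, (1 + ‖z‖) ^ (-(k : ℝ)) ∂μ := by
        rw [integral_const_mul, integral_sub_right_eq_self (fun z : V => (1 + ‖z‖) ^ (-(k : ℝ)))]
    _ = _ := by ring

end Oscillatory

/-! ### Bounds for derivatives of products, exponentials and compositions. -/

section DerivativeBounds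

variable {V : Type*} [NormedAddCommGroup V] [NormedSpace ℝ V]

theorem norm_iteratedFDeriv_mul_le_two_pow {A : Type*} [NormedRing A] [NormedAlgebra ℝ A] {f h : V → A} {k : ℕ}
    {x : V} {a b : ℝ} (hf : ContDiff ℝ ∞ f) (hh : ContDiff ℝ ∞ h)
    (ha : ∀ i ≤ k, ‖iteratedFDeriv ℝ i f x‖ ≤ a) (hb : ∀ i ≤ k, ‖iteratedFDeriv ℝ i h x‖ ≤ b) :
    ∀ i ≤ k, ‖iteratedFDeriv ℝ i (fun y => f y * h y) x‖ ≤ 2 ^ k * a * b := by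
  intro i hi
  have ha0 : 0 ≤ a := (norm_nonneg _).trans (ha 0 (Nat.zero_le _))
  have hb0 : 0 ≤ b := (norm_nonneg _).trans (hb 0 (Nat.zero_le _))
  refine (norm_iteratedFDeriv_mul_le hf hh x (n := i) (by exact_mod_cast le_top)).trans ?_
  calc _ ≤ ∑ j ∈ Finset.range (i + 1), (i.choose j : ℝ) * a * b := by
        refine Finset.sum_le_sum fun j hj => ?_
        have hj' : j ≤ i := Nat.lt_succ_iff.mp (Finset.mem_range.mp hj)
        gcongr
        · exact ha j (hj'.trans hi)
        · exact hb (i - j) ((Nat.sub_le _ _).trans hi)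
    _ = 2 ^ i * a * b := by
        rw [← Finset.sum_mul, ← Finset.sum_mul]
        congr 2
        exact_mod_cast Nat.sum_range_choose i
    _ ≤ _ := by gcongr; norm_num

theorem norm_iteratedFDeriv_clm_le {W : Type*} [NormedAddCommGroup W] [NormedSpace ℝ W]
    (ℓ : V →L[ℝ] W) (x : V) (i : ℕ) : ‖iteratedFDeriv ℝ i ℓ x‖ ≤ ‖ℓ‖ * (1 + ‖x‖) := by
  have h0 := norm_nonneg x
  have h1 := norm_nonneg ℓ
  match i with
  | 0 =>
    rw [norm_iteratedFDeriv_zero]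
    exact (ℓ.le_opNorm x).trans (by gcongr; linarith)
  | 1 =>
    rw [← zero_add 1, ← norm_iteratedFDeriv_fderiv, norm_iteratedFDeriv_zero, ℓ.fderiv]
    nlinarith
  | i + 2 =>
    rw [← norm_iteratedFDeriv_fderiv]
    have : fderiv ℝ (ℓ : V → W) = fun _ => ℓ := by ext1 y; exact ℓ.fderiv
    rw [this, iteratedFDeriv_const_of_ne (by omega)]
    simp; positivity

/-- All derivatives of `t ↦ exp (it)` have modulus one, so only derivatives of `f` of order at least
one enter; the size of `f` itself is irrelevant. -/
theorem norm_iteratedFDeriv_exp_I_mul_le {f : V → ℝ} {k : ℕ} {x : V} {D : ℝ} (hD : 1 ≤ D)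
    (hf : ContDiff ℝ ∞ f) (h : ∀ i ≤ k, 1 ≤ i → ‖iteratedFDeriv ℝ i f x‖ ≤ D) :
    ∀ i ≤ k, ‖iteratedFDeriv ℝ i (fun y => Complex.exp (Complex.I * (f y : ℂ))) x‖ ≤
      k.factorial * D ^ k := by
  intro i hi
  have hG : ContDiff ℝ ∞ (fun t : ℝ => Complex.exp (Complex.I * (t : ℂ))) :=
    (contDiff_const.mul Complex.ofRealCLM.contDiff).cexp
  have hiter : ∀ n, iteratedDeriv n (fun t : ℝ => Complex.exp (Complex.I * (t : ℂ))) =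
      fun t : ℝ => Complex.I ^ n * Complex.exp (Complex.I * (t : ℂ)) := by
    intro n
    induction n with
    | zero => simp
    | succ n ih =>
      rw [iteratedDeriv_succ, ih]
      ext t
      have h1 : HasDerivAt (fun t : ℝ => Complex.exp (Complex.I * (t : ℂ)))
          (Complex.exp (Complex.I * (t : ℂ)) * (Complex.I * 1)) t :=
        ((Complex.ofRealCLM.hasDerivAt (x := t)).const_mul Complex.I).cexp
      rw [(h1.const_mul _).deriv]
      ring
  have := norm_iteratedFDeriv_comp_le hG hf (n := i) (by exact_mod_cast le_top) x (C := 1) (D := D)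
    (fun j _ => by
      rw [norm_iteratedFDeriv_eq_norm_iteratedDeriv, hiter]
      rw [norm_mul, norm_pow, Complex.norm_I, one_pow, one_mul, mul_comm Complex.I,
        Complex.norm_exp_ofReal_mul_I])
    (fun j hj1 hj => (h j (hj.trans hi) hj1).trans (le_self_pow₀ hD (by omega)))
  refine this.trans ?_
  have h1 : (i.factorial : ℝ) ≤ k.factorial := by exact_mod_cast Nat.factorial_le hi
  rw [mul_one]
  gcongr

theorem norm_iteratedFDeriv_comp_clm_add_le {U W : Type*} [NormedAddCommGroup W] [NormedSpace ℝ W]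
    [NormedAddCommGroup U] [NormedSpace ℝ U] {f : U → W} (hf : ContDiff ℝ ∞ f) (A : V →L[ℝ] U)
    (hA : ‖A‖ ≤ 1) (b : U) (x : V) (i : ℕ) :
    ‖iteratedFDeriv ℝ i (fun y => f (b + A y)) x‖ ≤ ‖iteratedFDeriv ℝ i f (b + A x)‖ := by
  have h1 : (fun y => f (b + A y)) = (fun u => f (b + u)) ∘ A := rfl
  have h2 : ContDiff ℝ ∞ fun u => f (b + u) := hf.comp (contDiff_const.add contDiff_id)
  rw [h1, A.iteratedFDeriv_comp_right h2 x (by exact_mod_cast le_top)]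
  refine (ContinuousMultilinearMap.norm_compContinuousLinearMap_le _ _).trans ?_
  rw [iteratedFDeriv_comp_add_left]
  refine mul_le_of_le_one_right (norm_nonneg _) (Finset.prod_le_one (fun _ _ => norm_nonneg _)
    fun _ _ => hA)

end DerivativeBounds

/-! ### Derivatives of convolutions. -/

section ConvolutionBounds

variable {E : Type} [NormedAddCommGroup E] [NormedSpace ℝ E] [FiniteDimensional ℝ E]
  [MeasurableSpace E] [BorelSpace E]

/-- Every derivative falls on the smooth factor. Each differentiation replaces the value space `F`
by `E →L[ℝ] F`, so the induction must quantify over the value spaces and over `L`. -/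
theorem norm_iteratedFDeriv_convolution_le (μ : Measure E) [μ.IsAddHaarMeasure] {f : E → ℝ}
    (hf : Continuous f) (i : ℕ) : ∀ {F G : Type} [NormedAddCommGroup F] [NormedSpace ℝ F]
    [NormedAddCommGroup G] [NormedSpace ℝ G] [CompleteSpace G] (L : F →L[ℝ] ℝ →L[ℝ] G) {φ : E → F}, ContDiff ℝ ∞ φ →
    HasCompactSupport φ → ∀ x, ‖iteratedFDeriv ℝ i (convolution φ f L μ) x‖ ≤
      ‖L‖ * ∫ y, ‖iteratedFDeriv ℝ i φ y‖ * |f (x - y)| ∂μ := by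
  induction i with
  | zero =>
    intro F G _ _ _ _ _ L φ hφ hφc x
    simp only [norm_iteratedFDeriv_zero]
    rw [convolution_def, ← integral_const_mul]
    refine norm_integral_le_of_norm_le (Continuous.integrable_of_hasCompactSupport ?_ ?_)
      (Eventually.of_forall fun y => ?_)
    · have := hφ.continuous; fun_prop
    · exact (hφc.norm.mul_right).mul_left
    · calc _ ≤ ‖L‖ * ‖φ y‖ * ‖f (x - y)‖ := L.le_opNorm₂ _ _
        _ = _ := by rw [Real.norm_eq_abs, mul_assoc]
  | succ i ih =>
    intro F G _ _ _ _ _ L φ hφ hφc x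
    rw [← norm_iteratedFDeriv_fderiv]
    have h1 : fderiv ℝ (convolution φ f L μ) =
        convolution (fderiv ℝ φ) f (L.precompL E) μ := by
      ext1 y
      exact (hφc.hasFDerivAt_convolution_left L (hφ.of_le (by simp)) hf.locallyIntegrable y).fderiv
    rw [h1]
    refine (ih (L.precompL E) (hφ.fderiv_right (m := ∞) (by simp)) (hφc.fderiv (𝕜 := ℝ)) x).trans ?_
    simp_rw [norm_iteratedFDeriv_fderiv]
    exact mul_le_mul_of_nonneg_right (L.norm_precompL_le E)
      (integral_nonneg fun y => by positivity)

end ConvolutionBounds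

/-! ### Mollification of the symbol and its second order Taylor remainder. -/

/-- A smooth even probability density supported in the ball of radius `r`. -/
structure IsMollifier {V : Type*} [NormedAddCommGroup V] [NormedSpace ℝ V] [MeasurableSpace V]
    (μ : Measure V) (r : ℝ) (η : V → ℝ) : Prop where
  contDiff : ContDiff ℝ ∞ η
  support : ∀ u, r ≤ ‖u‖ → η u = 0
  nonneg : ∀ u, 0 ≤ η u
  even : ∀ u, η (-u) = η u
  integral_eq_one : ∫ u, η u ∂μ = 1

section Mollifier

variable {V : Type*} [NormedAddCommGroup V] [NormedSpace ℝ V] [FiniteDimensional ℝ V]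
  [MeasurableSpace V] [BorelSpace V]

theorem exists_isMollifier (μ : Measure V) [μ.IsAddHaarMeasure] {r : ℝ} (hr : 0 < r) :
    ∃ η : V → ℝ, IsMollifier μ r η := by
  let b : ContDiffBump (0 : V) := ⟨r / 2, r, by positivity, by linarith⟩
  refine ⟨b.normed μ, b.contDiff_normed, fun u hu => ?_, fun u => b.nonneg_normed u,
    fun u => b.normed_neg u, b.integral_normed⟩
  have : u ∉ Function.support (b.normed μ) := by
    rw [b.support_normed_eq]; simpa using hu
  simpa using this

variable {μ : Measure V} [μ.IsAddHaarMeasure] {η : V → ℝ} {r : ℝ}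

omit [MeasurableSpace V] [BorelSpace V] in
theorem hasCompactSupport_of_norm_le {F : Type*} [Zero F] {f : V → F}
    (h : ∀ u, r ≤ ‖u‖ → f u = 0) : HasCompactSupport f :=
  HasCompactSupport.of_support_subset_isCompact (isCompact_closedBall 0 r) fun u hu => by
    rw [mem_closedBall_zero_iff]
    by_contra hlt
    exact hu (h u (not_le.mp hlt).le)

omit [BorelSpace V] [μ.IsAddHaarMeasure] in
theorem IsMollifier.hasCompactSupport (h : IsMollifier μ r η) : HasCompactSupport η :=
  hasCompactSupport_of_norm_le h.support

theorem IsMollifier.integrable (h : IsMollifier μ r η) : Integrable η μ :=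
  h.contDiff.continuous.integrable_of_hasCompactSupport h.hasCompactSupport

/-- Evenness kills first moments. This makes the error of mollification quadratic in the scale and
leaves affine functions unchanged. -/
theorem IsMollifier.integral_mul_clm (h : IsMollifier μ r η) (A : V →L[ℝ] ℝ) :
    ∫ y, η y * A y ∂μ = 0 := by
  have h1 := integral_neg_eq_self (fun y => η y * A y) μ
  simp only [h.even, map_neg, mul_neg, integral_neg] at h1
  linarith

end Mollifier

/-- The average of `T` over the ball of radius `δ`, with density `η`. -/
noncomputable def mollify {V : Type*} [NormedAddCommGroup V] [NormedSpace ℝ V] [MeasurableSpace V]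
    (μ : Measure V) (η : V → ℝ) (T : V → ℝ) (δ : ℝ) (ξ : V) : ℝ :=
  ∫ y, η y * T (ξ - δ • y) ∂μ

section MollifyBounds

variable {E : Type} [NormedAddCommGroup E] [NormedSpace ℝ E] [FiniteDimensional ℝ E]
  [MeasurableSpace E] [BorelSpace E] {μ : Measure E} [μ.IsAddHaarMeasure] {η : E → ℝ} {T : E → ℝ}
  {M : ℝ}

theorem integrable_mollifier_mul (hη : IsMollifier μ 1 η) {f : E → ℝ} (hf : Continuous f) :
    Integrable (fun y => η y * f y) μ :=
  (hη.contDiff.continuous.mul hf).integrable_of_hasCompactSupport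
    hη.hasCompactSupport.mul_right

/-- The linear Taylor term integrates to zero, which leaves the quadratic remainder. At scale `δ =
s⁻¹ L⁻¹` the error, multiplied by the time `s²`, is `M L⁻²`. -/
theorem abs_mollify_sub_le (hη : IsMollifier μ 1 η) (hT : Continuous T) (hM : 0 ≤ M)
    (h2 : ∀ ξ v, |T (ξ + v) - T ξ - fderiv ℝ T ξ v| ≤ M * ‖v‖ ^ 2) (δ : ℝ) (ξ : E) :
    |mollify μ η T δ ξ - T ξ| ≤ M * δ ^ 2 := by
  have h3 : mollify μ η T δ ξ - T ξ =
      ∫ y, η y * (T (ξ + (-δ) • y) - T ξ - fderiv ℝ T ξ ((-δ) • y)) ∂μ := by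
    have e1 : ∀ y, η y * (T (ξ + (-δ) • y) - T ξ - fderiv ℝ T ξ ((-δ) • y)) =
        η y * T (ξ - δ • y) - η y * T ξ - η y * ((-δ) • fderiv ℝ T ξ) y := by
      intro y
      rw [neg_smul, ← sub_eq_add_neg, map_neg, map_smul]
      simp; ring
    simp_rw [e1]
    rw [integral_sub, integral_sub, hη.integral_mul_clm, integral_mul_const, hη.integral_eq_one]
    · simp [mollify]
    · exact integrable_mollifier_mul hη (by fun_prop)
    · exact hη.integrable.mul_const _
    · exact (integrable_mollifier_mul hη (by fun_prop)).sub (hη.integrable.mul_const _)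
    · exact integrable_mollifier_mul hη (by fun_prop)
  rw [h3, ← Real.norm_eq_abs]
  calc _ ≤ ∫ y, η y * (M * δ ^ 2) ∂μ := by
        refine norm_integral_le_of_norm_le (hη.integrable.mul_const _)
          (Eventually.of_forall fun y => ?_)
        rw [norm_mul, Real.norm_eq_abs, Real.norm_eq_abs, abs_of_nonneg (hη.nonneg y)]
        by_cases hy : 1 ≤ ‖y‖
        · simp [hη.support y hy]
        · refine mul_le_mul_of_nonneg_left ((h2 _ _).trans ?_) (hη.nonneg y)
          rw [norm_smul, mul_pow]
          have : ‖y‖ ^ 2 ≤ 1 := pow_le_one₀ (norm_nonneg _) (not_le.mp hy).le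
          have h4 : ‖-δ‖ ^ 2 = δ ^ 2 := by simp
          rw [h4]
          gcongr
          nlinarith [sq_nonneg δ]
    _ = M * δ ^ 2 := by rw [integral_mul_const, hη.integral_eq_one, one_mul]

/-- The second order Taylor remainder of `T` at `ζ` at scale `1 / s`, averaged at scale `1 / L`. -/
noncomputable def taylorRemainder (μ : Measure E) (η T : E → ℝ) (s L : ℝ) (ζ : E) : E → ℝ :=
  convolution (fun y => L ^ Module.finrank ℝ E * η (L • y))
    (fun v => s ^ 2 * (T (ζ + s⁻¹ • v) - T ζ - fderiv ℝ T ζ (s⁻¹ • v)))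
    (ContinuousLinearMap.mul ℝ ℝ) μ

/-- Averaging preserves the affine Taylor polynomial of `T` at `ζ`, so in a window of width `1 / s`
the averaged symbol is that polynomial plus `s⁻²` times a smooth function whose derivatives are
bounded independently of `s`. -/
theorem mollify_eq_add_taylorRemainder (hη : IsMollifier μ 1 η) (hT : Continuous T) {s L : ℝ}
    (hs : 0 < s) (hL : 0 < L) (ζ v : E) :
    mollify μ η T (s⁻¹ * L⁻¹) (ζ + s⁻¹ • v) =
      T ζ + s⁻¹ * fderiv ℝ T ζ v + (s ^ 2)⁻¹ * taylorRemainder μ η T s L ζ v := by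
  have h1 : taylorRemainder μ η T s L ζ v =
      ∫ y, η y * (s ^ 2 * (T (ζ + s⁻¹ • (v - L⁻¹ • y)) - T ζ -
        fderiv ℝ T ζ (s⁻¹ • (v - L⁻¹ • y)))) ∂μ := by
    set G : E → ℝ := fun y => η y * (s ^ 2 * (T (ζ + s⁻¹ • (v - L⁻¹ • y)) - T ζ -
        fderiv ℝ T ζ (s⁻¹ • (v - L⁻¹ • y))))
    have h2 := Measure.integral_comp_smul μ G L
    rw [abs_of_pos (by positivity), smul_eq_mul] at h2
    have h3 : ∫ y, G y ∂μ = L ^ Module.finrank ℝ E * ∫ y, G (L • y) ∂μ := by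
      rw [h2]; field_simp
    rw [h3, ← integral_const_mul, taylorRemainder, convolution_def]
    congr 1 with y
    simp only [G, ContinuousLinearMap.mul_apply', inv_smul_smul₀ hL.ne']
    ring
  have h2 : ∀ y, η y * (s ^ 2 * (T (ζ + s⁻¹ • (v - L⁻¹ • y)) - T ζ -
        fderiv ℝ T ζ (s⁻¹ • (v - L⁻¹ • y)))) =
      s ^ 2 * (η y * T (ζ + s⁻¹ • v - (s⁻¹ * L⁻¹) • y)) - η y * (s ^ 2 * (T ζ + s⁻¹ * fderiv ℝ T ζ v))
        + η y * ((s ^ 2 * (s⁻¹ * L⁻¹)) • fderiv ℝ T ζ) y := by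
    intro y
    have : ζ + s⁻¹ • (v - L⁻¹ • y) = ζ + s⁻¹ • v - (s⁻¹ * L⁻¹) • y := by
      rw [smul_sub, smul_smul]; abel
    rw [this]
    simp
    ring
  have i1 : Integrable (fun y => η y * T (ζ + s⁻¹ • v - (s⁻¹ * L⁻¹) • y)) μ :=
    integrable_mollifier_mul hη (by fun_prop)
  simp_rw [h1, h2]
  rw [integral_add, integral_sub, hη.integral_mul_clm, integral_mul_const, hη.integral_eq_one,
    integral_const_mul]
  · simp only [mollify]
    field_simp
    ring
  · exact i1.const_mul _
  · exact hη.integrable.mul_const _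
  · exact (i1.const_mul _).sub (hη.integrable.mul_const _)
  · exact integrable_mollifier_mul hη (by fun_prop)

theorem contDiff_taylorRemainder (hη : IsMollifier μ 1 η) (hT : Continuous T) {s L : ℝ}
    (hL : 0 < L) (ζ : E) : ContDiff ℝ ∞ (taylorRemainder μ η T s L ζ) := by
  refine HasCompactSupport.contDiff_convolution_left _ ?_ ?_ (Continuous.locallyIntegrable ?_)
  · exact (hη.hasCompactSupport.comp_smul hL.ne').mul_left
  · exact contDiff_const.mul (hη.contDiff.comp (contDiff_const_smul L))
  · fun_prop

/-- The derivatives fall on the kernel `L^n η (L ·)`, and the rescaled Taylor remainder is only used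
through its size, at most `4M` on the ball of radius `2`. Estimating the support of the kernel by
the unit ball wastes a factor `L^n`; any polynomial loss in `L` is harmless later. -/
theorem exists_norm_iteratedFDeriv_taylorRemainder_le (hη : IsMollifier μ 1 η) (hM : 0 ≤ M)
    (k : ℕ) : ∃ C, 0 ≤ C ∧ ∀ T : E → ℝ, Continuous T →
    (∀ ξ v, |T (ξ + v) - T ξ - fderiv ℝ T ξ v| ≤ M * ‖v‖ ^ 2) → ∀ s L : ℝ, 0 < s → 1 ≤ L →
    ∀ ζ v : E, ‖v‖ ≤ 1 → ∀ i ≤ k,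
      ‖iteratedFDeriv ℝ i (taylorRemainder μ η T s L ζ) v‖ ≤ C * L ^ (Module.finrank ℝ E + k) := by
  have hb : ∃ C, 0 ≤ C ∧ ∀ i ≤ k, ∀ x, ‖iteratedFDeriv ℝ i η x‖ ≤ C := by
    have : ∀ i : ℕ, ∃ C, ∀ x, ‖iteratedFDeriv ℝ i η x‖ ≤ C := fun i =>
      (hη.contDiff.continuous_iteratedFDeriv (m := i) (by exact_mod_cast le_top)).bounded_above_of_compact_support
        (hη.hasCompactSupport.iteratedFDeriv (𝕜 := ℝ) i)
    choose C hC using this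
    refine ⟨∑ i ∈ Finset.range (k + 1), |C i|, by positivity, fun i hi x => (hC i x).trans ?_⟩
    exact (le_abs_self _).trans (Finset.single_le_sum (f := fun i => |C i|) (fun _ _ => abs_nonneg _)
      (Finset.mem_range.mpr (Nat.lt_succ_of_le hi)))
  obtain ⟨C, hC0, hC⟩ := hb
  refine ⟨C * (M * 4) * μ.real (Metric.closedBall 0 1), by positivity, ?_⟩
  intro T hT h2 s L hs hL ζ v hv i hi
  have hL0 : 0 < L := by linarith
  set n := Module.finrank ℝ E
  set φ : E → ℝ := fun y => L ^ n * η (L • y) with hφdef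
  have hφ : ContDiff ℝ ∞ φ := contDiff_const.mul (hη.contDiff.comp (contDiff_const_smul L))
  have hφs : Function.support φ ⊆ Metric.closedBall 0 1 := by
    intro y hy
    rw [mem_closedBall_zero_iff]
    by_contra hlt
    refine hy ?_
    simp only [hφdef]
    rw [hη.support, mul_zero]
    rw [norm_smul, Real.norm_of_nonneg hL0.le]
    nlinarith [norm_nonneg y]
  have hφc : HasCompactSupport φ :=
    HasCompactSupport.of_support_subset_isCompact (isCompact_closedBall 0 1) hφs
  have hts : tsupport φ ⊆ Metric.closedBall 0 1 := closure_minimal hφs Metric.isClosed_closedBall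
  have h1 := norm_iteratedFDeriv_convolution_le μ
    (f := fun v => s ^ 2 * (T (ζ + s⁻¹ • v) - T ζ - fderiv ℝ T ζ (s⁻¹ • v))) (by fun_prop) i
    (ContinuousLinearMap.mul ℝ ℝ) hφ hφc v
  have hder : ∀ y, ‖iteratedFDeriv ℝ i φ y‖ ≤ C * L ^ (n + k) := by
    intro y
    have e1 : φ = (L ^ n) • (fun y => η (L • y)) := rfl
    have hsm : ContDiff ℝ ∞ fun y => η (L • y) := hη.contDiff.comp (contDiff_const_smul L)
    rw [e1, iteratedFDeriv_const_smul_apply (hsm.of_le (by exact_mod_cast le_top)).contDiffAt,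
      norm_smul, congrFun (iteratedFDeriv_comp_const_smul L (hη.contDiff.of_le (by exact_mod_cast le_top))) y,
      norm_smul, norm_pow, norm_pow, Real.norm_of_nonneg hL0.le]
    have := hC i hi (L • y)
    calc _ ≤ L ^ n * (L ^ k * C) := by gcongr
      _ = _ := by ring
  refine h1.trans ?_
  calc _ ≤ 1 * ∫ y in Metric.closedBall (0 : E) 1, ‖iteratedFDeriv ℝ i φ y‖ *
        |s ^ 2 * (T (ζ + s⁻¹ • (v - y)) - T ζ - fderiv ℝ T ζ (s⁻¹ • (v - y)))| ∂μ := by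
        rw [setIntegral_eq_integral_of_forall_compl_eq_zero]
        · exact mul_le_mul_of_nonneg_right (ContinuousLinearMap.opNorm_mul_le ℝ ℝ)
            (integral_nonneg fun y => by positivity)
        · intro y hy
          have : iteratedFDeriv ℝ i φ y = 0 := by
            by_contra h
            exact hy (hts (support_iteratedFDeriv_subset i h))
          simp [this]
    _ ≤ 1 * (C * L ^ (n + k) * (M * 4) * μ.real (Metric.closedBall 0 1)) := by
        gcongr
        refine (Real.le_norm_self _).trans
          (norm_setIntegral_le_of_norm_le_const measure_closedBall_lt_top fun y hy => ?_)
        rw [norm_mul, norm_norm]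
        have hy' : ‖v - y‖ ≤ 2 := by
          have := norm_sub_le v y
          rw [mem_closedBall_zero_iff] at hy
          linarith
        refine mul_le_mul (hder y) ?_ (norm_nonneg _) (by positivity)
        rw [Real.norm_eq_abs, abs_abs, abs_mul, abs_of_nonneg (by positivity : 0 ≤ s ^ 2)]
        calc _ ≤ s ^ 2 * (M * ‖s⁻¹ • (v - y)‖ ^ 2) := by gcongr; exact h2 _ _
          _ = M * ‖v - y‖ ^ 2 := by
            rw [norm_smul, Real.norm_of_nonneg (by positivity)]; field_simp
          _ ≤ M * 2 ^ 2 := by gcongr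
          _ = M * 4 := by norm_num
    _ = _ := by ring

end MollifyBounds

/-! ### Kernel bound for a dyadic time piece with mollified symbol. -/

section KernelBound

theorem exists_norm_iteratedFDeriv_le {V W : Type*} [NormedAddCommGroup V] [NormedSpace ℝ V]
    [NormedAddCommGroup W] [NormedSpace ℝ W] {f : V → W} (hf : ContDiff ℝ ∞ f)
    (hc : HasCompactSupport f) (k : ℕ) :
    ∃ C, 0 ≤ C ∧ ∀ i ≤ k, ∀ x, ‖iteratedFDeriv ℝ i f x‖ ≤ C := by
  have : ∀ i : ℕ, ∃ C, ∀ x, ‖iteratedFDeriv ℝ i f x‖ ≤ C := fun i =>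
    (hf.continuous_iteratedFDeriv (m := i) (by exact_mod_cast le_top)).bounded_above_of_compact_support
      (hc.iteratedFDeriv (𝕜 := ℝ) i)
  choose C hC using this
  refine ⟨∑ i ∈ Finset.range (k + 1), |C i|, by positivity, fun i hi x => (hC i x).trans ?_⟩
  exact (le_abs_self _).trans (Finset.single_le_sum (f := fun i => |C i|) (fun _ _ => abs_nonneg _)
    (Finset.mem_range.mpr (Nat.lt_succ_of_le hi)))

variable {E : Type} [NormedAddCommGroup E] [NormedSpace ℝ E] [FiniteDimensional ℝ E]
  [MeasurableSpace E] [BorelSpace E]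

/-- The phase left over in a window after removal of the constant and linear parts. -/
noncomputable def windowPhase (μ : Measure E) (η T : E → ℝ) (s L : ℝ) (z : ℝ × E) (u : ℝ × E) : ℝ :=
  -(u.1 * fderiv ℝ T (s⁻¹ • z.2) u.2) -
    (s⁻¹ * z.1 + s⁻¹ * u.1) * taylorRemainder μ η T s L (s⁻¹ • z.2) u.2

variable {μ : Measure E} [μ.IsAddHaarMeasure] {η : E → ℝ} {M : ℝ}

theorem contDiff_windowPhase (hη : IsMollifier μ 1 η) {T : E → ℝ} (hT : Continuous T) {s L : ℝ}
    (hL : 0 < L) (z : ℝ × E) : ContDiff ℝ ∞ (windowPhase μ η T s L z) := by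
  have h1 := contDiff_taylorRemainder hη hT (s := s) hL (s⁻¹ • z.2)
  unfold windowPhase
  have h2 : ContDiff ℝ ∞ fun u : ℝ × E => taylorRemainder μ η T s L (s⁻¹ • z.2) u.2 :=
    h1.comp contDiff_snd
  fun_prop

/-- The phase is the product of the time increment with a linear form of norm at most `M`, plus a
time factor of size at most `6` times the Taylor remainder. As `s⁻¹ ≤ 1`, neither grows with `s`. -/
theorem exists_norm_iteratedFDeriv_windowPhase_le (hη : IsMollifier μ 1 η) (hM : 0 ≤ M) (k : ℕ) :
    ∃ C, 1 ≤ C ∧ ∀ T : E → ℝ, Continuous T → (∀ ξ, ‖fderiv ℝ T ξ‖ ≤ M) →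
    (∀ ξ v, |T (ξ + v) - T ξ - fderiv ℝ T ξ v| ≤ M * ‖v‖ ^ 2) → ∀ s L : ℝ, 1 ≤ s → 1 ≤ L →
    ∀ z : ℝ × E, |s⁻¹ * z.1| ≤ 5 → ∀ u : ℝ × E, ‖u‖ ≤ 1 → ∀ i ≤ k,
      ‖iteratedFDeriv ℝ i (windowPhase μ η T s L z) u‖ ≤ C * L ^ (Module.finrank ℝ E + k) := by
  obtain ⟨C, hC0, hC⟩ := exists_norm_iteratedFDeriv_taylorRemainder_le hη hM k
  refine ⟨1 + (2 ^ k * 2 * (2 * M) + 2 ^ k * 7 * C), le_add_of_nonneg_right (by positivity), ?_⟩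
  intro T hT hT1 hT2 s L hs hL z hz u hu i hi
  have hs0 : 0 < s := by linarith
  have hs1 : s⁻¹ ≤ 1 := inv_le_one_of_one_le₀ hs
  have hL1 : 1 ≤ L ^ (Module.finrank ℝ E + k) := one_le_pow₀ hL
  have hu1 : ‖u.1‖ ≤ 1 := (norm_fst_le u).trans hu
  have hu2 : ‖u.2‖ ≤ 1 := (norm_snd_le u).trans hu
  have hρ := contDiff_taylorRemainder hη hT (s := s) (zero_lt_one.trans_le hL) (s⁻¹ • z.2)
  set ρ := taylorRemainder μ η T s L (s⁻¹ • z.2)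
  set A : E →L[ℝ] ℝ := fderiv ℝ T (s⁻¹ • z.2)
  set pr1 : ℝ × E →L[ℝ] ℝ := ContinuousLinearMap.fst ℝ ℝ E
  set pr2 : ℝ × E →L[ℝ] E := ContinuousLinearMap.snd ℝ ℝ E
  have hpr1 : ‖pr1‖ ≤ 1 := ContinuousLinearMap.norm_fst_le ℝ ℝ E
  have hpr2 : ‖pr2‖ ≤ 1 := ContinuousLinearMap.norm_snd_le ℝ ℝ E
  have e1 : ∀ i ≤ k, ‖iteratedFDeriv ℝ i (fun y : ℝ × E => pr1 y * (A.comp pr2) y) u‖ ≤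
      2 ^ k * 2 * (2 * M) := by
    refine norm_iteratedFDeriv_mul_le_two_pow pr1.contDiff (A.comp pr2).contDiff (fun i _ => ?_) fun i _ => ?_
    · refine (norm_iteratedFDeriv_clm_le pr1 u i).trans ?_
      nlinarith [norm_nonneg pr1, norm_nonneg u]
    · refine (norm_iteratedFDeriv_clm_le (A.comp pr2) u i).trans ?_
      have : ‖A.comp pr2‖ ≤ M * 1 := (A.opNorm_comp_le pr2).trans (by gcongr; exact hT1 _)
      have h0 := norm_nonneg (A.comp pr2)
      nlinarith [norm_nonneg u]
  have e2 : ∀ i ≤ k, ‖iteratedFDeriv ℝ i (fun y : ℝ × E =>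
      (fun t : ℝ => ContinuousLinearMap.id ℝ ℝ t) (s⁻¹ * z.1 + (s⁻¹ • pr1) y) * ρ (0 + pr2 y)) u‖ ≤
      2 ^ k * 7 * (C * L ^ (Module.finrank ℝ E + k)) := by
    have hA : ‖s⁻¹ • pr1‖ ≤ 1 := by
      rw [norm_smul, Real.norm_of_nonneg (by positivity)]
      nlinarith [norm_nonneg pr1]
    refine norm_iteratedFDeriv_mul_le_two_pow ?_ ?_ (fun i _ => ?_) fun i hi => ?_
    · exact (ContinuousLinearMap.id ℝ ℝ).contDiff.comp (contDiff_const.add (s⁻¹ • pr1).contDiff)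
    · exact hρ.comp (contDiff_const.add pr2.contDiff)
    · refine (norm_iteratedFDeriv_comp_clm_add_le (ContinuousLinearMap.id ℝ ℝ).contDiff (s⁻¹ • pr1)
        hA (s⁻¹ * z.1) u i).trans ((norm_iteratedFDeriv_clm_le _ _ _).trans ?_)
      have h1 : ‖s⁻¹ * z.1 + (s⁻¹ • pr1) u‖ ≤ 6 := by
        refine (norm_add_le _ _).trans ?_
        have h3 : ‖(s⁻¹ • pr1) u‖ ≤ 1 := ((s⁻¹ • pr1).le_opNorm u).trans (by
          nlinarith [norm_nonneg u, norm_nonneg (s⁻¹ • pr1)])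
        rw [Real.norm_eq_abs]
        linarith
      have h2 : ‖ContinuousLinearMap.id ℝ ℝ‖ ≤ 1 := ContinuousLinearMap.norm_id_le
      nlinarith [norm_nonneg (s⁻¹ * z.1 + (s⁻¹ • pr1) u), norm_nonneg (ContinuousLinearMap.id ℝ ℝ)]
    · refine (norm_iteratedFDeriv_comp_clm_add_le hρ pr2 hpr2 0 u i).trans ?_
      exact hC T hT hT2 s L hs0 hL _ _ (by simpa [pr2] using hu2) i hi
  have e3 : windowPhase μ η T s L z = (-fun y : ℝ × E => pr1 y * (A.comp pr2) y) -
      fun y : ℝ × E =>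
      (fun t : ℝ => ContinuousLinearMap.id ℝ ℝ t) (s⁻¹ * z.1 + (s⁻¹ • pr1) y) * ρ (0 + pr2 y) := by
    ext y
    simp [windowPhase, pr1, pr2, A, ρ]
  have c1 : ContDiff ℝ ∞ (fun y : ℝ × E => pr1 y * (A.comp pr2) y) := by fun_prop
  have c2 : ContDiff ℝ ∞ (fun y : ℝ × E =>
      (fun t : ℝ => ContinuousLinearMap.id ℝ ℝ t) (s⁻¹ * z.1 + (s⁻¹ • pr1) y) * ρ (0 + pr2 y)) :=
    ((ContinuousLinearMap.id ℝ ℝ).contDiff.comp (contDiff_const.add (s⁻¹ • pr1).contDiff)).mul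
      (hρ.comp (contDiff_const.add pr2.contDiff))
  have f1 := e1 i hi
  have f2 := e2 i hi
  generalize (fun y : ℝ × E => pr1 y * (A.comp pr2) y) = q1 at e3 c1 f1
  generalize (fun y : ℝ × E => (fun t : ℝ => ContinuousLinearMap.id ℝ ℝ t)
    (s⁻¹ * z.1 + (s⁻¹ • pr1) y) * ρ (0 + pr2 y)) = q2 at e3 c2 f2
  have d1 : ContDiff ℝ i (-q1) := (c1.of_le (by exact_mod_cast le_top)).neg
  have d2 : ContDiff ℝ i (-q2) := (c2.of_le (by exact_mod_cast le_top)).neg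
  rw [e3, sub_eq_add_neg, iteratedFDeriv_add_apply d1.contDiffAt d2.contDiffAt,
    iteratedFDeriv_neg_apply, iteratedFDeriv_neg_apply]
  refine (norm_add_le _ _).trans ?_
  rw [norm_neg, norm_neg]
  have f3 : 0 ≤ 2 ^ k * 2 * (2 * M) := by positivity
  calc _ ≤ 2 ^ k * 2 * (2 * M) * 1 + 2 ^ k * 7 * (C * L ^ (Module.finrank ℝ E + k)) := by linarith
    _ ≤ 2 ^ k * 2 * (2 * M) * L ^ (Module.finrank ℝ E + k) + 2 ^ k * 7 * (C * L ^ (Module.finrank ℝ E + k)) := by gcongr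
    _ ≤ _ := by nlinarith

/-- The amplitude in a window. -/
noncomputable def windowAmplitude (μ : Measure E) (η T : E → ℝ) (θ : E → ℂ) (β : ℝ × E → ℝ)
    (a : ℝ → ℂ) (s L : ℝ) (z : ℝ × E) (u : ℝ × E) : ℂ :=
  a (s⁻¹ * z.1 + s⁻¹ * u.1) * (θ (s⁻¹ • z.2 + s⁻¹ • u.2) *
    ((β u : ℂ) * Complex.exp (Complex.I * (windowPhase μ η T s L z u : ℂ))))

theorem contDiff_windowAmplitude (hη : IsMollifier μ 1 η) {T : E → ℝ} (hT : Continuous T)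
    {θ : E → ℂ} (hθ : ContDiff ℝ ∞ θ) {β : ℝ × E → ℝ} (hβ : ContDiff ℝ ∞ β) {a : ℝ → ℂ}
    (ha : ContDiff ℝ ∞ a) {s L : ℝ} (hL : 0 < L) (z : ℝ × E) :
    ContDiff ℝ ∞ (windowAmplitude μ η T θ β a s L z) := by
  have h1 := contDiff_windowPhase hη hT (s := s) hL z
  unfold windowAmplitude
  refine (ha.comp (by fun_prop)).mul ((hθ.comp (by fun_prop)).mul
    ((Complex.ofRealCLM.contDiff.comp hβ).mul ?_))
  exact (contDiff_const.mul (Complex.ofRealCLM.contDiff.comp h1)).cexp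

theorem exists_norm_iteratedFDeriv_windowAmplitude_le (hη : IsMollifier μ 1 η) (hM : 0 ≤ M)
    {θ : E → ℂ} (hθ : ContDiff ℝ ∞ θ) (hθc : HasCompactSupport θ) {β : ℝ × E → ℝ}
    (hβ : ContDiff ℝ ∞ β) {r : ℝ} (hr : r ≤ 1) (hβs : ∀ u, r ≤ ‖u‖ → β u = 0) (k : ℕ) :
    ∃ C, ∃ m : ℕ, 0 ≤ C ∧ ∀ T : E → ℝ, Continuous T → (∀ ξ, ‖fderiv ℝ T ξ‖ ≤ M) →
    (∀ ξ v, |T (ξ + v) - T ξ - fderiv ℝ T ξ v| ≤ M * ‖v‖ ^ 2) → ∀ a : ℝ → ℂ, ContDiff ℝ ∞ a →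
    ∀ A : ℝ, (∀ i ≤ k, ∀ t, ‖iteratedFDeriv ℝ i a t‖ ≤ A) → ∀ s L : ℝ, 1 ≤ s → 1 ≤ L →
    ∀ z : ℝ × E, |s⁻¹ * z.1| ≤ 5 → ∀ i ≤ k, ∀ u : ℝ × E,
      ‖iteratedFDeriv ℝ i (windowAmplitude μ η T θ β a s L z) u‖ ≤ C * A * L ^ m := by
  obtain ⟨C1, hC1, h1⟩ := exists_norm_iteratedFDeriv_windowPhase_le (μ := μ) hη hM k
  obtain ⟨C2, hC2, h2⟩ := exists_norm_iteratedFDeriv_le hθ hθc k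
  have hβc : HasCompactSupport β := hasCompactSupport_of_norm_le hβs
  have hβ' : ContDiff ℝ ∞ fun u => (β u : ℂ) := Complex.ofRealCLM.contDiff.comp hβ
  obtain ⟨C3, hC3, h3⟩ := exists_norm_iteratedFDeriv_le hβ' (hβc.comp_left (g := fun x : ℝ => (x : ℂ)) (by simp)) k
  set n := Module.finrank ℝ E + k
  -- The exponent `n * k` of `L` is the `k`-th power of the phase bound `C1 * L ^ n` in the estimate
  -- for the exponential.
  refine ⟨2 ^ k * (2 ^ k * C2 * (2 ^ k * C3 * (k.factorial * C1 ^ k))), n * k, by positivity, ?_⟩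
  intro T hT hT1 hT2 a ha A hA s L hs hL z hz i hi u
  have hs0 : 0 < s := by linarith
  have hs1 : s⁻¹ ≤ 1 := inv_le_one_of_one_le₀ hs
  have hA0 : 0 ≤ A := (norm_nonneg _).trans (hA 0 (Nat.zero_le _) 0)
  by_cases hu : ‖u‖ ≤ 1
  swap
  · have hsupp : tsupport (windowAmplitude μ η T θ β a s L z) ⊆ Metric.closedBall 0 r := by
      refine closure_minimal (fun y hy => ?_) Metric.isClosed_closedBall
      rw [mem_closedBall_zero_iff]
      by_contra hlt
      exact hy (by simp [windowAmplitude, hβs y (not_le.mp hlt).le])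
    have : iteratedFDeriv ℝ i (windowAmplitude μ η T θ β a s L z) u = 0 := by
      by_contra h
      have := hsupp (support_iteratedFDeriv_subset i h)
      rw [mem_closedBall_zero_iff] at this
      linarith
    rw [this, norm_zero]
    positivity
  set pr1 : ℝ × E →L[ℝ] ℝ := ContinuousLinearMap.fst ℝ ℝ E
  set pr2 : ℝ × E →L[ℝ] E := ContinuousLinearMap.snd ℝ ℝ E
  have hpr1 : ‖s⁻¹ • pr1‖ ≤ 1 := by
    rw [norm_smul, Real.norm_of_nonneg (by positivity)]
    nlinarith [norm_nonneg pr1, ContinuousLinearMap.norm_fst_le ℝ ℝ E]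
  have hpr2 : ‖s⁻¹ • pr2‖ ≤ 1 := by
    rw [norm_smul, Real.norm_of_nonneg (by positivity)]
    nlinarith [norm_nonneg pr2, ContinuousLinearMap.norm_snd_le ℝ ℝ E]
  have hph := contDiff_windowPhase hη hT (s := s) (zero_lt_one.trans_le hL) z
  have hexp : ContDiff ℝ ∞ fun y => Complex.exp (Complex.I * (windowPhase μ η T s L z y : ℂ)) :=
    (contDiff_const.mul (Complex.ofRealCLM.contDiff.comp hph)).cexp
  have b4 := norm_iteratedFDeriv_exp_I_mul_le (k := k) (x := u) (D := C1 * L ^ n)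
    (one_le_mul_of_one_le_of_one_le hC1 (one_le_pow₀ hL)) hph
    (fun i hi _ => h1 T hT hT1 hT2 s L hs hL z hz u hu i hi)
  have b3 := norm_iteratedFDeriv_mul_le_two_pow (k := k) hβ' hexp (fun i hi => h3 i hi u) b4
  have hθ' : ContDiff ℝ ∞ fun y : ℝ × E => θ (s⁻¹ • z.2 + (s⁻¹ • pr2) y) :=
    hθ.comp (contDiff_const.add (s⁻¹ • pr2).contDiff)
  have ha' : ContDiff ℝ ∞ fun y : ℝ × E => a (s⁻¹ * z.1 + (s⁻¹ • pr1) y) :=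
    ha.comp (contDiff_const.add (s⁻¹ • pr1).contDiff)
  have b2 := norm_iteratedFDeriv_mul_le_two_pow (k := k) hθ' (hβ'.mul hexp) (x := u)
    (fun i hi => (norm_iteratedFDeriv_comp_clm_add_le hθ _ hpr2 _ _ _).trans (h2 i hi _)) b3
  have b1 := norm_iteratedFDeriv_mul_le_two_pow (k := k) ha' (hθ'.mul (hβ'.mul hexp)) (x := u)
    (fun i hi => (norm_iteratedFDeriv_comp_clm_add_le ha _ hpr1 _ _ _).trans (hA i hi _)) b2
  refine (b1 i hi).trans (le_of_eq ?_)
  rw [mul_pow, ← pow_mul]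
  ring

end KernelBound

section KernelBound

variable {E : Type} [NormedAddCommGroup E] [NormedSpace ℝ E] [FiniteDimensional ℝ E]
  [MeasurableSpace E] [BorelSpace E]

/-- Quantitative nondegeneracy of the phase `σ (T - λ)`, in the variables `(σ, ξ)`. -/
def NondegenerateOn (T : E → ℝ) (U : Set E) (c : ℝ) : Prop :=
  ∀ σ ∈ Set.Icc (1 / 2 : ℝ) 5, ∀ σ' ∈ Set.Icc (1 / 2 : ℝ) 5, ∀ ζ ∈ U, ∀ ζ' ∈ U,
    c * (|σ - σ'| + ‖ζ - ζ'‖) ≤ |T ζ - T ζ'| + ‖σ • fderiv ℝ T ζ - σ' • fderiv ℝ T ζ'‖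

variable {μ : Measure E} [μ.IsAddHaarMeasure] {η : E → ℝ} {M : ℝ}

/-- The linear phase in a window. -/
noncomputable def windowFrequency (T : E → ℝ) (X : E →L[ℝ] ℝ) (s l : ℝ) (z : ℝ × E) :
    ℝ × E →L[ℝ] ℝ :=
  (-(s * (T (s⁻¹ • z.2) - l))) • ContinuousLinearMap.fst ℝ ℝ E +
    (s⁻¹ • X - z.1 • fderiv ℝ T (s⁻¹ • z.2)).comp (ContinuousLinearMap.snd ℝ ℝ E)

-- Evaluated on `(1, 0)` and `(0, v)`, the difference of two frequencies is, up to sign, `s` times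
-- the two quantities in `NondegenerateOn`; the parameters `l` and `X` cancel. The separation of `z`
-- and `z'` carries the same factor `s`, so the constant does not depend on `s`. The factor `1 / 2`
-- appears because each of the two quantities is bounded by the full norm.
omit [FiniteDimensional ℝ E] [MeasurableSpace E] [BorelSpace E] in
theorem norm_windowFrequency_sub_ge {T : E → ℝ} {U : Set E} {c : ℝ}
    (hU : NondegenerateOn T U c) (hc : 0 < c) (X : E →L[ℝ] ℝ) {s : ℝ} (hs : 0 < s) (l : ℝ)
    {z z' : ℝ × E} (hz : s⁻¹ * z.1 ∈ Set.Icc (1 / 2 : ℝ) 5 ∧ s⁻¹ • z.2 ∈ U)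
    (hz' : s⁻¹ * z'.1 ∈ Set.Icc (1 / 2 : ℝ) 5 ∧ s⁻¹ • z'.2 ∈ U) :
    c / 2 * ‖z - z'‖ ≤ ‖windowFrequency T X s l z - windowFrequency T X s l z'‖ := by
  set D := windowFrequency T X s l z - windowFrequency T X s l z'
  have h1 := hU _ hz.1 _ hz'.1 _ hz.2 _ hz'.2
  have h2 : s * |T (s⁻¹ • z.2) - T (s⁻¹ • z'.2)| ≤ ‖D‖ := by
    have := D.le_opNorm (1, 0)
    have e : D (1, 0) = -(s * (T (s⁻¹ • z.2) - T (s⁻¹ • z'.2))) := by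
      simp [D, windowFrequency]; ring
    rw [e, norm_neg, norm_mul, Real.norm_of_nonneg hs.le, Prod.norm_mk] at this
    simpa using this
  have h3 : s * ‖(s⁻¹ * z.1) • fderiv ℝ T (s⁻¹ • z.2) - (s⁻¹ * z'.1) • fderiv ℝ T (s⁻¹ • z'.2)‖ ≤
      ‖D‖ := by
    have e : s * ‖(s⁻¹ * z.1) • fderiv ℝ T (s⁻¹ • z.2) -
        (s⁻¹ * z'.1) • fderiv ℝ T (s⁻¹ • z'.2)‖ =
        ‖z.1 • fderiv ℝ T (s⁻¹ • z.2) - z'.1 • fderiv ℝ T (s⁻¹ • z'.2)‖ := by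
      rw [mul_smul, mul_smul, ← smul_sub, norm_smul, Real.norm_of_nonneg (by positivity)]
      field_simp
    rw [e]
    refine ContinuousLinearMap.opNorm_le_bound _ (norm_nonneg _) fun v => ?_
    have := D.le_opNorm (0, v)
    have e : D (0, v) = -((z.1 • fderiv ℝ T (s⁻¹ • z.2) - z'.1 • fderiv ℝ T (s⁻¹ • z'.2)) v) := by
      simp [D, windowFrequency]
    rw [e, norm_neg, Prod.norm_mk] at this
    simpa using this
  have h4 : ‖z - z'‖ ≤ s * (|s⁻¹ * z.1 - s⁻¹ * z'.1| + ‖s⁻¹ • z.2 - s⁻¹ • z'.2‖) := by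
    rw [← mul_sub, ← smul_sub, abs_mul, norm_smul, abs_of_pos (by positivity : 0 < s⁻¹),
      Real.norm_of_nonneg (by positivity : 0 ≤ s⁻¹), ← mul_add, mul_inv_cancel_left₀ hs.ne',
      Prod.norm_def]
    refine max_le ?_ ?_
    · rw [Real.norm_eq_abs]; simp only [Prod.fst_sub]; linarith [norm_nonneg (z.2 - z'.2)]
    · simp only [Prod.snd_sub]; linarith [abs_nonneg (z.1 - z'.1)]
  have h5 := mul_le_mul_of_nonneg_left h1 hs.le
  have h6 := mul_le_mul_of_nonneg_left h4 hc.le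
  nlinarith

/-- Sup bound for the kernel of a dyadic piece of the resolvent with mollified symbol. -/
theorem exists_norm_dyadic_kernel_le (hη : IsMollifier μ 1 η) (hM : 0 ≤ M) {U : Set E} {c : ℝ}
    (hc : 0 < c) {θ : E → ℂ} (hθ : ContDiff ℝ ∞ θ) (hθc : HasCompactSupport θ) {r : ℝ}
    (hr : 0 < r) (hr1 : r ≤ 1 / 2) (hθU : ∀ ξ v, θ (ξ + v) ≠ 0 → ‖v‖ ≤ r → ξ ∈ U) :
    ∃ C, ∃ m : ℕ, 0 ≤ C ∧ ∀ T : E → ℝ, Continuous T → (∀ ξ, ‖fderiv ℝ T ξ‖ ≤ M) →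
    (∀ ξ v, |T (ξ + v) - T ξ - fderiv ℝ T ξ v| ≤ M * ‖v‖ ^ 2) → NondegenerateOn T U c →
    ∀ a : ℝ → ℂ, ContDiff ℝ ∞ a → (∀ t, t ∉ Set.Icc (1 : ℝ) 4 → a t = 0) →
    ∀ A : ℝ, (∀ i ≤ Module.finrank ℝ E + 2, ∀ t, ‖iteratedFDeriv ℝ i a t‖ ≤ A) →
    ∀ s L : ℝ, 1 ≤ s → 1 ≤ L → ∀ (l : ℝ) (X : E →L[ℝ] ℝ),
      ‖∫ u : ℝ × E, a u.1 * θ u.2 * Complex.exp (Complex.I *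
        ((X u.2 - u.1 * (s ^ 2 * (mollify μ η T (s⁻¹ * L⁻¹) u.2 - l)) : ℝ) : ℂ))
          ∂((volume : Measure ℝ).prod μ)‖ ≤
      C * A * L ^ m * (s ^ (Module.finrank ℝ E + 1))⁻¹ := by
  obtain ⟨β, hβ⟩ := exists_isMollifier ((volume : Measure ℝ).prod μ) hr
  have hfr : Module.finrank ℝ (ℝ × E) = Module.finrank ℝ E + 1 := by
    rw [Module.finrank_prod, Module.finrank_self, add_comm]
  obtain ⟨C1, m, hC1, h1⟩ := exists_norm_iteratedFDeriv_windowAmplitude_le hη hM hθ hθc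
    hβ.contDiff (by linarith) hβ.support (Module.finrank ℝ E + 2)
  -- The window sum needs more integrations by parts than the dimension of time-frequency space,
  -- which is `finrank E + 1`.
  obtain ⟨C2, hC2, h2⟩ := norm_integral_le_of_windows ((volume : Measure ℝ).prod μ)
    (k := Module.finrank ℝ E + 2) (by omega) (half_pos hc)
  refine ⟨C2 * C1, m, by positivity, ?_⟩
  intro T hT hT1 hT2 hND a ha has A hA s L hs hL l X
  have hs0 : 0 < s := by linarith
  have hs1 : s⁻¹ ≤ 1 := inv_le_one_of_one_le₀ hs
  have hL0 : 0 < L := by linarith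
  have hA0 : 0 ≤ A := (norm_nonneg _).trans (hA 0 (Nat.zero_le _) 0)
  have hac : HasCompactSupport a :=
    HasCompactSupport.of_support_subset_isCompact (isCompact_Icc (a := (1 : ℝ)) (b := 4))
      fun t ht => by by_contra h; exact ht (has t h)
  set G : ℝ × E → ℂ := fun u => a u.1 * θ u.2 * Complex.exp (Complex.I *
        ((X u.2 - u.1 * (s ^ 2 * (mollify μ η T (s⁻¹ * L⁻¹) u.2 - l)) : ℝ) : ℂ)) with hG
  have hmc : Continuous (mollify μ η T (s⁻¹ * L⁻¹)) := by
    have e : mollify μ η T (s⁻¹ * L⁻¹) = fun ξ => T 0 + s⁻¹ * fderiv ℝ T 0 (s • ξ) +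
        (s ^ 2)⁻¹ * taylorRemainder μ η T s L 0 (s • ξ) := by
      ext ξ
      rw [← mollify_eq_add_taylorRemainder hη hT hs0 hL0, inv_smul_smul₀ hs0.ne', zero_add]
    rw [e]
    have := (contDiff_taylorRemainder hη hT (s := s) hL0 0).continuous
    fun_prop
  have hGc : Continuous G := by
    have := ha.continuous
    have := hθ.continuous
    fun_prop
  have hGs : HasCompactSupport G := by
    refine HasCompactSupport.of_support_subset_isCompact (hac.isCompact.prod hθc.isCompact)
      fun u hu => ?_
    refine ⟨subset_tsupport _ fun h => hu ?_, subset_tsupport _ fun h => hu ?_⟩ <;> simp [hG, h]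
  -- Rescaling time and frequency by `s` brings the phase to unit scale and produces the whole decay
  -- factor.
  have hscale : ∫ u, G u ∂((volume : Measure ℝ).prod μ) =
      (s ^ (Module.finrank ℝ E + 1))⁻¹ * ∫ u, G (s⁻¹ • u) ∂((volume : Measure ℝ).prod μ) := by
    rw [Measure.integral_comp_smul, hfr, Complex.real_smul, ← mul_assoc, inv_pow, inv_inv,
      abs_of_pos (by positivity)]
    push_cast
    rw [inv_mul_cancel₀ (by exact_mod_cast (by positivity : s ^ (Module.finrank ℝ E + 1) ≠ 0)), one_mul]
  have main : ‖∫ u, G (s⁻¹ • u) ∂((volume : Measure ℝ).prod μ)‖ ≤ C2 * (C1 * A * L ^ m) := by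
    refine h2 (fun u => G (s⁻¹ • u)) β
      (fun z => Complex.exp (((s⁻¹ * X z.2 - z.1 * (s * (T (s⁻¹ • z.2) - l)) : ℝ) : ℂ) * Complex.I))
      (windowFrequency T X s l) (windowAmplitude μ η T θ β a s L)
      {z | s⁻¹ * z.1 ∈ Set.Icc (1 / 2 : ℝ) 5 ∧ s⁻¹ • z.2 ∈ U} (C1 * A * L ^ m) (by positivity)
      (hGc.comp (continuous_const_smul _)) (hGs.comp_smul (by positivity)) hβ.contDiff.continuous
      hβ.hasCompactSupport hβ.integral_eq_one ?_ (fun z => by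
        rw [Complex.norm_exp_ofReal_mul_I]) (fun z _ => contDiff_windowAmplitude hη hT hθ hβ.contDiff ha hL0 z)
      ?_ ?_ ?_ ?_
    · intro z u
      have e1 := mollify_eq_add_taylorRemainder hη hT hs0 hL0 (s⁻¹ • z.2) u.2
      simp only [hG, windowAmplitude, Prod.smul_fst, Prod.smul_snd, Prod.fst_add, Prod.snd_add,
        smul_add, smul_eq_mul] at e1 ⊢
      rw [e1]
      -- The phase splits exactly into a constant, which goes into the unimodular factor `c z`, a
      -- linear part and the window phase.
      have e2 : X (s⁻¹ • z.2 + s⁻¹ • u.2) - (s⁻¹ * z.1 + s⁻¹ * u.1) * (s ^ 2 *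
          (T (s⁻¹ • z.2) + s⁻¹ * fderiv ℝ T (s⁻¹ • z.2) u.2 + (s ^ 2)⁻¹ *
            taylorRemainder μ η T s L (s⁻¹ • z.2) u.2 - l)) =
          (s⁻¹ * X z.2 - z.1 * (s * (T (s⁻¹ • z.2) - l))) + windowFrequency T X s l z u +
            windowPhase μ η T s L z u := by
        simp [windowFrequency, windowPhase]
        field_simp
        ring
      rw [e2]
      push_cast
      rw [mul_add, mul_add, Complex.exp_add, Complex.exp_add]
      ring_nf
    · intro z u hu
      simp [windowAmplitude, hβ.support u (by linarith)]
    -- A window meeting the support of the amplitude has its centre within `r ≤ 1 / 2` of that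
    -- support: time `[1, 4]` widens to `[1 / 2, 5]`, and the frequency lies in `U` by `hθU`.
    · intro z hz u
      by_contra h
      refine hz ?_
      have hβu : β u ≠ 0 := fun h0 => h (by simp [h0])
      have hur : ‖u‖ < r := by
        by_contra hlt
        exact hβu (hβ.support u (not_lt.mp hlt))
      have hau : a (s⁻¹ * (z.1 + u.1)) ≠ 0 := fun h0 => h (by
        have h0' := h0; rw [mul_add] at h0'; simp [hG, h0'])
      have hθu : θ (s⁻¹ • (z.2 + u.2)) ≠ 0 := fun h0 => h (by
        have h0' := h0; rw [smul_add] at h0'; simp [hG, h0'])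
      have hu1 : |s⁻¹ * u.1| ≤ r := by
        rw [abs_mul, abs_of_pos (by positivity)]
        have : |u.1| ≤ ‖u‖ := norm_fst_le u
        nlinarith [abs_nonneg u.1]
      have hu2 : ‖s⁻¹ • u.2‖ ≤ r := by
        rw [norm_smul, Real.norm_of_nonneg (by positivity)]
        have := norm_snd_le u
        nlinarith [norm_nonneg u.2]
      constructor
      · have h4 : s⁻¹ * (z.1 + u.1) ∈ Set.Icc (1 : ℝ) 4 := by
          by_contra h0; exact hau (has _ h0)
        rw [abs_le] at hu1
        rw [mul_add] at h4
        constructor <;> linarith [h4.1, h4.2]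
      · rw [smul_add] at hθu
        exact hθU _ _ hθu hu2
    · intro z hz i hi u
      refine h1 T hT hT1 hT2 a ha A hA s L hs hL z ?_ i hi u
      rw [abs_le]; constructor <;> linarith [hz.1.1, hz.1.2]
    · intro z hz z' hz'
      exact norm_windowFrequency_sub_ge hND hc X hs0 l hz hz'
  rw [hscale, norm_mul, Complex.norm_real, Real.norm_of_nonneg (by positivity), mul_comm]
  calc _ ≤ (C2 * (C1 * A * L ^ m)) * (s ^ (Module.finrank ℝ E + 1))⁻¹ := by gcongr
    _ = _ := by ring

end KernelBound

/-! ### Sesquilinear forms of Fourier multipliers on `L²`. -/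

/-- The space `L²(ℝ^d)`. -/
abbrev LTwo (d : ℕ) : Type := Lp ℂ 2 (volume : Measure (EuclideanSpace ℝ (Fin d)))

section FourierForm

variable {d : ℕ}

local notation "𝔼" => EuclideanSpace ℝ (Fin d)

/-- On `L¹ ∩ L²` the `L²` Fourier transform is given by the Fourier integral. -/
theorem coeFn_fourier_ae_eq (f : LTwo d) (hf : Integrable f) :
    (𝓕 f : LTwo d) =ᵐ[volume] 𝓕 (f : 𝔼 → ℂ) := by
  have hc : Continuous (𝓕 (f : 𝔼 → ℂ)) :=
    VectorFourier.fourierIntegral_continuous Real.continuous_fourierChar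
      continuous_inner hf
  -- Both sides are tested on smooth compactly supported functions. The `L²` transform moves to the
  -- test function through tempered distributions, the Fourier integral through the multiplication
  -- formula.
  refine ae_eq_of_integral_contDiff_smul_eq
    ((Lp.memLp (𝓕 f : LTwo d)).locallyIntegrable (by norm_num)) hc.locallyIntegrable
    fun φ hφ hφc => ?_
  have hφ' : ContDiff ℝ ∞ fun x => (φ x : ℂ) := Complex.ofRealCLM.contDiff.comp hφ
  set Φ : 𝓢(EuclideanSpace ℝ (Fin d), ℂ) :=
    (hφc.comp_left (g := fun x : ℝ => (x : ℂ)) (by simp)).toSchwartzMap hφ' with hΦ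
  have h1 := congrArg (fun D : 𝓢'(EuclideanSpace ℝ (Fin d), ℂ) => D Φ)
    (Lp.fourier_toTemperedDistribution_eq f)
  simp only [TemperedDistribution.fourier_apply, Lp.toTemperedDistribution_apply] at h1
  have h2 : ∀ x, Φ x = (φ x : ℂ) := fun x => rfl
  have h3 : ∫ x, φ x • (𝓕 f : LTwo d) x = ∫ x, Φ x • (𝓕 f : LTwo d) x := by
    simp only [h2, Complex.real_smul, smul_eq_mul]
  have h4 : ∫ x, φ x • 𝓕 (f : 𝔼 → ℂ) x = ∫ x, 𝓕 (f : 𝔼 → ℂ) x • Φ x := by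
    simp only [h2, Complex.real_smul, smul_eq_mul, mul_comm]
  rw [h3, ← h1, h4]
  have h5 := VectorFourier.integral_fourierIntegral_smul_eq_flip (μ := volume) (ν := volume)
    (L := innerₗ (EuclideanSpace ℝ (Fin d))) Real.continuous_fourierChar continuous_inner hf
    (Φ.integrable (μ := volume))
  rw [flip_innerₗ] at h5
  simp only [smul_eq_mul] at h5 ⊢
  simp_rw [mul_comm _ (f _)]
  exact h5.symm

/-- The sesquilinear form of the Fourier multiplier with symbol `m`. -/
noncomputable def multiplierForm (m : 𝔼 → ℂ) (f g : LTwo d) : ℂ :=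
  ∫ ξ, m ξ * ((𝓕 f : LTwo d) ξ * starRingEnd ℂ ((𝓕 g : LTwo d) ξ))

/-- The quadratic form of the Fourier multiplier with nonnegative symbol `w`. -/
noncomputable def weightForm (w : 𝔼 → ℝ) (f : LTwo d) : ℝ :=
  ∫ ξ, w ξ * ‖(𝓕 f : LTwo d) ξ‖ ^ 2

theorem integrable_fourier_mul_conj (f g : LTwo d) :
    Integrable fun ξ => (𝓕 f : LTwo d) ξ * starRingEnd ℂ ((𝓕 g : LTwo d) ξ) :=
  (Lp.memLp (𝓕 f : LTwo d)).integrable_mul (Lp.memLp (𝓕 g : LTwo d)).star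

theorem integrable_norm_fourier_sq (f : LTwo d) :
    Integrable fun ξ => ‖(𝓕 f : LTwo d) ξ‖ ^ 2 :=
  (Lp.memLp (𝓕 f : LTwo d)).integrable_norm_pow (by norm_num)

theorem integral_norm_fourier_sq (f : LTwo d) :
    ∫ ξ, ‖(𝓕 f : LTwo d) ξ‖ ^ 2 = ‖f‖ ^ 2 := by
  rw [← Lp.norm_fourier_eq f]
  have := L2.inner_def (𝕜 := ℂ) (𝓕 f : LTwo d) (𝓕 f)
  rw [inner_self_eq_norm_sq_to_K] at this
  have h2 : ∫ ξ, inner ℂ ((𝓕 f : LTwo d) ξ) ((𝓕 f : LTwo d) ξ) =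
      ((∫ ξ, ‖(𝓕 f : LTwo d) ξ‖ ^ 2 : ℝ) : ℂ) := by
    rw [← integral_complex_ofReal]
    congr 1 with ξ
    rw [inner_self_eq_norm_sq_to_K]; simp
  rw [h2] at this
  apply Complex.ofReal_injective
  rw [← this]
  simp

theorem integrable_multiplierForm {m : 𝔼 → ℂ} (hm : AEStronglyMeasurable m) {B : ℝ}
    (hB : ∀ ξ, ‖m ξ‖ ≤ B) (f g : LTwo d) :
    Integrable fun ξ => m ξ * ((𝓕 f : LTwo d) ξ * starRingEnd ℂ ((𝓕 g : LTwo d) ξ)) :=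
  (integrable_fourier_mul_conj f g).bdd_mul hm (Eventually.of_forall hB)

theorem integrable_weightForm {w : 𝔼 → ℝ} (hw : AEStronglyMeasurable w) {B : ℝ}
    (hB : ∀ ξ, |w ξ| ≤ B) (f : LTwo d) :
    Integrable fun ξ => w ξ * ‖(𝓕 f : LTwo d) ξ‖ ^ 2 :=
  (integrable_norm_fourier_sq f).bdd_mul hw (Eventually.of_forall hB)

theorem weightForm_nonneg {w : 𝔼 → ℝ} (hw : ∀ ξ, 0 ≤ w ξ) (f : LTwo d) : 0 ≤ weightForm w f :=
  integral_nonneg fun ξ => mul_nonneg (hw ξ) (by positivity)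

theorem weightForm_le {w : 𝔼 → ℝ} {B : ℝ} (hw : ∀ ξ, 0 ≤ w ξ)
    (hB : ∀ ξ, w ξ ≤ B) (f : LTwo d) : weightForm w f ≤ B * ‖f‖ ^ 2 := by
  rw [← integral_norm_fourier_sq, ← integral_const_mul]
  refine integral_mono_of_nonneg (Eventually.of_forall fun ξ => mul_nonneg (hw ξ) (by positivity))
    ((integrable_norm_fourier_sq f).const_mul _) (Eventually.of_forall fun ξ => ?_)
  exact mul_le_mul_of_nonneg_right (hB ξ) (by positivity)

theorem weightForm_mono {w w' : 𝔼 → ℝ} (hw : ∀ ξ, 0 ≤ w ξ) (hw' : AEStronglyMeasurable w') {B : ℝ}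
    (hB : ∀ ξ, |w' ξ| ≤ B) (h : ∀ ξ, w ξ ≤ w' ξ) (f : LTwo d) :
    weightForm w f ≤ weightForm w' f :=
  integral_mono_of_nonneg (Eventually.of_forall fun ξ => mul_nonneg (hw ξ) (by positivity))
    (integrable_weightForm hw' hB f) (Eventually.of_forall fun ξ =>
      mul_le_mul_of_nonneg_right (h ξ) (by positivity))

/-- Cauchy–Schwarz for a multiplier dominated by a weight. -/
theorem norm_multiplierForm_le {m : 𝔼 → ℂ} {w : 𝔼 → ℝ} (hw : AEStronglyMeasurable w) {B : ℝ}
    (hB : ∀ ξ, |w ξ| ≤ B) (h : ∀ ξ, ‖m ξ‖ ≤ w ξ) (f g : LTwo d) :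
    ‖multiplierForm m f g‖ ≤ √(weightForm w f) * √(weightForm w g) := by
  have hw0 : ∀ ξ, 0 ≤ w ξ := fun ξ => (norm_nonneg _).trans (h ξ)
  have hmem : ∀ f : LTwo d, MemLp (fun ξ => √(w ξ) * ‖(𝓕 f : LTwo d) ξ‖) 2 := by
    intro f
    have h1 : AEStronglyMeasurable fun ξ => √(w ξ) :=
      Real.continuous_sqrt.comp_aestronglyMeasurable hw
    refine (memLp_two_iff_integrable_sq (h1.mul (Lp.memLp (𝓕 f : LTwo d)).1.norm)).2 ?_
    refine (integrable_weightForm hw hB f).congr (Eventually.of_forall fun ξ => ?_)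
    simp only [Pi.mul_apply, mul_pow, Real.sq_sqrt (hw0 ξ)]
  have hsq : ∀ f : LTwo d, (∫ ξ, (√(w ξ) * ‖(𝓕 f : LTwo d) ξ‖) ^ (2 : ℝ)) ^ (1 / (2 : ℝ)) =
      √(weightForm w f) := by
    intro f
    rw [Real.sqrt_eq_rpow, weightForm]
    congr 2 with ξ
    rw [Real.rpow_two, mul_pow, Real.sq_sqrt (hw0 ξ)]
  have key := integral_mul_le_Lp_mul_Lq_of_nonneg (μ := (volume : Measure 𝔼))
    (Real.HolderConjugate.two_two)
    (f := fun ξ => √(w ξ) * ‖(𝓕 f : LTwo d) ξ‖) (g := fun ξ => √(w ξ) * ‖(𝓕 g : LTwo d) ξ‖)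
    (Eventually.of_forall fun ξ => by positivity) (Eventually.of_forall fun ξ => by positivity)
    (by simpa using hmem f) (by simpa using hmem g)
  rw [hsq, hsq] at key
  refine le_trans (norm_integral_le_of_norm_le ((hmem f).integrable_mul (hmem g))
    (Eventually.of_forall fun ξ => ?_)) key
  simp only [Pi.mul_apply, norm_mul, RCLike.norm_conj]
  calc _ ≤ w ξ * (‖(𝓕 f : LTwo d) ξ‖ * ‖(𝓕 g : LTwo d) ξ‖) := by gcongr; exact h ξ
    _ = (√(w ξ) * √(w ξ)) * (‖(𝓕 f : LTwo d) ξ‖ * ‖(𝓕 g : LTwo d) ξ‖) := by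
        rw [Real.mul_self_sqrt (hw0 ξ)]
    _ = _ := by ring

theorem norm_multiplierForm_le_of_bounded {m : 𝔼 → ℂ} {B : ℝ} (hB : ∀ ξ, ‖m ξ‖ ≤ B) (f g : LTwo d) :
    ‖multiplierForm m f g‖ ≤ B * (‖f‖ * ‖g‖) := by
  have hB0 : 0 ≤ B := (norm_nonneg _).trans (hB 0)
  have h1 := norm_multiplierForm_le (w := fun _ => B) aestronglyMeasurable_const (B := B)
    (fun _ => (abs_of_nonneg hB0).le) hB f g
  have h2 : ∀ f : LTwo d, weightForm (fun _ => B) f = B * ‖f‖ ^ 2 := fun f => by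
    rw [weightForm, integral_const_mul, integral_norm_fourier_sq]
  rw [h2, h2, ← Real.sqrt_mul (by positivity)] at h1
  refine h1.trans (le_of_eq ?_)
  rw [show B * ‖f‖ ^ 2 * (B * ‖g‖ ^ 2) = (B * (‖f‖ * ‖g‖)) ^ 2 by ring, Real.sqrt_sq (by positivity)]

theorem multiplierForm_add_left {m : 𝔼 → ℂ} (hm : AEStronglyMeasurable m) {B : ℝ}
    (hB : ∀ ξ, ‖m ξ‖ ≤ B) (f f' g : LTwo d) :
    multiplierForm m (f + f') g = multiplierForm m f g + multiplierForm m f' g := by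
  simp only [multiplierForm]
  rw [← integral_add (integrable_multiplierForm hm hB f g) (integrable_multiplierForm hm hB f' g)]
  refine integral_congr_ae ?_
  have : (𝓕 (f + f') : LTwo d) = 𝓕 f + 𝓕 f' := FourierTransform.fourier_add f f'
  rw [this]
  filter_upwards [Lp.coeFn_add (𝓕 f : LTwo d) (𝓕 f')] with ξ h
  rw [h]; simp only [Pi.add_apply]; ring

theorem multiplierForm_add_right {m : 𝔼 → ℂ} (hm : AEStronglyMeasurable m) {B : ℝ}
    (hB : ∀ ξ, ‖m ξ‖ ≤ B) (f g g' : LTwo d) :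
    multiplierForm m f (g + g') = multiplierForm m f g + multiplierForm m f g' := by
  simp only [multiplierForm]
  rw [← integral_add (integrable_multiplierForm hm hB f g) (integrable_multiplierForm hm hB f g')]
  refine integral_congr_ae ?_
  have : (𝓕 (g + g') : LTwo d) = 𝓕 g + 𝓕 g' := FourierTransform.fourier_add g g'
  rw [this]
  filter_upwards [Lp.coeFn_add (𝓕 g : LTwo d) (𝓕 g')] with ξ h
  rw [h]; simp only [Pi.add_apply, map_add]; ring

theorem multiplierForm_zero_left (m : 𝔼 → ℂ) (g : LTwo d) : multiplierForm m 0 g = 0 := by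
  simp only [multiplierForm]
  have : (𝓕 (0 : LTwo d) : LTwo d) = 0 := (Lp.fourierTransformₗᵢ _ ℂ).map_zero
  rw [this, integral_eq_zero_of_ae]
  filter_upwards [Lp.coeFn_zero ℂ 2 (volume : Measure 𝔼)] with ξ h
  rw [h]; simp

theorem multiplierForm_zero_right (m : 𝔼 → ℂ) (f : LTwo d) : multiplierForm m f 0 = 0 := by
  simp only [multiplierForm]
  have : (𝓕 (0 : LTwo d) : LTwo d) = 0 := (Lp.fourierTransformₗᵢ _ ℂ).map_zero
  rw [this, integral_eq_zero_of_ae]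
  filter_upwards [Lp.coeFn_zero ℂ 2 (volume : Measure 𝔼)] with ξ h
  rw [h]; simp

/-- The kernel bound `L¹ → L^∞`. -/
theorem norm_multiplierForm_le_of_kernel {m : 𝔼 → ℂ} (hm : Integrable m) {κ : ℝ}
    (hκ : ∀ x : 𝔼, ‖∫ ξ, Complex.exp (Complex.I * ((2 * Real.pi * inner ℝ x ξ : ℝ) : ℂ)) * m ξ‖ ≤ κ)
    {f g : LTwo d} (hf : Integrable f) (hg : Integrable g) :
    ‖multiplierForm m f g‖ ≤ κ * ((∫ x, ‖f x‖) * ∫ x, ‖g x‖) := by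
  set F : 𝔼 → ℂ := 𝓕 (f : 𝔼 → ℂ)
  set G : 𝔼 → ℂ := 𝓕 (g : 𝔼 → ℂ)
  have hGc : Continuous G := VectorFourier.fourierIntegral_continuous Real.continuous_fourierChar
      continuous_inner hg
  have hGb : ∀ ξ, ‖G ξ‖ ≤ ∫ x, ‖g x‖ := fun ξ =>
    VectorFourier.norm_fourierIntegral_le_integral_norm _ _ _ _ _
  have e1 : multiplierForm m f g = ∫ ξ, F ξ • (m ξ * starRingEnd ℂ (G ξ)) := by
    refine integral_congr_ae ?_
    filter_upwards [coeFn_fourier_ae_eq f hf, coeFn_fourier_ae_eq g hg] with ξ h1 h2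
    rw [h1, h2, smul_eq_mul]; ring
  have hmG : Integrable fun ξ => m ξ * starRingEnd ℂ (G ξ) :=
    hm.mul_bdd (Complex.continuous_conj.comp hGc).aestronglyMeasurable
      (Eventually.of_forall fun ξ => by simpa using hGb ξ)
  have e2 := VectorFourier.integral_fourierIntegral_smul_eq_flip (μ := volume) (ν := volume)
    (L := innerₗ (EuclideanSpace ℝ (Fin d))) Real.continuous_fourierChar continuous_inner hf hmG
  rw [flip_innerₗ] at e2
  have e3 : multiplierForm m f g = ∫ y, f y • 𝓕 (fun ξ => m ξ * starRingEnd ℂ (G ξ)) y := by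
    rw [e1]; exact e2
  have hchar : ∀ y ξ : 𝔼, ((Real.fourierChar (-(inner ℝ ξ y)) : Circle) : ℂ) =
      Complex.exp (Complex.I * ((2 * Real.pi * inner ℝ (-y) ξ : ℝ) : ℂ)) := by
    intro y ξ
    rw [Real.fourierChar_apply, inner_neg_left, real_inner_comm, mul_comm Complex.I]
  -- The multiplication formula is used a second time, now for `g`; the transform `𝓕 M x` is the
  -- conjugate of the convolution kernel at `x - y`.
  have e4 : ∀ y, ‖𝓕 (fun ξ => m ξ * starRingEnd ℂ (G ξ)) y‖ ≤ κ * ∫ x, ‖g x‖ := by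
    intro y
    set M : 𝔼 → ℂ := fun ξ => starRingEnd ℂ (((Real.fourierChar (-(inner ℝ ξ y)) : Circle) : ℂ) * m ξ)
    have hMi : Integrable M := by
      have h0 : Integrable fun ξ => ((Real.fourierChar (-(inner ℝ ξ y)) : Circle) : ℂ) * m ξ := by
        refine hm.bdd_mul (c := 1) (Continuous.aestronglyMeasurable ?_)
          (Eventually.of_forall fun ξ => (Circle.norm_coe _).le)
        have := Real.continuous_fourierChar
        fun_prop
      exact (Complex.conjCLE.toContinuousLinearMap).integrable_comp h0
    have h1 : 𝓕 (fun ξ => m ξ * starRingEnd ℂ (G ξ)) y = starRingEnd ℂ (∫ ξ, G ξ • M ξ) := by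
      rw [← integral_conj, Real.fourier_eq]
      congr 1 with ξ
      simp only [M, Circle.smul_def, smul_eq_mul, map_mul, Complex.conj_conj]
      ring
    have h2 := VectorFourier.integral_fourierIntegral_smul_eq_flip (μ := volume) (ν := volume)
      (L := innerₗ (EuclideanSpace ℝ (Fin d))) Real.continuous_fourierChar continuous_inner hg hMi
    rw [flip_innerₗ] at h2
    have h3 : ∫ ξ, G ξ • M ξ = ∫ x, g x • 𝓕 M x := h2
    rw [h1, RCLike.norm_conj, h3, ← integral_const_mul]
    refine norm_integral_le_of_norm_le (hg.norm.const_mul _) (Eventually.of_forall fun x => ?_)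
    rw [norm_smul, mul_comm]
    refine mul_le_mul_of_nonneg_right ?_ (norm_nonneg _)
    have h4 : 𝓕 M x = starRingEnd ℂ (∫ ξ, Complex.exp (Complex.I *
        ((2 * Real.pi * inner ℝ (x - y) ξ : ℝ) : ℂ)) * m ξ) := by
      rw [← integral_conj, Real.fourier_eq]
      congr 1 with ξ
      simp only [M, Circle.smul_def, smul_eq_mul, hchar, map_mul, ← mul_assoc]
      congr 1
      rw [← Complex.exp_conj, ← Complex.exp_conj, ← Complex.exp_add]
      congr 1
      simp only [map_mul, Complex.conj_I, Complex.conj_ofReal, inner_neg_left, inner_sub_left]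
      push_cast; ring
    rw [h4, RCLike.norm_conj]
    exact hκ _
  rw [e3]
  calc _ ≤ ∫ y, ‖f y‖ * (κ * ∫ x, ‖g x‖) :=
        norm_integral_le_of_norm_le (hf.norm.mul_const _) (Eventually.of_forall fun y => by
          rw [norm_smul]; exact mul_le_mul_of_nonneg_left (e4 y) (norm_nonneg _))
    _ = _ := by rw [integral_mul_const]; ring

end FourierForm

/-! ### Time amplitudes and their Fourier integrals. -/

section Amplitudes

/-- A smooth cutoff, `1` on `(-∞, 1]` and `0` on `[2, ∞)`. -/
noncomputable def smoothCutoff (s : ℝ) : ℝ := Real.smoothTransition (2 - s)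

/-- A smooth bump supported in `[1, 4]` whose dyadic dilates form a partition of unity. -/
noncomputable def dyadicBump (s : ℝ) : ℝ := smoothCutoff (s / 2) - smoothCutoff s

/-- The dyadic bump with an exponential damping factor. -/
noncomputable def dampedBump (b σ : ℝ) : ℂ := ((dyadicBump σ * Real.exp (-b * σ) : ℝ) : ℂ)

theorem smoothCutoff_of_le {s : ℝ} (h : s ≤ 1) : smoothCutoff s = 1 :=
  Real.smoothTransition.one_of_one_le (by linarith)

theorem smoothCutoff_of_ge {s : ℝ} (h : 2 ≤ s) : smoothCutoff s = 0 :=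
  Real.smoothTransition.zero_of_nonpos (by linarith)

theorem contDiff_smoothCutoff : ContDiff ℝ ∞ smoothCutoff :=
  Real.smoothTransition.contDiff.comp (contDiff_const.sub contDiff_id)

theorem smoothCutoff_mem_Icc (s : ℝ) : smoothCutoff s ∈ Set.Icc (0 : ℝ) 1 :=
  ⟨Real.smoothTransition.nonneg _, Real.smoothTransition.le_one _⟩

theorem contDiff_dyadicBump : ContDiff ℝ ∞ dyadicBump :=
  (contDiff_smoothCutoff.comp (contDiff_id.div_const 2)).sub contDiff_smoothCutoff

theorem dyadicBump_eq_zero {s : ℝ} (h : s ∉ Set.Icc (1 : ℝ) 4) : dyadicBump s = 0 := by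
  rw [Set.mem_Icc, not_and_or, not_le, not_le] at h
  rcases h with h | h
  · rw [dyadicBump, smoothCutoff_of_le (by linarith), smoothCutoff_of_le h.le, sub_self]
  · rw [dyadicBump, smoothCutoff_of_ge (by linarith), smoothCutoff_of_ge (by linarith), sub_self]

theorem hasCompactSupport_of_eq_zero_off_Icc {F : Type*} [Zero F] {f : ℝ → F} {x y : ℝ}
    (h : ∀ t, t ∉ Set.Icc x y → f t = 0) : HasCompactSupport f :=
  HasCompactSupport.of_support_subset_isCompact isCompact_Icc fun t ht => by
    by_contra h0; exact ht (h t h0)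

theorem iteratedFDeriv_eq_zero_off_Icc {F : Type*} [NormedAddCommGroup F] [NormedSpace ℝ F]
    {f : ℝ → F} {x y : ℝ} (h : ∀ t, t ∉ Set.Icc x y → f t = 0) (i : ℕ) {t : ℝ}
    (ht : t ∉ Set.Icc x y) : iteratedFDeriv ℝ i f t = 0 := by
  have h1 : tsupport f ⊆ Set.Icc x y :=
    closure_minimal (fun t ht => by by_contra h0; exact ht (h t h0)) isClosed_Icc
  by_contra h2
  exact ht (h1 (support_iteratedFDeriv_subset i h2))

theorem iteratedDeriv_cexp_const_mul_ofReal (c : ℂ) (n : ℕ) :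
    iteratedDeriv n (fun t : ℝ => Complex.exp (c * (t : ℂ))) =
      fun t : ℝ => c ^ n * Complex.exp (c * (t : ℂ)) := by
  induction n with
  | zero => simp
  | succ n ih =>
    rw [iteratedDeriv_succ, ih]
    ext t
    have h1 : HasDerivAt (fun t : ℝ => Complex.exp (c * (t : ℂ)))
        (Complex.exp (c * (t : ℂ)) * (c * 1)) t :=
      ((Complex.ofRealCLM.hasDerivAt (x := t)).const_mul c).cexp
    rw [(h1.const_mul _).deriv]
    ring

theorem contDiff_cexp_const_mul_ofReal (c : ℂ) :
    ContDiff ℝ ∞ fun t : ℝ => Complex.exp (c * (t : ℂ)) :=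
  (contDiff_const.mul Complex.ofRealCLM.contDiff).cexp

theorem dampedBump_eq_mul (b : ℝ) :
    dampedBump b = fun σ => (dyadicBump σ : ℂ) * Complex.exp (((-b : ℝ) : ℂ) * (σ : ℂ)) := by
  ext σ
  simp [dampedBump]

theorem contDiff_dampedBump (b : ℝ) : ContDiff ℝ ∞ (dampedBump b) := by
  rw [dampedBump_eq_mul]
  exact (Complex.ofRealCLM.contDiff.comp contDiff_dyadicBump).mul (contDiff_cexp_const_mul_ofReal _)

theorem dampedBump_eq_zero (b : ℝ) : ∀ t, t ∉ Set.Icc (1 : ℝ) 4 → dampedBump b t = 0 := by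
  intro t ht
  simp [dampedBump, dyadicBump_eq_zero ht]

/-- On `[1, 4]` the factor `exp (-bσ)` is at most `exp (-b)`, which absorbs the powers of `b` from
differentiation and one power more. That spare factor `(1 + b)⁻¹`, with `b = N ε`, is what later
permits comparison with the Poisson weight at height `ε` when `N ε > 1`. -/
theorem exists_norm_iteratedFDeriv_dampedBump_le (k : ℕ) : ∃ C, 0 ≤ C ∧ ∀ b, 0 ≤ b → ∀ i ≤ k, ∀ t,
    ‖iteratedFDeriv ℝ i (dampedBump b) t‖ ≤ C * (1 + b)⁻¹ := by
  have h1 : ContDiff ℝ ∞ fun σ => (dyadicBump σ : ℂ) :=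
    Complex.ofRealCLM.contDiff.comp contDiff_dyadicBump
  obtain ⟨C, hC0, hC⟩ := exists_norm_iteratedFDeriv_le h1
    (hasCompactSupport_of_eq_zero_off_Icc (x := 1) (y := 4) fun t ht => by
      simp [dyadicBump_eq_zero ht]) k
  refine ⟨2 ^ k * C * (Real.exp 1 * (k + 1).factorial), by positivity, fun b hb i hi t => ?_⟩
  by_cases ht : t ∈ Set.Icc (1 : ℝ) 4
  swap
  · rw [iteratedFDeriv_eq_zero_off_Icc (dampedBump_eq_zero b) i ht, norm_zero]
    positivity
  rw [dampedBump_eq_mul]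
  have h2 : ∀ i ≤ k, ‖iteratedFDeriv ℝ i (fun σ : ℝ => Complex.exp (((-b : ℝ) : ℂ) * (σ : ℂ))) t‖ ≤
      Real.exp 1 * (k + 1).factorial * (1 + b)⁻¹ := by
    intro i hi
    rw [norm_iteratedFDeriv_eq_norm_iteratedDeriv, iteratedDeriv_cexp_const_mul_ofReal, norm_mul,
      norm_pow, Complex.norm_real, norm_neg, Real.norm_of_nonneg hb, ← Complex.ofReal_mul,
      Complex.norm_exp_ofReal, ← div_eq_mul_inv, le_div_iff₀ (by positivity)]
    have h3 := Real.pow_div_factorial_le_exp (1 + b) (by positivity) (k + 1)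
    rw [div_le_iff₀ (by positivity)] at h3
    calc b ^ i * Real.exp (-b * t) * (1 + b)
        ≤ (1 + b) ^ i * Real.exp (-b) * (1 + b) := by
          gcongr
          · linarith
          · nlinarith [ht.1]
      _ = (1 + b) ^ (i + 1) * Real.exp (-b) := by ring
      _ ≤ (1 + b) ^ (k + 1) * Real.exp (-b) := by gcongr; linarith
      _ ≤ Real.exp (1 + b) * (k + 1).factorial * Real.exp (-b) := by gcongr
      _ = Real.exp 1 * (k + 1).factorial := by
          rw [Real.exp_add, mul_right_comm, mul_assoc (Real.exp 1), ← Real.exp_add]; simp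
  refine (norm_iteratedFDeriv_mul_le_two_pow h1 (contDiff_cexp_const_mul_ofReal _)
    (fun i hi => hC i hi t) h2 i hi).trans (le_of_eq ?_)
  ring

/-- The Fourier integral of an amplitude on the line. -/
noncomputable def oscTransform (a : ℝ → ℂ) (t : ℝ) : ℂ :=
  ∫ σ : ℝ, Complex.exp (Complex.I * ((-t * σ : ℝ) : ℂ)) * a σ

/-- The bounds from zero and from two integrations by parts are added; each contributes `3 A`, where
`3` is the length of `[1, 4]`. -/
theorem norm_oscTransform_le {a : ℝ → ℂ} (ha : ContDiff ℝ ∞ a)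
    (hs : ∀ t, t ∉ Set.Icc (1 : ℝ) 4 → a t = 0) {A : ℝ}
    (hA : ∀ i ≤ 2, ∀ t, ‖iteratedFDeriv ℝ i a t‖ ≤ A) (t : ℝ) :
    ‖oscTransform a t‖ ≤ 6 * A * (1 + t ^ 2)⁻¹ := by
  have hint : ∀ i ≤ 2, ∫ u, ‖iteratedFDeriv ℝ i a u‖ ≤ 3 * A := by
    intro i hi
    rw [← setIntegral_eq_integral_of_forall_compl_eq_zero (s := Set.Icc (1 : ℝ) 4)
      fun u hu => by rw [iteratedFDeriv_eq_zero_off_Icc hs i hu, norm_zero]]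
    refine (Real.le_norm_self _).trans ((norm_setIntegral_le_of_norm_le_const (C := A)
      (by simp) fun u _ => ?_).trans (le_of_eq ?_))
    · rw [norm_norm]; exact hA i hi u
    · simp; ring
  have h := fun k => pow_mul_norm_integral_exp_mul_le (μ := (volume : Measure ℝ))
    ((-t) • ContinuousLinearMap.id ℝ ℝ) 1 k ha (hasCompactSupport_of_eq_zero_off_Icc hs)
  have h0 := (h 0).trans (mul_le_mul_of_nonneg_left (hint 0 (by norm_num)) (by positivity))
  have h2 := (h 2).trans (mul_le_mul_of_nonneg_left (hint 2 le_rfl) (by positivity))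
  simp only [smul_apply, ContinuousLinearMap.id_apply, smul_eq_mul, pow_zero,
    one_mul, norm_one, one_pow, mul_one, abs_neg, sq_abs] at h0 h2
  rw [← div_eq_mul_inv, le_div_iff₀ (by positivity)]
  simp only [oscTransform]
  linarith

/-- With `δ = t' - t` the difference is the transform of `a σ (1 - exp (-iδσ))`. On `[1, 4]` this
amplitude has derivatives of order `|δ|`, where `|δ| ≤ B` is used to reduce `δ²` to `|δ|`, so the
decay in `t` persists with a gain `|δ|`. -/
theorem exists_norm_oscTransform_sub_le {B : ℝ} (hB : 0 ≤ B) : ∃ C, 0 ≤ C ∧ ∀ a : ℝ → ℂ, ContDiff ℝ ∞ a →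
    (∀ t, t ∉ Set.Icc (1 : ℝ) 4 → a t = 0) → ∀ A : ℝ,
    (∀ i ≤ 2, ∀ t, ‖iteratedFDeriv ℝ i a t‖ ≤ A) → ∀ t t' : ℝ, |t' - t| ≤ B →
    ‖oscTransform a t - oscTransform a t'‖ ≤ C * A * |t' - t| * (1 + t ^ 2)⁻¹ := by
  refine ⟨6 * (2 ^ 2 * (4 + 1 + B)), by positivity, fun a ha hs A hA t t' htt => ?_⟩
  have hA0 : 0 ≤ A := (norm_nonneg _).trans (hA 0 (by norm_num) 0)
  set δ := t' - t with hδ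
  set e : ℝ → ℂ := fun σ => 1 - Complex.exp ((-(Complex.I * δ)) * (σ : ℂ)) with he
  have hes : ContDiff ℝ ∞ e := contDiff_const.sub (contDiff_cexp_const_mul_ofReal _)
  have hac := hasCompactSupport_of_eq_zero_off_Icc hs
  have hsub : oscTransform a t - oscTransform a t' = oscTransform (fun σ => a σ * e σ) t := by
    simp only [oscTransform]
    rw [← integral_sub]
    · congr 1 with σ
      have : Complex.exp (Complex.I * ((-t' * σ : ℝ) : ℂ)) =
          Complex.exp (Complex.I * ((-t * σ : ℝ) : ℂ)) * Complex.exp ((-(Complex.I * δ)) * (σ : ℂ)) := by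
        rw [← Complex.exp_add]; congr 1; rw [hδ]; push_cast; ring
      rw [this, he]
      ring
    · exact Continuous.integrable_of_hasCompactSupport (by have := ha.continuous; fun_prop) hac.mul_left
    · exact Continuous.integrable_of_hasCompactSupport (by have := ha.continuous; fun_prop) hac.mul_left
  have hb : ∀ i ≤ 2, ∀ u, ‖iteratedFDeriv ℝ i (fun σ => a σ * e σ) u‖ ≤
      2 ^ 2 * A * ((4 + 1 + B) * |δ|) := by
    intro i hi u
    by_cases hu : u ∈ Set.Icc (1 : ℝ) 4
    swap
    · rw [iteratedFDeriv_eq_zero_off_Icc (fun t ht => by simp [hs t ht]) i hu, norm_zero]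
      positivity
    refine norm_iteratedFDeriv_mul_le_two_pow ha hes (fun i hi => hA i hi u) (fun j hj => ?_) i hi
    have hn : ∀ u : ℝ, ‖Complex.exp ((-(Complex.I * δ)) * (u : ℂ))‖ = 1 := by
      intro u
      rw [show (-(Complex.I * δ)) * (u : ℂ) = ((-(δ * u) : ℝ) : ℂ) * Complex.I by push_cast; ring,
        Complex.norm_exp_ofReal_mul_I]
    have hderiv : ∀ n, iteratedDeriv (n + 1) e u =
        -((-(Complex.I * δ)) ^ (n + 1) * Complex.exp ((-(Complex.I * δ)) * (u : ℂ))) := by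
      intro n
      have h1 : e = fun σ => (1 : ℂ) - (fun σ : ℝ => Complex.exp ((-(Complex.I * δ)) * (σ : ℂ))) σ := rfl
      rw [h1, iteratedDeriv_const_sub (by omega), iteratedDeriv_neg,
        iteratedDeriv_cexp_const_mul_ofReal]
    rw [norm_iteratedFDeriv_eq_norm_iteratedDeriv]
    have hδ0 := abs_nonneg δ
    match j, hj with
    | 0, _ =>
      rw [iteratedDeriv_zero]
      have h1 := Real.norm_exp_I_mul_ofReal_sub_one_le (x := -(δ * u))
      have h2 : ‖e u‖ ≤ |δ| * 4 := by
        have h3 : (-(Complex.I * δ)) * (u : ℂ) = Complex.I * ((-(δ * u) : ℝ) : ℂ) := by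
          push_cast; ring
        rw [he, norm_sub_rev]
        simp only [h3]
        refine h1.trans ?_
        rw [Real.norm_eq_abs, abs_neg, abs_mul]
        exact mul_le_mul_of_nonneg_left (abs_le.2 ⟨by linarith [hu.1], hu.2⟩) hδ0
      nlinarith
    | 1, _ =>
      rw [hderiv 0, norm_neg, norm_mul, hn]
      simp only [zero_add, pow_one, norm_neg, norm_mul, Complex.norm_I, Complex.norm_real,
        Real.norm_eq_abs]
      nlinarith
    | 2, _ =>
      rw [hderiv 1, norm_neg, norm_mul, hn, norm_pow]
      simp only [norm_neg, norm_mul, Complex.norm_I, Complex.norm_real, Real.norm_eq_abs, one_mul,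
        mul_one]
      have h1 : |δ| ^ (1 + 1) = |δ| * |δ| := by ring
      rw [h1]
      nlinarith [mul_le_mul_of_nonneg_left htt hδ0]
  rw [hsub]
  refine (norm_oscTransform_le (ha.mul hes) (fun t ht => by simp [hs t ht]) hb t).trans (le_of_eq ?_)
  ring

end Amplitudes

/-! ### Dyadic pieces of the resolvent symbol. -/

section DyadicSymbols

variable {d : ℕ}

local notation "𝔼" => EuclideanSpace ℝ (Fin d)

/-- A dyadic piece, at time scale `N`, of the resolvent symbol `θ / (S - l)`. -/
noncomputable def dyadicSymbol (a : ℝ → ℂ) (θ S : 𝔼 → ℝ) (l N : ℝ) (ξ : 𝔼) : ℂ :=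
  (N : ℂ) * (θ ξ : ℂ) * oscTransform a (N * (S ξ - l))

/-- The weight that dominates a dyadic piece of the resolvent symbol. -/
noncomputable def dyadicWeight (θ T : 𝔼 → ℝ) (l N : ℝ) (ξ : 𝔼) : ℝ :=
  θ ξ * (N * (1 + (N * (T ξ - l)) ^ 2)⁻¹)

theorem dyadicWeight_nonneg {θ T : 𝔼 → ℝ} (hθ : ∀ ξ, 0 ≤ θ ξ) {N : ℝ} (hN : 0 ≤ N) (l : ℝ) (ξ : 𝔼) :
    0 ≤ dyadicWeight θ T l N ξ :=
  mul_nonneg (hθ ξ) (by positivity)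

theorem dyadicWeight_le {θ T : 𝔼 → ℝ} (hθ : ∀ ξ, 0 ≤ θ ξ) {B : ℝ} (hB : ∀ ξ, θ ξ ≤ B) {N : ℝ}
    (hN : 0 ≤ N) (l : ℝ) (ξ : 𝔼) : dyadicWeight θ T l N ξ ≤ B * N := by
  refine mul_le_mul (hB ξ) ?_ (by positivity) ((hθ ξ).trans (hB ξ))
  refine mul_le_of_le_one_right hN (inv_le_one_of_one_le₀ ?_)
  nlinarith [sq_nonneg (N * (T ξ - l))]

theorem continuous_dyadicWeight {θ T : 𝔼 → ℝ} (hθ : Continuous θ) (hT : Continuous T) (l N : ℝ) :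
    Continuous (dyadicWeight θ T l N) := by
  unfold dyadicWeight
  refine hθ.mul (continuous_const.mul (Continuous.inv₀ (by fun_prop) fun ξ => ?_))
  positivity

theorem continuous_oscTransform {a : ℝ → ℂ} (ha : Continuous a) (hac : HasCompactSupport a) :
    Continuous (oscTransform a) := by
  refine continuous_of_dominated (bound := fun σ => ‖a σ‖) (fun t => ?_) (fun t => ?_)
    (ha.norm.integrable_of_hasCompactSupport hac.norm) ?_
  · exact Continuous.aestronglyMeasurable (by fun_prop)
  · refine Eventually.of_forall fun σ => ?_
    rw [norm_mul, mul_comm Complex.I, Complex.norm_exp_ofReal_mul_I, one_mul]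
  · exact Eventually.of_forall fun σ => by fun_prop

theorem continuous_dyadicSymbol {a : ℝ → ℂ} (ha : Continuous a) (hac : HasCompactSupport a)
    {θ S : 𝔼 → ℝ} (hθ : Continuous θ) (hS : Continuous S) (l N : ℝ) :
    Continuous (dyadicSymbol a θ S l N) := by
  have := continuous_oscTransform ha hac
  unfold dyadicSymbol
  fun_prop

theorem norm_dyadicSymbol_le {a : ℝ → ℂ} (ha : ContDiff ℝ ∞ a)
    (hs : ∀ t, t ∉ Set.Icc (1 : ℝ) 4 → a t = 0) {A : ℝ}
    (hA : ∀ i ≤ 2, ∀ t, ‖iteratedFDeriv ℝ i a t‖ ≤ A) {θ : 𝔼 → ℝ} (hθ : ∀ ξ, 0 ≤ θ ξ) (T : 𝔼 → ℝ)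
    (l : ℝ) {N : ℝ} (hN : 0 ≤ N) (ξ : 𝔼) :
    ‖dyadicSymbol a θ T l N ξ‖ ≤ 6 * A * dyadicWeight θ T l N ξ := by
  rw [dyadicSymbol, norm_mul, norm_mul, Complex.norm_real, Complex.norm_real,
    Real.norm_of_nonneg hN, Real.norm_of_nonneg (hθ ξ)]
  refine (mul_le_mul_of_nonneg_left (norm_oscTransform_le ha hs hA _)
    (mul_nonneg hN (hθ ξ))).trans (le_of_eq ?_)
  rw [dyadicWeight]; ring

/-- The phase `N (S - l)` differs from `N (T - l)` by at most `D`, so exchanging `S` for `T` gains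
the factor `D`. The dominating weight involves only `T`, which lets the bootstrap hypothesis for `T`
control this error. -/
theorem exists_norm_dyadicSymbol_sub_le {B : ℝ} (hB : 0 ≤ B) : ∃ C, 0 ≤ C ∧ ∀ a : ℝ → ℂ,
    ContDiff ℝ ∞ a → (∀ t, t ∉ Set.Icc (1 : ℝ) 4 → a t = 0) → ∀ A : ℝ,
    (∀ i ≤ 2, ∀ t, ‖iteratedFDeriv ℝ i a t‖ ≤ A) → ∀ θ : 𝔼 → ℝ, (∀ ξ, 0 ≤ θ ξ) → ∀ T S : 𝔼 → ℝ,
    ∀ l N D : ℝ, 0 ≤ N → D ≤ B → (∀ ξ, N * |S ξ - T ξ| ≤ D) → ∀ ξ,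
    ‖dyadicSymbol a θ T l N ξ - dyadicSymbol a θ S l N ξ‖ ≤ C * A * D * dyadicWeight θ T l N ξ := by
  obtain ⟨C, hC0, hC⟩ := exists_norm_oscTransform_sub_le hB
  refine ⟨C, hC0, fun a ha hs A hA θ hθ T S l N D hN hDB hD ξ => ?_⟩
  have hA0 : 0 ≤ A := (norm_nonneg _).trans (hA 0 (by norm_num) 0)
  have h1 : |N * (S ξ - l) - N * (T ξ - l)| ≤ D := by
    rw [← mul_sub, abs_mul, abs_of_nonneg hN, sub_sub_sub_cancel_right]; exact hD ξ
  rw [dyadicSymbol, dyadicSymbol, ← mul_sub, norm_mul, norm_mul, Complex.norm_real,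
    Complex.norm_real, Real.norm_of_nonneg hN, Real.norm_of_nonneg (hθ ξ)]
  calc N * θ ξ * ‖oscTransform a (N * (T ξ - l)) - oscTransform a (N * (S ξ - l))‖
      ≤ N * θ ξ * (C * A * |N * (S ξ - l) - N * (T ξ - l)| * (1 + (N * (T ξ - l)) ^ 2)⁻¹) :=
        mul_le_mul_of_nonneg_left (hC a ha hs A hA _ _ (h1.trans hDB)) (mul_nonneg hN (hθ ξ))
    _ ≤ N * θ ξ * (C * A * D * (1 + (N * (T ξ - l)) ^ 2)⁻¹) := by
        have := mul_nonneg hN (hθ ξ)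
        gcongr
    _ = _ := by rw [dyadicWeight]; ring

/-- By Fubini the kernel of a dyadic piece is a joint oscillatory integral in time and frequency;
the nondegeneracy of the phase is available only in these joint variables. -/
theorem integral_exp_mul_dyadicSymbol {a : ℝ → ℂ} (ha : Continuous a) (hac : HasCompactSupport a)
    {θ S : 𝔼 → ℝ} (hθ : Continuous θ) (hθc : HasCompactSupport θ) (hS : Continuous S) (l N : ℝ)
    (X : 𝔼 →L[ℝ] ℝ) :
    ∫ ξ, Complex.exp (Complex.I * ((X ξ : ℝ) : ℂ)) * dyadicSymbol a θ S l N ξ =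
      N * ∫ u : ℝ × 𝔼, a u.1 * (θ u.2 : ℂ) * Complex.exp (Complex.I *
        ((X u.2 - u.1 * (N * (S u.2 - l)) : ℝ) : ℂ)) := by
  have hcont : Continuous fun u : ℝ × 𝔼 => a u.1 * (θ u.2 : ℂ) * Complex.exp (Complex.I *
        ((X u.2 - u.1 * (N * (S u.2 - l)) : ℝ) : ℂ)) := by fun_prop
  have hcs : HasCompactSupport fun u : ℝ × 𝔼 => a u.1 * (θ u.2 : ℂ) * Complex.exp (Complex.I *
        ((X u.2 - u.1 * (N * (S u.2 - l)) : ℝ) : ℂ)) := by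
    refine HasCompactSupport.intro (hac.isCompact.prod hθc.isCompact) fun u hu => ?_
    rw [Set.mem_prod, not_and_or] at hu
    rcases hu with hu | hu
    · simp [image_eq_zero_of_notMem_tsupport hu]
    · simp [image_eq_zero_of_notMem_tsupport hu]
  rw [show (volume : Measure (ℝ × 𝔼)) = volume.prod volume from rfl,
    integral_prod_symm _ (hcont.integrable_of_hasCompactSupport hcs), ← integral_const_mul]
  congr 1 with ξ
  rw [dyadicSymbol, oscTransform, ← mul_assoc, ← integral_const_mul, ← integral_const_mul]
  congr 1 with σ
  rw [show ((X ξ - σ * (N * (S ξ - l)) : ℝ) : ℂ) = ((X ξ : ℝ) : ℂ) + ((-(N * (S ξ - l)) * σ : ℝ) : ℂ) by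
    push_cast; ring, mul_add, Complex.exp_add]
  ring

theorem continuous_mollify {μ : Measure 𝔼} [μ.IsAddHaarMeasure] {η T : 𝔼 → ℝ}
    (hη : IsMollifier μ 1 η) (hT : Continuous T) {s L : ℝ} (hs : 0 < s) (hL : 0 < L) :
    Continuous (mollify μ η T (s⁻¹ * L⁻¹)) := by
  have h : mollify μ η T (s⁻¹ * L⁻¹) = fun ξ => T 0 + s⁻¹ * fderiv ℝ T 0 (s • ξ) +
      (s ^ 2)⁻¹ * taylorRemainder μ η T s L 0 (s • ξ) := by
    ext ξ
    rw [← mollify_eq_add_taylorRemainder hη hT hs hL, zero_add, inv_smul_smul₀ hs.ne']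
  rw [h]
  have := (contDiff_taylorRemainder hη hT hL (s := s) 0).continuous
  fun_prop

theorem multiplierForm_symbol_add {m m' : 𝔼 → ℂ} (hm : AEStronglyMeasurable m)
    (hm' : AEStronglyMeasurable m') {B B' : ℝ} (hB : ∀ ξ, ‖m ξ‖ ≤ B) (hB' : ∀ ξ, ‖m' ξ‖ ≤ B')
    (f g : LTwo d) :
    multiplierForm (fun ξ => m ξ + m' ξ) f g = multiplierForm m f g + multiplierForm m' f g := by
  simp only [multiplierForm, add_mul]
  exact integral_add (integrable_multiplierForm hm hB f g) (integrable_multiplierForm hm' hB' f g)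

theorem multiplierForm_const_mul (c : ℂ) (m : 𝔼 → ℂ) (f g : LTwo d) :
    multiplierForm (fun ξ => c * m ξ) f g = c * multiplierForm m f g := by
  simp only [multiplierForm, mul_assoc]
  exact integral_const_mul _ _

theorem weightForm_const_mul (c : ℝ) (w : 𝔼 → ℝ) (f : LTwo d) :
    weightForm (fun ξ => c * w ξ) f = c * weightForm w f := by
  simp only [weightForm, mul_assoc]
  exact integral_const_mul _ _

/-- The estimate for a dyadic piece of the resolvent: a trivial bound by the weight, improved for
separated data by the kernel bound for the regularised phase. -/
theorem exists_norm_dyadic_form_le {T : 𝔼 → ℝ} {M c r : ℝ} {U : Set 𝔼} (hM : 0 ≤ M)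
    (hT : Continuous T) (hT1 : ∀ ξ, ‖fderiv ℝ T ξ‖ ≤ M)
    (hT2 : ∀ ξ v, |T (ξ + v) - T ξ - fderiv ℝ T ξ v| ≤ M * ‖v‖ ^ 2) (hc : 0 < c)
    (hU : NondegenerateOn T U c) {θ : 𝔼 → ℝ} (hθ : ContDiff ℝ ∞ θ) (hθc : HasCompactSupport θ)
    (hθ0 : ∀ ξ, 0 ≤ θ ξ) (hr : 0 < r) (hr1 : r ≤ 1 / 2)
    (hθU : ∀ ξ v, θ (ξ + v) ≠ 0 → ‖v‖ ≤ r → ξ ∈ U) :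
    ∃ C, ∃ m : ℕ, 0 ≤ C ∧ ∀ b l s L : ℝ, 0 ≤ b → 1 ≤ s → 1 ≤ L → ∀ f g : LTwo d,
      Integrable f → Integrable g → ∀ G,
      √(weightForm (fun ξ => (1 + b)⁻¹ * dyadicWeight θ T l (s ^ 2) ξ) f) *
        √(weightForm (fun ξ => (1 + b)⁻¹ * dyadicWeight θ T l (s ^ 2) ξ) g) ≤ G →
      ‖multiplierForm (dyadicSymbol (dampedBump b) θ T l (s ^ 2)) f g‖ ≤
        C * (min G (L ^ m * (s ^ 2 * (s ^ (d + 1))⁻¹) * ((∫ x, ‖f x‖) * ∫ x, ‖g x‖)) +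
          (L ^ 2)⁻¹ * G) := by
  obtain ⟨η, hη⟩ := exists_isMollifier (volume : Measure 𝔼) one_pos
  obtain ⟨C1, m, hC1, hker⟩ := exists_norm_dyadic_kernel_le hη hM hc (θ := fun ξ => (θ ξ : ℂ))
    (Complex.ofRealCLM.contDiff.comp hθ) (hθc.comp_left Complex.ofReal_zero) hr hr1
    (fun ξ v h hv => hθU ξ v (by simpa using h) hv)
  obtain ⟨C2, hC2, hsub⟩ := exists_norm_dyadicSymbol_sub_le (d := d) hM
  obtain ⟨C3, hC3, hdamp⟩ := exists_norm_iteratedFDeriv_dampedBump_le (d + 2)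
  obtain ⟨Bθ, hBθ⟩ : ∃ B, ∀ ξ, θ ξ ≤ B := by
    obtain ⟨B, hB⟩ := hθc.exists_bound_of_continuous hθ.continuous
    exact ⟨B, fun ξ => (le_abs_self _).trans (hB ξ)⟩
  refine ⟨(6 + C2 * M) * C3 + C1 * C3, m, by positivity,
    fun b l s L hb hs hL f g hf hg G hG => ?_⟩
  have hs0 : 0 < s := by linarith
  have hL0 : 0 < L := by linarith
  set a := dampedBump b with ha
  set S := mollify volume η T (s⁻¹ * L⁻¹) with hS
  set w : 𝔼 → ℝ := fun ξ => (1 + b)⁻¹ * dyadicWeight θ T l (s ^ 2) ξ with hw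
  have has := contDiff_dampedBump b
  have haz := dampedBump_eq_zero b
  have hac : HasCompactSupport a := hasCompactSupport_of_eq_zero_off_Icc haz
  have hA2 : ∀ i ≤ 2, ∀ t, ‖iteratedFDeriv ℝ i a t‖ ≤ C3 * (1 + b)⁻¹ :=
    fun i hi => hdamp b hb i (by omega)
  have hScont : Continuous S := continuous_mollify hη hT hs0 hL0
  have hw0 : ∀ ξ, 0 ≤ w ξ := fun ξ =>
    mul_nonneg (by positivity) (dyadicWeight_nonneg hθ0 (by positivity) l ξ)
  have hwc : Continuous w := continuous_const.mul (continuous_dyadicWeight hθ.continuous hT l _)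
  have hwB : ∀ ξ, w ξ ≤ (1 + b)⁻¹ * (Bθ * s ^ 2) := fun ξ =>
    mul_le_mul_of_nonneg_left (dyadicWeight_le hθ0 hBθ (by positivity) l ξ) (by positivity)
  -- The mollification scale is `s⁻¹ L⁻¹` and the time is `s²`, so the phase error is `s² · M (s⁻¹
  -- L⁻¹)² = M L⁻²`, uniformly in `s`.
  have hSig : ∀ ξ, s ^ 2 * |S ξ - T ξ| ≤ M * (L ^ 2)⁻¹ := by
    intro ξ
    refine (mul_le_mul_of_nonneg_left (abs_mollify_sub_le hη hT hM hT2 _ ξ)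
      (by positivity)).trans (le_of_eq ?_)
    field_simp
  have hLinv : (L ^ 2)⁻¹ ≤ 1 := inv_le_one_of_one_le₀ (by nlinarith)
  have hDM : M * (L ^ 2)⁻¹ ≤ M := mul_le_of_le_one_right hM hLinv
  set mT := dyadicSymbol a θ T l (s ^ 2) with hmT
  set mS := dyadicSymbol a θ S l (s ^ 2) with hmS
  have hmTc : Continuous mT := continuous_dyadicSymbol has.continuous hac hθ.continuous hT l _
  have hmSc : Continuous mS := continuous_dyadicSymbol has.continuous hac hθ.continuous hScont l _
  have hmTw : ∀ ξ, ‖mT ξ‖ ≤ 6 * C3 * w ξ := fun ξ =>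
    (norm_dyadicSymbol_le has haz hA2 hθ0 T l (by positivity) ξ).trans (le_of_eq (by rw [hw]; ring))
  have hdiffw : ∀ ξ, ‖mT ξ - mS ξ‖ ≤ (C2 * M * C3 * (L ^ 2)⁻¹) * w ξ := fun ξ =>
    (hsub a has haz _ hA2 θ hθ0 T S l _ _ (by positivity) hDM hSig ξ).trans
      (le_of_eq (by rw [hw]; ring))
  have hG0 : 0 ≤ G := (by positivity : (0:ℝ) ≤ _).trans hG
  have hform : ∀ (n : 𝔼 → ℂ) (D : ℝ), 0 ≤ D → (∀ ξ, ‖n ξ‖ ≤ D * w ξ) →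
      ‖multiplierForm n f g‖ ≤ D * G := by
    intro n D hD hn
    have h1 := norm_multiplierForm_le (m := n) (w := fun ξ => D * w ξ)
      (continuous_const.mul hwc).aestronglyMeasurable (B := D * ((1 + b)⁻¹ * (Bθ * s ^ 2)))
      (fun ξ => by
        rw [abs_of_nonneg (mul_nonneg hD (hw0 ξ))]
        exact mul_le_mul_of_nonneg_left (hwB ξ) hD) hn f g
    rw [weightForm_const_mul D w f, weightForm_const_mul D w g, Real.sqrt_mul hD, Real.sqrt_mul hD,
      mul_mul_mul_comm, Real.mul_self_sqrt hD] at h1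
    exact h1.trans (mul_le_mul_of_nonneg_left hG hD)
  have hmSw : ∀ ξ, ‖mS ξ‖ ≤ ((6 + C2 * M) * C3) * w ξ := by
    intro ξ
    have h1 : ‖mS ξ‖ ≤ ‖mT ξ‖ + ‖mT ξ - mS ξ‖ := by
      rw [norm_sub_rev]; exact norm_le_norm_add_norm_sub' _ _
    have h2 : (C2 * M * C3 * (L ^ 2)⁻¹) * w ξ ≤ C2 * M * C3 * w ξ :=
      mul_le_mul_of_nonneg_right (mul_le_of_le_one_right (by positivity) hLinv) (hw0 ξ)
    linarith [hmTw ξ, hdiffw ξ]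
  have hsplit : multiplierForm mT f g = multiplierForm mS f g +
      multiplierForm (fun ξ => mT ξ - mS ξ) f g := by
    rw [← multiplierForm_symbol_add (m' := fun ξ => mT ξ - mS ξ) hmSc.aestronglyMeasurable (hmTc.sub hmSc).aestronglyMeasurable
      (B := ((6 + C2 * M) * C3) * ((1 + b)⁻¹ * (Bθ * s ^ 2)))
      (B' := (C2 * M * C3 * (L ^ 2)⁻¹) * ((1 + b)⁻¹ * (Bθ * s ^ 2)))]
    · congr 1; ext ξ; ring
    · exact fun ξ => (hmSw ξ).trans (mul_le_mul_of_nonneg_left (hwB ξ) (by positivity))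
    · exact fun ξ => (hdiffw ξ).trans (mul_le_mul_of_nonneg_left (hwB ξ) (by positivity))
  set P := (∫ x, ‖f x‖) * ∫ x, ‖g x‖ with hP
  have hP0 : 0 ≤ P := mul_nonneg (integral_nonneg fun _ => norm_nonneg _)
    (integral_nonneg fun _ => norm_nonneg _)
  have hkernel : ‖multiplierForm mS f g‖ ≤ (C1 * C3) * (L ^ m * (s ^ 2 * (s ^ (d + 1))⁻¹) * P) := by
    have hmSint : Integrable mS := by
      refine hmSc.integrable_of_hasCompactSupport ?_
      refine HasCompactSupport.intro hθc.isCompact fun ξ hξ => ?_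
      simp [hmS, dyadicSymbol, image_eq_zero_of_notMem_tsupport hξ]
    refine (norm_multiplierForm_le_of_kernel hmSint
      (κ := s ^ 2 * (C1 * (C3 * (1 + b)⁻¹) * L ^ m * (s ^ (d + 1))⁻¹)) (fun x => ?_) hf hg).trans ?_
    · have h1 := integral_exp_mul_dyadicSymbol has.continuous hac hθ.continuous hθc hScont l (s ^ 2)
        ((2 * Real.pi) • innerSL ℝ x)
      simp only [smul_apply, innerSL_apply_apply, smul_eq_mul] at h1
      rw [hmS, h1, norm_mul, Complex.norm_real, Real.norm_of_nonneg (by positivity)]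
      refine mul_le_mul_of_nonneg_left ?_ (by positivity)
      have h2 := hker T hT hT1 hT2 hU a has haz _ (fun i hi t => hdamp b hb i (by simpa using hi) t) s L
        hs hL l ((2 * Real.pi) • innerSL ℝ x)
      simpa only [finrank_euclideanSpace_fin, smul_apply, innerSL_apply_apply, smul_eq_mul] using! h2
    · have hb1 : (1 + b)⁻¹ ≤ 1 := inv_le_one_of_one_le₀ (by linarith)
      calc s ^ 2 * (C1 * (C3 * (1 + b)⁻¹) * L ^ m * (s ^ (d + 1))⁻¹) * P
          ≤ s ^ 2 * (C1 * (C3 * 1) * L ^ m * (s ^ (d + 1))⁻¹) * P := by gcongr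
        _ = _ := by ring
  have h1 := hform mS _ (by positivity) hmSw
  have h2 := hform _ _ (by positivity) hdiffw
  rw [hsplit]
  -- The mollified piece satisfies both the weight bound, with the weight of `T`, and the kernel
  -- bound; the difference `mT - mS` satisfies only the weight bound, with gain `L⁻²`.
  have hmin : ‖multiplierForm mS f g‖ ≤ ((6 + C2 * M) * C3 + C1 * C3) *
      min G (L ^ m * (s ^ 2 * (s ^ (d + 1))⁻¹) * P) := by
    rcases min_choice G (L ^ m * (s ^ 2 * (s ^ (d + 1))⁻¹) * P) with h | h <;> rw [h]
    · refine h1.trans (mul_le_mul_of_nonneg_right ?_ hG0)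
      have : 0 ≤ C1 * C3 := by positivity
      linarith
    · refine hkernel.trans (mul_le_mul_of_nonneg_right ?_ (by positivity))
      have : 0 ≤ (6 + C2 * M) * C3 := by positivity
      linarith
  have h3 : C2 * M * C3 * (L ^ 2)⁻¹ * G ≤ ((6 + C2 * M) * C3 + C1 * C3) * ((L ^ 2)⁻¹ * G) := by
    rw [mul_assoc]
    refine mul_le_mul_of_nonneg_right ?_ (by positivity)
    have : 0 ≤ C1 * C3 := by positivity
    nlinarith
  calc _ ≤ ‖multiplierForm mS f g‖ + ‖multiplierForm (fun ξ => mT ξ - mS ξ) f g‖ := norm_add_le _ _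
    _ ≤ _ := by rw [mul_add]; linarith

end DyadicSymbols

/-! ### Summation over time and height scales. -/

section Summation

/-- Shifting the index by `⌊a / γ⌋` recentres the two-sided geometric series, so the bound is
uniform in `a`. -/
theorem exists_sum_two_rpow_neg_abs_le {β γ : ℝ} (hβ : 0 < β) (hγ : 0 < γ) :
    ∃ S, 0 ≤ S ∧ ∀ (a : ℝ) (F : Finset ℤ), ∑ k ∈ F, (2 : ℝ) ^ (-(β * |a + k * γ|)) ≤ S := by
  set r : ℝ := 2 ^ (-(β * γ)) with hr
  have hr0 : 0 < r := by positivity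
  have hr1 : r < 1 := Real.rpow_lt_one_of_one_lt_of_neg one_lt_two (by nlinarith)
  have hsum : Summable fun n : ℤ => r ^ n.natAbs := by
    refine Summable.of_nat_of_neg ?_ ?_ <;>
      simpa using summable_geometric_of_lt_one hr0.le hr1
  refine ⟨2 ^ (β * γ) * ∑' n : ℤ, r ^ n.natAbs,
    mul_nonneg (by positivity) (tsum_nonneg fun _ => by positivity), fun a F => ?_⟩
  have hterm : ∀ k : ℤ, (2 : ℝ) ^ (-(β * |a + k * γ|)) ≤
      2 ^ (β * γ) * r ^ (⌊a / γ⌋ + k).natAbs := by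
    intro k
    rw [hr, ← Real.rpow_natCast, ← Real.rpow_mul zero_le_two, ← Real.rpow_add two_pos]
    refine Real.rpow_le_rpow_of_exponent_le one_le_two ?_
    rw [Nat.cast_natAbs]
    push_cast
    have h1 : |a + k * γ| = γ * |a / γ + k| := by
      rw [← abs_of_pos hγ, ← abs_mul, abs_of_pos hγ]; congr 1; field_simp
    have h2 : |(⌊a / γ⌋ : ℝ) + k| ≤ |a / γ + k| + 1 := by
      have := Int.floor_le (a / γ)
      have := Int.lt_floor_add_one (a / γ)
      rw [abs_le]
      constructor <;> cases abs_cases (a / γ + k) <;> linarith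
    rw [h1]
    nlinarith [mul_le_mul_of_nonneg_left h2 (mul_pos hβ hγ).le]
  calc ∑ k ∈ F, (2 : ℝ) ^ (-(β * |a + k * γ|))
      ≤ ∑ k ∈ F, 2 ^ (β * γ) * r ^ (⌊a / γ⌋ + k).natAbs := Finset.sum_le_sum fun k _ => hterm k
    _ = 2 ^ (β * γ) * ∑ n ∈ F.map (addLeftEmbedding ⌊a / γ⌋), r ^ n.natAbs := by
        rw [Finset.sum_map, Finset.mul_sum]; simp
    _ ≤ _ := by
        gcongr
        exact hsum.sum_le_tsum _ fun _ _ => by positivity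

/-- A Schur test: the weights `2^(-β |j/2 + kγ|)` are summable in `k` uniformly in `j`, and in `j`
uniformly in `k`. Cauchy–Schwarz in `k` for fixed `j`, followed by summation over `j`, uses only `∑
u ≤ 1` and `∑ v ≤ 1`. Hence nothing is lost at the endpoint and the number `J` of time scales does
not enter. -/
theorem exists_schur_sum_le {β γ : ℝ} (hβ : 0 < β) (hγ : 0 < γ) :
    ∃ S, 0 ≤ S ∧ ∀ (J : ℕ) (F G : Finset ℤ) (u v : ℤ → ℝ), (∀ k, 0 ≤ u k) → (∀ k, 0 ≤ v k) →
      ∑ k ∈ F, u k ≤ 1 → ∑ k ∈ G, v k ≤ 1 →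
      ∑ j ∈ Finset.range J, ∑ k ∈ F, ∑ l ∈ G, √(u k) * √(v l) *
        (2 : ℝ) ^ (-(β * (|(j : ℝ) / 2 + k * γ| + |(j : ℝ) / 2 + l * γ|))) ≤ S := by
  obtain ⟨S1, hS1, h1⟩ := exists_sum_two_rpow_neg_abs_le hβ hγ
  obtain ⟨S2, hS2, h2⟩ := exists_sum_two_rpow_neg_abs_le hβ (γ := 1 / 2) (by norm_num)
  refine ⟨S1 * S2, by positivity, fun J F G u v hu hv huF hvG => ?_⟩
  set e : ℕ → ℤ → ℝ := fun j k => 2 ^ (-(β * |(j : ℝ) / 2 + k * γ|)) with he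
  have he0 : ∀ j k, 0 ≤ e j k := fun j k => by positivity
  have key : ∀ (F : Finset ℤ) (u : ℤ → ℝ), (∀ k, 0 ≤ u k) → ∑ k ∈ F, u k ≤ 1 →
      ∑ j ∈ Finset.range J, (∑ k ∈ F, √(u k) * e j k) ^ 2 ≤ S1 * S2 := by
    intro F u hu huF
    calc ∑ j ∈ Finset.range J, (∑ k ∈ F, √(u k) * e j k) ^ 2
        ≤ ∑ j ∈ Finset.range J, S1 * ∑ k ∈ F, u k * e j k := by
          refine Finset.sum_le_sum fun j _ => ?_
          have h3 := Finset.sum_mul_sq_le_sq_mul_sq F (fun k => √(e j k)) (fun k => √(u k * e j k))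
          have h4 : ∀ k, √(e j k) * √(u k * e j k) = √(u k) * e j k := by
            intro k
            rw [Real.sqrt_mul (hu k), mul_left_comm, Real.mul_self_sqrt (he0 j k)]
          simp only [h4, Real.sq_sqrt (he0 j _), Real.sq_sqrt (mul_nonneg (hu _) (he0 j _))] at h3
          exact h3.trans (mul_le_mul_of_nonneg_right (h1 _ F)
            (Finset.sum_nonneg fun k _ => mul_nonneg (hu k) (he0 j k)))
      _ = S1 * ∑ k ∈ F, u k * ∑ j ∈ Finset.range J, e j k := by
          rw [← Finset.mul_sum, Finset.sum_comm]; simp only [Finset.mul_sum]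
      _ ≤ S1 * ∑ k ∈ F, u k * S2 := by
          gcongr with k _
          · exact hu k
          · have h5 := h2 (k * γ) ((Finset.range J).map Nat.castEmbedding)
            rw [Finset.sum_map] at h5
            refine le_of_eq_of_le (Finset.sum_congr rfl fun j _ => ?_) h5
            simp only [he, Nat.castEmbedding_apply, Int.cast_natCast]
            congr 4; ring
      _ ≤ S1 * S2 := by
          rw [← Finset.sum_mul]
          exact mul_le_mul_of_nonneg_left (mul_le_of_le_one_left hS2 huF) hS1
  calc _ = ∑ j ∈ Finset.range J, (∑ k ∈ F, √(u k) * e j k) * ∑ l ∈ G, √(v l) * e j l := by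
        refine Finset.sum_congr rfl fun j _ => ?_
        rw [Finset.sum_mul_sum]
        refine Finset.sum_congr rfl fun k _ => Finset.sum_congr rfl fun l _ => ?_
        rw [mul_mul_mul_comm, he, ← Real.rpow_add two_pos]
        congr 2; ring
    _ ≤ ∑ j ∈ Finset.range J, ((∑ k ∈ F, √(u k) * e j k) ^ 2 + (∑ l ∈ G, √(v l) * e j l) ^ 2) / 2 :=
        Finset.sum_le_sum fun j _ => by
          nlinarith [sq_nonneg ((∑ k ∈ F, √(u k) * e j k) - ∑ l ∈ G, √(v l) * e j l)]
    _ ≤ S1 * S2 := by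
        rw [← Finset.sum_div, Finset.sum_add_distrib]
        linarith [key F u hu huF, key G v hv hvG]

/-- Interpolation between the trivial and the kernel bound for one dyadic piece. -/
theorem min_interpolate_le {h τ ρ β X B : ℝ} {m : ℕ} (hh : 0 < h) (hτ : 0 < τ) (hτ1 : τ < 1)
    (hτh : 2 * h * τ ≤ 1 - τ) (hρm : ρ * m ≤ h / 2) (hβ1 : β ≤ h * τ / 2) (hβ2 : β ≤ 2 * ρ)
    (hX : 0 ≤ X) (hB : 0 < B) (x y : ℝ) :
    min (X * 2 ^ (-((|x| - x) / 2 + (|y| - y) / 2)))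
        ((B * 2 ^ (ρ * (|x| + |y|))) ^ m * 2 ^ (-(h * (x + y)))) +
      ((B * 2 ^ (ρ * (|x| + |y|))) ^ 2)⁻¹ * (X * 2 ^ (-((|x| - x) / 2 + (|y| - y) / 2))) ≤
    (X ^ (1 - τ) * (B ^ m) ^ τ + X * (B ^ 2)⁻¹) * 2 ^ (-(β * (|x| + |y|))) := by
  set n := |x| + |y| with hn
  set g := (|x| - x) / 2 + (|y| - y) / 2 with hg
  have hn0 : 0 ≤ n := by positivity
  have hg0 : 0 ≤ g := by
    have := le_abs_self x
    have := le_abs_self y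
    rw [hg]; linarith
  rw [add_mul]
  refine add_le_add ?_ ?_
  · set a := X * (2 : ℝ) ^ (-g) with ha
    set q := (B * (2 : ℝ) ^ (ρ * n)) ^ m * (2 : ℝ) ^ (-(h * (x + y))) with hq
    have ha0 : 0 ≤ a := by positivity
    have hq0 : 0 ≤ q := by positivity
    -- The minimum is at most the geometric mean with weights `1 - τ` and `τ`.
    have h1 : min a q ≤ a ^ (1 - τ) * q ^ τ := by
      have hm0 : 0 ≤ min a q := le_min ha0 hq0
      calc min a q = min a q ^ (1 - τ) * min a q ^ τ := by
            rw [← Real.rpow_add_of_nonneg hm0 (by linarith) hτ.le]; simp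
        _ ≤ _ := by
            exact mul_le_mul (Real.rpow_le_rpow hm0 (min_le_left _ _) (by linarith))
              (Real.rpow_le_rpow hm0 (min_le_right _ _) hτ.le) (by positivity) (by positivity)
    refine h1.trans ?_
    have h2 : q = B ^ m * 2 ^ (ρ * n * m - h * (x + y)) := by
      rw [hq, mul_pow, ← Real.rpow_natCast (2 ^ _ : ℝ), ← Real.rpow_mul zero_le_two, mul_assoc,
        ← Real.rpow_add two_pos]
      rfl
    rw [h2, ha, Real.mul_rpow hX (by positivity), Real.mul_rpow (by positivity) (by positivity),
      ← Real.rpow_mul zero_le_two, ← Real.rpow_mul zero_le_two, mul_mul_mul_comm,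
      ← Real.rpow_add two_pos]
    refine mul_le_mul_of_nonneg_left (Real.rpow_le_rpow_of_exponent_le one_le_two ?_)
      (by positivity)
    have h3 : ρ * n * m ≤ h / 2 * n := by nlinarith
    have h4 : (ρ * n * m - h * (x + y)) * τ ≤ (h / 2 * n - h * (x + y)) * τ := by gcongr
    have h5 : β * n ≤ h * τ / 2 * n := by gcongr
    have h6 : 2 * h * τ * g ≤ (1 - τ) * g := by gcongr
    -- The kernel bound grows when `x + y < 0`. By this identity and `2hτ ≤ 1 - τ` the growth is
    -- paid for by the decay `2^(-g)` in the trivial bound, and `2^(-hτn)` remains; half of it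
    -- absorbs the loss `2^(ρnmτ)`.
    have h7 : n - (x + y) = 2 * g := by rw [hn, hg]; ring
    have h8 : (h / 2 * n - h * (x + y)) * τ = 2 * h * τ * g - h * τ / 2 * n := by
      have : x + y = n - 2 * g := by linarith
      rw [this]; ring
    linarith
  · have h1 : (2 : ℝ) ^ (-g) ≤ 1 := Real.rpow_le_one_of_one_le_of_nonpos one_le_two (by linarith)
    have h2 : ((B * (2 : ℝ) ^ (ρ * n)) ^ 2)⁻¹ = (B ^ 2)⁻¹ * 2 ^ (-(2 * ρ * n)) := by
      rw [mul_pow, mul_inv, Real.rpow_neg zero_le_two, ← Real.rpow_natCast (2 ^ _ : ℝ),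
        ← Real.rpow_mul zero_le_two]
      congr 3; push_cast; ring
    rw [h2]
    calc (B ^ 2)⁻¹ * 2 ^ (-(2 * ρ * n)) * (X * 2 ^ (-g))
        ≤ (B ^ 2)⁻¹ * 2 ^ (-(β * n)) * (X * 1) := by
          gcongr
          exact one_le_two
      _ = _ := by ring

end Summation

/-! ### Decomposition of the resolvent in time. -/

section TimeDecomposition

/-- The resolvent function as a sum of dyadic time pieces, up to a bounded error. -/
theorem exists_norm_inv_sub_sum_oscTransform_le {ε : ℝ} (hε : 0 < ε) : ∃ J : ℕ, ∀ t : ℝ,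
    ‖((t : ℂ) - Complex.I * ε)⁻¹ - Complex.I * ∑ j ∈ Finset.range J,
      ((2 ^ j : ℝ) : ℂ) * oscTransform (dampedBump (2 ^ j * ε)) (2 ^ j * t)‖ ≤ 3 := by
  -- The damping truncates the time integral at `2^J`. The number `J` depends on `ε`, which is
  -- harmless because the later sum over `j < J` is bounded independently of `J`.
  obtain ⟨J, hJ⟩ : ∃ J : ℕ, Real.exp (-ε * 2 ^ J) / ε ≤ 1 := by
    have h1 : Tendsto (fun J : ℕ => Real.exp (-ε * 2 ^ J) / ε) atTop (𝓝 (0 / ε)) := by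
      refine Tendsto.div_const (Real.tendsto_exp_neg_atTop_nhds_zero.comp
        ((tendsto_pow_atTop_atTop_of_one_lt one_lt_two).const_mul_atTop hε) |>.congr fun J => ?_) _
      simp
    rw [zero_div] at h1
    exact (h1.eventually (eventually_le_nhds one_pos)).exists
  refine ⟨J, fun t => ?_⟩
  set c : ℂ := -(ε + Complex.I * t) with hc
  have hcre : c.re = -ε := by simp [hc]
  have hne : ∀ s : ℝ, ‖Complex.exp (c * s)‖ = Real.exp (-ε * s) := fun s => by
    rw [Complex.norm_exp]; simp [hcre]
  have hE : IntegrableOn (fun s : ℝ => Complex.exp (c * s)) (Set.Ioi 0) :=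
    integrableOn_exp_mul_complex_Ioi (by rw [hcre]; linarith) 0
  have hχE : ∀ a : ℝ, IntegrableOn (fun s : ℝ => (smoothCutoff (s / a) : ℂ) * Complex.exp (c * s))
      (Set.Ioi 0) := fun a =>
    hE.bdd_mul (c := 1) (Continuous.aestronglyMeasurable (Complex.continuous_ofReal.comp
      (contDiff_smoothCutoff.continuous.comp (continuous_id.div_const a))))
      (Eventually.of_forall fun s => by
        rw [Complex.norm_real, Real.norm_of_nonneg (smoothCutoff_mem_Icc _).1]
        exact (smoothCutoff_mem_Icc _).2)
  set r : ℕ → ℂ := fun J => ∫ s in Set.Ioi (0 : ℝ), (smoothCutoff (s / 2 ^ J) : ℂ) *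
    Complex.exp (c * s) with hr
  -- The dyadic bump is the difference of consecutive cutoffs, so the pieces telescope to `r J - r
  -- 0`.
  have hstep : ∀ j, r (j + 1) - r j = ((2 ^ j : ℝ) : ℂ) *
      oscTransform (dampedBump (2 ^ j * ε)) (2 ^ j * t) := by
    intro j
    rw [hr]
    simp only
    rw [← integral_sub (hχE _) (hχE _)]
    have h1 : ∀ s : ℝ, (smoothCutoff (s / 2 ^ (j + 1)) : ℂ) * Complex.exp (c * s) -
        (smoothCutoff (s / 2 ^ j) : ℂ) * Complex.exp (c * s) =
        (fun σ : ℝ => (dyadicBump σ : ℂ) * Complex.exp (c * ((2 ^ j * σ : ℝ) : ℂ)))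
          ((2 ^ j)⁻¹ * s) := by
      intro s
      have h2 : (2 : ℝ) ^ j * ((2 ^ j)⁻¹ * s) = s := by field_simp
      simp only [dyadicBump, h2]
      rw [show (2 ^ j)⁻¹ * s / 2 = s / 2 ^ (j + 1) by field_simp; ring,
        show (2 ^ j)⁻¹ * s = s / 2 ^ j by field_simp]
      push_cast; ring
    simp only [h1]
    rw [integral_comp_mul_left_Ioi (fun σ : ℝ => (dyadicBump σ : ℂ) *
      Complex.exp (c * ((2 ^ j * σ : ℝ) : ℂ))) 0 (by positivity : (0:ℝ) < (2 ^ j)⁻¹), inv_inv,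
      mul_zero, Complex.real_smul, setIntegral_eq_integral_of_forall_compl_eq_zero]
    · rw [oscTransform]
      congr 2 with σ
      rw [dampedBump, hc]
      push_cast
      rw [mul_comm (Complex.exp (Complex.I * _)), mul_assoc, ← Complex.exp_add]
      congr 2; ring
    · intro σ hσ
      rw [dyadicBump_eq_zero]
      · simp
      · simp only [Set.mem_Ioi, not_lt] at hσ
        simp only [Set.mem_Icc, not_and_or]; left; linarith
  have hsum : ∑ j ∈ Finset.range J, ((2 ^ j : ℝ) : ℂ) *
      oscTransform (dampedBump (2 ^ j * ε)) (2 ^ j * t) = r J - r 0 := by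
    rw [← Finset.sum_range_sub]
    exact Finset.sum_congr rfl fun j _ => (hstep j).symm
  have hfull : ((t : ℂ) - Complex.I * ε)⁻¹ = Complex.I * ∫ s in Set.Ioi (0 : ℝ), Complex.exp (c * s) := by
    rw [integral_exp_mul_complex_Ioi (by rw [hcre]; linarith)]
    have hc0 : c ≠ 0 := fun h => by rw [h] at hcre; simp at hcre; linarith
    have h2 : (t : ℂ) - Complex.I * ε = Complex.I * c := by
      rw [hc, mul_neg, mul_add, ← mul_assoc, Complex.I_mul_I]; ring
    rw [h2]
    simp only [Complex.ofReal_zero, mul_zero, Complex.exp_zero]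
    rw [mul_inv, Complex.inv_I]
    ring
  -- Times below `2` are not decomposed and contribute at most `2`; times beyond `2^J` contribute at
  -- most `1`. Together they give the error `3`.
  have hr0 : ‖r 0‖ ≤ 2 := by
    have h1 : r 0 = ∫ s in Set.Ioc (0 : ℝ) 2, (smoothCutoff (s / 2 ^ 0) : ℂ) * Complex.exp (c * s) := by
      rw [hr]
      refine (setIntegral_eq_of_subset_of_forall_sdiff_eq_zero measurableSet_Ioi
        Set.Ioc_subset_Ioi_self fun s hs => ?_)
      rw [smoothCutoff_of_ge]
      · simp
      · have := hs.2
        simp only [Set.mem_Ioc, not_and, not_le] at this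
        have := this hs.1
        simp; linarith
    rw [h1]
    refine (norm_setIntegral_le_of_norm_le_const (C := 1) (by simp) fun s hs => ?_).trans (by simp)
    rw [norm_mul, hne, Complex.norm_real, Real.norm_of_nonneg (smoothCutoff_mem_Icc _).1]
    refine mul_le_one₀ (smoothCutoff_mem_Icc _).2 (Real.exp_pos _).le (Real.exp_le_one_iff.2 ?_)
    nlinarith [hs.1]
  have htail : ‖(∫ s in Set.Ioi (0 : ℝ), Complex.exp (c * s)) - r J‖ ≤ 1 := by
    rw [hr]
    simp only
    rw [← integral_sub hE (hχE _)]
    have h1 : ∫ s in Set.Ioi (0 : ℝ), (Complex.exp (c * s) - (smoothCutoff (s / 2 ^ J) : ℂ) *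
        Complex.exp (c * s)) = ∫ s in Set.Ioi ((2 : ℝ) ^ J), (Complex.exp (c * s) -
        (smoothCutoff (s / 2 ^ J) : ℂ) * Complex.exp (c * s)) := by
      refine (setIntegral_eq_of_subset_of_forall_sdiff_eq_zero measurableSet_Ioi
        (Set.Ioi_subset_Ioi (by positivity)) fun s hs => ?_)
      rw [smoothCutoff_of_le]
      · simp
      · have := hs.2
        simp only [Set.mem_Ioi, not_lt] at this
        rw [div_le_one (by positivity)]; exact this
    rw [h1]
    refine le_trans ?_ hJ
    have h2 : ∫ s in Set.Ioi ((2 : ℝ) ^ J), Real.exp (-ε * s) = Real.exp (-ε * 2 ^ J) / ε := by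
      rw [integral_exp_mul_Ioi (by linarith)]; ring
    rw [← h2]
    refine norm_integral_le_of_norm_le (integrableOn_exp_mul_Ioi (by linarith) _)
      (Eventually.of_forall fun s => ?_)
    rw [← one_sub_mul, norm_mul, hne]
    refine mul_le_of_le_one_left (Real.exp_pos _).le ?_
    rw [← Complex.ofReal_one, ← Complex.ofReal_sub, Complex.norm_real, Real.norm_eq_abs, abs_le]
    have := smoothCutoff_mem_Icc (s / 2 ^ J)
    constructor <;> linarith [this.1, this.2]
  rw [hsum, hfull, ← mul_sub, norm_mul, Complex.norm_I, one_mul]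
  calc _ = ‖((∫ s in Set.Ioi (0 : ℝ), Complex.exp (c * s)) - r J) + r 0‖ := by congr 1; ring
    _ ≤ 1 + 2 := (norm_add_le _ _).trans (add_le_add htail hr0)
    _ = 3 := by norm_num

end TimeDecomposition

/-! ### Decomposition of functions into level sets. -/

section LevelDecomposition

variable {d : ℕ}

local notation "𝔼" => EuclideanSpace ℝ (Fin d)

/-- The set where `|f|` lies between two consecutive powers of `2`. -/
def levelSet (f : 𝔼 → ℂ) (k : ℤ) : Set 𝔼 := {x | (2 : ℝ) ^ k ≤ ‖f x‖ ∧ ‖f x‖ < 2 ^ (k + 1)}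

theorem measurableSet_levelSet (f : LTwo d) (k : ℤ) : MeasurableSet (levelSet f k) := by
  have h : Measurable fun x => ‖f x‖ := (Lp.stronglyMeasurable f).measurable.norm
  exact (measurableSet_le measurable_const h).inter (measurableSet_lt h measurable_const)

theorem eq_of_mem_levelSet {f : 𝔼 → ℂ} {k l : ℤ} {x : 𝔼} (hk : x ∈ levelSet f k)
    (hl : x ∈ levelSet f l) : k = l := by
  have h1 : k < l + 1 := (zpow_lt_zpow_iff_right₀ one_lt_two).1 (hk.1.trans_lt hl.2)
  have h2 : l < k + 1 := (zpow_lt_zpow_iff_right₀ one_lt_two).1 (hl.1.trans_lt hk.2)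
  omega

theorem exists_mem_levelSet {f : 𝔼 → ℂ} {x : 𝔼} (hx : f x ≠ 0) : ∃ k, x ∈ levelSet f k :=
  exists_mem_Ico_zpow (norm_pos_iff.2 hx) one_lt_two

theorem sum_indicator_levelSet {F : Type*} [AddCommMonoid F] (f : 𝔼 → ℂ) (φ : 𝔼 → F) (x : 𝔼)
    (hx : f x ≠ 0) : ∃ k : ℤ, ∀ s : Finset ℤ,
      ∑ l ∈ s, (levelSet f l).indicator φ x = if k ∈ s then φ x else 0 := by
  obtain ⟨k, hk⟩ := exists_mem_levelSet hx
  refine ⟨k, fun s => ?_⟩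
  rw [← Finset.sum_ite_eq s k fun _ => φ x]
  refine Finset.sum_congr rfl fun l _ => ?_
  by_cases h : x ∈ levelSet f l
  · rw [Set.indicator_of_mem h, if_pos (eq_of_mem_levelSet hk h)]
  · rw [Set.indicator_of_notMem h, if_neg fun h' : k = l => h (h' ▸ hk)]

/-- The part of an `L²` function on a level set. -/
noncomputable def levelPiece (f : LTwo d) (k : ℤ) : LTwo d :=
  ((Lp.memLp f).indicator (measurableSet_levelSet f k)).toLp _

theorem coeFn_levelPiece (f : LTwo d) (k : ℤ) :
    levelPiece f k =ᵐ[volume] (levelSet f k).indicator f := MemLp.coeFn_toLp _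

theorem integrable_norm_sq (f : LTwo d) : Integrable fun x => ‖f x‖ ^ 2 :=
  (Lp.memLp f).integrable_norm_pow (by norm_num)

theorem integral_norm_sq_eq (f : LTwo d) : ∫ x, ‖f x‖ ^ 2 = ‖f‖ ^ 2 := by
  have h := L2.inner_def (𝕜 := ℂ) f f
  rw [inner_self_eq_norm_sq_to_K] at h
  have h2 : ∀ x, inner ℂ (f x) (f x) = ((‖f x‖ ^ 2 : ℝ) : ℂ) := fun x => by
    rw [inner_self_eq_norm_sq_to_K]; simp
  simp only [h2] at h
  rw [integral_complex_ofReal] at h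
  apply Complex.ofReal_injective
  rw [← h]
  simp

/-- Dominated convergence with majorant `|f|²`. Convergence in `L²` suffices, because forms with
bounded symbol are continuous there. -/
theorem tendsto_sum_levelPiece (f : LTwo d) :
    Tendsto (fun n : ℕ => ∑ k ∈ Finset.Icc (-(n : ℤ)) n, levelPiece f k) atTop (𝓝 f) := by
  rw [tendsto_iff_norm_sub_tendsto_zero]
  have hcoe : ∀ n : ℕ, ∀ᵐ x, (∑ k ∈ Finset.Icc (-(n : ℤ)) n, levelPiece f k - f : LTwo d) x =
      ∑ k ∈ Finset.Icc (-(n : ℤ)) n, (levelSet f k).indicator f x - f x := by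
    intro n
    filter_upwards [Lp.coeFn_sub (∑ k ∈ Finset.Icc (-(n : ℤ)) n, levelPiece f k) f,
      Lp.coeFn_finsetSum (Finset.Icc (-(n : ℤ)) n) (levelPiece f),
      ae_all_iff.2 (coeFn_levelPiece f)] with x h1 h2 h3
    rw [h1, Pi.sub_apply, h2, Finset.sum_apply]
    simp only [h3]
  have h0 : Tendsto (fun n : ℕ => ∫ x, ‖(∑ k ∈ Finset.Icc (-(n : ℤ)) n, levelPiece f k - f : LTwo d) x‖ ^ 2)
      atTop (𝓝 (∫ _ : 𝔼, (0 : ℝ))) := by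
    refine tendsto_integral_of_dominated_convergence (fun x => ‖f x‖ ^ 2)
      (fun n => ((Lp.aestronglyMeasurable _).norm.pow 2)) (integrable_norm_sq f) (fun n => ?_) ?_
    · filter_upwards [hcoe n] with x hx
      rw [hx, norm_pow, norm_norm]
      by_cases h : f x = 0
      · have : ∀ k, (levelSet f k).indicator f x = 0 := fun k => by
          by_cases hk : x ∈ levelSet f k <;> simp [hk, h]
        simp [this, h]
      · obtain ⟨k, hk⟩ := sum_indicator_levelSet f f x h
        rw [hk]
        split_ifs <;> simp
    · filter_upwards [ae_all_iff.2 hcoe] with x hx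
      simp only [hx]
      by_cases h : f x = 0
      · have : ∀ k, (levelSet f k).indicator f x = 0 := fun k => by
          by_cases hk : x ∈ levelSet f k <;> simp [hk, h]
        simp [this, h]
      · obtain ⟨k, hk⟩ := sum_indicator_levelSet f f x h
        refine tendsto_const_nhds.congr' ?_
        filter_upwards [eventually_ge_atTop k.natAbs] with n hn
        rw [hk, if_pos]
        · simp
        · rw [Finset.mem_Icc]; omega
  simp only [integral_norm_sq_eq, integral_zero] at h0
  have h1 := h0.sqrt
  simpa [Real.sqrt_sq] using h1

/-- The contribution of a level set to `∫ |f|^p`. -/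
noncomputable def levelMass (p : ℝ) (f : LTwo d) (k : ℤ) : ℝ := ∫ x in levelSet f k, ‖f x‖ ^ p

theorem levelMass_nonneg (p : ℝ) (f : LTwo d) (k : ℤ) : 0 ≤ levelMass p f k :=
  integral_nonneg fun _ => by positivity

theorem sum_levelMass_le {p : ℝ} (hp : 0 < p) {f : LTwo d} (hf : Integrable fun x => ‖f x‖ ^ p)
    (s : Finset ℤ) : ∑ k ∈ s, levelMass p f k ≤ ∫ x, ‖f x‖ ^ p := by
  have h1 : ∀ k, levelMass p f k = ∫ x, (levelSet f k).indicator (fun x => ‖f x‖ ^ p) x := fun k =>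
    (integral_indicator (measurableSet_levelSet f k)).symm
  simp only [h1]
  rw [← integral_finsetSum _ fun k _ => hf.indicator (measurableSet_levelSet f k)]
  refine integral_mono (integrable_finsetSum _ fun k _ => hf.indicator (measurableSet_levelSet f k)) hf
    fun x => ?_
  by_cases h : f x = 0
  · have : ∀ k, (levelSet f k).indicator (fun x => ‖f x‖ ^ p) x = 0 := fun k => by
      by_cases hk : x ∈ levelSet f k <;> simp [hk, h, hp.ne']
    simp only [this, Finset.sum_const_zero]
    positivity
  · obtain ⟨k, hk⟩ := sum_indicator_levelSet f (fun x => ‖f x‖ ^ p) x h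
    simp only
    rw [hk]
    split_ifs
    · exact le_rfl
    · positivity

theorem norm_rpow_levelPiece_ae {q : ℝ} (hq : 0 < q) (f : LTwo d) (k : ℤ) :
    (fun x => ‖levelPiece f k x‖ ^ q) =ᵐ[volume] (levelSet f k).indicator fun x => ‖f x‖ ^ q := by
  filter_upwards [coeFn_levelPiece f k] with x hx
  rw [hx]
  by_cases h : x ∈ levelSet f k <;> simp [h, hq.ne']

theorem integral_norm_rpow_levelPiece {p : ℝ} (hp : 0 < p) (f : LTwo d) (k : ℤ) :
    ∫ x, ‖levelPiece f k x‖ ^ p = levelMass p f k := by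
  rw [integral_congr_ae (norm_rpow_levelPiece_ae hp f k), integral_indicator
    (measurableSet_levelSet f k), levelMass]

theorem integrable_norm_rpow_levelPiece {p : ℝ} (hp : 0 < p) {f : LTwo d}
    (hf : Integrable fun x => ‖f x‖ ^ p) (k : ℤ) : Integrable fun x => ‖levelPiece f k x‖ ^ p :=
  (integrable_congr (norm_rpow_levelPiece_ae hp f k)).2 (hf.indicator (measurableSet_levelSet f k))

/-- On a level set the powers of `|f|` are comparable. -/
theorem norm_levelPiece_rpow_le {p q c : ℝ} (hq : 0 < q) {f : LTwo d}
    (hf : Integrable fun x => ‖f x‖ ^ p) {k : ℤ}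
    (h : ∀ r : ℝ, 2 ^ (k : ℝ) ≤ r → r < 2 ^ ((k : ℝ) + 1) → r ^ (q - p) ≤ c) :
    Integrable (fun x => ‖levelPiece f k x‖ ^ q) ∧
      ∫ x, ‖levelPiece f k x‖ ^ q ≤ c * levelMass p f k := by
  have hle : ∀ x, (levelSet f k).indicator (fun x => ‖f x‖ ^ q) x ≤
      c * (levelSet f k).indicator (fun x => ‖f x‖ ^ p) x := by
    intro x
    by_cases hx : x ∈ levelSet f k
    · simp only [Set.indicator_of_mem hx]
      have h0 : 0 < ‖f x‖ := (by positivity : (0 : ℝ) < 2 ^ k).trans_le hx.1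
      have h1 := h ‖f x‖ (by rw [Real.rpow_intCast]; exact hx.1)
        (by have := hx.2; rw [← Real.rpow_intCast] at this; simpa using this)
      calc ‖f x‖ ^ q = ‖f x‖ ^ (q - p) * ‖f x‖ ^ p := by rw [← Real.rpow_add h0]; simp
        _ ≤ _ := by gcongr
    · simp [hx]
  have hi : Integrable fun x => c * (levelSet f k).indicator (fun x => ‖f x‖ ^ p) x :=
    (hf.indicator (measurableSet_levelSet f k)).const_mul c
  have hI : Integrable ((levelSet f k).indicator fun x => ‖f x‖ ^ q) := by
    refine hi.mono' ?_ (Eventually.of_forall fun x => ?_)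
    · have hm : Measurable fun x => ‖f x‖ ^ q :=
        (Lp.stronglyMeasurable f).measurable.norm.pow_const q
      exact (hm.indicator (measurableSet_levelSet f k)).aestronglyMeasurable
    · rw [Real.norm_of_nonneg (Set.indicator_nonneg (fun _ _ => by positivity) _)]
      exact hle x
  refine ⟨(integrable_congr (norm_rpow_levelPiece_ae hq f k)).2 hI, ?_⟩
  rw [integral_congr_ae (norm_rpow_levelPiece_ae hq f k)]
  refine (integral_mono hI hi hle).trans (le_of_eq ?_)
  rw [integral_const_mul, integral_indicator (measurableSet_levelSet f k), levelMass]

/-- Since `2 - p ≥ 0`, the upper end `2^(k+1)` of the level is used; the factor `2` bounds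
`2^(2-p)`. -/
theorem norm_levelPiece_sq_le {p : ℝ} (hp : 1 ≤ p) (hp2 : p ≤ 2) {f : LTwo d}
    (hf : Integrable fun x => ‖f x‖ ^ p) (k : ℤ) :
    ‖levelPiece f k‖ ^ 2 ≤ 2 * 2 ^ (k * (2 - p)) * levelMass p f k := by
  have h := (norm_levelPiece_rpow_le (c := 2 * 2 ^ (k * (2 - p))) (q := 2)
    two_pos hf (k := k) fun r hr1 hr2 => ?_).2
  · simp only [Real.rpow_two] at h
    rwa [integral_norm_sq_eq] at h
  · have h0 : 0 < r := (by positivity : (0 : ℝ) < 2 ^ (k : ℝ)).trans_le hr1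
    calc r ^ (2 - p) ≤ (2 ^ ((k : ℝ) + 1)) ^ (2 - p) :=
          Real.rpow_le_rpow h0.le hr2.le (by linarith)
      _ = 2 ^ (2 - p) * 2 ^ (k * (2 - p)) := by
          rw [← Real.rpow_mul zero_le_two, ← Real.rpow_add two_pos]; congr 1; ring
      _ ≤ 2 ^ (1 : ℝ) * 2 ^ (k * (2 - p)) := by
          gcongr
          · exact one_le_two
          · linarith
      _ = _ := by rw [Real.rpow_one]

/-- Since `1 - p ≤ 0`, the lower end `2^k` of the level is used and no constant appears. -/
theorem integral_norm_levelPiece_le {p : ℝ} (hp : 1 ≤ p) {f : LTwo d}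
    (hf : Integrable fun x => ‖f x‖ ^ p) (k : ℤ) : Integrable (levelPiece f k) ∧
      ∫ x, ‖levelPiece f k x‖ ≤ 2 ^ (-(k * (p - 1))) * levelMass p f k := by
  have h := norm_levelPiece_rpow_le (c := 2 ^ (-(k * (p - 1)))) (q := 1)
    one_pos hf (k := k) fun r hr1 hr2 => ?_
  · simp only [Real.rpow_one] at h
    exact ⟨(integrable_norm_iff (Lp.aestronglyMeasurable _)).1 h.1, h.2⟩
  · have h0 : (0 : ℝ) < 2 ^ (k : ℝ) := by positivity
    calc r ^ (1 - p) ≤ (2 ^ (k : ℝ)) ^ (1 - p) :=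
          Real.rpow_le_rpow_of_nonpos h0 hr1 (by linarith)
      _ = _ := by rw [← Real.rpow_mul zero_le_two]; congr 1; ring

end LevelDecomposition

/-! ### Algebra, continuity and homogeneity of multiplier forms. -/

section FormAlgebra

variable {d : ℕ}

local notation "𝔼" => EuclideanSpace ℝ (Fin d)

theorem multiplierForm_sum_left {m : 𝔼 → ℂ} (hm : AEStronglyMeasurable m) {B : ℝ}
    (hB : ∀ ξ, ‖m ξ‖ ≤ B) {ι : Type*} (s : Finset ι) (f : ι → LTwo d) (g : LTwo d) :
    multiplierForm m (∑ i ∈ s, f i) g = ∑ i ∈ s, multiplierForm m (f i) g := by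
  classical
  induction s using Finset.induction_on with
  | empty => simp [multiplierForm_zero_left]
  | insert i s hi ih =>
    rw [Finset.sum_insert hi, Finset.sum_insert hi, multiplierForm_add_left hm hB, ih]

theorem multiplierForm_sum_right {m : 𝔼 → ℂ} (hm : AEStronglyMeasurable m) {B : ℝ}
    (hB : ∀ ξ, ‖m ξ‖ ≤ B) {ι : Type*} (s : Finset ι) (f : LTwo d) (g : ι → LTwo d) :
    multiplierForm m f (∑ i ∈ s, g i) = ∑ i ∈ s, multiplierForm m f (g i) := by
  classical
  induction s using Finset.induction_on with
  | empty => simp [multiplierForm_zero_right]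
  | insert i s hi ih =>
    rw [Finset.sum_insert hi, Finset.sum_insert hi, multiplierForm_add_right hm hB, ih]

theorem multiplierForm_symbol_sum {ι : Type*} (s : Finset ι) {m : ι → 𝔼 → ℂ}
    (hm : ∀ i, AEStronglyMeasurable (m i)) {B : ι → ℝ} (hB : ∀ i ξ, ‖m i ξ‖ ≤ B i) (f g : LTwo d) :
    multiplierForm (fun ξ => ∑ i ∈ s, m i ξ) f g = ∑ i ∈ s, multiplierForm (m i) f g := by
  simp only [multiplierForm, Finset.sum_mul]
  exact integral_finsetSum _ fun i _ => integrable_multiplierForm (hm i) (hB i) f g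

theorem multiplierForm_smul_left (m : 𝔼 → ℂ) (c : ℂ) (f g : LTwo d) :
    multiplierForm m (c • f) g = c * multiplierForm m f g := by
  simp only [multiplierForm]
  rw [← integral_const_mul]
  refine integral_congr_ae ?_
  have : (𝓕 (c • f) : LTwo d) = c • 𝓕 f := FourierTransform.fourier_smul c f
  rw [this]
  filter_upwards [Lp.coeFn_smul c (𝓕 f : LTwo d)] with ξ h
  rw [h]; simp only [Pi.smul_apply, smul_eq_mul]; ring

theorem multiplierForm_smul_right (m : 𝔼 → ℂ) (c : ℂ) (f g : LTwo d) :
    multiplierForm m f (c • g) = starRingEnd ℂ c * multiplierForm m f g := by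
  simp only [multiplierForm]
  rw [← integral_const_mul]
  refine integral_congr_ae ?_
  have : (𝓕 (c • g) : LTwo d) = c • 𝓕 g := FourierTransform.fourier_smul c g
  rw [this]
  filter_upwards [Lp.coeFn_smul c (𝓕 g : LTwo d)] with ξ h
  rw [h]; simp only [Pi.smul_apply, smul_eq_mul, map_mul]; ring

/-- This symmetry exchanges the half planes and extracts the imaginary part of the resolvent form.
-/
theorem multiplierForm_conj (m : 𝔼 → ℂ) (f g : LTwo d) :
    multiplierForm (fun ξ => starRingEnd ℂ (m ξ)) f g =
      starRingEnd ℂ (multiplierForm m g f) := by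
  simp only [multiplierForm]
  rw [← integral_conj]
  congr 1 with ξ
  simp only [map_mul, Complex.conj_conj]; ring

theorem weightForm_eq_multiplierForm (w : 𝔼 → ℝ) (f : LTwo d) :
    ((weightForm w f : ℝ) : ℂ) = multiplierForm (fun ξ => (w ξ : ℂ)) f f := by
  simp only [weightForm, multiplierForm]
  rw [← integral_complex_ofReal]
  congr 1 with ξ
  rw [Complex.mul_conj, Complex.normSq_eq_norm_sq]
  push_cast; ring

theorem tendsto_multiplierForm {m : 𝔼 → ℂ} (hm : AEStronglyMeasurable m) {B : ℝ}
    (hB : ∀ ξ, ‖m ξ‖ ≤ B) {F G : ℕ → LTwo d} {f g : LTwo d} (hF : Tendsto F atTop (𝓝 f))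
    (hG : Tendsto G atTop (𝓝 g)) :
    Tendsto (fun n => multiplierForm m (F n) (G n)) atTop (𝓝 (multiplierForm m f g)) := by
  have h1 : ∀ n, multiplierForm m (F n) (G n) = multiplierForm m f g +
      multiplierForm m (F n - f) (G n) + multiplierForm m f (G n - g) := by
    intro n
    have h2 := multiplierForm_add_left hm hB f (F n - f) (G n)
    have h3 := multiplierForm_add_right hm hB f g (G n - g)
    rw [add_sub_cancel] at h2 h3
    rw [h2, h3]; ring
  simp only [h1]
  have hF' := tendsto_iff_norm_sub_tendsto_zero.1 hF
  have hG' := tendsto_iff_norm_sub_tendsto_zero.1 hG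
  have h4 : Tendsto (fun n => multiplierForm m (F n - f) (G n)) atTop (𝓝 0) := by
    refine squeeze_zero_norm (fun n => norm_multiplierForm_le_of_bounded hB _ _) ?_
    simpa using (hF'.mul hG.norm).const_mul B
  have h5 : Tendsto (fun n => multiplierForm m f (G n - g)) atTop (𝓝 0) := by
    refine squeeze_zero_norm (fun n => norm_multiplierForm_le_of_bounded hB _ _) ?_
    simpa using (hG'.const_mul ‖f‖).const_mul B
  simpa using (tendsto_const_nhds.add h4).add h5

/-- A bound on the unit ball of `L^p` extends by homogeneity. -/
theorem norm_multiplierForm_le_of_unit_ball {m : 𝔼 → ℂ} {p D : ℝ} (hp : 0 < p)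
    (h : ∀ f g : LTwo d, Integrable (fun x => ‖f x‖ ^ p) → Integrable (fun x => ‖g x‖ ^ p) →
      ∫ x, ‖f x‖ ^ p ≤ 1 → ∫ x, ‖g x‖ ^ p ≤ 1 → ‖multiplierForm m f g‖ ≤ D)
    {f g : LTwo d} (hf : Integrable fun x => ‖f x‖ ^ p) (hg : Integrable fun x => ‖g x‖ ^ p) :
    ‖multiplierForm m f g‖ ≤ D * ((∫ x, ‖f x‖ ^ p) ^ p⁻¹ * (∫ x, ‖g x‖ ^ p) ^ p⁻¹) := by
  have hnorm : ∀ f : LTwo d, Integrable (fun x => ‖f x‖ ^ p) → ∃ f' : LTwo d,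
      Integrable (fun x => ‖f' x‖ ^ p) ∧ ∫ x, ‖f' x‖ ^ p ≤ 1 ∧
      f = (((∫ x, ‖f x‖ ^ p) ^ p⁻¹ : ℝ) : ℂ) • f' := by
    intro f hf
    have h0 : 0 ≤ ∫ x, ‖f x‖ ^ p := integral_nonneg fun _ => by positivity
    rcases h0.eq_or_lt with h1 | h1
    · have h2 : f = 0 := by
        have h3 := (integral_eq_zero_iff_of_nonneg (fun _ => by positivity) hf).1 h1.symm
        refine Lp.ext ?_
        filter_upwards [h3, Lp.coeFn_zero ℂ 2 (volume : Measure 𝔼)] with x hx hx0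
        rw [hx0]
        simpa [Real.rpow_eq_zero (norm_nonneg _) hp.ne'] using hx
      refine ⟨0, ?_, ?_, ?_⟩
      · rw [← h2]; exact hf
      · rw [← h2, ← h1]; exact zero_le_one
      · rw [smul_zero]; exact h2
    · set c := (∫ x, ‖f x‖ ^ p) ^ p⁻¹ with hc
      have hc0 : 0 < c := by positivity
      have hco : (fun x => ‖(((c⁻¹ : ℝ) : ℂ) • f : LTwo d) x‖ ^ p) =ᵐ[volume]
          fun x => (c⁻¹) ^ p * ‖f x‖ ^ p := by
        filter_upwards [Lp.coeFn_smul ((c⁻¹ : ℝ) : ℂ) f] with x hx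
        rw [hx, Pi.smul_apply, norm_smul, Complex.norm_real, Real.norm_of_nonneg (by positivity),
          Real.mul_rpow (by positivity) (norm_nonneg _)]
      refine ⟨((c⁻¹ : ℝ) : ℂ) • f, (integrable_congr hco).2 (hf.const_mul _), ?_, ?_⟩
      · rw [integral_congr_ae hco, integral_const_mul, Real.inv_rpow hc0.le, hc,
          ← Real.rpow_mul h0, inv_mul_cancel₀ hp.ne', Real.rpow_one, inv_mul_cancel₀ h1.ne']
      · rw [smul_smul, ← Complex.ofReal_mul, mul_inv_cancel₀ hc0.ne', Complex.ofReal_one, one_smul]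
  obtain ⟨f', hf1, hf2, hf3⟩ := hnorm f hf
  obtain ⟨g', hg1, hg2, hg3⟩ := hnorm g hg
  have hcf : 0 ≤ (∫ x, ‖f x‖ ^ p) ^ p⁻¹ :=
    Real.rpow_nonneg (integral_nonneg fun _ => by positivity) _
  have hcg : 0 ≤ (∫ x, ‖g x‖ ^ p) ^ p⁻¹ :=
    Real.rpow_nonneg (integral_nonneg fun _ => by positivity) _
  set a := (∫ x, ‖f x‖ ^ p) ^ p⁻¹
  set b := (∫ x, ‖g x‖ ^ p) ^ p⁻¹
  rw [hf3, hg3, multiplierForm_smul_left, multiplierForm_smul_right, norm_mul, norm_mul,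
    Complex.norm_real, RCLike.norm_conj, Complex.norm_real, Real.norm_of_nonneg hcf,
    Real.norm_of_nonneg hcg]
  calc a * (b * ‖multiplierForm m f' g'‖) ≤ a * (b * D) := by
        gcongr
        exact h f' g' hf1 hg1 hf2 hg2
    _ = _ := by ring

end FormAlgebra

/-! ### Poisson weights and the bootstrap hypothesis. -/

section Bootstrap

variable {d : ℕ}

local notation "𝔼" => EuclideanSpace ℝ (Fin d)

/-- The unit ball of `L^p`, inside `L²`. -/
def UnitBall (p : ℝ) (f : LTwo d) : Prop :=
  Integrable (fun x => ‖f x‖ ^ p) ∧ ∫ x, ‖f x‖ ^ p ≤ 1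

theorem UnitBall.levelMass_le_one {p : ℝ} (hp : 0 < p) {f : LTwo d} (hf : UnitBall p f) (k : ℤ) :
    levelMass p f k ≤ 1 := by
  have h := (sum_levelMass_le hp hf.1 {k}).trans hf.2
  simpa using h

/-- The restriction of an `L²` function to a measurable set. -/
noncomputable def restrictLTwo {A : Set 𝔼} (hA : MeasurableSet A) (f : LTwo d) : LTwo d :=
  ((Lp.memLp f).indicator hA).toLp _

theorem coeFn_restrictLTwo {A : Set 𝔼} (hA : MeasurableSet A) (f : LTwo d) :
    restrictLTwo hA f =ᵐ[volume] A.indicator f := MemLp.coeFn_toLp _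

theorem weightForm_add_le {w : 𝔼 → ℝ} (hw : ∀ ξ, 0 ≤ w ξ) (hwm : AEStronglyMeasurable w) {B : ℝ}
    (hB : ∀ ξ, |w ξ| ≤ B) (f g : LTwo d) :
    weightForm w (f + g) ≤ 2 * weightForm w f + 2 * weightForm w g := by
  simp only [weightForm]
  rw [← integral_const_mul, ← integral_const_mul, ← integral_add
    ((integrable_weightForm hwm hB f).const_mul 2) ((integrable_weightForm hwm hB g).const_mul 2)]
  refine integral_mono_ae (integrable_weightForm hwm hB _)
    (((integrable_weightForm hwm hB f).const_mul 2).add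
      ((integrable_weightForm hwm hB g).const_mul 2)) ?_
  have : (𝓕 (f + g) : LTwo d) = 𝓕 f + 𝓕 g := FourierTransform.fourier_add f g
  rw [this]
  filter_upwards [Lp.coeFn_add (𝓕 f : LTwo d) (𝓕 g)] with ξ h
  rw [h]
  simp only [Pi.add_apply]
  have h1 := norm_add_le ((𝓕 f : LTwo d) ξ) ((𝓕 g : LTwo d) ξ)
  have h2 : ‖(𝓕 f : LTwo d) ξ + (𝓕 g : LTwo d) ξ‖ ^ 2 ≤
      2 * ‖(𝓕 f : LTwo d) ξ‖ ^ 2 + 2 * ‖(𝓕 g : LTwo d) ξ‖ ^ 2 := by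
    nlinarith [norm_nonneg ((𝓕 f : LTwo d) ξ + (𝓕 g : LTwo d) ξ),
      sq_nonneg (‖(𝓕 f : LTwo d) ξ‖ - ‖(𝓕 g : LTwo d) ξ‖)]
  nlinarith [hw ξ]

/-- Cut at height one: `|f| ≤ |f|^p` where `|f| > 1`, and `|f|^r ≤ |f|^p` where `|f| ≤ 1`. -/
theorem UnitBall.exists_add_eq {p r : ℝ} (hp : 1 ≤ p) (hpr : p ≤ r) {f : LTwo d} (hf : UnitBall p f) :
    ∃ f₁ f₂ : LTwo d, f₁ + f₂ = f ∧ Integrable f₁ ∧ ∫ x, ‖f₁ x‖ ≤ 1 ∧ UnitBall r f₂ := by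
  have hmeas : Measurable fun x => ‖f x‖ := (Lp.stronglyMeasurable f).measurable.norm
  have hA : MeasurableSet {x | 1 < ‖f x‖} := measurableSet_lt measurable_const hmeas
  set f1 := restrictLTwo hA f
  set f2 := restrictLTwo hA.compl f
  have h1 : ∀ᵐ x, ‖f1 x‖ ≤ ‖f x‖ ^ p := by
    filter_upwards [coeFn_restrictLTwo hA f] with x hx
    rw [hx]
    by_cases h : x ∈ {x | 1 < ‖f x‖}
    · rw [Set.indicator_of_mem h]
      exact Real.self_le_rpow_of_one_le (le_of_lt h) hp
    · rw [Set.indicator_of_notMem h, norm_zero]; positivity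
  have h2 : ∀ᵐ x, ‖f2 x‖ ^ r ≤ ‖f x‖ ^ p := by
    filter_upwards [coeFn_restrictLTwo hA.compl f] with x hx
    rw [hx]
    by_cases h : x ∈ {x | 1 < ‖f x‖}ᶜ
    · rw [Set.indicator_of_mem h]
      have h' : ‖f x‖ ≤ 1 := by simpa using h
      rcases (norm_nonneg (f x)).eq_or_lt with h0 | h0
      · rw [← h0, Real.zero_rpow (by linarith), Real.zero_rpow (by linarith)]
      · exact Real.rpow_le_rpow_of_exponent_ge h0 h' hpr
    · rw [Set.indicator_of_notMem h, norm_zero, Real.zero_rpow (by linarith)]; positivity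
  have hf1 : Integrable f1 := hf.1.mono' (Lp.aestronglyMeasurable _) h1
  have hf2 : Integrable fun x => ‖f2 x‖ ^ r := hf.1.mono'
    ((Lp.aestronglyMeasurable f2).norm.aemeasurable.pow_const r).aestronglyMeasurable (by
      filter_upwards [h2] with x hx
      rw [Real.norm_of_nonneg (by positivity)]; exact hx)
  refine ⟨f1, f2, Lp.ext ?_, hf1, (integral_mono_ae hf1.norm hf.1 h1).trans hf.2, hf2,
    (integral_mono_ae hf2 hf.1 h2).trans hf.2⟩
  filter_upwards [Lp.coeFn_add f1 f2, coeFn_restrictLTwo hA f, coeFn_restrictLTwo hA.compl f]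
    with x h1 h2 h3
  rw [h1, Pi.add_apply, h2, h3, Set.indicator_self_add_compl_apply]

/-- A compactly supported frequency weight is bounded on `L^p`, `1 ≤ p ≤ 2`. -/
theorem exists_weightForm_le_of_unitBall {θ : 𝔼 → ℝ} (hθ : Continuous θ) (hθc : HasCompactSupport θ)
    (hθ0 : ∀ ξ, 0 ≤ θ ξ) {p : ℝ} (hp : 1 ≤ p) (hp2 : p ≤ 2) :
    ∃ C, 0 ≤ C ∧ ∀ f : LTwo d, UnitBall p f → weightForm θ f ≤ C := by
  obtain ⟨B, hB⟩ := hθc.exists_bound_of_continuous hθ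
  have hB0 : 0 ≤ B := (norm_nonneg _).trans (hB 0)
  have hθi : Integrable θ := hθ.integrable_of_hasCompactSupport hθc
  have hI0 : 0 ≤ ∫ ξ, θ ξ := integral_nonneg hθ0
  refine ⟨2 * (∫ ξ, θ ξ) + 2 * B, by positivity, fun f hf => ?_⟩
  obtain ⟨f1, f2, hsum, hf1, hf1i, hf2⟩ := hf.exists_add_eq hp hp2
  have hf2i : ‖f2‖ ^ 2 ≤ 1 := by
    rw [← integral_norm_sq_eq]
    simpa only [Real.rpow_two] using hf2.2
  have hw1 : weightForm θ f1 ≤ ∫ ξ, θ ξ := by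
    have h3 := norm_multiplierForm_le_of_kernel (m := fun ξ => (θ ξ : ℂ)) hθi.ofReal
      (κ := ∫ ξ, θ ξ) (fun x => ?_) hf1 hf1
    · rw [← weightForm_eq_multiplierForm, Complex.norm_real] at h3
      refine (Real.le_norm_self _).trans (h3.trans (mul_le_of_le_one_right hI0 ?_))
      exact mul_le_one₀ hf1i (integral_nonneg fun _ => norm_nonneg _) hf1i
    · refine (norm_integral_le_integral_norm _).trans (le_of_eq (integral_congr_ae
        (Eventually.of_forall fun ξ => ?_)))
      simp only
      rw [norm_mul, mul_comm Complex.I, Complex.norm_exp_ofReal_mul_I, one_mul, Complex.norm_real,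
        Real.norm_of_nonneg (hθ0 ξ)]
  have hw2 : weightForm θ f2 ≤ B :=
    (weightForm_le hθ0 (fun ξ => (le_abs_self _).trans (hB ξ)) f2).trans
      (mul_le_of_le_one_right hB0 hf2i)
  rw [← hsum]
  refine (weightForm_add_le hθ0 hθ.aestronglyMeasurable hB f1 f2).trans ?_
  linarith

/-- The imaginary part of the resolvent symbol, localised by `θ`. -/
noncomputable def poissonWeight (θ T : 𝔼 → ℝ) (l ε : ℝ) (ξ : 𝔼) : ℝ :=
  θ ξ * (ε / ((T ξ - l) ^ 2 + ε ^ 2))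

theorem continuous_poissonWeight {θ T : 𝔼 → ℝ} (hθ : Continuous θ) (hT : Continuous T) (l : ℝ)
    {ε : ℝ} (hε : 0 < ε) : Continuous (poissonWeight θ T l ε) := by
  unfold poissonWeight
  exact hθ.mul (Continuous.div (by fun_prop) (by fun_prop) fun ξ => by positivity)

theorem poissonWeight_nonneg {θ T : 𝔼 → ℝ} (hθ : ∀ ξ, 0 ≤ θ ξ) (l : ℝ) {ε : ℝ} (hε : 0 < ε)
    (ξ : 𝔼) : 0 ≤ poissonWeight θ T l ε ξ := mul_nonneg (hθ ξ) (by positivity)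

theorem poissonWeight_le {θ T : 𝔼 → ℝ} (hθ : ∀ ξ, 0 ≤ θ ξ) (l : ℝ) {ε : ℝ} (hε : 0 < ε)
    (ξ : 𝔼) : poissonWeight θ T l ε ξ ≤ ε⁻¹ * θ ξ := by
  rw [poissonWeight, mul_comm]
  refine mul_le_mul_of_nonneg_right ?_ (hθ ξ)
  rw [div_le_iff₀ (by positivity)]
  field_simp
  nlinarith [sq_nonneg (T ξ - l)]

/-- Uniform boundedness, on the unit ball of `L^p`, of the imaginary part of the resolvent at
distance at least `ε` from the real axis. -/
def PoissonBounded (θ T : 𝔼 → ℝ) (p ε X : ℝ) : Prop :=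
  ∀ ε' ≥ ε, ∀ l, ∀ f : LTwo d, UnitBall p f → weightForm (poissonWeight θ T l ε') f ≤ X

/-- If `N ε ≤ 1`, the weight is exactly the Poisson weight at height `1 / N`. Otherwise the factor
`(1 + N ε)⁻¹` from the damping makes it comparable to the Poisson weight at height `ε`. Both heights
are at least `ε`, which is why `PoissonBounded` includes all larger heights. -/
theorem dyadicWeight_le_poissonWeight {θ T : 𝔼 → ℝ} (hθ : ∀ ξ, 0 ≤ θ ξ) {ε N : ℝ} (hε : 0 < ε)
    (hN : 0 < N) (l : ℝ) (ξ : 𝔼) : (1 + N * ε)⁻¹ * dyadicWeight θ T l N ξ ≤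
      poissonWeight θ T l (max ε N⁻¹) ξ := by
  rw [dyadicWeight, poissonWeight, mul_left_comm]
  refine mul_le_mul_of_nonneg_left ?_ (hθ ξ)
  set t := T ξ - l
  rcases le_total ε N⁻¹ with h | h
  · rw [max_eq_right h]
    have h1 : N * (1 + (N * t) ^ 2)⁻¹ = N⁻¹ / (t ^ 2 + N⁻¹ ^ 2) := by field_simp; ring
    rw [← h1]
    refine mul_le_of_le_one_left (by positivity) (inv_le_one_of_one_le₀ ?_)
    nlinarith
  · rw [max_eq_left h, inv_mul_eq_div, ← div_eq_mul_inv, div_div, div_le_div_iff₀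
      (by positivity) (by positivity)]
    have h1 : 1 ≤ N * ε := by
      rw [inv_le_iff_one_le_mul₀ hN] at h; linarith
    have h2 : 0 ≤ t ^ 2 := sq_nonneg t
    have h3 : N * (t ^ 2 + ε ^ 2) ≤ ε * (N * ε * (1 + (N * t) ^ 2)) := by
      have : ε * (N * ε * (1 + (N * t) ^ 2)) = N * ε ^ 2 + N * ((N * ε) ^ 2 * t ^ 2) := by ring
      rw [this]
      have h4 : 1 * t ^ 2 ≤ (N * ε) ^ 2 * t ^ 2 := by gcongr; nlinarith
      nlinarith
    refine h3.trans ?_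
    have : 0 ≤ 1 + (N * t) ^ 2 := by positivity
    nlinarith [mul_nonneg hε.le this]

/-- On a single level set the Poisson bound is linear in the mass. -/
theorem PoissonBounded.levelPiece {θ T : 𝔼 → ℝ} (hθ : Continuous θ) (hθc : HasCompactSupport θ)
    (hθ0 : ∀ ξ, 0 ≤ θ ξ) (hT : Continuous T) {p ε X : ℝ} (hp : 1 ≤ p) (hp2 : p ≤ 2) (hε : 0 < ε)
    (h : PoissonBounded θ T p ε X) {ε' : ℝ} (hε' : ε ≤ ε') (l : ℝ) {f : LTwo d} (hf : UnitBall p f)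
    (k : ℤ) : weightForm (poissonWeight θ T l ε') (levelPiece f k) ≤ X * levelMass p f k := by
  have hp0 : 0 < p := by linarith
  have hε'0 : 0 < ε' := by linarith
  obtain ⟨B, hB⟩ := hθc.exists_bound_of_continuous hθ
  have hwB : ∀ ξ, |poissonWeight θ T l ε' ξ| ≤ ε'⁻¹ * B := fun ξ => by
    rw [abs_of_nonneg (poissonWeight_nonneg hθ0 l hε'0 ξ)]
    exact (poissonWeight_le hθ0 l hε'0 ξ).trans
      (mul_le_mul_of_nonneg_left ((le_abs_self _).trans (hB ξ)) (by positivity))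
  have hX0 : 0 ≤ X := by
    refine (weightForm_nonneg (poissonWeight_nonneg hθ0 l hε'0) (0 : LTwo d)).trans (h ε' hε' l 0 ?_)
    have h0 : (fun x => ‖(0 : LTwo d) x‖ ^ p) =ᵐ[volume] fun _ => (0 : ℝ) := by
      filter_upwards [Lp.coeFn_zero ℂ 2 (volume : Measure 𝔼)] with x hx
      rw [hx]; simp [hp0.ne']
    exact ⟨(integrable_congr h0).2 (integrable_zero _ _ _), by rw [integral_congr_ae h0]; simp⟩
  have hfk := integrable_norm_rpow_levelPiece hp0 hf.1 k
  have h1 := norm_multiplierForm_le_of_unit_ball (m := fun ξ => (poissonWeight θ T l ε' ξ : ℂ)) hp0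
    (D := X) (fun f g hf hg hf1 hg1 => by
      refine (norm_multiplierForm_le (w := poissonWeight θ T l ε')
        (continuous_poissonWeight hθ hT l hε'0).aestronglyMeasurable hwB (fun ξ => ?_) f g).trans ?_
      · rw [Complex.norm_real, Real.norm_of_nonneg (poissonWeight_nonneg hθ0 l hε'0 ξ)]
      · refine (mul_le_mul (Real.sqrt_le_sqrt (h ε' hε' l f ⟨hf, hf1⟩))
          (Real.sqrt_le_sqrt (h ε' hε' l g ⟨hg, hg1⟩)) (Real.sqrt_nonneg _)
          (Real.sqrt_nonneg _)).trans (Real.mul_self_sqrt hX0).le) hfk hfk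
  rw [← weightForm_eq_multiplierForm, Complex.norm_real, integral_norm_rpow_levelPiece hp0] at h1
  refine (Real.le_norm_self _).trans (h1.trans (mul_le_mul_of_nonneg_left ?_ hX0))
  have hu0 := levelMass_nonneg p f k
  have hu1 := hf.levelMass_le_one hp0 k
  rcases hu0.eq_or_lt with h2 | h2
  · rw [← h2, Real.zero_rpow (by positivity)]; simp
  · rw [← Real.rpow_add h2]
    -- Homogeneity gives the power `2 / p` of the mass. As the mass is at most one and `p ≤ 2`, this
    -- is at most its first power, the form needed for summation over levels.
    have hinv : (1 : ℝ) ≤ p⁻¹ + p⁻¹ := by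
      have : (2 : ℝ)⁻¹ ≤ p⁻¹ := inv_anti₀ hp0 hp2
      linarith
    simpa using Real.rpow_le_rpow_of_exponent_ge h2 hu1 hinv

/-- The trivial and the bootstrap bound for the weight of a dyadic piece on a level set. -/
theorem exists_weightForm_dyadicWeight_levelPiece_le {θ T : 𝔼 → ℝ} (hθ : Continuous θ)
    (hθc : HasCompactSupport θ) (hθ0 : ∀ ξ, 0 ≤ θ ξ) (hT : Continuous T) {p : ℝ} (hp : 1 ≤ p)
    (hp2 : p ≤ 2) : ∃ C, 1 ≤ C ∧ ∀ ε X, 0 < ε → 1 ≤ X → PoissonBounded θ T p ε X → ∀ (l : ℝ) (j : ℕ)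
      (f : LTwo d), UnitBall p f → ∀ (k : ℤ) (x : ℝ), x = (j : ℝ) / 2 + k * ((2 - p) / 2) →
      √(weightForm (fun ξ => (1 + 2 ^ j * ε)⁻¹ * dyadicWeight θ T l (2 ^ j) ξ) (levelPiece f k)) ≤
        √C * √(levelMass p f k) * (√X * 2 ^ (-((|x| - x) / 2))) := by
  obtain ⟨B, hB⟩ := hθc.exists_bound_of_continuous hθ
  have hB0 : 0 ≤ B := (norm_nonneg _).trans (hB 0)
  refine ⟨1 + 2 * B, by linarith, fun ε X hε hX h l j f hf k x hx => ?_⟩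
  have hp0 : 0 < p := by linarith
  set u := levelMass p f k with hu
  have hu0 : 0 ≤ u := levelMass_nonneg p f k
  have hN : (0 : ℝ) < 2 ^ j := by positivity
  have hmax : ε ≤ max ε (2 ^ j)⁻¹ := le_max_left _ _
  have hmax0 : 0 < max ε (2 ^ j : ℝ)⁻¹ := hε.trans_le hmax
  set w := fun ξ => (1 + 2 ^ j * ε)⁻¹ * dyadicWeight θ T l (2 ^ j) ξ with hw
  have hw0 : ∀ ξ, 0 ≤ w ξ := fun ξ =>
    mul_nonneg (by positivity) (dyadicWeight_nonneg hθ0 hN.le l ξ)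
  -- The bootstrap bound, through the Poisson weight; the next one is the trivial bound `N ‖f_k‖₂²`,
  -- with `2^(2x) = N 2^(k(2-p))`.
  have h1 : weightForm w (levelPiece f k) ≤ X * u := by
    refine le_trans (weightForm_mono hw0
      (continuous_poissonWeight hθ hT l hmax0).aestronglyMeasurable
      (B := (max ε (2 ^ j)⁻¹)⁻¹ * B) (fun ξ => ?_)
      (fun ξ => dyadicWeight_le_poissonWeight hθ0 hε hN l ξ) _)
      (h.levelPiece hθ hθc hθ0 hT hp hp2 hε hmax l hf k)
    rw [abs_of_nonneg (poissonWeight_nonneg hθ0 l hmax0 ξ)]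
    exact (poissonWeight_le hθ0 l hmax0 ξ).trans
      (mul_le_mul_of_nonneg_left ((le_abs_self _).trans (hB ξ)) (by positivity))
  have h2 : weightForm w (levelPiece f k) ≤ 2 * B * u * 2 ^ (2 * x) := by
    refine (weightForm_le hw0 (B := B * 2 ^ j) (fun ξ => ?_) _).trans ?_
    · refine (mul_le_of_le_one_left (dyadicWeight_nonneg hθ0 hN.le l ξ)
        (inv_le_one_of_one_le₀ ?_)).trans
        (dyadicWeight_le hθ0 (fun ξ => (le_abs_self _).trans (hB ξ)) hN.le l ξ)
      have : 0 < 2 ^ j * ε := by positivity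
      linarith
    · refine (mul_le_mul_of_nonneg_left (norm_levelPiece_sq_le hp hp2 hf.1 k)
        (by positivity)).trans (le_of_eq ?_)
      have h3 : (2 : ℝ) ^ (2 * x) = 2 ^ j * 2 ^ (k * (2 - p)) := by
        rw [← Real.rpow_natCast, ← Real.rpow_add two_pos, hx]; congr 1; ring
      rw [h3]; ring
  have h4 : (2 : ℝ) ^ (-((|x| - x) / 2)) = √(2 ^ (-(|x| - x))) := by
    rw [Real.sqrt_eq_rpow, ← Real.rpow_mul zero_le_two]; congr 1; ring
  rw [h4, ← Real.sqrt_mul (by positivity), ← Real.sqrt_mul (by positivity),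
    ← Real.sqrt_mul (by positivity)]
  refine Real.sqrt_le_sqrt ?_
  -- The bootstrap bound serves for `x ≥ 0`; the trivial bound, which decays as `x → -∞`, serves for
  -- `x ≤ 0`.
  rcases le_total 0 x with h5 | h5
  · rw [abs_of_nonneg h5, sub_self, neg_zero, Real.rpow_zero]
    refine h1.trans ?_
    have : 0 ≤ B * (u * X) := by positivity
    nlinarith
  · rw [abs_of_nonpos h5, show -(-x - x) = 2 * x by ring]
    refine h2.trans ?_
    have h6 : 0 ≤ u * 2 ^ (2 * x) := by positivity
    calc 2 * B * u * 2 ^ (2 * x) ≤ (1 + 2 * B) * (u * 2 ^ (2 * x)) * 1 := by nlinarith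
      _ ≤ (1 + 2 * B) * (u * 2 ^ (2 * x)) * X := by gcongr
      _ = _ := by ring

end Bootstrap

/-! ### The endpoint exponent: one time scale and two level sets. -/

section Endpoint

variable {d : ℕ}

local notation "𝔼" => EuclideanSpace ℝ (Fin d)

/-- The Stein–Tomas exponent. -/
noncomputable def steinTomas (d : ℕ) : ℝ := 2 * (d + 1) / (d + 3)

theorem steinTomas_le_two : steinTomas d ≤ 2 := by
  rw [steinTomas, div_le_iff₀ (by positivity)]; linarith

theorem one_le_steinTomas (hd : 1 ≤ d) : 1 ≤ steinTomas d := by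
  have : (1 : ℝ) ≤ d := by exact_mod_cast hd
  rw [steinTomas, le_div_iff₀ (by positivity)]; linarith

/-- The resolvent symbol, localised by `θ`. -/
noncomputable def resolventSymbol (θ T : 𝔼 → ℝ) (z : ℂ) (ξ : 𝔼) : ℂ :=
  (θ ξ : ℂ) * ((T ξ : ℂ) - z)⁻¹

-- At the Stein–Tomas exponent the trivial and the kernel bound depend on time and height only
-- through `x = j/2 + k(2-p)/2` and its analogue `y` for `g`, and they balance at `x = y = 0`.
-- Interpolating between them gives exponential decay in `|x| + |y|`, ready for
-- `exists_schur_sum_le`, and a power of `X` below one.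
set_option maxHeartbeats 1000000 in
theorem exists_norm_dyadic_levelPiece_le (hd : 2 ≤ d) {T : 𝔼 → ℝ} {M c r : ℝ} {U : Set 𝔼}
    (hM : 0 ≤ M) (hT : Continuous T) (hT1 : ∀ ξ, ‖fderiv ℝ T ξ‖ ≤ M)
    (hT2 : ∀ ξ v, |T (ξ + v) - T ξ - fderiv ℝ T ξ v| ≤ M * ‖v‖ ^ 2) (hc : 0 < c)
    (hU : NondegenerateOn T U c) {θ : 𝔼 → ℝ} (hθ : ContDiff ℝ ∞ θ) (hθc : HasCompactSupport θ)
    (hθ0 : ∀ ξ, 0 ≤ θ ξ) (hr : 0 < r) (hr1 : r ≤ 1 / 2)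
    (hθU : ∀ ξ v, θ (ξ + v) ≠ 0 → ‖v‖ ≤ r → ξ ∈ U) :
    ∃ C, ∃ m : ℕ, ∃ β : ℝ, 0 ≤ C ∧ 0 < β ∧ ∀ ε X B : ℝ, 0 < ε → 1 ≤ X → 1 ≤ B →
      PoissonBounded θ T (steinTomas d) ε X → ∀ (l : ℝ) (j : ℕ) (f g : LTwo d),
      UnitBall (steinTomas d) f → UnitBall (steinTomas d) g → ∀ k k' : ℤ,
      ‖multiplierForm (dyadicSymbol (dampedBump (2 ^ j * ε)) θ T l (2 ^ j))
        (levelPiece f k) (levelPiece g k')‖ ≤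
      C * (X ^ (1 - (d : ℝ)⁻¹) * (B ^ m) ^ (d : ℝ)⁻¹ + X * (B ^ 2)⁻¹) *
        (√(levelMass (steinTomas d) f k) * √(levelMass (steinTomas d) g k') *
          2 ^ (-(β * (|(j : ℝ) / 2 + k * ((2 - steinTomas d) / 2)| +
            |(j : ℝ) / 2 + k' * ((2 - steinTomas d) / 2)|)))) := by
  set p := steinTomas d with hp
  have hp1 : 1 ≤ p := one_le_steinTomas (by omega)
  have hp2 : p ≤ 2 := steinTomas_le_two
  have hp0 : 0 < p := by linarith
  have hd2 : (2 : ℝ) ≤ d := by exact_mod_cast hd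
  obtain ⟨C1, m, hC1, hform⟩ := exists_norm_dyadic_form_le hM hT hT1 hT2 hc hU hθ hθc hθ0 hr hr1 hθU
  obtain ⟨C2, hC2, hweight⟩ := exists_weightForm_dyadicWeight_levelPiece_le hθ.continuous hθc hθ0 hT
    hp1 hp2
  -- The kernel at time `N` is `O(N^(-h))`. The weight `τ = 1 / d` below is chosen so that `2hτ = 1
  -- - τ`.
  set h : ℝ := (d - 1) / 2 with hh
  have hh0 : 0 < h := by rw [hh]; linarith
  set τ : ℝ := (d : ℝ)⁻¹ with hτ
  have hτ0 : 0 < τ := by positivity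
  have hτ1 : τ < 1 := inv_lt_one_of_one_lt₀ (by linarith)
  have hτh : 2 * h * τ ≤ 1 - τ := by
    rw [hh, hτ]; apply le_of_eq; field_simp
  -- The growth rate of `L` is kept so small that `L ^ m` consumes at most half of the kernel decay.
  set ρ : ℝ := h / (2 * (m + 1)) with hρ
  have hρ0 : 0 < ρ := by positivity
  have hρm : ρ * m ≤ h / 2 := by
    rw [hρ, div_mul_eq_mul_div, div_le_div_iff₀ (by positivity) (by positivity)]
    nlinarith
  set β : ℝ := min (h * τ / 2) (2 * ρ) with hβ
  have hβ0 : 0 < β := lt_min (by positivity) (by positivity)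
  -- This identity is what determines the exponent: by it the kernel bound equals `2^(-h(x+y))`
  -- times the masses.
  have hexp : h * ((2 - p) / 2) = p - 1 := by
    rw [hh, hp, steinTomas]; field_simp; ring
  refine ⟨C1 * C2, m, β, by positivity, hβ0, fun ε X B hε hX hB hP l j f g hf hg k k' => ?_⟩
  set x := (j : ℝ) / 2 + k * ((2 - p) / 2) with hx
  set y := (j : ℝ) / 2 + k' * ((2 - p) / 2) with hy
  set u := levelMass p f k with hu
  set v := levelMass p g k' with hv
  have hu0 : 0 ≤ u := levelMass_nonneg p f k
  have hv0 : 0 ≤ v := levelMass_nonneg p g k'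
  have hu1 : u ≤ 1 := hf.levelMass_le_one hp0 k
  have hv1 : v ≤ 1 := hg.levelMass_le_one hp0 k'
  set s : ℝ := 2 ^ ((j : ℝ) / 2) with hs
  have hs1 : 1 ≤ s := Real.one_le_rpow one_le_two (by positivity)
  have hs2 : s ^ 2 = 2 ^ j := by
    rw [hs, ← Real.rpow_natCast, ← Real.rpow_mul zero_le_two, ← Real.rpow_natCast]
    congr 1; push_cast; ring
  -- The mollification gets finer away from the balanced scales, so that the replacement error `L⁻²`
  -- is summable; the factor `B` makes its total small.
  set L : ℝ := B * 2 ^ (ρ * (|x| + |y|)) with hL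
  have hL1 : 1 ≤ L := one_le_mul_of_one_le_of_one_le hB (Real.one_le_rpow one_le_two (by positivity))
  set D := C2 * (√u * √v) with hD
  have hD0 : 0 ≤ D := by positivity
  set G := X * (2 : ℝ) ^ (-((|x| - x) / 2 + (|y| - y) / 2)) with hG
  obtain ⟨hfi, hfb⟩ := integral_norm_levelPiece_le hp1 hf.1 k
  obtain ⟨hgi, hgb⟩ := integral_norm_levelPiece_le hp1 hg.1 k'
  have h1 := hform (2 ^ j * ε) l s L (by positivity) hs1 hL1 (levelPiece f k) (levelPiece g k')
    hfi hgi (D * G) (by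
      rw [hs2]
      refine (mul_le_mul (hweight ε X hε hX hP l j f hf k x hx)
        (hweight ε X hε hX hP l j g hg k' y hy) (Real.sqrt_nonneg _) (by positivity)).trans
        (le_of_eq ?_)
      have e1 : √C2 * √C2 = C2 := Real.mul_self_sqrt (by linarith)
      have e2 : √X * √X = X := Real.mul_self_sqrt (by linarith)
      have e3 : (2 : ℝ) ^ (-((|x| - x) / 2 + (|y| - y) / 2)) =
          2 ^ (-((|x| - x) / 2)) * 2 ^ (-((|y| - y) / 2)) := by
        rw [← Real.rpow_add two_pos]; congr 1; ring
      rw [hD, hG, e3]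
      calc _ = (√C2 * √C2) * (√X * √X) * (√u * √v) *
            (2 ^ (-((|x| - x) / 2)) * 2 ^ (-((|y| - y) / 2))) := by ring
        _ = _ := by rw [e1, e2]; ring)
  rw [hs2] at h1
  have hkern : L ^ m * (2 ^ j * (s ^ (d + 1))⁻¹) *
      ((∫ x, ‖levelPiece f k x‖) * ∫ x, ‖levelPiece g k' x‖) ≤
      D * (L ^ m * 2 ^ (-(h * (x + y)))) := by
    have e1 : (2 : ℝ) ^ j * (s ^ (d + 1))⁻¹ = 2 ^ (-(h * j)) := by
      rw [hs, ← Real.rpow_natCast, ← Real.rpow_natCast, ← Real.rpow_mul zero_le_two,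
        ← Real.rpow_neg zero_le_two, ← Real.rpow_add two_pos]
      congr 1; rw [hh]; push_cast; ring
    have e2 : (2 : ℝ) ^ (-(h * (x + y))) = 2 ^ (-(h * j)) * 2 ^ (-(k * (p - 1))) *
        2 ^ (-(k' * (p - 1))) := by
      rw [← Real.rpow_add two_pos, ← Real.rpow_add two_pos, ← hexp, hx, hy]
      congr 1; ring
    have e3 : u * v ≤ D := by
      have h2 : u ≤ √u := Real.le_sqrt_of_sq_le (by nlinarith)
      have h3 : v ≤ √v := Real.le_sqrt_of_sq_le (by nlinarith)
      calc u * v ≤ √u * √v := mul_le_mul h2 h3 hv0 (Real.sqrt_nonneg _)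
        _ ≤ D := by rw [hD]; exact le_mul_of_one_le_left (by positivity) hC2
    rw [e1, e2]
    calc _ ≤ L ^ m * 2 ^ (-(h * j)) * ((2 ^ (-(k * (p - 1))) * u) * (2 ^ (-(k' * (p - 1))) * v)) := by
          gcongr
      _ = (u * v) * (L ^ m * (2 ^ (-(h * j)) * 2 ^ (-(k * (p - 1))) * 2 ^ (-(k' * (p - 1))))) := by ring
      _ ≤ _ := by gcongr
  have h2 := min_interpolate_le hh0 hτ0 hτ1 hτh hρm (min_le_left _ _ : β ≤ _) (min_le_right _ _)
    (by linarith : 0 ≤ X) (by linarith : 0 < B) x y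
  calc _ ≤ C1 * (min (D * G) (D * (L ^ m * 2 ^ (-(h * (x + y))))) + (L ^ 2)⁻¹ * (D * G)) := by
        refine h1.trans ?_
        gcongr
    _ = C1 * D * (min G (L ^ m * 2 ^ (-(h * (x + y)))) + (L ^ 2)⁻¹ * G) := by
        rw [← mul_min_of_nonneg _ _ hD0]; ring
    _ ≤ C1 * D * ((X ^ (1 - τ) * (B ^ m) ^ τ + X * (B ^ 2)⁻¹) * 2 ^ (-(β * (|x| + |y|)))) := by
        gcongr
    _ = _ := by rw [hD]; ring

end Endpoint

/-! ### The bootstrap and the local estimate in dimension at least two. -/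

section ResolventForm

variable {d : ℕ}

local notation "𝔼" => EuclideanSpace ℝ (Fin d)

theorem sub_ofReal_add_mul_I_ne_zero {t l ε : ℝ} (hε : ε ≠ 0) :
    (t : ℂ) - (l + ε * Complex.I) ≠ 0 := by
  intro h
  have := congrArg Complex.im h
  simp at this
  exact hε this

theorem continuous_resolventSymbol {θ T : 𝔼 → ℝ} (hθ : Continuous θ) (hT : Continuous T) {l ε : ℝ}
    (hε : ε ≠ 0) : Continuous (resolventSymbol θ T (l + ε * Complex.I)) := by
  unfold resolventSymbol
  exact (Complex.continuous_ofReal.comp hθ).mul (Continuous.inv₀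
    ((Complex.continuous_ofReal.comp hT).sub continuous_const)
      fun ξ => sub_ofReal_add_mul_I_ne_zero hε)

theorem exists_norm_le_of_continuous {m : 𝔼 → ℂ} (hm : Continuous m) {θ : 𝔼 → ℝ}
    (hθc : HasCompactSupport θ) (h : ∀ ξ, θ ξ = 0 → m ξ = 0) : ∃ B, ∀ ξ, ‖m ξ‖ ≤ B :=
  (HasCompactSupport.intro hθc.isCompact fun ξ hξ =>
    h ξ (image_eq_zero_of_notMem_tsupport hξ)).exists_bound_of_continuous hm

theorem conj_resolventSymbol (θ T : 𝔼 → ℝ) (z : ℂ) (ξ : 𝔼) :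
    starRingEnd ℂ (resolventSymbol θ T z ξ) = resolventSymbol θ T (starRingEnd ℂ z) ξ := by
  simp [resolventSymbol]

/-- The Poisson form is the imaginary part of the resolvent form. -/
theorem weightForm_poissonWeight_le {θ T : 𝔼 → ℝ} (hθ : Continuous θ) (hθc : HasCompactSupport θ)
    (hT : Continuous T) (l : ℝ) {ε : ℝ} (hε : 0 < ε) (f : LTwo d) :
    weightForm (poissonWeight θ T l ε) f ≤
      ‖multiplierForm (resolventSymbol θ T (l + ε * Complex.I)) f f‖ := by
  set R := resolventSymbol θ T (l + ε * Complex.I) with hR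
  have hRc : Continuous R := continuous_resolventSymbol hθ hT hε.ne'
  obtain ⟨B, hB⟩ := exists_norm_le_of_continuous hRc hθc fun ξ h => by simp [hR, resolventSymbol, h]
  have h1 : ∀ ξ, ((poissonWeight θ T l ε ξ : ℝ) : ℂ) =
      (2 * Complex.I)⁻¹ * (R ξ + (-1) * starRingEnd ℂ (R ξ)) := by
    intro ξ
    have h2 : ((T ξ : ℂ) - (l + ε * Complex.I)) ≠ 0 := sub_ofReal_add_mul_I_ne_zero hε.ne'
    have h3 : ((T ξ : ℂ) - (l - ε * Complex.I)) ≠ 0 := by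
      have := sub_ofReal_add_mul_I_ne_zero (t := T ξ) (l := l) (neg_ne_zero.2 hε.ne')
      push_cast at this
      rwa [neg_mul, ← sub_eq_add_neg] at this
    have h4 : (T ξ - l) ^ 2 + ε ^ 2 ≠ 0 := by positivity
    have h5 : (((T ξ - l) ^ 2 + ε ^ 2 : ℝ) : ℂ) =
        ((T ξ : ℂ) - (l + ε * Complex.I)) * ((T ξ : ℂ) - (l - ε * Complex.I)) := by
      push_cast
      linear_combination ((ε : ℂ) ^ 2) * Complex.I_sq
    have h6 : starRingEnd ℂ ((l : ℂ) + ε * Complex.I) = l - ε * Complex.I := by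
      simp [sub_eq_add_neg]
    rw [hR, conj_resolventSymbol, h6, poissonWeight, Complex.ofReal_mul, Complex.ofReal_div, h5]
    simp only [resolventSymbol]
    have h7 := Complex.I_ne_zero
    field_simp
    ring
  have h2 : ((weightForm (poissonWeight θ T l ε) f : ℝ) : ℂ) =
      (2 * Complex.I)⁻¹ * (multiplierForm R f f - starRingEnd ℂ (multiplierForm R f f)) := by
    rw [weightForm_eq_multiplierForm]
    simp only [h1]
    rw [multiplierForm_const_mul, multiplierForm_symbol_add (B := B) (B' := B)
      hRc.aestronglyMeasurable (by fun_prop) hB (fun ξ => by simpa using hB ξ),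
      multiplierForm_const_mul, multiplierForm_conj]
    ring
  have h3 := congrArg norm h2
  rw [Complex.norm_real, norm_mul, norm_inv, norm_mul, Complex.norm_I] at h3
  have h4 := norm_sub_le (multiplierForm R f f) (starRingEnd ℂ (multiplierForm R f f))
  rw [RCLike.norm_conj] at h4
  refine (Real.le_norm_self _).trans (h3.le.trans ?_)
  norm_num
  linarith

/-- One step of the bootstrap: a bound for the Poisson form yields a bound for the resolvent form
that is sublinear up to a small constant. -/
theorem exists_norm_resolventForm_le_of_poissonBounded (hd : 2 ≤ d) {T : 𝔼 → ℝ} {M c r : ℝ}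
    {U : Set 𝔼} (hM : 0 ≤ M) (hT : Continuous T) (hT1 : ∀ ξ, ‖fderiv ℝ T ξ‖ ≤ M)
    (hT2 : ∀ ξ v, |T (ξ + v) - T ξ - fderiv ℝ T ξ v| ≤ M * ‖v‖ ^ 2) (hc : 0 < c)
    (hU : NondegenerateOn T U c) {θ : 𝔼 → ℝ} (hθ : ContDiff ℝ ∞ θ) (hθc : HasCompactSupport θ)
    (hθ0 : ∀ ξ, 0 ≤ θ ξ) (hr : 0 < r) (hr1 : r ≤ 1 / 2)
    (hθU : ∀ ξ v, θ (ξ + v) ≠ 0 → ‖v‖ ≤ r → ξ ∈ U) :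
    ∃ C, ∃ m : ℕ, 0 ≤ C ∧ ∀ ε X B : ℝ, 0 < ε → 1 ≤ X → 1 ≤ B →
      PoissonBounded θ T (steinTomas d) ε X → ∀ (l : ℝ) (f g : LTwo d),
      UnitBall (steinTomas d) f → UnitBall (steinTomas d) g →
      ‖multiplierForm (resolventSymbol θ T (l + ε * Complex.I)) f g‖ ≤
      C * (1 + (X ^ (1 - (d : ℝ)⁻¹) * (B ^ m) ^ (d : ℝ)⁻¹ + X * (B ^ 2)⁻¹)) := by
  have hp1 : 1 ≤ steinTomas d := one_le_steinTomas (by omega)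
  have hp2 : steinTomas d ≤ 2 := steinTomas_le_two
  have hp0 : 0 < steinTomas d := by linarith
  have hγ : 0 < (2 - steinTomas d) / 2 := by
    have : steinTomas d < 2 := by
      rw [steinTomas, div_lt_iff₀ (by positivity)]; linarith
    linarith
  obtain ⟨C0, hC0, hbase⟩ := exists_weightForm_le_of_unitBall hθ.continuous hθc hθ0 hp1 hp2
  obtain ⟨C1, m, β, hC1, hβ, hterm⟩ := exists_norm_dyadic_levelPiece_le hd hM hT hT1 hT2 hc hU hθ hθc
    hθ0 hr hr1 hθU
  obtain ⟨S, hS, hschur⟩ := exists_schur_sum_le hβ hγ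
  refine ⟨3 * C0 + C1 * S, m, by positivity, fun ε X B hε hX hB hP l f g hf hg => ?_⟩
  set Y := X ^ (1 - (d : ℝ)⁻¹) * (B ^ m) ^ (d : ℝ)⁻¹ + X * (B ^ 2)⁻¹ with hY
  have hY0 : 0 ≤ Y := by positivity
  obtain ⟨J, hJ⟩ := exists_norm_inv_sub_sum_oscTransform_le hε
  set n : ℕ → 𝔼 → ℂ := fun j => dyadicSymbol (dampedBump (2 ^ j * ε)) θ T l (2 ^ j) with hn
  have hnc : ∀ j, Continuous (n j) := fun j => continuous_dyadicSymbol
    (contDiff_dampedBump _).continuous (hasCompactSupport_of_eq_zero_off_Icc (dampedBump_eq_zero _))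
    hθ.continuous hT l _
  have hnB : ∀ j, ∃ B, ∀ ξ, ‖n j ξ‖ ≤ B := fun j =>
    exists_norm_le_of_continuous (hnc j) hθc fun ξ h => by simp [hn, dyadicSymbol, h]
  choose Bn hBn using hnB
  set R := resolventSymbol θ T (l + ε * Complex.I) with hR
  have hRc : Continuous R := continuous_resolventSymbol hθ.continuous hT hε.ne'
  set e : 𝔼 → ℂ := fun ξ => R ξ - Complex.I * ∑ j ∈ Finset.range J, n j ξ with he
  have hec : Continuous e := hRc.sub (continuous_const.mul (continuous_finsetSum _ fun j _ => hnc j))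
  obtain ⟨Bθ, hBθ⟩ := hθc.exists_bound_of_continuous hθ.continuous
  have heθ : ∀ ξ, ‖e ξ‖ ≤ 3 * θ ξ := by
    intro ξ
    have h1 : e ξ = (θ ξ : ℂ) * ((((T ξ - l : ℝ) : ℂ) - Complex.I * ε)⁻¹ - Complex.I *
        ∑ j ∈ Finset.range J, ((2 ^ j : ℝ) : ℂ) *
          oscTransform (dampedBump (2 ^ j * ε)) (2 ^ j * (T ξ - l))) := by
      simp only [he, hR, resolventSymbol, hn, dyadicSymbol]
      rw [mul_sub, mul_left_comm _ Complex.I]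
      simp only [Finset.mul_sum]
      congr 1
      · congr 2; push_cast; ring
      · exact Finset.sum_congr rfl fun j _ => by ring
    rw [h1, norm_mul, Complex.norm_real, Real.norm_of_nonneg (hθ0 ξ), mul_comm]
    exact mul_le_mul_of_nonneg_right (hJ _) (hθ0 ξ)
  have hsplit : multiplierForm R f g = multiplierForm e f g +
      Complex.I * ∑ j ∈ Finset.range J, multiplierForm (n j) f g := by
    rw [← multiplierForm_symbol_sum _ (fun j => (hnc j).aestronglyMeasurable) hBn,
      ← multiplierForm_const_mul, ← multiplierForm_symbol_add
        (m' := fun ξ => Complex.I * ∑ j ∈ Finset.range J, n j ξ) hec.aestronglyMeasurable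
        (continuous_const.mul (continuous_finsetSum _ fun j _ => hnc j)).aestronglyMeasurable
        (B := 3 * Bθ) (B' := ∑ j ∈ Finset.range J, Bn j)]
    · congr 1; ext ξ; simp only [he]; ring
    · exact fun ξ => (heθ ξ).trans (by linarith [(le_abs_self _).trans (hBθ ξ)])
    · intro ξ
      rw [norm_mul, Complex.norm_I, one_mul]
      exact (norm_sum_le _ _).trans (Finset.sum_le_sum fun j _ => hBn j ξ)
  have he' : ‖multiplierForm e f g‖ ≤ 3 * C0 := by
    have h1 := norm_multiplierForm_le (w := fun ξ => 3 * θ ξ)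
      (continuous_const.mul hθ.continuous).aestronglyMeasurable (B := 3 * Bθ)
      (fun ξ => by
        rw [abs_mul, abs_of_pos (by norm_num : (0:ℝ) < 3)]
        exact mul_le_mul_of_nonneg_left (hBθ ξ) (by norm_num)) heθ f g
    rw [weightForm_const_mul, weightForm_const_mul] at h1
    refine h1.trans ?_
    have h2 : √(3 * weightForm θ f) ≤ √(3 * C0) := Real.sqrt_le_sqrt (by linarith [hbase f hf])
    have h3 : √(3 * weightForm θ g) ≤ √(3 * C0) := Real.sqrt_le_sqrt (by linarith [hbase g hg])
    exact (mul_le_mul h2 h3 (Real.sqrt_nonneg _) (Real.sqrt_nonneg _)).trans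
      (Real.mul_self_sqrt (by positivity)).le
  have hsum : ‖∑ j ∈ Finset.range J, multiplierForm (n j) f g‖ ≤ C1 * Y * S := by
    -- For fixed `J` the forms are continuous on `L²`, so it suffices to bound finitely many levels
    -- uniformly.
    have hlim : Tendsto (fun N : ℕ => ‖∑ j ∈ Finset.range J, multiplierForm (n j)
        (∑ k ∈ Finset.Icc (-(N : ℤ)) N, levelPiece f k)
        (∑ k ∈ Finset.Icc (-(N : ℤ)) N, levelPiece g k)‖) atTop
        (𝓝 ‖∑ j ∈ Finset.range J, multiplierForm (n j) f g‖) :=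
      (tendsto_finsetSum _ fun j _ => tendsto_multiplierForm (hnc j).aestronglyMeasurable (hBn j)
        (tendsto_sum_levelPiece f) (tendsto_sum_levelPiece g)).norm
    refine le_of_tendsto' hlim fun N => ?_
    set F := Finset.Icc (-(N : ℤ)) N
    calc _ ≤ ∑ j ∈ Finset.range J, ∑ k ∈ F, ∑ k' ∈ F, C1 * Y *
          (√(levelMass (steinTomas d) f k) * √(levelMass (steinTomas d) g k') *
          2 ^ (-(β * (|(j : ℝ) / 2 + k * ((2 - steinTomas d) / 2)| +
            |(j : ℝ) / 2 + k' * ((2 - steinTomas d) / 2)|)))) := by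
          refine (norm_sum_le _ _).trans (Finset.sum_le_sum fun j _ => ?_)
          rw [multiplierForm_sum_left (hnc j).aestronglyMeasurable (hBn j)]
          refine (norm_sum_le _ _).trans (Finset.sum_le_sum fun k _ => ?_)
          rw [multiplierForm_sum_right (hnc j).aestronglyMeasurable (hBn j)]
          exact (norm_sum_le _ _).trans (Finset.sum_le_sum fun k' _ =>
            hterm ε X B hε hX hB hP l j f g hf hg k k')
      _ ≤ _ := by
          simp only [← Finset.mul_sum]
          exact mul_le_mul_of_nonneg_left (hschur J F F _ _ (fun k => levelMass_nonneg _ f k)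
            (fun k => levelMass_nonneg _ g k) ((sum_levelMass_le hp0 hf.1 F).trans hf.2)
            ((sum_levelMass_le hp0 hg.1 F).trans hg.2)) (by positivity)
  rw [hsplit]
  refine (norm_add_le _ _).trans ?_
  rw [norm_mul, Complex.norm_I, one_mul]
  have h1 : 0 ≤ C0 * Y := by positivity
  have h2 : 0 ≤ C1 * S := by positivity
  nlinarith

/-- A form of Young's inequality: the sublinear power is absorbed by `X / 4` above the threshold
`X0`, and is bounded by its value at `X0` below it. -/
theorem exists_forall_mul_rpow_le {τ Q : ℝ} (hτ : 0 < τ) (hτ1 : τ < 1) (hQ : 0 ≤ Q) :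
    ∃ K, 0 ≤ K ∧ ∀ X, 1 ≤ X → Q * X ^ (1 - τ) ≤ X / 4 + K := by
  set X0 := (4 * Q) ^ τ⁻¹ with hX0
  have hX00 : 0 ≤ X0 := by positivity
  refine ⟨Q * X0 ^ (1 - τ), by positivity, fun X hX => ?_⟩
  have hX' : 0 < X := by linarith
  rcases le_total X X0 with h | h
  · have : Q * X ^ (1 - τ) ≤ Q * X0 ^ (1 - τ) := by
      gcongr
    linarith
  · have h1 : 4 * Q ≤ X ^ τ := by
      have := Real.rpow_le_rpow hX00 h hτ.le
      rwa [hX0, ← Real.rpow_mul (by positivity), inv_mul_cancel₀ hτ.ne', Real.rpow_one] at this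
    have h2 : X ^ τ * X ^ (1 - τ) = X := by rw [← Real.rpow_add hX']; simp
    have h3 : 4 * Q * X ^ (1 - τ) ≤ X ^ τ * X ^ (1 - τ) := by gcongr
    have h4 : 0 ≤ Q * X0 ^ (1 - τ) := by positivity
    linarith

/-- The uniform resolvent estimate near a point of nonvanishing curvature, in dimension at
least two. -/
theorem exists_norm_resolventForm_le_of_two_le (hd : 2 ≤ d) {T : 𝔼 → ℝ} {M c r : ℝ}
    {U : Set 𝔼} (hM : 0 ≤ M) (hT : Continuous T) (hT1 : ∀ ξ, ‖fderiv ℝ T ξ‖ ≤ M)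
    (hT2 : ∀ ξ v, |T (ξ + v) - T ξ - fderiv ℝ T ξ v| ≤ M * ‖v‖ ^ 2) (hc : 0 < c)
    (hU : NondegenerateOn T U c) {θ : 𝔼 → ℝ} (hθ : ContDiff ℝ ∞ θ) (hθc : HasCompactSupport θ)
    (hθ0 : ∀ ξ, 0 ≤ θ ξ) (hr : 0 < r) (hr1 : r ≤ 1 / 2)
    (hθU : ∀ ξ v, θ (ξ + v) ≠ 0 → ‖v‖ ≤ r → ξ ∈ U) :
    ∃ C, 0 ≤ C ∧ ∀ (l ε : ℝ), 0 < ε → ∀ f g : LTwo d, UnitBall (steinTomas d) f →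
      UnitBall (steinTomas d) g →
      ‖multiplierForm (resolventSymbol θ T (l + ε * Complex.I)) f g‖ ≤ C := by
  obtain ⟨C, m, hC, hstep⟩ := exists_norm_resolventForm_le_of_poissonBounded hd hM hT hT1 hT2 hc hU
    hθ hθc hθ0 hr hr1 hθU
  obtain ⟨C0, hC0, hbase⟩ := exists_weightForm_le_of_unitBall hθ.continuous hθc hθ0
    (one_le_steinTomas (by omega : 1 ≤ d)) steinTomas_le_two
  have hd2 : (2 : ℝ) ≤ d := by exact_mod_cast hd
  -- This makes `C B⁻² ≤ 1 / 4`. With another quarter from the sublinear term, one step of the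
  -- bootstrap maps `X` to `X / 2 + K'`.
  set B : ℝ := 1 + 2 * C with hB
  have hB1 : 1 ≤ B := by linarith
  obtain ⟨K, hK, hyoung⟩ := exists_forall_mul_rpow_le (τ := (d : ℝ)⁻¹)
    (Q := C * (B ^ m) ^ (d : ℝ)⁻¹) (by positivity) (inv_lt_one_of_one_lt₀ (by linarith))
    (by positivity)
  set K' := C + K + 1 with hK'
  have hF : ∀ X, 1 ≤ X → C * (1 + (X ^ (1 - (d : ℝ)⁻¹) * (B ^ m) ^ (d : ℝ)⁻¹ + X * (B ^ 2)⁻¹)) ≤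
      X / 2 + K' := by
    intro X hX
    have h1 := hyoung X hX
    have h2 : C * (B ^ 2)⁻¹ ≤ 1 / 4 := by
      rw [← div_eq_mul_inv, div_le_div_iff₀ (by positivity) (by norm_num), hB]
      nlinarith
    have h3 : C * (B ^ 2)⁻¹ * X ≤ 1 / 4 * X := by gcongr
    have h4 : C * (1 + (X ^ (1 - (d : ℝ)⁻¹) * (B ^ m) ^ (d : ℝ)⁻¹ + X * (B ^ 2)⁻¹)) =
      C + C * (B ^ m) ^ (d : ℝ)⁻¹ * X ^ (1 - (d : ℝ)⁻¹) + C * (B ^ 2)⁻¹ * X := by ring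
    rw [h4]
    linarith
  have hnext : ∀ ε X, 0 < ε → 1 ≤ X → PoissonBounded θ T (steinTomas d) ε X →
      PoissonBounded θ T (steinTomas d) ε (X / 2 + K') := by
    intro ε X hε hX hP ε' hε' l f hf
    have hε'0 : 0 < ε' := by linarith
    refine (weightForm_poissonWeight_le hθ.continuous hθc hT l hε'0 f).trans ?_
    exact (hstep ε' X B hε'0 hX hB1 (fun e he => hP e (hε'.trans he)) l f f hf hf).trans (hF X hX)
  have hunif : ∀ ε, 0 < ε → PoissonBounded θ T (steinTomas d) ε (2 * K') := by
    intro ε hε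
    -- At fixed `ε` the Poisson kernel is at most `1 / ε`, so the iteration starts from a finite
    -- bound. Each step halves the part that depends on `ε` and preserves the fixed point `2 K'`.
    have hiter : ∀ n : ℕ, PoissonBounded θ T (steinTomas d) ε (ε⁻¹ * C0 / 2 ^ n + 2 * K') := by
      intro n
      induction n with
      | zero =>
        intro ε' hε' l f hf
        have hε'0 : 0 < ε' := by linarith
        have h1 : weightForm (poissonWeight θ T l ε') f ≤ weightForm (fun ξ => ε⁻¹ * θ ξ) f := by
          obtain ⟨Bθ, hBθ⟩ := hθc.exists_bound_of_continuous hθ.continuous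
          refine weightForm_mono (w' := fun ξ => ε⁻¹ * θ ξ) (poissonWeight_nonneg hθ0 l hε'0)
            (continuous_const.mul hθ.continuous).aestronglyMeasurable (B := ε⁻¹ * Bθ) (fun ξ => ?_)
            (fun ξ => ?_) f
          · rw [abs_mul, abs_of_pos (by positivity : 0 < ε⁻¹)]
            exact mul_le_mul_of_nonneg_left (hBθ ξ) (by positivity)
          · exact (poissonWeight_le hθ0 l hε'0 ξ).trans
              (mul_le_mul_of_nonneg_right (inv_anti₀ hε hε') (hθ0 ξ))
        rw [weightForm_const_mul] at h1
        have h2 : ε⁻¹ * weightForm θ f ≤ ε⁻¹ * C0 := by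
          gcongr
          exact hbase f hf
        rw [pow_zero, div_one]
        linarith
      | succ n ih =>
        have h1 : 0 ≤ ε⁻¹ * C0 / 2 ^ n := by positivity
        have h2 := hnext ε _ hε (by linarith) ih
        have h3 : (ε⁻¹ * C0 / 2 ^ n + 2 * K') / 2 + K' = ε⁻¹ * C0 / 2 ^ (n + 1) + 2 * K' := by
          rw [pow_succ]; field_simp; ring
        rwa [h3] at h2
    intro ε' hε' l f hf
    have hlim : Tendsto (fun n : ℕ => ε⁻¹ * C0 / 2 ^ n + 2 * K') atTop (𝓝 (0 + 2 * K')) :=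
      (tendsto_const_nhds.div_atTop (tendsto_pow_atTop_atTop_of_one_lt one_lt_two)).add_const _
    rw [zero_add] at hlim
    exact ge_of_tendsto' hlim fun n => hiter n ε' hε' l f hf
  refine ⟨2 * K' / 2 + K', by linarith, fun l ε hε f g hf hg => ?_⟩
  exact (hstep ε _ B hε (by linarith) hB1 (hunif ε hε) l f g hf hg).trans (hF _ (by linarith))

end ResolventForm

/-! ### A direct `L¹ → L^∞` kernel bound, for dimension one. -/

section OneDimensional

variable {d : ℕ}

local notation "𝔼" => EuclideanSpace ℝ (Fin d)

theorem inv_sub_I_mul_eq_integral {ε : ℝ} (hε : 0 < ε) (t : ℝ) :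
    ((t : ℂ) - Complex.I * ε)⁻¹ =
      Complex.I * ∫ s in Set.Ioi (0 : ℝ), Complex.exp (-(ε + Complex.I * t) * s) := by
  have hcre : (-(ε + Complex.I * t)).re = -ε := by simp
  rw [integral_exp_mul_complex_Ioi (by rw [hcre]; linarith)]
  have hc0 : -((ε : ℂ) + Complex.I * t) ≠ 0 := fun h => by rw [h] at hcre; simp at hcre; linarith
  have h2 : (t : ℂ) - Complex.I * ε = Complex.I * (-(ε + Complex.I * t)) := by
    rw [mul_neg, mul_add, ← mul_assoc, Complex.I_mul_I]; ring
  rw [h2]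
  simp only [Complex.ofReal_zero, mul_zero, Complex.exp_zero]
  rw [mul_inv, Complex.inv_I]
  ring

theorem integral_inv_one_add_sub_mul_sq {α : ℝ} (hα : α ≠ 0) (a : ℝ) :
    Integrable (fun s : ℝ => (1 + (a - s * α) ^ 2)⁻¹) ∧
      ∫ s : ℝ, (1 + (a - s * α) ^ 2)⁻¹ = |α|⁻¹ * Real.pi := by
  have h : (fun s : ℝ => (1 + (a - s * α) ^ 2)⁻¹) =
      fun s => (fun t : ℝ => (fun u : ℝ => (1 + u ^ 2)⁻¹) (t - a)) (α * s) := by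
    ext s; congr 2; ring
  constructor
  · rw [h]
    exact (integrable_inv_one_add_sq.comp_sub_right a).comp_mul_left' hα
  · rw [h, Measure.integral_comp_mul_left (fun t : ℝ => (1 + (t - a) ^ 2)⁻¹),
      integral_sub_right_eq_self (fun u : ℝ => (1 + u ^ 2)⁻¹), integral_univ_inv_one_add_sq,
      abs_inv, smul_eq_mul]

/-- The kernel of `θ / (ℓ - iε)` for an affine function `ℓ` is bounded. -/
theorem norm_integral_exp_mul_div_affine_le {θ : 𝔼 → ℝ} (hθ : ContDiff ℝ ∞ θ)
    (hθc : HasCompactSupport θ) {e : 𝔼} (he : ‖e‖ ≤ 1) {c : ℝ} (hc : 0 < c) (A X : 𝔼 →L[ℝ] ℝ)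
    (hA : c ≤ |A e|) (b : ℝ) {ε : ℝ} (hε : 0 < ε) :
    ‖∫ ξ, Complex.exp (Complex.I * ((X ξ : ℝ) : ℂ)) *
      ((θ ξ : ℂ) * (((b + A ξ : ℝ) : ℂ) - Complex.I * ε)⁻¹)‖ ≤
    ((∫ ξ, ‖iteratedFDeriv ℝ 0 (fun ξ => (θ ξ : ℂ)) ξ‖) +
      ∫ ξ, ‖iteratedFDeriv ℝ 2 (fun ξ => (θ ξ : ℂ)) ξ‖) * (c⁻¹ * Real.pi) := by
  have hθ' : ContDiff ℝ ∞ fun ξ => (θ ξ : ℂ) := Complex.ofRealCLM.contDiff.comp hθ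
  have hθc' : HasCompactSupport fun ξ => (θ ξ : ℂ) := hθc.comp_left Complex.ofReal_zero
  set D := (∫ ξ, ‖iteratedFDeriv ℝ 0 (fun ξ => (θ ξ : ℂ)) ξ‖) +
      ∫ ξ, ‖iteratedFDeriv ℝ 2 (fun ξ => (θ ξ : ℂ)) ξ‖ with hD
  have hD0 : 0 ≤ D := add_nonneg (integral_nonneg fun _ => norm_nonneg _)
    (integral_nonneg fun _ => norm_nonneg _)
  have hα : A e ≠ 0 := fun h => by rw [h, abs_zero] at hA; linarith
  set F : 𝔼 → ℝ → ℂ := fun ξ s => Complex.exp (Complex.I * ((X ξ : ℝ) : ℂ)) *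
      ((θ ξ : ℂ) * (Complex.I * Complex.exp (-(ε + Complex.I * ((b + A ξ : ℝ) : ℂ)) * s))) with hF
  have hFint : Integrable (Function.uncurry F) (volume.prod (volume.restrict (Set.Ioi (0 : ℝ)))) := by
    have h1 : Integrable (fun u : 𝔼 × ℝ => ‖(θ u.1 : ℂ)‖ * Real.exp (-ε * u.2))
        (volume.prod (volume.restrict (Set.Ioi (0 : ℝ)))) :=
      (hθ'.continuous.integrable_of_hasCompactSupport hθc').norm.mul_prod
        (integrableOn_exp_mul_Ioi (by linarith) 0)
    refine h1.mono' ?_ (Eventually.of_forall fun u => ?_)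
    · have := hθ.continuous
      refine Continuous.aestronglyMeasurable ?_
      simp only [hF, Function.uncurry_def]
      fun_prop
    · simp only [hF, Function.uncurry_def]
      rw [norm_mul, norm_mul, norm_mul, mul_comm Complex.I ((X u.1 : ℝ) : ℂ),
        Complex.norm_exp_ofReal_mul_I, Complex.norm_I, one_mul, one_mul, Complex.norm_exp]
      simp
  have hswap : ∫ ξ, Complex.exp (Complex.I * ((X ξ : ℝ) : ℂ)) *
      ((θ ξ : ℂ) * (((b + A ξ : ℝ) : ℂ) - Complex.I * ε)⁻¹) =
      ∫ s in Set.Ioi (0 : ℝ), ∫ ξ, F ξ s := by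
    rw [← integral_integral_swap hFint]
    congr 1 with ξ
    rw [inv_sub_I_mul_eq_integral hε, ← integral_const_mul, ← integral_const_mul, ← integral_const_mul]
  obtain ⟨hi, hI⟩ := integral_inv_one_add_sub_mul_sq hα (X e)
  -- The phase at time `s` has slope `X e - s A e` along `e`. Zero and two integrations by parts
  -- give a bound integrable in `s`, because `A e ≠ 0`.
  have hinner : ∀ s ∈ Set.Ioi (0 : ℝ), ‖∫ ξ, F ξ s‖ ≤ D * (1 + (X e - s * A e) ^ 2)⁻¹ := by
    intro s hs
    have h1 : ∫ ξ, F ξ s = (Complex.I * Complex.exp (-(ε + Complex.I * b) * s)) *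
        ∫ ξ, Complex.exp (Complex.I * (((X - s • A) ξ : ℝ) : ℂ)) * (θ ξ : ℂ) := by
      rw [← integral_const_mul]
      congr 1 with ξ
      simp only [hF]
      have h2 : Complex.exp (Complex.I * ((X ξ : ℝ) : ℂ)) *
          Complex.exp (-(ε + Complex.I * ((b + A ξ : ℝ) : ℂ)) * s) =
          Complex.exp (-(ε + Complex.I * b) * s) *
            Complex.exp (Complex.I * (((X - s • A) ξ : ℝ) : ℂ)) := by
        rw [← Complex.exp_add, ← Complex.exp_add]
        congr 1
        simp only [sub_apply, smul_apply, smul_eq_mul]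
        push_cast; ring
      linear_combination (θ ξ : ℂ) * Complex.I * h2
    have h3 := fun k => pow_mul_norm_integral_exp_mul_le (μ := (volume : Measure 𝔼))
      (X - s • A) e k hθ' hθc'
    have h30 := h3 0
    have h32 := h3 2
    simp only [pow_zero, one_mul, sq_abs, sub_apply, smul_apply, smul_eq_mul] at h30 h32
    have h4 : ‖∫ ξ, Complex.exp (Complex.I * (((X - s • A) ξ : ℝ) : ℂ)) * (θ ξ : ℂ)‖ ≤
        D * (1 + (X e - s * A e) ^ 2)⁻¹ := by
      rw [← div_eq_mul_inv, le_div_iff₀ (by positivity), hD]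
      have h5 : ‖e‖ ^ 2 * ∫ ξ, ‖iteratedFDeriv ℝ 2 (fun ξ => (θ ξ : ℂ)) ξ‖ ≤
          ∫ ξ, ‖iteratedFDeriv ℝ 2 (fun ξ => (θ ξ : ℂ)) ξ‖ :=
        mul_le_of_le_one_left (integral_nonneg fun _ => norm_nonneg _)
          (pow_le_one₀ (norm_nonneg _) he)
      simp only [sub_apply, smul_apply, smul_eq_mul]
      linarith
    rw [h1, norm_mul, norm_mul, Complex.norm_I, one_mul, Complex.norm_exp]
    refine (mul_le_of_le_one_left (norm_nonneg _) ?_).trans h4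
    refine Real.exp_le_one_iff.2 ?_
    have : 0 < ε * s := mul_pos hε hs
    simp
    linarith
  rw [hswap]
  calc _ ≤ ∫ s in Set.Ioi (0 : ℝ), D * (1 + (X e - s * A e) ^ 2)⁻¹ :=
        norm_integral_le_of_norm_le (hi.const_mul D).integrableOn
          ((ae_restrict_iff' measurableSet_Ioi).2 (Eventually.of_forall hinner))
    _ ≤ ∫ s, D * (1 + (X e - s * A e) ^ 2)⁻¹ :=
        setIntegral_le_integral (hi.const_mul D) (Eventually.of_forall fun s => by positivity)
    _ = D * (|A e|⁻¹ * Real.pi) := by rw [integral_const_mul, hI]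
    _ ≤ _ := by gcongr

/-- The uniform resolvent estimate `L¹ → L^∞` for symbols that are injective, in a quantitative
sense, on the support of the cutoff. -/
theorem exists_norm_resolventForm_le_of_injective {T θ : 𝔼 → ℝ} (hT : Continuous T)
    (hθ : ContDiff ℝ ∞ θ) (hθc : HasCompactSupport θ) (hθ0 : ∀ ξ, 0 ≤ θ ξ) {e : 𝔼} (he : ‖e‖ ≤ 1)
    {c M : ℝ} (hc : 0 < c) (hM : 0 ≤ M)
    (hinj : ∀ ξ ∈ tsupport θ, ∀ ξ' ∈ tsupport θ, c * ‖ξ - ξ'‖ ≤ |T ξ - T ξ'|)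
    (hT2 : ∀ ξ ∈ tsupport θ, ∀ ξ' ∈ tsupport θ,
      |T ξ - T ξ' - fderiv ℝ T ξ' (ξ - ξ')| ≤ M * ‖ξ - ξ'‖ ^ 2)
    (hdiam : ∀ ξ ∈ tsupport θ, ∀ ξ' ∈ tsupport θ, M * ‖ξ - ξ'‖ ≤ c / 4)
    (hT1 : ∀ ξ ∈ tsupport θ, c ≤ |fderiv ℝ T ξ e|) :
    ∃ C, 0 ≤ C ∧ ∀ (l ε : ℝ), 0 < ε → ∀ f g : LTwo d, UnitBall 1 f → UnitBall 1 g →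
      ‖multiplierForm (resolventSymbol θ T (l + ε * Complex.I)) f g‖ ≤ C := by
  have hθi : Integrable θ := hθ.continuous.integrable_of_hasCompactSupport hθc
  set κ1 := ((∫ ξ, ‖iteratedFDeriv ℝ 0 (fun ξ => (θ ξ : ℂ)) ξ‖) +
      ∫ ξ, ‖iteratedFDeriv ℝ 2 (fun ξ => (θ ξ : ℂ)) ξ‖) * (c⁻¹ * Real.pi) with hκ1
  set κ2 := 8 * M / c ^ 2 * ∫ ξ, θ ξ with hκ2
  have hκ10 : 0 ≤ κ1 := mul_nonneg (add_nonneg (integral_nonneg fun _ => norm_nonneg _)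
    (integral_nonneg fun _ => norm_nonneg _)) (by positivity)
  have hκ20 : 0 ≤ κ2 := mul_nonneg (by positivity) (integral_nonneg hθ0)
  refine ⟨κ1 + κ2, by positivity, fun l ε hε f g hf hg => ?_⟩
  have hL1 : ∀ f : LTwo d, UnitBall 1 f → Integrable f ∧ ∫ x, ‖f x‖ ≤ 1 := by
    intro f hf
    have h1 := hf.1
    have h2 := hf.2
    simp only [Real.rpow_one] at h1 h2
    exact ⟨(integrable_norm_iff (Lp.aestronglyMeasurable _)).1 h1, h2⟩
  obtain ⟨hfi, hf1⟩ := hL1 f hf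
  obtain ⟨hgi, hg1⟩ := hL1 g hg
  set m := resolventSymbol θ T (l + ε * Complex.I) with hm
  have hmc : Continuous m := continuous_resolventSymbol hθ.continuous hT hε.ne'
  have hmi : Integrable m := hmc.integrable_of_hasCompactSupport
    (HasCompactSupport.intro hθc.isCompact fun ξ hξ => by
      simp [hm, resolventSymbol, image_eq_zero_of_notMem_tsupport hξ])
  have hker : ∀ x : 𝔼, ‖∫ ξ, Complex.exp (Complex.I * ((2 * Real.pi * inner ℝ x ξ : ℝ) : ℂ)) * m ξ‖ ≤
      κ1 + κ2 := by
    intro x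
    rcases (tsupport θ).eq_empty_or_nonempty with hemp | hne
    · have h0 : ∀ ξ, m ξ = 0 := fun ξ => by
        have : ξ ∉ tsupport θ := by rw [hemp]; exact Set.notMem_empty ξ
        simp [hm, resolventSymbol, image_eq_zero_of_notMem_tsupport this]
      simp only [h0, mul_zero, integral_zero, norm_zero]
      positivity
    -- At a minimiser `ζ` of `|T - l|` on the support, injectivity gives `|T ξ - l| ≥ (c/2) ‖ξ - ζ‖`
    -- whether or not `l` is attained. The symbol is compared with its affine Taylor polynomial at
    -- `ζ`.
    obtain ⟨ζ, hζ, hmin⟩ := hθc.isCompact.exists_isMinOn hne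
      (f := fun ξ => |T ξ - l|) (by fun_prop)
    set A := fderiv ℝ T ζ with hA
    set b := T ζ - l - A ζ with hb
    set m1 : 𝔼 → ℂ := fun ξ => (θ ξ : ℂ) * (((b + A ξ : ℝ) : ℂ) - Complex.I * ε)⁻¹ with hm1
    have hne1 : ∀ t : ℝ, ((t : ℂ) - Complex.I * ε) ≠ 0 := fun t h => by
      have := congrArg Complex.im h
      simp at this
      exact hε.ne' this
    have hm1c : Continuous m1 := by
      refine (Complex.continuous_ofReal.comp hθ.continuous).mul (Continuous.inv₀ (by fun_prop)
        fun ξ => hne1 _)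
    have hm1i : Integrable m1 := hm1c.integrable_of_hasCompactSupport
      (HasCompactSupport.intro hθc.isCompact fun ξ hξ => by
        simp [hm1, image_eq_zero_of_notMem_tsupport hξ])
    -- The numerator of the difference is at most `M ‖ξ - ζ‖²`; the denominators are at least `(c/2)
    -- ‖ξ - ζ‖` and `(c/4) ‖ξ - ζ‖`, the second because the support is small. The quotient stays
    -- bounded by `8M / c²`.
    have hdiff : ∀ ξ, ‖m ξ - m1 ξ‖ ≤ 8 * M / c ^ 2 * θ ξ := by
      intro ξ
      by_cases hξ : ξ ∈ tsupport θ
      swap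
      · simp [hm, hm1, resolventSymbol, image_eq_zero_of_notMem_tsupport hξ]
      set t := T ξ - l with ht
      set t1 := b + A ξ with ht1
      have hn : ∀ t : ℝ, |t| ≤ ‖(t : ℂ) - Complex.I * ε‖ := fun t => by
        have := Complex.abs_re_le_norm ((t : ℂ) - Complex.I * ε)
        simpa using this
      have hmξ : m ξ = (θ ξ : ℂ) * ((t : ℂ) - Complex.I * ε)⁻¹ := by
        simp only [hm, resolventSymbol, ht]
        congr 2; push_cast; ring
      rw [hmξ, hm1, ← mul_sub, norm_mul, Complex.norm_real, Real.norm_of_nonneg (hθ0 ξ), mul_comm]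
      refine mul_le_mul_of_nonneg_right ?_ (hθ0 ξ)
      have htt : |t1 - t| ≤ M * ‖ξ - ζ‖ ^ 2 := by
        have := hT2 ξ hξ ζ hζ
        rw [abs_sub_comm]
        convert this using 2
        rw [ht, ht1, hb, hA, map_sub]; ring
      have hmin' : |T ζ - l| ≤ |t| := hmin hξ
      have h1 : c / 2 * ‖ξ - ζ‖ ≤ |t| := by
        have h2 := hinj ξ hξ ζ hζ
        have h3 : |T ξ - T ζ| ≤ |t| + |T ζ - l| := by
          rw [ht, abs_sub_comm (T ζ) l]; exact abs_sub_le _ _ _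
        linarith
      have h2 : c / 4 * ‖ξ - ζ‖ ≤ |t1| := by
        have h3 : |t| ≤ |t1| + |t1 - t| := by
          have := abs_sub_abs_le_abs_sub t t1
          rw [abs_sub_comm t t1] at this; linarith
        have h4 := mul_le_mul_of_nonneg_right (hdiam ξ hξ ζ hζ) (norm_nonneg (ξ - ζ))
        nlinarith
      rw [inv_sub_inv (hne1 t) (hne1 t1), norm_div, norm_mul,
        show ((t1 : ℂ) - Complex.I * ε) - ((t : ℂ) - Complex.I * ε) = ((t1 - t : ℝ) : ℂ) by
          push_cast; ring, Complex.norm_real, Real.norm_eq_abs]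
      rw [div_le_iff₀ (mul_pos (norm_pos_iff.2 (hne1 t)) (norm_pos_iff.2 (hne1 t1)))]
      calc |t1 - t| ≤ M * ‖ξ - ζ‖ ^ 2 := htt
        _ = 8 * M / c ^ 2 * ((c / 2 * ‖ξ - ζ‖) * (c / 4 * ‖ξ - ζ‖)) := by field_simp; ring
        _ ≤ _ := by
            gcongr
            · exact h1.trans (hn t)
            · exact h2.trans (hn t1)
    have hexp : ∀ ξ, ‖Complex.exp (Complex.I * ((2 * Real.pi * inner ℝ x ξ : ℝ) : ℂ))‖ = 1 := fun ξ => by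
      rw [mul_comm Complex.I, Complex.norm_exp_ofReal_mul_I]
    have hec : Continuous fun ξ => Complex.exp (Complex.I * ((2 * Real.pi * inner ℝ x ξ : ℝ) : ℂ)) := by
      fun_prop
    have hbd : ∀ n : 𝔼 → ℂ, Integrable n → Integrable fun ξ =>
        Complex.exp (Complex.I * ((2 * Real.pi * inner ℝ x ξ : ℝ) : ℂ)) * n ξ := fun n hn =>
      hn.bdd_mul (c := 1) hec.aestronglyMeasurable (Eventually.of_forall fun ξ => (hexp ξ).le)
    have hsplit : ∫ ξ, Complex.exp (Complex.I * ((2 * Real.pi * inner ℝ x ξ : ℝ) : ℂ)) * m ξ =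
        (∫ ξ, Complex.exp (Complex.I * ((2 * Real.pi * inner ℝ x ξ : ℝ) : ℂ)) * m1 ξ) +
        ∫ ξ, Complex.exp (Complex.I * ((2 * Real.pi * inner ℝ x ξ : ℝ) : ℂ)) * (m ξ - m1 ξ) := by
      rw [← integral_add (hbd _ hm1i) (hbd (fun ξ => m ξ - m1 ξ) (hmi.sub hm1i))]
      congr 1 with ξ; ring
    rw [hsplit]
    refine (norm_add_le _ _).trans (add_le_add ?_ ?_)
    · have h1 := norm_integral_exp_mul_div_affine_le hθ hθc he hc A ((2 * Real.pi) • innerSL ℝ x)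
        (hT1 ζ hζ) b hε
      simpa only [smul_apply, innerSL_apply_apply, smul_eq_mul] using! h1
    · rw [hκ2, ← integral_const_mul]
      refine norm_integral_le_of_norm_le (hθi.const_mul _) (Eventually.of_forall fun ξ => ?_)
      rw [norm_mul, hexp, one_mul]
      exact hdiff ξ
  refine (norm_multiplierForm_le_of_kernel hmi hker hfi hgi).trans
    (mul_le_of_le_one_right (by positivity) ?_)
  exact mul_le_one₀ hf1 (integral_nonneg fun _ => norm_nonneg _) hg1

end OneDimensional

/-! ### From nonvanishing curvature to quantitative nondegeneracy. -/

section Geometry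

variable {d : ℕ}

local notation "𝔼" => EuclideanSpace ℝ (Fin d)

/-- A `C²` function agrees near any point with one of globally bounded geometry. -/
theorem exists_bounded_geometry {T : 𝔼 → ℝ} (hT : ContDiff ℝ 2 T) (ξ₀ : 𝔼) :
    ∃ S : 𝔼 → ℝ, ∃ M : ℝ, ContDiff ℝ 2 S ∧ 0 ≤ M ∧ (∀ ξ ∈ Metric.ball ξ₀ 1, S ξ = T ξ) ∧
      (∀ ξ, ‖fderiv ℝ S ξ‖ ≤ M) ∧ ∀ ξ v, |S (ξ + v) - S ξ - fderiv ℝ S ξ v| ≤ M * ‖v‖ ^ 2 := by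
  let b : ContDiffBump ξ₀ := ⟨1, 2, one_pos, one_lt_two⟩
  set S : 𝔼 → ℝ := fun ξ => b ξ * T ξ with hS
  have hS2 : ContDiff ℝ 2 S := b.contDiff.mul hT
  have hSc : HasCompactSupport S := b.hasCompactSupport.mul_right
  have hD1 : ContDiff ℝ 1 (fderiv ℝ S) := hS2.fderiv_right (by norm_num)
  have hDc : HasCompactSupport (fderiv ℝ S) := hSc.fderiv ℝ
  obtain ⟨B, hB⟩ := hDc.exists_bound_of_continuous hD1.continuous
  obtain ⟨K, hK⟩ := ContDiff.lipschitzWith_of_hasCompactSupport hDc hD1 one_ne_zero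
  refine ⟨S, max B K, hS2, le_max_of_le_right K.2, fun ξ hξ => ?_,
    fun ξ => (hB ξ).trans (le_max_left _ _), fun ξ v => ?_⟩
  · rw [hS]
    simp only
    rw [b.one_of_mem_closedBall (Metric.ball_subset_closedBall hξ), one_mul]
  · have h1 := Convex.norm_image_sub_le_of_norm_fderiv_le' (𝕜 := ℝ) (f := S)
      (s := Metric.closedBall ξ ‖v‖) (x := ξ) (y := ξ + v) (φ := fderiv ℝ S ξ) (C := K * ‖v‖)
      (fun x _ => (hS2.differentiable two_ne_zero) x) (fun x hx => ?_) (convex_closedBall _ _)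
      (by simp) (by simp)
    · rw [add_sub_cancel_left, Real.norm_eq_abs] at h1
      refine h1.trans ?_
      have : (K : ℝ) * ‖v‖ ^ 2 ≤ max B K * ‖v‖ ^ 2 :=
        mul_le_mul_of_nonneg_right (le_max_right _ _) (by positivity)
      linarith
    · have := hK.dist_le_mul x ξ
      rw [dist_eq_norm] at this
      exact this.trans (mul_le_mul_of_nonneg_left hx K.2)

theorem gradient_inner_eq (T : 𝔼 → ℝ) (ξ v : 𝔼) : inner ℝ (gradient T ξ) v = fderiv ℝ T ξ v := by
  rw [gradient, InnerProductSpace.toDual_symm_apply]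

/-- Nonvanishing curvature in terms of the first and second derivatives. -/
theorem eq_zero_of_gaussianCurvature_ne_zero {T : 𝔼 → ℝ} (hT : ContDiff ℝ 2 T) {ξ : 𝔼}
    (h1 : fderiv ℝ T ξ ≠ 0) (hcurv : gaussianCurvature T ξ ≠ 0) {a : ℝ} {v : 𝔼}
    (hv : fderiv ℝ T ξ v = 0) (hav : a • fderiv ℝ T ξ + fderiv ℝ (fderiv ℝ T) ξ v = 0) :
    a = 0 ∧ v = 0 := by
  set g := gradient T ξ with hg
  have hg0 : g ≠ 0 := by
    intro h
    apply h1
    ext w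
    rw [← gradient_inner_eq, ← hg, h, inner_zero_left]; simp
  have hDT : DifferentiableAt ℝ (fderiv ℝ T) ξ :=
    (hT.fderiv_right (m := 1) (by norm_num)).differentiable one_ne_zero ξ
  let ι : (𝔼 →L[ℝ] ℝ) →L[ℝ] 𝔼 :=
    { toFun := (InnerProductSpace.toDual ℝ 𝔼).symm
      map_add' := fun x y => map_add _ x y
      map_smul' := fun c x => by simp
      cont := (InnerProductSpace.toDual ℝ 𝔼).symm.continuous }
  have hgrad : HasFDerivAt (gradient T) (ι ∘L fderiv ℝ (fderiv ℝ T) ξ) ξ :=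
    ι.hasFDerivAt.comp ξ hDT.hasFDerivAt
  have hHv : (ι ∘L fderiv ℝ (fderiv ℝ T) ξ) v = -a • g := by
    have h2 : fderiv ℝ (fderiv ℝ T) ξ v = -a • fderiv ℝ T ξ := by
      rw [neg_smul]; exact eq_neg_of_add_eq_zero_right hav
    rw [ContinuousLinearMap.comp_apply, h2, map_smul]
    rfl
  have hnorm : DifferentiableAt ℝ (fun x => ‖gradient T x‖⁻¹) ξ :=
    (hgrad.differentiableAt.norm ℝ hg0).inv (norm_ne_zero_iff.2 hg0)
  have hn : HasFDerivAt (unitNormal T) _ ξ := hnorm.hasFDerivAt.smul hgrad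
  -- In the derivative of `‖∇T‖⁻¹ ∇T` along `v`, one term is a multiple of `∇T` always and the other
  -- because `D²T v = -a ∇T`. The tangential part therefore vanishes and `v` lies in the kernel of
  -- the shape operator.
  have hnv : ∃ t : ℝ, fderiv ℝ (unitNormal T) ξ v = t • g := by
    refine ⟨‖g‖⁻¹ * (-a) + fderiv ℝ (fun x => ‖gradient T x‖⁻¹) ξ v, ?_⟩
    rw [hn.fderiv, add_smul, mul_smul, ← hHv]
    simp
    rfl
  obtain ⟨t, ht⟩ := hnv
  have hvt : v ∈ levelTangent T ξ := by
    rw [levelTangent, Submodule.mem_orthogonal_singleton_iff_inner_right, gradient_inner_eq, hv]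
  have hgo : t • g ∈ (levelTangent T ξ)ᗮ := by
    refine Submodule.smul_mem _ _ ?_
    rw [levelTangent]
    exact Submodule.le_orthogonal_orthogonal _ (Submodule.mem_span_singleton_self _)
  have hS : shapeOperator T ξ ⟨v, hvt⟩ = 0 := by
    rw [shapeOperator]
    simp only [LinearMap.neg_apply, ContinuousLinearMap.coe_coe, ContinuousLinearMap.comp_apply,
      Submodule.subtypeL_apply, ht, neg_eq_zero]
    exact Submodule.orthogonalProjectionOnto_eq_zero_iff.2 hgo
  have hv0 : v = 0 := by
    by_contra hne
    refine hcurv ?_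
    rw [gaussianCurvature]
    by_contra hdet
    have hinj := (LinearEquiv.ofIsUnitDet (f := shapeOperator T ξ)
      (v := Module.finBasis ℝ (levelTangent T ξ)) (v' := Module.finBasis ℝ (levelTangent T ξ))
      (by rw [LinearMap.det_toMatrix]; exact isUnit_iff_ne_zero.2 hdet)).injective
    have h0 : (⟨v, hvt⟩ : levelTangent T ξ) = 0 := hinj (by
      rw [map_zero]; exact hS)
    exact hne (congrArg Subtype.val h0)
  refine ⟨?_, hv0⟩
  rw [hv0, map_zero, add_zero] at hav
  exact (smul_eq_zero.1 hav).resolve_right h1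

/-- The local quantitative nondegeneracy of a symbol at a point of nonvanishing curvature. -/
theorem exists_nondegenerateOn_ball {S : 𝔼 → ℝ} (hS : ContDiff ℝ 2 S) {ξ₀ : 𝔼}
    (hinj : ∀ (a : ℝ) (v : 𝔼), fderiv ℝ S ξ₀ v = 0 →
      a • fderiv ℝ S ξ₀ + fderiv ℝ (fderiv ℝ S) ξ₀ v = 0 → a = 0 ∧ v = 0) :
    ∃ R > 0, ∃ c > 0, NondegenerateOn S (Metric.ball ξ₀ R) c := by
  set A := fderiv ℝ S ξ₀ with hA
  set H := fderiv ℝ (fderiv ℝ S) ξ₀ with hH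
  -- The bordered Hessian of `S` at `ξ₀`, the linearisation of the two quantities in
  -- `NondegenerateOn` at time one; by `hinj` it is injective, hence bounded below.
  let Φ : ℝ × 𝔼 →L[ℝ] ℝ × (𝔼 →L[ℝ] ℝ) :=
    (A ∘L ContinuousLinearMap.snd ℝ ℝ 𝔼).prod
      ((ContinuousLinearMap.fst ℝ ℝ 𝔼).smulRight A + H ∘L ContinuousLinearMap.snd ℝ ℝ 𝔼)
  have hΦ : ∀ a v, Φ (a, v) = (A v, a • A + H v) := fun a v => by simp [Φ]
  obtain ⟨K, hK0, hK⟩ := LinearMap.exists_antilipschitzWith (Φ : ℝ × 𝔼 →ₗ[ℝ] ℝ × (𝔼 →L[ℝ] ℝ)) (by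
    rw [LinearMap.ker_eq_bot']
    rintro ⟨a, v⟩ h
    have h' : Φ (a, v) = 0 := h
    rw [hΦ, Prod.mk_eq_zero] at h'
    obtain ⟨h1, h2⟩ := hinj a v h'.1 h'.2
    rw [h1, h2]; rfl)
  have hlow : ∀ (a : ℝ) (v : 𝔼), |a| + ‖v‖ ≤ 2 * K * (|A v| + ‖a • A + H v‖) := by
    intro a v
    have h1 := hK.le_mul_dist (a, v) 0
    rw [map_zero, dist_zero_right, dist_zero_right] at h1
    have h2 : ‖(Φ : ℝ × 𝔼 →ₗ[ℝ] ℝ × (𝔼 →L[ℝ] ℝ)) (a, v)‖ ≤ |A v| + ‖a • A + H v‖ := by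
      change ‖Φ (a, v)‖ ≤ _
      rw [hΦ, Prod.norm_def]
      exact max_le (by simp) (le_add_of_nonneg_left (abs_nonneg _))
    have h3 : |a| ≤ ‖((a, v) : ℝ × 𝔼)‖ := norm_fst_le ((a, v) : ℝ × 𝔼)
    have h4 : ‖v‖ ≤ ‖((a, v) : ℝ × 𝔼)‖ := norm_snd_le ((a, v) : ℝ × 𝔼)
    have h5 : (0 : ℝ) < K := hK0
    nlinarith
  have hK0' : (0 : ℝ) < K := hK0
  -- The `C²` errors then enter with the factor `2Kη = 1 / 4`, and at most half of `|a| + ‖v‖` has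
  -- to be absorbed.
  set η : ℝ := (8 * K)⁻¹ with hη
  have hη0 : 0 < η := by positivity
  have hs1 : HasStrictFDerivAt S A ξ₀ := hS.contDiffAt.hasStrictFDerivAt two_ne_zero
  have hD1 : ContDiff ℝ 1 (fderiv ℝ S) := hS.fderiv_right (by norm_num)
  have hs2 : HasStrictFDerivAt (fderiv ℝ S) H ξ₀ := hD1.contDiffAt.hasStrictFDerivAt one_ne_zero
  have e1 := hs1.isLittleO.bound hη0
  have e2 := hs2.isLittleO.bound hη0
  have e3 : ∀ᶠ ξ in 𝓝 ξ₀, ‖fderiv ℝ S ξ - A‖ < η := by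
    have : Tendsto (fun ξ => fderiv ℝ S ξ - A) (𝓝 ξ₀) (𝓝 0) := by
      have := (hD1.continuous.tendsto ξ₀).sub_const A
      rwa [← hA, sub_self] at this
    simpa using this.norm.eventually (gt_mem_nhds (by simpa using hη0))
  rw [nhds_prod_eq] at e1 e2
  obtain ⟨R1, hR1, h1⟩ := Metric.eventually_nhds_iff_ball.1 (by
    rw [nhds_prod_eq]; exact e1.and e2 : ∀ᶠ q in 𝓝 (ξ₀, ξ₀), _)
  obtain ⟨R2, hR2, h2⟩ := Metric.eventually_nhds_iff_ball.1 e3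
  refine ⟨min R1 R2, lt_min hR1 hR2, (40 * K)⁻¹, by positivity,
    fun σ hσ σ' hσ' ζ hζ ζ' hζ' => ?_⟩
  have hb : (ζ, ζ') ∈ Metric.ball (ξ₀, ξ₀) R1 := by
    rw [← ball_prod_same]
    exact ⟨Metric.ball_subset_ball (min_le_left _ _) hζ,
      Metric.ball_subset_ball (min_le_left _ _) hζ'⟩
  obtain ⟨b1, b2⟩ := h1 _ hb
  have b3 := (h2 ζ (Metric.ball_subset_ball (min_le_right _ _) hζ)).le
  simp only at b1 b2
  set v := ζ - ζ' with hv
  have hσ'0 : 0 < σ' := by linarith [hσ'.1]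
  -- Dividing by `σ'` reduces every time to the model at time one; `σ' ∈ [1/2, 5]` costs the factors
  -- `2` in `hn2` and `5` in `ha5`.
  set a := (σ - σ') / σ' with ha
  have hsplit : σ • fderiv ℝ S ζ - σ' • fderiv ℝ S ζ' =
      σ' • ((a • A + H v) + (a • (fderiv ℝ S ζ - A) + (fderiv ℝ S ζ - fderiv ℝ S ζ' - H v))) := by
    have : σ = σ' * (1 + a) := by rw [ha]; field_simp; ring
    rw [this]
    module
  have hn1 : |A v| ≤ |S ζ - S ζ'| + η * ‖v‖ := by
    have : |A v| ≤ |S ζ - S ζ'| + |S ζ - S ζ' - A v| := by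
      have := abs_sub_abs_le_abs_sub (A v) (S ζ - S ζ')
      rw [abs_sub_comm (A v)] at this; linarith
    rw [Real.norm_eq_abs] at b1
    linarith
  have hn2 : ‖a • A + H v‖ ≤ 2 * ‖σ • fderiv ℝ S ζ - σ' • fderiv ℝ S ζ'‖ + (|a| * η + η * ‖v‖) := by
    rw [hsplit, norm_smul, Real.norm_of_nonneg hσ'0.le]
    set p := a • A + H v
    set q := a • (fderiv ℝ S ζ - A) + (fderiv ℝ S ζ - fderiv ℝ S ζ' - H v)
    have hq : ‖q‖ ≤ |a| * η + η * ‖v‖ := by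
      refine (norm_add_le _ _).trans (add_le_add ?_ b2)
      rw [norm_smul, Real.norm_eq_abs]
      gcongr
    have h3 : ‖p‖ ≤ ‖p + q‖ + ‖q‖ := by
      have := norm_sub_le (p + q) q
      rwa [add_sub_cancel_right] at this
    have h4 : ‖p + q‖ ≤ 2 * (σ' * ‖p + q‖) := by nlinarith [hσ'.1, norm_nonneg (p + q)]
    linarith
  have hmain := hlow a v
  have ha5 : |σ - σ'| ≤ 5 * |a| := by
    rw [ha, abs_div, abs_of_pos hσ'0, mul_div_assoc', le_div_iff₀ hσ'0]
    nlinarith [hσ'.2, abs_nonneg (σ - σ')]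
  have hKη : 2 * K * η = 1 / 4 := by rw [hη]; field_simp; norm_num
  set P := |S ζ - S ζ'|
  set Q := ‖σ • fderiv ℝ S ζ - σ' • fderiv ℝ S ζ'‖
  have hP0 : 0 ≤ P := abs_nonneg _
  have hQ0 : 0 ≤ Q := norm_nonneg _
  have h6 : |a| + ‖v‖ ≤ 2 * K * (P + 2 * Q) + 2 * K * η * (2 * ‖v‖ + |a|) := by
    refine hmain.trans ?_
    have : 2 * K * (|A v| + ‖a • A + H v‖) ≤
        2 * K * ((P + η * ‖v‖) + (2 * Q + (|a| * η + η * ‖v‖))) := by gcongr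
    linarith
  rw [hKη] at h6
  have h7 : |a| + ‖v‖ ≤ 8 * K * (P + Q) := by nlinarith [abs_nonneg a, norm_nonneg v]
  rw [inv_mul_le_iff₀ (by positivity)]
  nlinarith [norm_nonneg v]

end Geometry

/-! ### The uniform estimate near a regular point. -/

section LocalEstimate

variable {d : ℕ}

local notation "𝔼" => EuclideanSpace ℝ (Fin d)

theorem resolventSymbol_congr {θ T S : 𝔼 → ℝ} (h : ∀ ξ ∈ tsupport θ, S ξ = T ξ) (z : ℂ) :
    resolventSymbol θ S z = resolventSymbol θ T z := by
  ext ξ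
  by_cases hξ : ξ ∈ tsupport θ
  · rw [resolventSymbol, resolventSymbol, h ξ hξ]
  · simp [resolventSymbol, image_eq_zero_of_notMem_tsupport hξ]

/-- The bound for the resolvent form localised by `θ`, at the endpoint exponent and uniformly in
the upper half plane. -/
def ResolventBounded (θ T : 𝔼 → ℝ) : Prop :=
  ∃ C, 0 ≤ C ∧ ∀ l ε : ℝ, 0 < ε → ∀ f g : LTwo d, UnitBall (steinTomas d) f →
    UnitBall (steinTomas d) g →
    ‖multiplierForm (resolventSymbol θ T (l + ε * Complex.I)) f g‖ ≤ C

theorem ResolventBounded.congr {θ T S : 𝔼 → ℝ} (h : ∀ ξ ∈ tsupport θ, S ξ = T ξ)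
    (hS : ResolventBounded θ S) : ResolventBounded θ T := by
  obtain ⟨C, hC, h1⟩ := hS
  refine ⟨C, hC, fun l ε hε f g hf hg => ?_⟩
  rw [← resolventSymbol_congr h]
  exact h1 l ε hε f g hf hg

/-- On the line a nonzero derivative makes `T` locally bi-Lipschitz, and the endpoint exponent is
`1`; no curvature is needed. -/
theorem exists_resolventBounded_of_dim_one {T : EuclideanSpace ℝ (Fin 1) → ℝ}
    (hT : ContDiff ℝ 2 T) {ξ₀ : EuclideanSpace ℝ (Fin 1)} (h1 : fderiv ℝ T ξ₀ ≠ 0) :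
    ∃ R > 0, ∀ θ : EuclideanSpace ℝ (Fin 1) → ℝ, ContDiff ℝ ∞ θ → (∀ ξ, 0 ≤ θ ξ) →
      tsupport θ ⊆ Metric.ball ξ₀ R → ResolventBounded θ T := by
  obtain ⟨S, M, hS, hM, hST, hS1, hS2⟩ := exists_bounded_geometry hT ξ₀
  have hev : S =ᶠ[𝓝 ξ₀] T :=
    Filter.eventually_of_mem (Metric.ball_mem_nhds ξ₀ one_pos) hST
  set A := fderiv ℝ S ξ₀ with hA
  have hA0 : A ≠ 0 := by rwa [hA, hev.fderiv_eq]
  set e : EuclideanSpace ℝ (Fin 1) := EuclideanSpace.single 0 1 with he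
  have he1 : ‖e‖ ≤ 1 := by simp [he]
  have hrep : ∀ v : EuclideanSpace ℝ (Fin 1), v = v 0 • e := fun v => by
    ext i; fin_cases i; simp [he]
  have hAe : A e ≠ 0 := fun h => hA0 (by
    ext v; rw [hrep v, map_smul, h]; simp)
  set c := |A e| / 2 with hc
  have hc0 : 0 < c := by positivity
  have hAv : ∀ v, |A v| = 2 * c * ‖v‖ := by
    intro v
    have hnv : ‖v‖ = |v 0| := by rw [EuclideanSpace.norm_eq]; simp [Real.sqrt_sq_eq_abs]
    rw [hnv]
    conv_lhs => rw [hrep v, map_smul, smul_eq_mul, abs_mul]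
    rw [hc]; ring
  have hs1 : HasStrictFDerivAt S A ξ₀ := hS.contDiffAt.hasStrictFDerivAt two_ne_zero
  have e1 := hs1.isLittleO.bound hc0
  obtain ⟨R1, hR1, h2⟩ := Metric.eventually_nhds_iff_ball.1 e1
  have hD1 : ContDiff ℝ 1 (fderiv ℝ S) := hS.fderiv_right (by norm_num)
  have e2 : ∀ᶠ ξ in 𝓝 ξ₀, c < |fderiv ℝ S ξ e| := by
    have h3 : Continuous fun ξ => |fderiv ℝ S ξ e| := by
      have := hD1.continuous
      fun_prop
    refine h3.continuousAt.eventually (lt_mem_nhds ?_)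
    change c < |A e|
    rw [hc]
    exact half_lt_self (abs_pos.2 hAe)
  obtain ⟨R2, hR2, h3⟩ := Metric.eventually_nhds_iff_ball.1 e2
  -- The last entry gives `M · 2R ≤ c / 4`, the smallness of the support required for the affine
  -- comparison.
  set R := min (min R1 R2) (min 1 (c / (8 * (M + 1)))) with hR
  have hR0 : 0 < R := by positivity
  refine ⟨R, hR0, fun θ hθ hθ0 hθR => ?_⟩
  have hθc : HasCompactSupport θ := (isCompact_closedBall ξ₀ R).of_isClosed_subset
    (isClosed_tsupport θ) (hθR.trans Metric.ball_subset_closedBall)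
  have hsub1 : ∀ ξ ∈ tsupport θ, ξ ∈ Metric.ball ξ₀ R1 := fun ξ hξ =>
    Metric.ball_subset_ball ((min_le_left _ _).trans (min_le_left _ _)) (hθR hξ)
  have hsub2 : ∀ ξ ∈ tsupport θ, ξ ∈ Metric.ball ξ₀ R2 := fun ξ hξ =>
    Metric.ball_subset_ball ((min_le_left _ _).trans (min_le_right _ _)) (hθR hξ)
  refine ResolventBounded.congr (S := S) (fun ξ hξ => hST ξ
    (Metric.ball_subset_ball ((min_le_right _ _).trans (min_le_left _ _)) (hθR hξ))) ?_
  have hp : steinTomas 1 = 1 := by rw [steinTomas]; norm_num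
  rw [ResolventBounded, hp]
  refine exists_norm_resolventForm_le_of_injective hS.continuous hθ hθc hθ0 he1 hc0 hM
    (fun ξ hξ ξ' hξ' => ?_) (fun ξ _ ξ' _ => ?_) (fun ξ hξ ξ' hξ' => ?_)
    (fun ξ hξ => (h3 ξ (hsub2 ξ hξ)).le)
  · have h4 := h2 (ξ, ξ') (by
      rw [← ball_prod_same]; exact ⟨hsub1 ξ hξ, hsub1 ξ' hξ'⟩)
    rw [Real.norm_eq_abs] at h4
    have h5 := abs_sub_abs_le_abs_sub (A (ξ - ξ')) (S ξ - S ξ')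
    rw [abs_sub_comm (A (ξ - ξ')), hAv] at h5
    simp only at h4
    linarith
  · have h4 := hS2 ξ' (ξ - ξ')
    rwa [add_sub_cancel] at h4
  · have h4 : ‖ξ - ξ'‖ ≤ 2 * R := by
      rw [← dist_eq_norm]
      have h5 := Metric.mem_ball.1 (hθR hξ)
      have h6 := Metric.mem_ball'.1 (hθR hξ')
      linarith [dist_triangle ξ ξ₀ ξ']
    have h7 : R ≤ c / (8 * (M + 1)) := (min_le_right _ _).trans (min_le_right _ _)
    rw [le_div_iff₀ (by positivity)] at h7
    nlinarith [norm_nonneg (ξ - ξ')]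

/-- The nondegenerate ball of radius `R0` is shared: half for the support of the cutoff, half for
the windows that reach beyond it. -/
theorem exists_resolventBounded_of_two_le (hd : 2 ≤ d) {T : 𝔼 → ℝ} (hT : ContDiff ℝ 2 T)
    {ξ₀ : 𝔼} (h1 : fderiv ℝ T ξ₀ ≠ 0) (hcurv : gaussianCurvature T ξ₀ ≠ 0) :
    ∃ R > 0, ∀ θ : 𝔼 → ℝ, ContDiff ℝ ∞ θ → (∀ ξ, 0 ≤ θ ξ) →
      tsupport θ ⊆ Metric.ball ξ₀ R → ResolventBounded θ T := by
  obtain ⟨S, M, hS, hM, hST, hS1, hS2⟩ := exists_bounded_geometry hT ξ₀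
  have hev : S =ᶠ[𝓝 ξ₀] T :=
    Filter.eventually_of_mem (Metric.ball_mem_nhds ξ₀ one_pos) hST
  obtain ⟨R0, hR0, c, hc, hU⟩ := exists_nondegenerateOn_ball hS (ξ₀ := ξ₀) (by
    rw [hev.fderiv_eq, hev.fderiv.fderiv_eq]
    exact fun a v => eq_zero_of_gaussianCurvature_ne_zero hT h1 hcurv)
  refine ⟨min 1 (R0 / 2), by positivity, fun θ hθ hθ0 hθR => ?_⟩
  have hθc : HasCompactSupport θ := (isCompact_closedBall ξ₀ _).of_isClosed_subset
    (isClosed_tsupport θ) (hθR.trans Metric.ball_subset_closedBall)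
  refine ResolventBounded.congr (S := S) (fun ξ hξ => hST ξ
    (Metric.ball_subset_ball (min_le_left _ _) (hθR hξ))) ?_
  refine exists_norm_resolventForm_le_of_two_le hd hM hS.continuous hS1 hS2 hc hU hθ hθc hθ0
    (r := min (1 / 2) (R0 / 2)) (by positivity) (min_le_left _ _) fun ξ v hξ hv => ?_
  have h2 := Metric.mem_ball.1 (hθR (subset_tsupport θ hξ))
  have h3 : dist ξ (ξ + v) ≤ R0 / 2 := by
    rw [dist_self_add_right]; exact hv.trans (min_le_right _ _)
  rw [Metric.mem_ball]
  linarith [dist_triangle ξ (ξ + v) ξ₀, min_le_right (1 : ℝ) (R0 / 2)]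

/-- The uniform resolvent estimate near a regular point of nonvanishing curvature. -/
theorem exists_resolventBounded {T : 𝔼 → ℝ} (hT : ContDiff ℝ 2 T) {ξ₀ : 𝔼}
    (h1 : fderiv ℝ T ξ₀ ≠ 0) (hcurv : gaussianCurvature T ξ₀ ≠ 0) :
    ∃ R > 0, ∀ θ : 𝔼 → ℝ, ContDiff ℝ ∞ θ → (∀ ξ, 0 ≤ θ ξ) →
      tsupport θ ⊆ Metric.ball ξ₀ R → ResolventBounded θ T := by
  rcases d with _ | _ | d
  -- In dimension zero the differential vanishes, so there is no regular point.
  · exact absurd (ContinuousLinearMap.ext fun v => by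
      rw [Subsingleton.elim v 0, map_zero, map_zero]) h1
  · exact exists_resolventBounded_of_dim_one hT h1
  · exact exists_resolventBounded_of_two_le (by omega) hT h1 hcurv

end LocalEstimate

/-! ### Lowering the exponent by frequency localisation. -/

section Smoothing

variable {d : ℕ}

local notation "𝔼" => EuclideanSpace ℝ (Fin d)

open Convolution in
/-- Frequency localisation maps `L¹` to every `L^r`. -/
theorem exists_frequency_localization {k : 𝔼 → ℂ} (hk : ContDiff ℝ ∞ k) (hkc : HasCompactSupport k) :
    ∃ A, 1 ≤ A ∧ ∀ f : LTwo d, Integrable f → ∫ x, ‖f x‖ ≤ 1 → ∃ h : LTwo d,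
      ((𝓕 h : LTwo d) =ᵐ[volume] fun ξ => k ξ * (𝓕 f : LTwo d) ξ) ∧
      ∀ r : ℝ, 1 ≤ r → Integrable (fun x => ‖h x‖ ^ r) ∧ ∫ x, ‖h x‖ ^ r ≤ A ^ r := by
  set κ : 𝓢(𝔼, ℂ) := 𝓕⁻ (hkc.toSchwartzMap hk) with hκ
  have hκF : ∀ ξ, 𝓕 (κ : 𝔼 → ℂ) ξ = k ξ := by
    intro ξ
    have h1 : (𝓕 κ : 𝓢(𝔼, ℂ)) = hkc.toSchwartzMap hk := by
      rw [hκ, FourierTransform.fourier_fourierInv_eq]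
    have h2 := congrArg (fun φ : 𝓢(𝔼, ℂ) => φ ξ) h1
    rw [← SchwartzMap.fourier_coe]
    exact h2
  obtain ⟨B, hB⟩ : ∃ B, ∀ x, ‖κ x‖ ≤ B := by
    obtain ⟨B, _, hB⟩ := κ.decay 0 0
    exact ⟨B, fun x => by simpa using hB x⟩
  have hκi : Integrable (κ : 𝔼 → ℂ) := κ.integrable
  set A := 1 + B + ∫ x, ‖κ x‖ with hA
  have hB0 : 0 ≤ B := (norm_nonneg _).trans (hB 0)
  have hI0 : 0 ≤ ∫ x, ‖κ x‖ := integral_nonneg fun _ => norm_nonneg _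
  refine ⟨A, by linarith, fun f hf hf1 => ?_⟩
  -- Convolution with a Schwartz function puts `g` in `L¹ ∩ L^∞` with both norms at most `A`, hence
  -- in every `L^r` with the same bound.
  set g : 𝔼 → ℂ := (κ : 𝔼 → ℂ) ⋆[ContinuousLinearMap.mul ℂ ℂ] (f : 𝔼 → ℂ) with hg
  have hgi : Integrable g := hκi.integrable_convolution _ hf
  have hgdef : ∀ x, g x = ∫ t, κ t * f (x - t) := fun x => rfl
  have hgB : ∀ x, ‖g x‖ ≤ A := by
    intro x
    have hfx : Integrable fun t => f (x - t) := hf.comp_sub_left x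
    calc ‖g x‖ ≤ ∫ t, B * ‖f (x - t)‖ := by
          rw [hgdef]
          refine norm_integral_le_of_norm_le (hfx.norm.const_mul B) (Eventually.of_forall fun t => ?_)
          rw [norm_mul]
          gcongr
          exact hB t
      _ = B * ∫ t, ‖f t‖ := by
          rw [integral_const_mul, integral_sub_left_eq_self (fun t => ‖f t‖)]
      _ ≤ A := by nlinarith
  have hg1 : ∫ x, ‖g x‖ ≤ A := by
    have h1 := integral_convolution (μ := (volume : Measure 𝔼)) (ν := volume)
      (ContinuousLinearMap.mul ℝ ℝ) hκi.norm hf.norm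
    have hi : Integrable ((fun x => ‖κ x‖) ⋆[ContinuousLinearMap.mul ℝ ℝ] fun x => ‖f x‖) :=
      hκi.norm.integrable_convolution _ hf.norm
    calc ∫ x, ‖g x‖ ≤ ∫ x, ((fun x => ‖κ x‖) ⋆[ContinuousLinearMap.mul ℝ ℝ] fun x => ‖f x‖) x := by
          refine integral_mono hgi.norm hi fun x => ?_
          simp only [hgdef, convolution_def, ContinuousLinearMap.mul_apply']
          refine (norm_integral_le_integral_norm _).trans (le_of_eq ?_)
          simp only [norm_mul]
      _ = (∫ x, ‖κ x‖) * ∫ x, ‖f x‖ := h1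
      _ ≤ A := by nlinarith
  have hpow : ∀ r : ℝ, 1 ≤ r → ∀ x, ‖g x‖ ^ r ≤ A ^ (r - 1) * ‖g x‖ := by
    intro r hr x
    rcases (norm_nonneg (g x)).eq_or_lt with h0 | h0
    · rw [← h0, Real.zero_rpow (by linarith), mul_zero]
    · calc ‖g x‖ ^ r = ‖g x‖ ^ (r - 1) * ‖g x‖ := by
            rw [← Real.rpow_add_one h0.ne']; congr 1; ring
        _ ≤ _ := by
            gcongr
            exact hgB x
  have hpowi : ∀ r : ℝ, 1 ≤ r → Integrable (fun x => ‖g x‖ ^ r) := fun r hr =>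
    (hgi.norm.const_mul (A ^ (r - 1))).mono'
      ((hgi.aestronglyMeasurable.norm.aemeasurable.pow_const r).aestronglyMeasurable)
      (Eventually.of_forall fun x => by
        rw [Real.norm_of_nonneg (by positivity)]; exact hpow r hr x)
  have hg2 : MemLp g 2 volume := by
    rw [memLp_two_iff_integrable_sq_norm hgi.aestronglyMeasurable]
    have := hpowi 2 (by norm_num)
    simpa only [Real.rpow_two] using this
  have hco := hg2.coeFn_toLp
  refine ⟨hg2.toLp g, ?_, fun r hr => ?_⟩
  · have hi : Integrable (hg2.toLp g) := (integrable_congr hco).2 hgi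
    refine (coeFn_fourier_ae_eq _ hi).trans ?_
    have h1 : 𝓕 ((hg2.toLp g : LTwo d) : 𝔼 → ℂ) = 𝓕 g := by
      ext ξ
      rw [Real.fourier_eq, Real.fourier_eq]
      refine integral_congr_ae ?_
      filter_upwards [hco] with x hx
      rw [hx]
    rw [h1]
    filter_upwards [coeFn_fourier_ae_eq f hf] with ξ hξ
    rw [hg, Real.fourier_mul_convolution_eq hκi hf, hκF, hξ]
  · have hae : (fun x => ‖(hg2.toLp g : LTwo d) x‖ ^ r) =ᵐ[volume] fun x => ‖g x‖ ^ r := by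
      filter_upwards [hco] with x hx
      rw [hx]
    refine ⟨(integrable_congr hae).2 (hpowi r hr), ?_⟩
    rw [integral_congr_ae hae]
    calc ∫ x, ‖g x‖ ^ r ≤ ∫ x, A ^ (r - 1) * ‖g x‖ :=
          integral_mono (hpowi r hr) (hgi.norm.const_mul _) (hpow r hr)
      _ = A ^ (r - 1) * ∫ x, ‖g x‖ := integral_const_mul _ _
      _ ≤ A ^ (r - 1) * A := by gcongr
      _ = A ^ r := by
          rw [← Real.rpow_add_one (by linarith)]; congr 1; ring

/-- A bilinear bound on the unit ball of `L^p`. -/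
def FormBound (p : ℝ) (m : 𝔼 → ℂ) (D : ℝ) : Prop :=
  ∀ f g : LTwo d, UnitBall p f → UnitBall p g → ‖multiplierForm m f g‖ ≤ D

/-- For multipliers supported in a fixed compact set, a bound on `L^r` implies one on `L^p`,
`p ≤ r`. -/
theorem exists_formBound_of_le {k : 𝔼 → ℂ} (hk : ContDiff ℝ ∞ k) (hkc : HasCompactSupport k) :
    ∃ A, 0 ≤ A ∧ ∀ (p r : ℝ), 1 ≤ p → p ≤ r → ∀ (m : 𝔼 → ℂ) (B D : ℝ), AEStronglyMeasurable m →
      (∀ ξ, ‖m ξ‖ ≤ B) → (∀ ξ, m ξ ≠ 0 → k ξ = 1) → FormBound r m D → FormBound p m (A * D) := by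
  obtain ⟨A, hA, hloc⟩ := exists_frequency_localization hk hkc
  refine ⟨(A + 1) ^ 2, by positivity, fun p r hp hpr m B D hm hB hmk hD f g hf hg => ?_⟩
  have hr : 1 ≤ r := hp.trans hpr
  have hr0 : 0 < r := by linarith
  have hD' : ∀ f g : LTwo d, ∀ a b : ℝ, 0 ≤ a → 0 ≤ b → Integrable (fun x => ‖f x‖ ^ r) →
      Integrable (fun x => ‖g x‖ ^ r) → ∫ x, ‖f x‖ ^ r ≤ a ^ r → ∫ x, ‖g x‖ ^ r ≤ b ^ r →
      ‖multiplierForm m f g‖ ≤ D * (a * b) := by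
    intro f g a b ha hb hf hg hfa hgb
    have hD0 : 0 ≤ D := by
      have h0 : UnitBall r (0 : LTwo d) := by
        have h0 : (fun x => ‖(0 : LTwo d) x‖ ^ r) =ᵐ[volume] fun _ => (0 : ℝ) := by
          filter_upwards [Lp.coeFn_zero ℂ 2 (volume : Measure 𝔼)] with x hx
          rw [hx]; simp [hr0.ne']
        exact ⟨(integrable_congr h0).2 (integrable_zero _ _ _), by rw [integral_congr_ae h0]; simp⟩
      exact (norm_nonneg _).trans (hD 0 0 h0 h0)
    refine (norm_multiplierForm_le_of_unit_ball hr0 (fun f g hf hg hf1 hg1 =>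
      hD f g ⟨hf, hf1⟩ ⟨hg, hg1⟩) hf hg).trans ?_
    have hroot : ∀ x y : ℝ, 0 ≤ x → 0 ≤ y → x ≤ y ^ r → x ^ r⁻¹ ≤ y := by
      intro x y hx hy hxy
      have := Real.rpow_le_rpow hx hxy (inv_nonneg.2 hr0.le)
      rwa [← Real.rpow_mul hy, mul_inv_cancel₀ hr0.ne', Real.rpow_one] at this
    have hif : 0 ≤ ∫ x, ‖f x‖ ^ r := integral_nonneg fun _ => by positivity
    have hig : 0 ≤ ∫ x, ‖g x‖ ^ r := integral_nonneg fun _ => by positivity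
    gcongr
    · exact hroot _ _ hif ha hfa
    · exact hroot _ _ hig hb hgb
  -- Only the `L¹` parts need localising; since `m = m k`, the form does not notice it. The four
  -- resulting terms add up to `(A + 1)² D`.
  obtain ⟨f1, f2, hfs, hf1i, hf1, hf2⟩ := hf.exists_add_eq hp hpr
  obtain ⟨g1, g2, hgs, hg1i, hg1, hg2⟩ := hg.exists_add_eq hp hpr
  obtain ⟨h, hh, hhr⟩ := hloc f1 hf1i hf1
  obtain ⟨e, he, her⟩ := hloc g1 hg1i hg1
  have hk' : ∀ ξ, m ξ * k ξ = m ξ := fun ξ => by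
    by_cases h0 : m ξ = 0
    · rw [h0, zero_mul]
    · rw [hmk ξ h0, mul_one]
  have hk'' : ∀ ξ, m ξ * starRingEnd ℂ (k ξ) = m ξ := fun ξ => by
    by_cases h0 : m ξ = 0
    · rw [h0, zero_mul]
    · rw [hmk ξ h0, map_one, mul_one]
  have hleft : ∀ u, multiplierForm m f1 u = multiplierForm m h u := by
    intro u
    refine integral_congr_ae ?_
    filter_upwards [hh] with ξ hξ
    rw [hξ]
    linear_combination -((𝓕 f1 : LTwo d) ξ * starRingEnd ℂ ((𝓕 u : LTwo d) ξ)) * hk' ξ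
  have hright : ∀ u, multiplierForm m u g1 = multiplierForm m u e := by
    intro u
    refine integral_congr_ae ?_
    filter_upwards [he] with ξ hξ
    rw [hξ, map_mul]
    linear_combination -((𝓕 u : LTwo d) ξ * starRingEnd ℂ ((𝓕 g1 : LTwo d) ξ)) * hk'' ξ
  rw [← hfs, ← hgs, multiplierForm_add_left hm hB, multiplierForm_add_right hm hB,
    multiplierForm_add_right hm hB, hleft, hleft, hright, hright]
  have b11 := hD' h e A A (by linarith) (by linarith) (hhr r hr).1 (her r hr).1 (hhr r hr).2 (her r hr).2
  have b12 := hD' h g2 A 1 (by linarith) (by linarith) (hhr r hr).1 hg2.1 (hhr r hr).2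
    (by simpa using hg2.2)
  have b21 := hD' f2 e 1 A (by linarith) (by linarith) hf2.1 (her r hr).1
    (by simpa using hf2.2) (her r hr).2
  have b22 := hD' f2 g2 1 1 (by linarith) (by linarith) hf2.1 hg2.1
    (by simpa using hf2.2) (by simpa using hg2.2)
  calc _ ≤ ‖multiplierForm m h e‖ + ‖multiplierForm m h g2‖ +
        (‖multiplierForm m f2 e‖ + ‖multiplierForm m f2 g2‖) :=
        (norm_add_le _ _).trans (add_le_add (norm_add_le _ _) (norm_add_le _ _))
    _ ≤ D * (A * A) + D * (A * 1) + (D * (1 * A) + D * (1 * 1)) := by gcongr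
    _ = _ := by ring

end Smoothing

/-! ### Complex cutoffs, partition of unity and the global bilinear estimate. -/

section GlobalEstimate

variable {d : ℕ}

local notation "𝔼" => EuclideanSpace ℝ (Fin d)

theorem tsupport_mul_subset_right' {R : Type*} [MulZeroClass R] {f g : 𝔼 → R} :
    tsupport (fun ξ => f ξ * g ξ) ⊆ tsupport g :=
  closure_mono fun ξ hξ h => hξ (by simp [h])

/-- The resolvent symbol with a complex cutoff. -/
noncomputable def cutoffResolvent (χ : 𝔼 → ℂ) (T : 𝔼 → ℝ) (z : ℂ) (ξ : 𝔼) : ℂ :=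
  χ ξ * ((T ξ : ℂ) - z)⁻¹

theorem ofReal_sub_ne_zero {z : ℂ} (hz : z.im ≠ 0) (t : ℝ) : (t : ℂ) - z ≠ 0 := by
  intro h
  have := congrArg Complex.im h
  simp at this
  exact hz this

theorem continuous_cutoffResolvent {χ : 𝔼 → ℂ} {T : 𝔼 → ℝ} (hχ : Continuous χ) (hT : Continuous T)
    {z : ℂ} (hz : ∀ ξ, (T ξ : ℂ) - z ≠ 0) : Continuous (cutoffResolvent χ T z) := by
  unfold cutoffResolvent
  exact hχ.mul (Continuous.inv₀ (by fun_prop) hz)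

theorem exists_norm_cutoffResolvent_le {χ : 𝔼 → ℂ} {T : 𝔼 → ℝ} (hχ : Continuous χ)
    (hχc : HasCompactSupport χ) (hT : Continuous T) {z : ℂ} (hz : ∀ ξ, (T ξ : ℂ) - z ≠ 0) :
    ∃ B, ∀ ξ, ‖cutoffResolvent χ T z ξ‖ ≤ B :=
  (HasCompactSupport.intro hχc.isCompact fun ξ hξ => by
    simp [cutoffResolvent, image_eq_zero_of_notMem_tsupport hξ]).exists_bound_of_continuous
    (continuous_cutoffResolvent hχ hT hz)

/-- The bound in the upper half plane carries over to the lower one. -/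
theorem ResolventBounded.exists_formBound {θ T : 𝔼 → ℝ} (h : ResolventBounded θ T) :
    ∃ C, 0 ≤ C ∧ ∀ z : ℂ, z.im ≠ 0 → FormBound (steinTomas d) (resolventSymbol θ T z) C := by
  obtain ⟨C, hC, hb⟩ := h
  refine ⟨C, hC, fun z hz f g hf hg => ?_⟩
  rcases hz.lt_or_gt with h | h
  · have h1 := hb z.re (-z.im) (by linarith) g f hg hf
    have h2 : (z.re : ℂ) + ((-z.im : ℝ) : ℂ) * Complex.I = starRingEnd ℂ z := by
      apply Complex.ext <;> simp
    rw [h2] at h1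
    have h3 : resolventSymbol θ T z =
        fun ξ => starRingEnd ℂ (resolventSymbol θ T (starRingEnd ℂ z) ξ) := by
      ext ξ; rw [conj_resolventSymbol, Complex.conj_conj]
    rw [h3, multiplierForm_conj, RCLike.norm_conj]
    exact h1
  · have h1 := hb z.re z.im h f g hf hg
    rwa [Complex.re_add_im] at h1

theorem FormBound.const_mul {p : ℝ} {m : 𝔼 → ℂ} {D : ℝ} (h : FormBound p m D) (c : ℂ) :
    FormBound p (fun ξ => c * m ξ) (‖c‖ * D) := by
  intro f g hf hg
  rw [multiplierForm_const_mul, norm_mul]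
  exact mul_le_mul_of_nonneg_left (h f g hf hg) (norm_nonneg _)

theorem FormBound.sum {p : ℝ} {ι : Type*} (s : Finset ι) {m : ι → 𝔼 → ℂ} {B D : ι → ℝ}
    (hm : ∀ i, AEStronglyMeasurable (m i)) (hB : ∀ i ξ, ‖m i ξ‖ ≤ B i)
    (h : ∀ i, FormBound p (m i) (D i)) :
    FormBound p (fun ξ => ∑ i ∈ s, m i ξ) (∑ i ∈ s, D i) := by
  intro f g hf hg
  rw [multiplierForm_symbol_sum s hm hB]
  exact (norm_sum_le _ _).trans (Finset.sum_le_sum fun i _ => h i f g hf hg)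

theorem FormBound.add {p : ℝ} {m m' : 𝔼 → ℂ} {B B' D D' : ℝ}
    (hm : AEStronglyMeasurable m) (hm' : AEStronglyMeasurable m') (hB : ∀ ξ, ‖m ξ‖ ≤ B)
    (hB' : ∀ ξ, ‖m' ξ‖ ≤ B') (h : FormBound p m D) (h' : FormBound p m' D') :
    FormBound p (fun ξ => m ξ + m' ξ) (D + D') := by
  intro f g hf hg
  rw [multiplierForm_symbol_add hm hm' hB hB']
  exact (norm_add_le _ _).trans (add_le_add (h f g hf hg) (h' f g hf hg))

/-- The estimate for a complex cutoff, supported where the estimate holds for all nonnegative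
cutoffs. -/
theorem exists_formBound_cutoffResolvent_mul {T : 𝔼 → ℝ} (hT : Continuous T) {χ : 𝔼 → ℂ}
    (hχ : ContDiff ℝ ∞ χ) (hχc : HasCompactSupport χ) {θ : 𝔼 → ℝ} (hθ : ContDiff ℝ ∞ θ)
    (hθc : HasCompactSupport θ) (hθ0 : ∀ ξ, 0 ≤ θ ξ)
    (h : ∀ θ' : 𝔼 → ℝ, ContDiff ℝ ∞ θ' → (∀ ξ, 0 ≤ θ' ξ) → tsupport θ' ⊆ tsupport θ →
      ResolventBounded θ' T) :
    ∃ C, 0 ≤ C ∧ ∀ z : ℂ, z.im ≠ 0 →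
      FormBound (steinTomas d) (cutoffResolvent (fun ξ => χ ξ * (θ ξ : ℂ)) T z) C := by
  obtain ⟨B, hB⟩ := hχc.exists_bound_of_continuous hχ.continuous
  have hB0 : 0 ≤ B := (norm_nonneg _).trans (hB 0)
  -- A real cutoff is the difference of the nonnegative cutoffs `(ρ + B) θ` and `B θ`; the complex
  -- one is then recovered from its real and imaginary parts.
  have key : ∀ ρ : 𝔼 → ℝ, ContDiff ℝ ∞ ρ → (∀ ξ, |ρ ξ| ≤ B) → ∃ C, 0 ≤ C ∧ ∀ z : ℂ, z.im ≠ 0 →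
      FormBound (steinTomas d) (resolventSymbol (fun ξ => ρ ξ * θ ξ) T z) C := by
    intro ρ hρ hρB
    obtain ⟨C1, hC1, h1⟩ := (h (fun ξ => (ρ ξ + B) * θ ξ) ((hρ.add contDiff_const).mul hθ)
      (fun ξ => mul_nonneg (by linarith [(abs_le.1 (hρB ξ)).1]) (hθ0 ξ))
      tsupport_mul_subset_right').exists_formBound
    obtain ⟨C2, hC2, h2⟩ := (h (fun ξ => B * θ ξ) (contDiff_const.mul hθ)
      (fun ξ => mul_nonneg hB0 (hθ0 ξ)) tsupport_mul_subset_right').exists_formBound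
    refine ⟨C1 + C2, by positivity, fun z hz => ?_⟩
    have hc : ∀ ρ : 𝔼 → ℝ, Continuous ρ → Continuous (resolventSymbol (fun ξ => ρ ξ * θ ξ) T z) ∧
        ∃ B, ∀ ξ, ‖resolventSymbol (fun ξ => ρ ξ * θ ξ) T z ξ‖ ≤ B := by
      intro ρ hρ
      have hc1 : Continuous fun ξ => ((ρ ξ * θ ξ : ℝ) : ℂ) :=
        Complex.continuous_ofReal.comp (hρ.mul hθ.continuous)
      have hcs : HasCompactSupport fun ξ => ((ρ ξ * θ ξ : ℝ) : ℂ) :=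
        (hθc.mul_left (f := ρ)).comp_left Complex.ofReal_zero
      exact ⟨continuous_cutoffResolvent hc1 hT fun ξ => ofReal_sub_ne_zero hz _,
        exists_norm_cutoffResolvent_le hc1 hcs hT fun ξ => ofReal_sub_ne_zero hz _⟩
    obtain ⟨c1, B1, hB1⟩ := hc (fun ξ => ρ ξ + B) (hρ.continuous.add continuous_const)
    obtain ⟨c2, B2, hB2⟩ := hc (fun _ => B) continuous_const
    have h3 := FormBound.add c1.aestronglyMeasurable (continuous_const.mul c2).aestronglyMeasurable
      (m' := fun ξ => (-1) * resolventSymbol (fun ξ => B * θ ξ) T z ξ) hB1 (B' := B2)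
      (fun ξ => by simpa using hB2 ξ) (h1 z hz) ((h2 z hz).const_mul (-1))
    rw [norm_neg, norm_one, one_mul] at h3
    convert h3 using 2 with ξ
    simp only [resolventSymbol]
    push_cast; ring
  obtain ⟨C1, hC1, h1⟩ := key (fun ξ => (χ ξ).re) (Complex.reCLM.contDiff.comp hχ)
    (fun ξ => (Complex.abs_re_le_norm _).trans (hB ξ))
  obtain ⟨C2, hC2, h2⟩ := key (fun ξ => (χ ξ).im) (Complex.imCLM.contDiff.comp hχ)
    (fun ξ => (Complex.abs_im_le_norm _).trans (hB ξ))
  refine ⟨C1 + C2, by positivity, fun z hz => ?_⟩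
  have hc : ∀ ρ : 𝔼 → ℝ, Continuous ρ → Continuous (resolventSymbol (fun ξ => ρ ξ * θ ξ) T z) ∧
      ∃ B, ∀ ξ, ‖resolventSymbol (fun ξ => ρ ξ * θ ξ) T z ξ‖ ≤ B := by
    intro ρ hρ
    have hc1 : Continuous fun ξ => ((ρ ξ * θ ξ : ℝ) : ℂ) :=
      Complex.continuous_ofReal.comp (hρ.mul hθ.continuous)
    have hcs : HasCompactSupport fun ξ => ((ρ ξ * θ ξ : ℝ) : ℂ) :=
      (hθc.mul_left (f := ρ)).comp_left Complex.ofReal_zero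
    exact ⟨continuous_cutoffResolvent hc1 hT fun ξ => ofReal_sub_ne_zero hz _,
      exists_norm_cutoffResolvent_le hc1 hcs hT fun ξ => ofReal_sub_ne_zero hz _⟩
  obtain ⟨c1, B1, hB1⟩ := hc (fun ξ => (χ ξ).re) (Complex.continuous_re.comp hχ.continuous)
  obtain ⟨c2, B2, hB2⟩ := hc (fun ξ => (χ ξ).im) (Complex.continuous_im.comp hχ.continuous)
  have h3 := FormBound.add c1.aestronglyMeasurable (continuous_const.mul c2).aestronglyMeasurable
    (m' := fun ξ => Complex.I * resolventSymbol (fun ξ => (χ ξ).im * θ ξ) T z ξ) hB1 (B' := B2)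
    (fun ξ => by simpa using hB2 ξ) (h1 z hz) ((h2 z hz).const_mul Complex.I)
  rw [Complex.norm_I, one_mul] at h3
  convert h3 using 2 with ξ
  simp only [resolventSymbol, cutoffResolvent]
  have h4 : χ ξ = (χ ξ).re + (χ ξ).im * Complex.I := (Complex.re_add_im _).symm
  calc χ ξ * (θ ξ : ℂ) * ((T ξ : ℂ) - z)⁻¹ =
        ((χ ξ).re + (χ ξ).im * Complex.I) * (θ ξ : ℂ) * ((T ξ : ℂ) - z)⁻¹ := by rw [← h4]
    _ = _ := by push_cast; ring

/-- A smooth partition of unity on a compact set, subordinate to balls. -/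
theorem exists_partition_of_unity_balls {s : Set 𝔼} (hs : IsCompact s) (R : 𝔼 → ℝ)
    (hR : ∀ ξ, 0 < R ξ) : ∃ (t : Finset 𝔼) (θ : t → 𝔼 → ℝ), (∀ i, ContDiff ℝ ∞ (θ i)) ∧
      (∀ i ξ, 0 ≤ θ i ξ) ∧ (∀ i, tsupport (θ i) ⊆ Metric.ball i.1 (R i)) ∧
      ∀ ξ ∈ s, ∑ i, θ i ξ = 1 := by
  obtain ⟨t, _, ht⟩ := hs.elim_nhds_subcover (fun ξ => Metric.ball ξ (R ξ))
    (fun ξ _ => Metric.ball_mem_nhds ξ (hR ξ))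
  obtain ⟨f, hf⟩ := SmoothPartitionOfUnity.exists_isSubordinate (modelWithCornersSelf ℝ 𝔼) hs.isClosed
    (fun i : t => Metric.ball i.1 (R i)) (fun i => Metric.isOpen_ball) (by
      intro ξ hξ
      obtain ⟨i, hi, h⟩ := Set.mem_iUnion₂.1 (ht hξ)
      exact Set.mem_iUnion.2 ⟨⟨i, hi⟩, h⟩)
  refine ⟨t, fun i => f i, fun i => (f i).contMDiff.contDiff, fun i ξ => f.nonneg i ξ, hf,
    fun ξ hξ => ?_⟩
  rw [← finsum_eq_sum_of_fintype]
  exact f.sum_eq_one hξ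

/-- The estimate for a cutoff that avoids the energies in question. -/
theorem exists_formBound_of_le_norm_sub {T : 𝔼 → ℝ} {χ : 𝔼 → ℂ} {θ : 𝔼 → ℝ}
    (hθ : ContDiff ℝ ∞ θ) (hθc : HasCompactSupport θ) (hθ0 : ∀ ξ, 0 ≤ θ ξ) {B c : ℝ} (hc : 0 < c)
    (hB : ∀ ξ, ‖χ ξ‖ ≤ B) {p : ℝ} (hp : 1 ≤ p) (hp2 : p ≤ 2) :
    ∃ C, 0 ≤ C ∧ ∀ z : ℂ, (∀ ξ ∈ tsupport θ, c ≤ ‖(T ξ : ℂ) - z‖) →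
      FormBound p (cutoffResolvent (fun ξ => χ ξ * (θ ξ : ℂ)) T z) C := by
  have hB0 : 0 ≤ B := (norm_nonneg _).trans (hB 0)
  obtain ⟨C0, hC0, hbase⟩ := exists_weightForm_le_of_unitBall hθ.continuous hθc hθ0 hp hp2
  obtain ⟨Bθ, hBθ⟩ := hθc.exists_bound_of_continuous hθ.continuous
  refine ⟨B * c⁻¹ * C0, by positivity, fun z hz f g hf hg => ?_⟩
  have h1 := norm_multiplierForm_le (m := cutoffResolvent (fun ξ => χ ξ * (θ ξ : ℂ)) T z)
    (w := fun ξ => B * c⁻¹ * θ ξ) (continuous_const.mul hθ.continuous).aestronglyMeasurable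
    (B := B * c⁻¹ * Bθ) (fun ξ => by
      rw [abs_mul, abs_of_nonneg (by positivity : 0 ≤ B * c⁻¹)]
      exact mul_le_mul_of_nonneg_left (hBθ ξ) (by positivity)) (fun ξ => ?_) f g
  · rw [weightForm_const_mul, weightForm_const_mul] at h1
    refine h1.trans ?_
    have h2 : √(B * c⁻¹ * weightForm θ f) ≤ √(B * c⁻¹ * C0) :=
      Real.sqrt_le_sqrt (mul_le_mul_of_nonneg_left (hbase f hf) (by positivity))
    have h3 : √(B * c⁻¹ * weightForm θ g) ≤ √(B * c⁻¹ * C0) :=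
      Real.sqrt_le_sqrt (mul_le_mul_of_nonneg_left (hbase g hg) (by positivity))
    exact (mul_le_mul h2 h3 (Real.sqrt_nonneg _) (Real.sqrt_nonneg _)).trans
      (Real.mul_self_sqrt (by positivity)).le
  · by_cases hξ : ξ ∈ tsupport θ
    · rw [cutoffResolvent, norm_mul, norm_mul, Complex.norm_real, Real.norm_of_nonneg (hθ0 ξ),
        norm_inv]
      have h2 : ‖(T ξ : ℂ) - z‖⁻¹ ≤ c⁻¹ := inv_anti₀ hc (hz ξ hξ)
      calc ‖χ ξ‖ * θ ξ * ‖(T ξ : ℂ) - z‖⁻¹ ≤ B * θ ξ * c⁻¹ := by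
            have := hθ0 ξ
            gcongr
            exact hB ξ
        _ = _ := by ring
    · simp [cutoffResolvent, image_eq_zero_of_notMem_tsupport hξ]

/-- The spectral parameters in the estimate: those in `K`, and those on vertical lines through
real points of `K`. -/
def Admissible (K : Set ℂ) (z : ℂ) : Prop := z ∈ K ∨ (z.re : ℂ) ∈ K

/-- Closedness of `K` separates `T ξ` from `K` near `ξ₀`. On a vertical line through a real point of
`K`, taking real parts of `T ξ - z` can only decrease its modulus. -/
theorem exists_ball_le_norm_sub {T : 𝔼 → ℝ} (hT : Continuous T) {K : Set ℂ} (hK : IsCompact K)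
    {ξ₀ : 𝔼} (h : (T ξ₀ : ℂ) ∉ K) : ∃ R > 0, ∃ c > 0, ∀ ξ ∈ Metric.ball ξ₀ R, ∀ z, Admissible K z →
      c ≤ ‖(T ξ : ℂ) - z‖ := by
  obtain ⟨c, hc, hcK⟩ := Metric.isOpen_iff.1 hK.isClosed.isOpen_compl _ h
  have hTc : Continuous fun ξ => (T ξ : ℂ) := by fun_prop
  obtain ⟨R, hR, hRc⟩ := Metric.continuousAt_iff.1 (hTc.continuousAt (x := ξ₀)) (c / 2)
    (by positivity)
  refine ⟨R, hR, c / 2, by positivity, fun ξ hξ z hz => ?_⟩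
  have h1 : ∀ z ∈ K, c / 2 ≤ ‖(T ξ : ℂ) - z‖ := by
    intro z hz
    have h2 : c ≤ dist z (T ξ₀ : ℂ) := by
      by_contra h3
      exact hcK (Metric.mem_ball.2 (not_le.1 h3)) hz
    have h3 := hRc (Metric.mem_ball.1 hξ)
    rw [← dist_eq_norm, dist_comm]
    linarith [dist_triangle z (T ξ : ℂ) (T ξ₀ : ℂ)]
  rcases hz with hz | hz
  · exact h1 z hz
  · refine (h1 _ hz).trans ?_
    have h2 := Complex.abs_re_le_norm ((T ξ : ℂ) - z)
    rw [← Complex.ofReal_sub, Complex.norm_real, Real.norm_eq_abs]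
    simpa using h2

/-- If `T ξ₀ ∈ K`, the point is regular with nonvanishing curvature and the local estimate is
uniform in all nonreal `z`. If not, the symbol is bounded for every admissible `z`. -/
theorem exists_formBound_cutoffResolvent_ball {T : 𝔼 → ℝ} (hT : ContDiff ℝ 2 T) {K : Set ℂ}
    (hK : IsCompact K) (hKc : ∀ t ∈ criticalValues T, (t : ℂ) ∉ K)
    (hcurv : ∀ t : ℝ, (t : ℂ) ∈ K → ∀ ξ, T ξ = t → gaussianCurvature T ξ ≠ 0) {χ : 𝔼 → ℂ}
    (hχ : ContDiff ℝ ∞ χ) (hχc : HasCompactSupport χ) (hpe : 1 ≤ steinTomas d) (ξ₀ : 𝔼) :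
    ∃ R > 0, ∀ θ : 𝔼 → ℝ, ContDiff ℝ ∞ θ → (∀ ξ, 0 ≤ θ ξ) →
      tsupport θ ⊆ Metric.ball ξ₀ R → ∃ C, 0 ≤ C ∧ ∀ z : ℂ, z.im ≠ 0 → Admissible K z →
        FormBound (steinTomas d) (cutoffResolvent (fun ξ => χ ξ * (θ ξ : ℂ)) T z) C := by
  obtain ⟨B, hB⟩ := hχc.exists_bound_of_continuous hχ.continuous
  have hcs : ∀ {θ : 𝔼 → ℝ} {R : ℝ}, tsupport θ ⊆ Metric.ball ξ₀ R → HasCompactSupport θ :=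
    fun {θ R} h => (isCompact_closedBall ξ₀ R).of_isClosed_subset (isClosed_tsupport θ)
      (h.trans Metric.ball_subset_closedBall)
  by_cases h : (T ξ₀ : ℂ) ∈ K
  · have h1 : fderiv ℝ T ξ₀ ≠ 0 := fun h0 => hKc _ ⟨ξ₀, rfl, h0⟩ h
    obtain ⟨R, hR, hRes⟩ := exists_resolventBounded hT h1 (hcurv _ h _ rfl)
    refine ⟨R, hR, fun θ hθ hθ0 hθR => ?_⟩
    obtain ⟨C, hC, hb⟩ := exists_formBound_cutoffResolvent_mul hT.continuous hχ hχc hθ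
      (hcs hθR) hθ0 (fun θ' h1 h2 h3 => hRes θ' h1 h2 (h3.trans hθR))
    exact ⟨C, hC, fun z hz _ => hb z hz⟩
  · obtain ⟨R, hR, c, hc, hRc⟩ := exists_ball_le_norm_sub hT.continuous hK h
    refine ⟨R, hR, fun θ hθ hθ0 hθR => ?_⟩
    obtain ⟨C, hC, hb⟩ := exists_formBound_of_le_norm_sub (T := T) hθ (hcs hθR) hθ0 hc hB hpe
      steinTomas_le_two
    exact ⟨C, hC, fun z _ hz => hb z fun ξ hξ => hRc ξ (hθR hξ) z hz⟩

theorem exists_smooth_cutoff {s : Set 𝔼} (hs : IsCompact s) :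
    ∃ k : 𝔼 → ℝ, (∀ ξ ∈ s, k ξ = 1) ∧ ContDiff ℝ ∞ k ∧ HasCompactSupport k := by
  obtain ⟨r, hr⟩ := hs.isBounded.subset_closedBall 0
  let b : ContDiffBump (0 : 𝔼) := ⟨max r 1, max r 1 + 1, by positivity, by linarith⟩
  refine ⟨b, fun ξ hξ => b.one_of_mem_closedBall ?_, b.contDiff, b.hasCompactSupport⟩
  exact Metric.closedBall_subset_closedBall (le_max_left _ _) (hr hξ)

theorem formBound_cutoffResolvent_of_partition {T : 𝔼 → ℝ} (hT : Continuous T) {χ : 𝔼 → ℂ}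
    (hχ : Continuous χ) (hχc : HasCompactSupport χ) {ι : Type*} [Fintype ι] {θ : ι → 𝔼 → ℝ}
    (hθ : ∀ i, Continuous (θ i)) (hθ1 : ∀ ξ ∈ tsupport χ, ∑ i, θ i ξ = 1) {z : ℂ} (hz : z.im ≠ 0)
    {p : ℝ} {C : ι → ℝ}
    (h : ∀ i, FormBound p (cutoffResolvent (fun ξ => χ ξ * (θ i ξ : ℂ)) T z) (C i)) :
    FormBound p (cutoffResolvent χ T z) (∑ i, C i) := by
  have hTz : ∀ ξ, (T ξ : ℂ) - z ≠ 0 := fun ξ => ofReal_sub_ne_zero hz _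
  have hci : ∀ i, Continuous fun ξ => χ ξ * (θ i ξ : ℂ) := fun i =>
    hχ.mul (Complex.continuous_ofReal.comp (hθ i))
  choose Bi hBi using fun i => exists_norm_cutoffResolvent_le (hci i) hχc.mul_right hT hTz
  have h1 := FormBound.sum Finset.univ
    (fun i => (continuous_cutoffResolvent (hci i) hT hTz).aestronglyMeasurable) hBi h
  have h2 : cutoffResolvent χ T z =
      fun ξ => ∑ i, cutoffResolvent (fun ξ => χ ξ * (θ i ξ : ℂ)) T z ξ := by
    ext ξ
    simp only [cutoffResolvent]
    rw [← Finset.sum_mul, ← Finset.mul_sum, ← Complex.ofReal_sum]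
    by_cases hξ : ξ ∈ tsupport χ
    · rw [hθ1 ξ hξ, Complex.ofReal_one, mul_one]
    · rw [image_eq_zero_of_notMem_tsupport hξ, zero_mul, zero_mul, zero_mul]
  rw [h2]
  exact h1

/-- The uniform bilinear resolvent estimate. -/
theorem exists_formBound_cutoffResolvent {T : 𝔼 → ℝ} (hT : ContDiff ℝ 2 T) {K : Set ℂ}
    (hK : IsCompact K) (hKc : ∀ t ∈ criticalValues T, (t : ℂ) ∉ K)
    (hcurv : ∀ t : ℝ, (t : ℂ) ∈ K → ∀ ξ, T ξ = t → gaussianCurvature T ξ ≠ 0) {χ : 𝔼 → ℂ}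
    (hχ : ContDiff ℝ ∞ χ) (hχc : HasCompactSupport χ) {p : ℝ} (hp : 1 ≤ p)
    (hp2 : p ≤ steinTomas d) :
    ∃ C, 0 ≤ C ∧ ∀ z : ℂ, z.im ≠ 0 → Admissible K z → FormBound p (cutoffResolvent χ T z) C := by
  choose R hR hRes using
    exists_formBound_cutoffResolvent_ball hT hK hKc hcurv hχ hχc (hp.trans hp2)
  obtain ⟨t, θ, hθ, hθ0, hθR, hθ1⟩ := exists_partition_of_unity_balls hχc.isCompact R hR
  have hex : ∀ i : t, ∃ C, 0 ≤ C ∧ ∀ z : ℂ, z.im ≠ 0 → Admissible K z →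
      FormBound (steinTomas d) (cutoffResolvent (fun ξ => χ ξ * (θ i ξ : ℂ)) T z) C :=
    fun i => hRes i.1 (θ i) (hθ i) (hθ0 i) (hθR i)
  clear hRes
  choose C hCb using hex
  obtain ⟨k, hk1, hk, hkc⟩ := exists_smooth_cutoff hχc.isCompact
  obtain ⟨A, hA, hAb⟩ := exists_formBound_of_le (k := fun ξ => (k ξ : ℂ))
    (Complex.ofRealCLM.contDiff.comp hk) (hkc.comp_left Complex.ofReal_zero)
  refine ⟨A * ∑ i, C i, mul_nonneg hA (Finset.sum_nonneg fun i _ => (hCb i).1), fun z hz hzK => ?_⟩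
  have hTz : ∀ ξ, (T ξ : ℂ) - z ≠ 0 := fun ξ => ofReal_sub_ne_zero hz _
  obtain ⟨Bm, hBm⟩ := exists_norm_cutoffResolvent_le hχ.continuous hχc hT.continuous hTz
  refine hAb p _ hp hp2 _ Bm _
    (continuous_cutoffResolvent hχ.continuous hT.continuous hTz).aestronglyMeasurable hBm
    (fun ξ hξ => ?_) (formBound_cutoffResolvent_of_partition hT.continuous hχ.continuous hχc
      (fun i => (hθ i).continuous) hθ1 hz fun i => (hCb i).2 z hz hzK)
  have h1 : ξ ∈ tsupport χ := by
    by_contra h2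
    exact hξ (by simp [cutoffResolvent, image_eq_zero_of_notMem_tsupport h2])
  rw [hk1 ξ h1, Complex.ofReal_one]

end GlobalEstimate

/-! ### Limiting absorption for smooth integrands. -/

section BoundaryIntegral

variable {d : ℕ}

local notation "𝔼" => EuclideanSpace ℝ (Fin d)

/-- A function on `(0, ∞)` whose derivative is `O(ε^{-1/2})` has a limit at `0`. -/
theorem exists_tendsto_of_norm_deriv_le {F F' : ℝ → ℂ} {C : ℝ}
    (h : ∀ ε, 0 < ε → HasDerivAt F (F' ε) ε) (hb : ∀ ε, 0 < ε → ‖F' ε‖ ≤ C / √ε) :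
    ∃ L, Tendsto F (𝓝[>] 0) (𝓝 L) := by
  -- The substitution `ε = s²` makes the derivative bounded, so the function is Lipschitz in `s` and
  -- Cauchy at `0`.
  have hG : ∀ s ∈ Set.Ioi (0 : ℝ),
      HasDerivWithinAt (fun s => F (s ^ 2)) ((2 * s : ℝ) • F' (s ^ 2)) (Set.Ioi 0) s := by
    intro s hs
    have hsq : HasDerivAt (fun s : ℝ => s ^ 2) (2 * s) s := by simpa using hasDerivAt_pow 2 s
    exact (HasDerivAt.scomp (h := fun s : ℝ => s ^ 2) s (h (s ^ 2) (pow_pos hs 2))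
      hsq).hasDerivWithinAt
  have hbd : ∀ s ∈ Set.Ioi (0 : ℝ), ‖(2 * s : ℝ) • F' (s ^ 2)‖ ≤ (2 * |C|).toNNReal := by
    intro s hs
    have hs : 0 < s := hs
    have h1 := hb (s ^ 2) (by positivity)
    rw [Real.sqrt_sq hs.le] at h1
    rw [norm_smul, Real.norm_of_nonneg (by positivity), Real.coe_toNNReal _ (by positivity)]
    calc 2 * s * ‖F' (s ^ 2)‖ ≤ 2 * s * (C / s) := by gcongr
      _ = 2 * C := by field_simp
      _ ≤ 2 * |C| := by linarith [le_abs_self C]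
  have hL := (convex_Ioi (0 : ℝ)).lipschitzOnWith_of_nnnorm_hasDerivWithin_le hG hbd
  have hc : Cauchy (map (fun s : ℝ => F (s ^ 2)) (𝓝[>] 0)) :=
    (cauchy_nhds.mono inf_le_left : Cauchy (𝓝[>] (0 : ℝ))).map_of_le hL.uniformContinuousOn
      inf_le_right
  obtain ⟨L, hL⟩ := cauchy_map_iff_exists_tendsto.1 hc
  refine ⟨L, ?_⟩
  have h1 : Tendsto Real.sqrt (𝓝[>] 0) (𝓝[>] 0) := by
    refine tendsto_nhdsWithin_iff.2 ⟨?_, ?_⟩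
    · simpa using (Real.continuous_sqrt.tendsto 0).mono_left nhdsWithin_le_nhds
    · filter_upwards [self_mem_nhdsWithin] with ε hε using Real.sqrt_pos.2 hε
  refine (hL.comp h1).congr' ?_
  filter_upwards [self_mem_nhdsWithin] with ε hε
  simp only [Function.comp_apply, Real.sq_sqrt (le_of_lt hε)]

/-- The Schwartz function with a given smooth compactly supported Fourier transform. -/
noncomputable def bandlimited {k : 𝔼 → ℂ} (hk : ContDiff ℝ ∞ k) (hkc : HasCompactSupport k) :
    𝓢(𝔼, ℂ) := 𝓕⁻ (hkc.toSchwartzMap hk)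

theorem fourier_bandlimited {k : 𝔼 → ℂ} (hk : ContDiff ℝ ∞ k) (hkc : HasCompactSupport k) :
    (𝓕 ((bandlimited hk hkc).toLp 2 : LTwo d) : LTwo d) =ᵐ[volume] k := by
  rw [SchwartzMap.toLp_fourier_eq, bandlimited, FourierTransform.fourier_fourierInv_eq]
  exact SchwartzMap.coeFn_toLp _ _ _

theorem integrable_norm_rpow_schwartz (φ : 𝓢(𝔼, ℂ)) {p : ℝ} (hp : 0 < p) :
    Integrable fun x => ‖φ x‖ ^ p := by
  have h := φ.memLp (ENNReal.ofReal p) (volume : Measure 𝔼)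
  have h1 := h.integrable_norm_rpow (by simpa using hp) ENNReal.ofReal_ne_top
  rwa [ENNReal.toReal_ofReal hp.le] at h1

theorem steinTomas_pos : 0 < steinTomas d := by unfold steinTomas; positivity

/-- The resolvent bound is tested on one fixed Schwartz function whose Fourier transform is `1` on
the support of `θ`. -/
theorem ResolventBounded.exists_integral_poissonWeight_le {θ T : 𝔼 → ℝ} (hT : Continuous T)
    (hθ : Continuous θ) (hθc : HasCompactSupport θ) (h : ResolventBounded θ T) :
    ∃ C, 0 ≤ C ∧ ∀ l ε : ℝ, 0 < ε → ∫ ξ, poissonWeight θ T l ε ξ ≤ C := by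
  obtain ⟨C, hC, hb⟩ := h
  obtain ⟨k, hk1, hk, hkc⟩ := exists_smooth_cutoff hθc.isCompact
  have hk' : ContDiff ℝ ∞ fun ξ => (k ξ : ℂ) := Complex.ofRealCLM.contDiff.comp hk
  have hkc' : HasCompactSupport fun ξ => (k ξ : ℂ) := hkc.comp_left Complex.ofReal_zero
  set f : LTwo d := (bandlimited hk' hkc').toLp 2 with hf
  have hfi : Integrable fun x => ‖f x‖ ^ steinTomas d := by
    refine (integrable_norm_rpow_schwartz (bandlimited hk' hkc') (steinTomas_pos (d := d))).congr ?_
    filter_upwards [SchwartzMap.coeFn_toLp (bandlimited hk' hkc') 2 (volume : Measure 𝔼)] with x hx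
    rw [hf, hx]
  set N := (∫ x, ‖f x‖ ^ steinTomas d) ^ (steinTomas d)⁻¹
  have hN : 0 ≤ N := Real.rpow_nonneg (integral_nonneg fun _ => by positivity) _
  refine ⟨C * (N * N), by positivity, fun l ε hε => ?_⟩
  have h1 := norm_multiplierForm_le_of_unit_ball steinTomas_pos
    (fun f g hf hg hf1 hg1 => hb l ε hε f g ⟨hf, hf1⟩ ⟨hg, hg1⟩) hfi hfi
  refine le_trans (le_of_eq ?_) ((weightForm_poissonWeight_le hθ hθc hT l hε f).trans h1)
  rw [weightForm]
  refine integral_congr_ae ?_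
  filter_upwards [fourier_bandlimited hk' hkc'] with ξ hξ
  rw [hf, hξ]
  by_cases h2 : ξ ∈ tsupport θ
  · rw [hk1 ξ h2]; simp
  · simp [poissonWeight, image_eq_zero_of_notMem_tsupport h2]

theorem norm_sub_sq_eq (s t ε : ℝ) {σ : ℝ} (hσ : σ = 1 ∨ σ = -1) :
    ‖(s : ℂ) - (t + σ * ε * Complex.I)‖ ^ 2 = (s - t) ^ 2 + ε ^ 2 := by
  rw [← Complex.normSq_eq_norm_sq, Complex.normSq_apply]
  rcases hσ with rfl | rfl <;> simp <;> ring

theorem im_add_mul_I_ne_zero (t : ℝ) {ε : ℝ} (hε : ε ≠ 0) {σ : ℝ} (hσ : σ = 1 ∨ σ = -1) :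
    ((t : ℂ) + σ * ε * Complex.I).im ≠ 0 := by
  rcases hσ with rfl | rfl <;> simpa using hε

theorem le_norm_sub (s t : ℝ) {ε : ℝ} (hε : 0 ≤ ε) {σ : ℝ} (hσ : σ = 1 ∨ σ = -1) :
    ε ≤ ‖(s : ℂ) - (t + σ * ε * Complex.I)‖ := by
  have h := norm_sub_sq_eq s t ε hσ
  nlinarith [norm_nonneg ((s : ℂ) - (t + σ * ε * Complex.I)), sq_nonneg (s - t)]

theorem hasDerivAt_integral_mul_inv {T : 𝔼 → ℝ} (hT : Continuous T) {H : 𝔼 → ℂ}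
    (hH : Continuous H) (hHc : HasCompactSupport H) (t : ℝ) {σ : ℝ} (hσ : σ = 1 ∨ σ = -1) {ε : ℝ}
    (hε : 0 < ε) :
    HasDerivAt (fun ε : ℝ => ∫ ξ, H ξ * ((T ξ : ℂ) - (t + σ * ε * Complex.I))⁻¹)
      (∫ ξ, H ξ * (σ * Complex.I * (((T ξ : ℂ) - (t + σ * ε * Complex.I))⁻¹) ^ 2)) ε := by
  have hne : ∀ {e : ℝ}, 0 < e → ∀ ξ, (T ξ : ℂ) - (t + σ * e * Complex.I) ≠ 0 := fun he ξ =>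
    ofReal_sub_ne_zero (im_add_mul_I_ne_zero t he.ne' hσ) _
  have hc : ∀ {e : ℝ}, 0 < e → Continuous fun ξ => ((T ξ : ℂ) - (t + σ * e * Complex.I))⁻¹ :=
    fun he => Continuous.inv₀ (by fun_prop) (hne he)
  have hσ1 : ‖(σ : ℂ)‖ = 1 := by rcases hσ with rfl | rfl <;> simp
  have hball : ∀ e ∈ Metric.ball ε (ε / 2), ε / 2 < e := fun e he => by
    have := abs_lt.1 (Real.dist_eq e ε ▸ Metric.mem_ball.1 he)
    linarith [this.1]
  refine (hasDerivAt_integral_of_dominated_loc_of_deriv_le (𝕜 := ℝ) (μ := volume) (x₀ := ε)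
    (s := Metric.ball ε (ε / 2))
    (F := fun e ξ => H ξ * ((T ξ : ℂ) - (t + σ * e * Complex.I))⁻¹)
    (F' := fun e ξ => H ξ * (σ * Complex.I * (((T ξ : ℂ) - (t + σ * e * Complex.I))⁻¹) ^ 2))
    (bound := fun ξ => ‖H ξ‖ * ((ε / 2)⁻¹) ^ 2)
    (Metric.ball_mem_nhds ε (half_pos hε)) ?_ ?_ ?_ ?_ ?_ ?_).2
  · filter_upwards [lt_mem_nhds hε] with e he
    exact (hH.mul (hc he)).aestronglyMeasurable
  · exact (hH.mul (hc hε)).integrable_of_hasCompactSupport hHc.mul_right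
  · exact (hH.mul (continuous_const.mul ((hc hε).pow 2))).aestronglyMeasurable
  · refine Eventually.of_forall fun ξ e he => ?_
    have h1 := hball e he
    rw [norm_mul, norm_mul, norm_mul, hσ1, Complex.norm_I, norm_pow, norm_inv, one_mul, one_mul]
    gcongr
    exact h1.le.trans (le_norm_sub _ _ (by linarith) hσ)
  · exact (hH.norm.mul continuous_const).integrable_of_hasCompactSupport hHc.norm.mul_right
  · refine Eventually.of_forall fun ξ e he => ?_
    have he0 : 0 < e := by linarith [hball e he]
    have h1 : HasDerivAt (fun e : ℝ => (T ξ : ℂ) - (t + σ * e * Complex.I)) (-(σ * Complex.I)) e := by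
      have h2 : HasDerivAt (fun e : ℝ => (e : ℂ)) 1 e := Complex.ofRealCLM.hasDerivAt
      simpa using (((h2.const_mul (σ : ℂ)).mul_const Complex.I).const_add (t : ℂ)).const_sub (T ξ : ℂ)
    have h3 := (h1.fun_inv (hne he0 ξ)).const_mul (H ξ)
    refine h3.congr_deriv ?_
    rw [neg_neg, div_eq_mul_inv, inv_pow]

/-- Integration by parts in a direction transversal to the level sets. -/
theorem integral_mul_inv_sq_eq {T : 𝔼 → ℝ} (hT : ContDiff ℝ 2 T) {H G : 𝔼 → ℂ} (hG : ContDiff ℝ 1 G)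
    (hGc : HasCompactSupport G) (e : 𝔼) (hHG : ∀ ξ, H ξ = G ξ * (fderiv ℝ T ξ e : ℂ)) {z : ℂ}
    (hz : z.im ≠ 0) :
    ∫ ξ, H ξ * (((T ξ : ℂ) - z)⁻¹) ^ 2 = ∫ ξ, fderiv ℝ G ξ e * ((T ξ : ℂ) - z)⁻¹ := by
  have hne : ∀ ξ, (T ξ : ℂ) - z ≠ 0 := fun ξ => ofReal_sub_ne_zero hz _
  have hTd : ∀ ξ, HasFDerivAt (fun ξ => (T ξ : ℂ)) (Complex.ofRealCLM ∘L fderiv ℝ T ξ) ξ := fun ξ =>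
    Complex.ofRealCLM.hasFDerivAt.comp ξ ((hT.differentiable (by norm_num)) ξ).hasFDerivAt
  have hw : ∀ ξ, HasFDerivAt (fun ξ => ((T ξ : ℂ) - z)⁻¹)
      (-(((T ξ : ℂ) - z) ^ 2)⁻¹ • (Complex.ofRealCLM ∘L fderiv ℝ T ξ)) ξ := fun ξ =>
    (hasDerivAt_inv (hne ξ)).comp_hasFDerivAt ξ ((hTd ξ).sub_const z)
  have hwe : ∀ ξ, fderiv ℝ (fun ξ => ((T ξ : ℂ) - z)⁻¹) ξ e =
      -((((T ξ : ℂ) - z)⁻¹) ^ 2 * (fderiv ℝ T ξ e : ℂ)) := fun ξ => by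
    rw [(hw ξ).fderiv]
    simp
  have hwc : Continuous fun ξ => ((T ξ : ℂ) - z)⁻¹ :=
    Continuous.inv₀ (by have := hT.continuous; fun_prop) hne
  have hTe : Continuous fun ξ => (fderiv ℝ T ξ e : ℂ) :=
    Complex.continuous_ofReal.comp ((hT.continuous_fderiv (by norm_num)).clm_apply continuous_const)
  have hGe : Continuous fun ξ => fderiv ℝ G ξ e :=
    (hG.continuous_fderiv (by norm_num)).clm_apply continuous_const
  have hGec : HasCompactSupport fun ξ => fderiv ℝ G ξ e := hGc.fderiv_apply (𝕜 := ℝ) e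
  have key := integral_mul_fderiv_eq_neg_fderiv_mul_of_integrable (μ := (volume : Measure 𝔼))
    (f := G) (g := fun ξ => ((T ξ : ℂ) - z)⁻¹) (v := e)
    ((hGe.mul hwc).integrable_of_hasCompactSupport hGec.mul_right)
    (by
      simp only [hwe]
      exact (hG.continuous.mul ((hwc.pow 2).mul hTe).neg).integrable_of_hasCompactSupport
        hGc.mul_right)
    ((hG.continuous.mul hwc).integrable_of_hasCompactSupport hGc.mul_right)
    (fun ξ _ => hG.differentiable (by norm_num) ξ) (fun ξ _ => (hw ξ).differentiableAt)
  rw [← neg_eq_iff_eq_neg, ← integral_neg] at key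
  rw [← key]
  refine integral_congr_ae (Eventually.of_forall fun ξ => ?_)
  simp only [hwe, hHG]
  ring

/-- Pointwise `√ε / |T - z| ≤ 1 + ε / |T - z|²`, and the last term is the Poisson kernel. -/
theorem integral_mul_norm_inv_le {θ T : 𝔼 → ℝ} (hT : Continuous T) (hθ : Continuous θ)
    (hθc : HasCompactSupport θ) (hθ0 : ∀ ξ, 0 ≤ θ ξ) (t : ℝ) {σ : ℝ} (hσ : σ = 1 ∨ σ = -1) {ε : ℝ}
    (hε : 0 < ε) :
    ∫ ξ, θ ξ * ‖((T ξ : ℂ) - (t + σ * ε * Complex.I))⁻¹‖ ≤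
      ((∫ ξ, θ ξ) + ∫ ξ, poissonWeight θ T t ε ξ) / √ε := by
  have hs : 0 < √ε := Real.sqrt_pos.2 hε
  have hθi := hθ.integrable_of_hasCompactSupport (μ := (volume : Measure 𝔼)) hθc
  have hP : Integrable fun ξ => poissonWeight θ T t ε ξ :=
    (continuous_poissonWeight hθ hT t hε).integrable_of_hasCompactSupport hθc.mul_right
  rw [← integral_add hθi hP, ← integral_div]
  refine integral_mono_of_nonneg (Eventually.of_forall fun ξ => by have := hθ0 ξ; positivity)
    ((hθi.add hP).div_const _) (Eventually.of_forall fun ξ => ?_)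
  have h1 := norm_sub_sq_eq (T ξ) t ε hσ
  have h2 := hε.trans_le (le_norm_sub (T ξ) t hε.le hσ)
  simp only [norm_inv, poissonWeight]
  rw [← h1]
  set x := ‖(T ξ : ℂ) - (t + σ * ε * Complex.I)‖
  rw [show θ ξ + θ ξ * (ε / x ^ 2) = θ ξ * (1 + ε / x ^ 2) by ring, mul_div_assoc]
  refine mul_le_mul_of_nonneg_left ?_ (hθ0 ξ)
  rw [le_div_iff₀ hs]
  have h3 : ε / x ^ 2 = (x⁻¹ * √ε) ^ 2 := by rw [mul_pow, Real.sq_sqrt hε.le]; ring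
  rw [h3]
  nlinarith [sq_nonneg (x⁻¹ * √ε - 1), sq_nonneg (x⁻¹ * √ε)]

/-- Boundary values of the resolvent integral near a regular point. -/
theorem exists_tendsto_integral_of_resolventBounded {θ T : 𝔼 → ℝ} (hT : ContDiff ℝ 2 T)
    (hθ : Continuous θ) (hθc : HasCompactSupport θ) (hθ0 : ∀ ξ, 0 ≤ θ ξ)
    (hR : ResolventBounded θ T) {H : 𝔼 → ℂ} (hH : ContDiff ℝ 1 H) (hHc : HasCompactSupport H)
    (hHθ : ∀ ξ ∈ tsupport H, θ ξ = 1) {e : 𝔼} (he : ∀ ξ ∈ tsupport H, fderiv ℝ T ξ e ≠ 0) (t : ℝ)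
    {σ : ℝ} (hσ : σ = 1 ∨ σ = -1) :
    ∃ L, Tendsto (fun ε : ℝ => ∫ ξ, H ξ * ((T ξ : ℂ) - (t + σ * ε * Complex.I))⁻¹)
      (𝓝[>] 0) (𝓝 L) := by
  obtain ⟨C, hC, hb⟩ := hR.exists_integral_poissonWeight_le hT.continuous hθ hθc
  -- Dividing by the transversal derivative keeps `G` of class `C¹`, which is all that `T ∈ C²`
  -- allows and all that one integration by parts needs. It lowers `(T - z)⁻²` to `(T - z)⁻¹`, whose
  -- integral is `O(ε^(-1/2))`.
  set G : 𝔼 → ℂ := fun ξ => H ξ * (fderiv ℝ T ξ e : ℂ)⁻¹ with hGdef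
  have hTe : ContDiff ℝ 1 fun ξ => (fderiv ℝ T ξ e : ℂ) :=
    Complex.ofRealCLM.contDiff.comp ((hT.fderiv_right (m := 1) (by norm_num)).clm_apply contDiff_const)
  have hG : ContDiff ℝ 1 G := by
    refine contDiff_iff_contDiffAt.2 fun ξ => ?_
    by_cases hξ : ξ ∈ tsupport H
    · exact hH.contDiffAt.mul (hTe.contDiffAt.inv (by exact_mod_cast he ξ hξ))
    · refine (contDiffAt_const (c := (0 : ℂ))).congr_of_eventuallyEq ?_
      filter_upwards [notMem_tsupport_iff_eventuallyEq.1 hξ] with η hη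
      simp [hGdef, hη]
  have hGc : HasCompactSupport G := hHc.mul_right
  have hHG : ∀ ξ, H ξ = G ξ * (fderiv ℝ T ξ e : ℂ) := by
    intro ξ
    by_cases hξ : ξ ∈ tsupport H
    · have : (fderiv ℝ T ξ e : ℂ) ≠ 0 := by exact_mod_cast he ξ hξ
      simp only [hGdef]; field_simp
    · simp [hGdef, image_eq_zero_of_notMem_tsupport hξ]
  have hGe : Continuous fun ξ => fderiv ℝ G ξ e :=
    (hG.continuous_fderiv (by norm_num)).clm_apply continuous_const
  obtain ⟨M, hM⟩ := (hGc.fderiv_apply (𝕜 := ℝ) e).exists_bound_of_continuous hGe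
  have hM0 : 0 ≤ M := (norm_nonneg _).trans (hM 0)
  have hMθ : ∀ ξ, ‖fderiv ℝ G ξ e‖ ≤ M * θ ξ := by
    intro ξ
    by_cases hξ : ξ ∈ tsupport H
    · rw [hHθ ξ hξ, mul_one]; exact hM ξ
    · have h1 : G =ᶠ[𝓝 ξ] fun _ => (0 : ℂ) := by
        filter_upwards [notMem_tsupport_iff_eventuallyEq.1 hξ] with η hη
        simp [hGdef, hη]
      rw [h1.fderiv_eq]
      simpa using mul_nonneg hM0 (hθ0 ξ)
  refine exists_tendsto_of_norm_deriv_le (C := M * ((∫ ξ, θ ξ) + C))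
    (fun ε hε => hasDerivAt_integral_mul_inv hT.continuous hH.continuous hHc t hσ hε)
    fun ε hε => ?_
  have hz := im_add_mul_I_ne_zero t hε.ne' hσ
  set z : ℂ := t + σ * ε * Complex.I with hzdef
  have h1 : ∀ ξ, H ξ * (σ * Complex.I * (((T ξ : ℂ) - z)⁻¹) ^ 2) =
      (σ * Complex.I) * (H ξ * (((T ξ : ℂ) - z)⁻¹) ^ 2) := fun ξ => by ring
  have hσ1 : ‖(σ : ℂ) * Complex.I‖ = 1 := by rcases hσ with rfl | rfl <;> simp
  simp only [h1]
  rw [integral_const_mul, norm_mul, hσ1, one_mul, integral_mul_inv_sq_eq hT hG hGc e hHG hz]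
  have hwc : Continuous fun ξ => ((T ξ : ℂ) - z)⁻¹ :=
    Continuous.inv₀ (by have := hT.continuous; fun_prop) fun ξ => ofReal_sub_ne_zero hz _
  have hi : Integrable fun ξ => θ ξ * ‖((T ξ : ℂ) - z)⁻¹‖ :=
    (hθ.mul hwc.norm).integrable_of_hasCompactSupport hθc.mul_right
  calc ‖∫ ξ, fderiv ℝ G ξ e * ((T ξ : ℂ) - z)⁻¹‖ ≤ ∫ ξ, M * (θ ξ * ‖((T ξ : ℂ) - z)⁻¹‖) := by
        refine norm_integral_le_of_norm_le (hi.const_mul M) (Eventually.of_forall fun ξ => ?_)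
        rw [norm_mul, ← mul_assoc]
        exact mul_le_mul_of_nonneg_right (hMθ ξ) (norm_nonneg _)
    _ = M * ∫ ξ, θ ξ * ‖((T ξ : ℂ) - z)⁻¹‖ := integral_const_mul _ _
    _ ≤ M * (((∫ ξ, θ ξ) + C) / √ε) := by
        refine mul_le_mul_of_nonneg_left
          ((integral_mul_norm_inv_le hT.continuous hθ hθc hθ0 t hσ hε).trans ?_) hM0
        gcongr
        exact hb t ε hε
    _ = _ := by ring

end BoundaryIntegral

section BoundaryIntegral

variable {d : ℕ}

local notation "𝔼" => EuclideanSpace ℝ (Fin d)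

theorem tendsto_integral_mul_inv_of_le {T : 𝔼 → ℝ} (hT : Continuous T) {H : 𝔼 → ℂ}
    (hH : Continuous H) (hHc : HasCompactSupport H) {t σ c : ℝ} (hσ : σ = 1 ∨ σ = -1) (hc : 0 < c)
    (h : ∀ ξ ∈ tsupport H, ∀ ε : ℝ, c ≤ ‖(T ξ : ℂ) - (t + σ * ε * Complex.I)‖) :
    Tendsto (fun ε : ℝ => ∫ ξ, H ξ * ((T ξ : ℂ) - (t + σ * ε * Complex.I))⁻¹)
      (𝓝[>] 0) (𝓝 (∫ ξ, H ξ * ((T ξ : ℂ) - t)⁻¹)) := by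
  refine tendsto_integral_filter_of_dominated_convergence (fun ξ => ‖H ξ‖ * c⁻¹) ?_ ?_ ?_ ?_
  · filter_upwards [self_mem_nhdsWithin] with ε hε
    exact (hH.mul (Continuous.inv₀ (by fun_prop) fun ξ =>
      ofReal_sub_ne_zero (im_add_mul_I_ne_zero t (ne_of_gt hε) hσ) _)).aestronglyMeasurable
  · refine Eventually.of_forall fun ε => Eventually.of_forall fun ξ => ?_
    by_cases hξ : ξ ∈ tsupport H
    · rw [norm_mul, norm_inv]
      gcongr
      exact h ξ hξ ε
    · simp [image_eq_zero_of_notMem_tsupport hξ]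
  · exact (hH.norm.mul continuous_const).integrable_of_hasCompactSupport hHc.norm.mul_right
  · refine Eventually.of_forall fun ξ => ?_
    by_cases hξ : ξ ∈ tsupport H
    · have h0 := h ξ hξ 0
      have hne : (T ξ : ℂ) - (t + σ * ((0 : ℝ) : ℂ) * Complex.I) ≠ 0 :=
        norm_pos_iff.1 (hc.trans_le h0)
      have h1 : ContinuousAt
          (fun ε : ℝ => H ξ * ((T ξ : ℂ) - (t + σ * ε * Complex.I))⁻¹) 0 :=
        continuousAt_const.mul (ContinuousAt.inv₀ (by fun_prop) hne)
      simpa using h1.tendsto.mono_left nhdsWithin_le_nhds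
    · simp [image_eq_zero_of_notMem_tsupport hξ]

theorem exists_tendsto_integral_ball {T : 𝔼 → ℝ} (hT : ContDiff ℝ 2 T) {K : Set ℂ}
    (hK : IsCompact K) (hKc : ∀ t ∈ criticalValues T, (t : ℂ) ∉ K)
    (hcurv : ∀ t : ℝ, (t : ℂ) ∈ K → ∀ ξ, T ξ = t → gaussianCurvature T ξ ≠ 0) (ξ₀ : 𝔼) :
    ∃ R > 0, ∀ H : 𝔼 → ℂ, ContDiff ℝ 1 H → tsupport H ⊆ Metric.ball ξ₀ R → ∀ t : ℝ, (t : ℂ) ∈ K →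
      ∀ σ : ℝ, σ = 1 ∨ σ = -1 → ∃ L,
        Tendsto (fun ε : ℝ => ∫ ξ, H ξ * ((T ξ : ℂ) - (t + σ * ε * Complex.I))⁻¹)
          (𝓝[>] 0) (𝓝 L) := by
  have hcs : ∀ {H : 𝔼 → ℂ} {R : ℝ}, tsupport H ⊆ Metric.ball ξ₀ R → HasCompactSupport H :=
    fun {H R} h => (isCompact_closedBall ξ₀ R).of_isClosed_subset (isClosed_tsupport H)
      (h.trans Metric.ball_subset_closedBall)
  by_cases h : (T ξ₀ : ℂ) ∈ K
  · have h1 : fderiv ℝ T ξ₀ ≠ 0 := fun h0 => hKc _ ⟨ξ₀, rfl, h0⟩ h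
    obtain ⟨R, hR, hRes⟩ := exists_resolventBounded hT h1 (hcurv _ h _ rfl)
    obtain ⟨e, he⟩ : ∃ e, fderiv ℝ T ξ₀ e ≠ 0 := by
      by_contra! h2
      exact h1 (ContinuousLinearMap.ext h2)
    have hTe : Continuous fun ξ => fderiv ℝ T ξ e :=
      (hT.continuous_fderiv (by norm_num)).clm_apply continuous_const
    obtain ⟨R', hR', hball⟩ := Metric.eventually_nhds_iff_ball.1
      (hTe.continuousAt.eventually_ne he)
    let b : ContDiffBump ξ₀ := ⟨R / 2, 3 * R / 4, by positivity, by linarith⟩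
    have hb : tsupport b ⊆ Metric.ball ξ₀ R := by
      rw [b.tsupport_eq]
      exact Metric.closedBall_subset_ball (by change 3 * R / 4 < R; linarith)
    refine ⟨min (R / 2) R', by positivity, fun H hH hHs t _ σ hσ => ?_⟩
    refine exists_tendsto_integral_of_resolventBounded hT b.continuous b.hasCompactSupport
      (fun ξ => b.nonneg) (hRes b b.contDiff (fun ξ => b.nonneg) hb) hH (hcs hHs) (fun ξ hξ => ?_)
      (e := e) (fun ξ hξ => ?_) t hσ
    · exact b.one_of_mem_closedBall (Metric.ball_subset_closedBall
        (Metric.ball_subset_ball (min_le_left _ _) (hHs hξ)))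
    · exact hball ξ (Metric.ball_subset_ball (min_le_right _ _) (hHs hξ))
  · obtain ⟨R, hR, c, hc, hRc⟩ := exists_ball_le_norm_sub hT.continuous hK h
    refine ⟨R, hR, fun H hH hHs t ht σ hσ => ⟨_, tendsto_integral_mul_inv_of_le hT.continuous
      hH.continuous (hcs hHs) hσ hc fun ξ hξ ε => hRc ξ (hHs hξ) _ (Or.inr ?_)⟩⟩
    simpa using ht

/-- The limiting absorption principle for smooth integrands. -/
theorem exists_tendsto_integral_mul_inv {T : 𝔼 → ℝ} (hT : ContDiff ℝ 2 T) {K : Set ℂ}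
    (hK : IsCompact K) (hKc : ∀ t ∈ criticalValues T, (t : ℂ) ∉ K)
    (hcurv : ∀ t : ℝ, (t : ℂ) ∈ K → ∀ ξ, T ξ = t → gaussianCurvature T ξ ≠ 0) {H : 𝔼 → ℂ}
    (hH : ContDiff ℝ 1 H) (hHc : HasCompactSupport H) {t : ℝ} (ht : (t : ℂ) ∈ K) {σ : ℝ}
    (hσ : σ = 1 ∨ σ = -1) :
    ∃ L, Tendsto (fun ε : ℝ => ∫ ξ, H ξ * ((T ξ : ℂ) - (t + σ * ε * Complex.I))⁻¹)
      (𝓝[>] 0) (𝓝 L) := by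
  choose R hR hloc using exists_tendsto_integral_ball hT hK hKc hcurv
  obtain ⟨s, θ, hθ, _, hθR, hθ1⟩ := exists_partition_of_unity_balls hHc.isCompact R hR
  have hi : ∀ i : s, ∃ L, Tendsto (fun ε : ℝ => ∫ ξ, (H ξ * (θ i ξ : ℂ)) *
      ((T ξ : ℂ) - (t + σ * ε * Complex.I))⁻¹) (𝓝[>] 0) (𝓝 L) := fun i =>
    hloc i.1 _ (hH.mul (Complex.ofRealCLM.contDiff.comp ((hθ i).of_le (by norm_num))))
      ((tsupport_mul_subset_right' (g := fun ξ => (θ i ξ : ℂ))).trans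
        ((closure_mono (Function.support_subset_iff'.2 fun ξ hξ => by
          simpa using hξ)).trans (hθR i))) t ht σ hσ
  clear hloc
  choose L hL using hi
  refine ⟨∑ i, L i, (tendsto_finsetSum Finset.univ fun i _ => hL i).congr' ?_⟩
  filter_upwards [self_mem_nhdsWithin] with ε hε
  have hc : Continuous fun ξ => ((T ξ : ℂ) - (t + σ * ε * Complex.I))⁻¹ :=
    Continuous.inv₀ (by have := hT.continuous; fun_prop) fun ξ =>
      ofReal_sub_ne_zero (im_add_mul_I_ne_zero t (ne_of_gt hε) hσ) _
  rw [← integral_finsetSum]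
  · refine integral_congr_ae (Eventually.of_forall fun ξ => ?_)
    simp only
    rw [← Finset.sum_mul, ← Finset.mul_sum, ← Complex.ofReal_sum]
    by_cases hξ : ξ ∈ tsupport H
    · rw [hθ1 ξ hξ, Complex.ofReal_one, mul_one]
    · simp [image_eq_zero_of_notMem_tsupport hξ]
  · intro i _
    exact ((hH.continuous.mul (Complex.continuous_ofReal.comp (hθ i).continuous)).mul
      hc).integrable_of_hasCompactSupport hHc.mul_right.mul_right

end BoundaryIntegral

/-! ### The converse of Hölder's inequality for functions in `L²`. -/

section ConverseHoelder

variable {d : ℕ}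

local notation "𝔼" => EuclideanSpace ℝ (Fin d)

theorem eLpNorm_top_le_of_forall_norm_integral_le (u : LTwo d) {D : ℝ} (hD : 0 ≤ D)
    (h : ∀ φ : LTwo d, MemLp φ 1 volume →
      ‖∫ x, u x * starRingEnd ℂ (φ x)‖ ≤ D * (eLpNorm φ 1 volume).toReal) :
    eLpNorm u ⊤ volume ≤ ENNReal.ofReal D := by
  have hum : Measurable fun x => ‖u x‖ := (Lp.stronglyMeasurable u).norm.measurable
  have key : ∀ a, D < a → volume {x | a ≤ ‖u x‖} = 0 := by
    intro a ha
    have ha0 : 0 < a := hD.trans_lt ha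
    set E := {x | a ≤ ‖u x‖} with hE
    have hEm : MeasurableSet E := measurableSet_le measurable_const hum
    have hfin : volume E ≠ ⊤ := by
      have h1 := (integrable_norm_sq u).measure_ge_lt_top (pow_pos ha0 2)
      refine ne_of_lt (lt_of_le_of_lt (measure_mono fun x hx => ?_) h1)
      exact pow_le_pow_left₀ ha0.le hx 2
    -- The test function is the phase of `u` on `{|u| ≥ a}`, a set of finite measure because `u ∈
    -- L²`. Testing gives `a |E| ≤ D |E|`, so `E` is null when `a > D`.
    set ψ : 𝔼 → ℂ := E.indicator fun x => (‖u x‖ : ℂ)⁻¹ * u x with hψ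
    have hψm : AEStronglyMeasurable ψ := by
      refine AEStronglyMeasurable.indicator ?_ hEm
      exact ((Complex.measurable_ofReal.comp hum).inv.mul
        (Lp.stronglyMeasurable u).measurable).aestronglyMeasurable
    have hψ1 : ∀ x, ‖ψ x‖ ≤ ‖E.indicator (fun _ => (1 : ℂ)) x‖ := by
      intro x
      by_cases hx : x ∈ E
      · rw [hψ, Set.indicator_of_mem hx, Set.indicator_of_mem hx]
        have : (‖u x‖ : ℝ) ≠ 0 := (ha0.trans_le hx).ne'
        simp [this]
      · rw [hψ, Set.indicator_of_notMem hx, Set.indicator_of_notMem hx]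
    have hmem : ∀ r : ℝ≥0∞, MemLp ψ r volume := fun r =>
      (memLp_indicator_const r hEm (1 : ℂ) (Or.inr hfin)).mono hψm (Eventually.of_forall hψ1)
    have hcoe := (hmem 2).coeFn_toLp
    have h1 := h ((hmem 2).toLp ψ) ((memLp_congr_ae hcoe).2 (hmem 1))
    rw [eLpNorm_congr_ae hcoe] at h1
    have h2 : (eLpNorm ψ 1 volume).toReal ≤ volume.real E := by
      refine ENNReal.toReal_mono hfin ((eLpNorm_mono hψ1).trans ?_)
      rw [eLpNorm_indicator_const hEm one_ne_zero ENNReal.one_ne_top]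
      simp
    have h3 : ∫ x, u x * starRingEnd ℂ ((hmem 2).toLp ψ x) = ((∫ x in E, ‖u x‖ : ℝ) : ℂ) := by
      rw [← integral_complex_ofReal, ← integral_indicator hEm]
      refine integral_congr_ae ?_
      filter_upwards [hcoe] with x hx
      rw [hx, hψ]
      by_cases hxE : x ∈ E
      · rw [Set.indicator_of_mem hxE, Set.indicator_of_mem hxE]
        have h4 : (‖u x‖ : ℂ) ≠ 0 := by exact_mod_cast (ha0.trans_le hxE).ne'
        rw [map_mul, map_inv₀, Complex.conj_ofReal, mul_left_comm, Complex.mul_conj,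
          Complex.normSq_eq_norm_sq]
        push_cast
        field_simp
      · rw [Set.indicator_of_notMem hxE, Set.indicator_of_notMem hxE]; simp
    have h4 : a * volume.real E ≤ ∫ x in E, ‖u x‖ := by
      have : IsFiniteMeasure (volume.restrict E) := ⟨by simpa using hfin.lt_top⟩
      have hi : IntegrableOn (fun x => ‖u x‖) E :=
        (((Lp.memLp u).restrict E).integrable (by norm_num)).norm
      exact setIntegral_ge_of_const_le_real hEm hfin (fun x hx => hx) hi
    rw [h3, Complex.norm_real] at h1
    have h5 := (le_abs_self _).trans h1
    have h6 : volume.real E = 0 := by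
      have h0 : 0 ≤ volume.real E := measureReal_nonneg
      nlinarith
    exact ((measureReal_eq_zero_iff hfin).1 h6)
  rw [eLpNorm_exponent_top]
  refine eLpNormEssSup_le_of_ae_bound ?_
  have h1 : ∀ n : ℕ, ∀ᵐ x, ‖u x‖ < D + 1 / (n + 1) := fun n => by
    rw [ae_iff]
    simpa only [not_lt] using key _ (lt_add_of_pos_right D (by positivity))
  filter_upwards [ae_all_iff.2 h1] with x hx
  have h2 : Tendsto (fun n : ℕ => D + 1 / ((n : ℝ) + 1)) atTop (𝓝 (D + 0)) :=
    tendsto_const_nhds.add tendsto_one_div_add_atTop_nhds_zero_nat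
  rw [add_zero] at h2
  exact ge_of_tendsto' h2 fun n => (hx n).le

/-- The extremal function `|u|^(q-2) u` need not lie in `L²`, so `u` is truncated to `{|u| ≤ n}`.
The truncations satisfy the bound with the same constant, which passes to `u` by Fatou's lemma. -/
theorem eLpNorm_le_of_forall_norm_integral_le_of_lt {p q : ℝ} (hpq : p.HolderConjugate q)
    (hq : 2 ≤ q) (u : LTwo d) {D : ℝ} (hD : 0 ≤ D)
    (h : ∀ φ : LTwo d, MemLp φ (ENNReal.ofReal p) volume →
      ‖∫ x, u x * starRingEnd ℂ (φ x)‖ ≤ D * (eLpNorm φ (ENNReal.ofReal p) volume).toReal) :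
    eLpNorm u (ENNReal.ofReal q) volume ≤ ENNReal.ofReal D := by
  have hum : Measurable u := (Lp.stronglyMeasurable u).measurable
  have hp0 : 0 < p := hpq.pos
  have hq0 : 0 < q := hpq.symm.pos
  have hA : ∀ n : ℕ, MeasurableSet {x | ‖u x‖ ≤ n} := fun n =>
    measurableSet_le hum.norm measurable_const
  set w : ℕ → 𝔼 → ℂ := fun n => {x | ‖u x‖ ≤ n}.indicator u with hw
  have hwm : ∀ n, Measurable (w n) := fun n => hum.indicator (hA n)
  have hwn : ∀ n x, ‖w n x‖ ≤ n := by
    intro n x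
    by_cases hx : ‖u x‖ ≤ n
    · rw [hw]; simpa [Set.indicator_of_mem (show x ∈ {x | ‖u x‖ ≤ n} from hx)] using hx
    · rw [hw]; simp [Set.indicator_of_notMem (show x ∉ {x | ‖u x‖ ≤ n} from hx)]
  have hwu : ∀ n x, ‖w n x‖ ≤ ‖u x‖ := fun n x => norm_indicator_le_norm_self _ _
  have huw : ∀ n x, u x * starRingEnd ℂ (w n x) = (‖w n x‖ : ℂ) ^ 2 := by
    intro n x
    by_cases hx : x ∈ {x | ‖u x‖ ≤ n}
    · rw [hw]; simp only [Set.indicator_of_mem hx]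
      rw [Complex.mul_conj, Complex.normSq_eq_norm_sq]; push_cast; rfl
    · rw [hw]; simp [Set.indicator_of_notMem hx]
  have hbd : ∀ n, eLpNorm (w n) (ENNReal.ofReal q) volume ≤ ENNReal.ofReal D := by
    intro n
    have hI : Integrable fun x => ‖w n x‖ ^ q := by
      refine ((integrable_norm_sq u).const_mul ((n : ℝ) ^ (q - 2))).mono'
        ((hwm n).norm.pow_const q).aestronglyMeasurable (Eventually.of_forall fun x => ?_)
      rw [Real.norm_of_nonneg (by positivity)]
      rcases (norm_nonneg (w n x)).eq_or_lt with h0 | h0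
      · rw [← h0, Real.zero_rpow hq0.ne']; positivity
      · calc ‖w n x‖ ^ q = ‖w n x‖ ^ (q - 2) * ‖w n x‖ ^ 2 := by
              rw [← Real.rpow_natCast, ← Real.rpow_add h0]; norm_num
          _ ≤ (n : ℝ) ^ (q - 2) * ‖u x‖ ^ 2 :=
              mul_le_mul (Real.rpow_le_rpow (norm_nonneg _) (hwn n x) (by linarith))
                (pow_le_pow_left₀ (norm_nonneg _) (hwu n x) 2) (by positivity) (by positivity)
    have hwq : MemLp (w n) (ENNReal.ofReal q) volume := by
      rw [← integrable_norm_rpow_iff (hwm n).aestronglyMeasurable (by simpa using hq0)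
        ENNReal.ofReal_ne_top, ENNReal.toReal_ofReal hq0.le]
      exact hI
    set I := ∫ x, ‖w n x‖ ^ q with hIdef
    have hI0 : 0 ≤ I := integral_nonneg fun _ => by positivity
    set ψ : 𝔼 → ℂ := fun x => ((‖w n x‖ ^ (q - 2) : ℝ) : ℂ) * w n x with hψ
    have hψm : AEStronglyMeasurable ψ :=
      ((Complex.measurable_ofReal.comp ((hwm n).norm.pow_const (q - 2))).mul
        (hwm n)).aestronglyMeasurable
    have hψn : ∀ x, ‖ψ x‖ = ‖w n x‖ ^ (q - 1) := by
      intro x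
      rw [hψ, norm_mul, Complex.norm_real, Real.norm_of_nonneg (by positivity)]
      rcases (norm_nonneg (w n x)).eq_or_lt with h0 | h0
      · rw [← h0, mul_zero, Real.zero_rpow (by linarith)]
      · conv_lhs => rw [← Real.rpow_one ‖w n x‖, ← Real.rpow_mul h0.le, one_mul,
          ← Real.rpow_add h0]
        congr 1; ring
    have hψp : ∀ x, ‖ψ x‖ ^ p = ‖w n x‖ ^ q := by
      intro x
      rw [hψn, ← Real.rpow_mul (norm_nonneg _)]
      congr 1
      have := hpq.mul_eq_add
      nlinarith
    have hψ2 : MemLp ψ 2 volume := by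
      refine ((Lp.memLp u).const_mul ((n : ℝ) ^ (q - 2) : ℝ)).mono hψm (Eventually.of_forall fun x => ?_)
      simp only [hψ, norm_mul, Complex.norm_real]
      rw [Real.norm_of_nonneg (by positivity), Real.norm_of_nonneg (by positivity)]
      exact mul_le_mul (Real.rpow_le_rpow (norm_nonneg _) (hwn n x) (by linarith)) (hwu n x)
        (norm_nonneg _) (by positivity)
    have hψP : MemLp ψ (ENNReal.ofReal p) volume := by
      rw [← integrable_norm_rpow_iff hψm (by simpa using hp0)
        ENNReal.ofReal_ne_top, ENNReal.toReal_ofReal hp0.le]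
      simpa only [hψp] using hI
    have hcoe := hψ2.coeFn_toLp
    have h1 := h (hψ2.toLp ψ) ((memLp_congr_ae hcoe).2 hψP)
    rw [eLpNorm_congr_ae hcoe, hψP.eLpNorm_eq_integral_rpow_norm (by simpa using hp0)
      ENNReal.ofReal_ne_top, ENNReal.toReal_ofReal hp0.le] at h1
    simp only [hψp] at h1
    rw [ENNReal.toReal_ofReal (by positivity)] at h1
    have h2 : ∫ x, u x * starRingEnd ℂ (hψ2.toLp ψ x) = (I : ℂ) := by
      rw [hIdef, ← integral_complex_ofReal]
      refine integral_congr_ae ?_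
      filter_upwards [hcoe] with x hx
      rw [hx, hψ]
      simp only
      rw [map_mul, Complex.conj_ofReal, mul_left_comm, huw]
      norm_cast
      rcases (norm_nonneg (w n x)).eq_or_lt with h0 | h0
      · rw [← h0, Real.zero_rpow hq0.ne']; simp
      · rw [← Real.rpow_natCast, ← Real.rpow_add h0]; norm_num
    rw [h2, Complex.norm_real, Real.norm_of_nonneg hI0] at h1
    rw [hwq.eLpNorm_eq_integral_rpow_norm (by simpa using hq0) ENNReal.ofReal_ne_top,
      ENNReal.toReal_ofReal hq0.le]
    refine ENNReal.ofReal_le_ofReal ?_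
    rw [← hIdef]
    rcases hI0.eq_or_lt with h0 | h0
    · rw [← h0, Real.zero_rpow (inv_ne_zero hq0.ne')]; exact hD
    · have h3 : I = I ^ q⁻¹ * I ^ p⁻¹ := by
        rw [← Real.rpow_add h0, add_comm, hpq.inv_add_inv_eq_one, Real.rpow_one]
      have h4 : 0 < I ^ p⁻¹ := Real.rpow_pos_of_pos h0 _
      refine le_of_mul_le_mul_right ?_ h4
      rw [← h3]; exact h1
  refine Lp.eLpNorm_le_of_ae_tendsto (u := atTop) (Eventually.of_forall hbd)
    (fun n => (hwm n).aestronglyMeasurable) (Eventually.of_forall fun x => ?_)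
  refine tendsto_const_nhds.congr' ?_
  obtain ⟨N, hN⟩ := exists_nat_ge ‖u x‖
  filter_upwards [eventually_ge_atTop N] with n hn
  have hx : x ∈ {x | ‖u x‖ ≤ n} := hN.trans (by exact_mod_cast hn)
  rw [hw]; simp only [Set.indicator_of_mem hx]

/-- The converse of Hölder's inequality. -/
theorem eLpNorm_le_of_forall_norm_integral_le {p q : ℝ≥0∞} (hpq : p.HolderConjugate q)
    (hp : p ≤ 2) (u : LTwo d) {D : ℝ} (hD : 0 ≤ D)
    (h : ∀ φ : LTwo d, MemLp φ p volume →
      ‖∫ x, u x * starRingEnd ℂ (φ x)‖ ≤ D * (eLpNorm φ p volume).toReal) :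
    eLpNorm u q volume ≤ ENNReal.ofReal D := by
  have hp1 : 1 ≤ p := hpq.one_le
  rcases hp1.eq_or_lt with rfl | hp1
  · have hq : q = ⊤ := by
      have := hpq.inv_add_inv_eq_one
      simpa using this
    subst hq
    exact eLpNorm_top_le_of_forall_norm_integral_le u hD h
  · have hpt : p ≠ ⊤ := ne_top_of_le_ne_top (by norm_num) hp
    have hq : 2 ≤ q := by
      have h1 := hpq.inv_add_inv_eq_one
      by_contra! h2
      have h3 : (2 : ℝ≥0∞)⁻¹ < q⁻¹ := ENNReal.inv_lt_inv.2 h2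
      have h4 : (2 : ℝ≥0∞)⁻¹ ≤ p⁻¹ := ENNReal.inv_le_inv.2 hp
      have h5 := ENNReal.add_lt_add_of_le_of_lt (by simp) h4 h3
      rw [ENNReal.inv_two_add_inv_two, h1] at h5
      exact lt_irrefl _ h5
    have hqt : q ≠ ⊤ := by
      rintro rfl
      have h1 := hpq.inv_add_inv_eq_one
      simp at h1
      exact hp1.ne' h1
    have hr : p.toReal.HolderConjugate q.toReal := by
      refine Real.holderConjugate_iff.2 ⟨?_, ?_⟩
      · simpa using (ENNReal.toReal_lt_toReal ENNReal.one_ne_top hpt).2 hp1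
      · have h1 := congrArg ENNReal.toReal hpq.inv_add_inv_eq_one
        rwa [ENNReal.toReal_add (by simpa using (zero_lt_one.trans hp1).ne')
          (by simpa using (lt_of_lt_of_le (by norm_num) hq).ne'), ENNReal.toReal_inv,
          ENNReal.toReal_inv, ENNReal.toReal_one] at h1
    rw [← ENNReal.ofReal_toReal hqt]
    refine eLpNorm_le_of_forall_norm_integral_le_of_lt hr ?_ u hD ?_
    · simpa using (ENNReal.toReal_le_toReal (by norm_num) hqt).2 hq
    · rwa [ENNReal.ofReal_toReal hpt]

end ConverseHoelder

/-! ### From bilinear forms to operators. -/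

section MultiplierOperator

variable {d : ℕ}

local notation "𝔼" => EuclideanSpace ℝ (Fin d)

/-- On `L¹ ∩ L²` the inverse `L²` Fourier transform is given by the Fourier integral. -/
theorem coeFn_fourierInv_ae_eq (f : LTwo d) (hf : Integrable f) :
    (𝓕⁻ f : LTwo d) =ᵐ[volume] 𝓕⁻ (f : 𝔼 → ℂ) := by
  have hc0 : Continuous (𝓕 (f : 𝔼 → ℂ)) :=
    VectorFourier.fourierIntegral_continuous Real.continuous_fourierChar continuous_inner hf
  have hneg : ∀ x, 𝓕⁻ (f : 𝔼 → ℂ) x = 𝓕 (f : 𝔼 → ℂ) (-x) := fun x =>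
    Real.fourierInv_eq_fourier_neg _ _
  have hc : Continuous (𝓕⁻ (f : 𝔼 → ℂ)) := by
    rw [funext hneg]; exact hc0.comp continuous_neg
  refine ae_eq_of_integral_contDiff_smul_eq
    ((Lp.memLp (𝓕⁻ f : LTwo d)).locallyIntegrable (by norm_num)) hc.locallyIntegrable
    fun φ hφ hφc => ?_
  have hφ' : ContDiff ℝ ∞ fun x => (φ x : ℂ) := Complex.ofRealCLM.contDiff.comp hφ
  set Φ : 𝓢(EuclideanSpace ℝ (Fin d), ℂ) :=
    (hφc.comp_left (g := fun x : ℝ => (x : ℂ)) (by simp)).toSchwartzMap hφ' with hΦ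
  have h1 := congrArg (fun D : 𝓢'(EuclideanSpace ℝ (Fin d), ℂ) => D Φ)
    (Lp.fourierInv_toTemperedDistribution_eq f)
  simp only [TemperedDistribution.fourierInv_apply, Lp.toTemperedDistribution_apply] at h1
  have h2 : ∀ x, Φ x = (φ x : ℂ) := fun x => rfl
  have h3 : ∫ x, φ x • (𝓕⁻ f : LTwo d) x = ∫ x, Φ x • (𝓕⁻ f : LTwo d) x := by
    simp only [h2, Complex.real_smul, smul_eq_mul]
  have h4 : ∫ x, φ x • 𝓕⁻ (f : 𝔼 → ℂ) x = ∫ x, 𝓕 (f : 𝔼 → ℂ) x • Φ (-x) := by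
    rw [← integral_neg_eq_self]
    simp only [h2, hneg, Complex.real_smul, smul_eq_mul, mul_comm, neg_neg]
  rw [h3, ← h1, h4]
  have h5 := VectorFourier.integral_fourierIntegral_smul_eq_flip (μ := volume) (ν := volume)
    (L := innerₗ (EuclideanSpace ℝ (Fin d))) Real.continuous_fourierChar continuous_inner hf
    ((Φ.integrable (μ := volume)).comp_neg)
  rw [flip_innerₗ] at h5
  have h6 : ∀ ξ, (𝓕⁻ Φ : 𝓢(𝔼, ℂ)) ξ = 𝓕 (fun x => Φ (-x)) ξ := fun ξ => by
    rw [← Real.fourierInv_eq_fourier_comp_neg, ← SchwartzMap.fourierInv_coe]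
  simp only [smul_eq_mul, h6] at h5 ⊢
  simp_rw [mul_comm _ (f _)]
  exact h5.symm

theorem fourier_fourierMultiplier {m : 𝔼 → ℂ} (hm : AEStronglyMeasurable m) {B : ℝ}
    (hB : ∀ ξ, ‖m ξ‖ ≤ B) (f : LTwo d) :
    (𝓕 (fourierMultiplier m f) : LTwo d) =ᵐ[volume] fun ξ => m ξ * (𝓕 f : LTwo d) ξ := by
  have h : MemLp (fun ξ => m ξ * (𝓕 f : LTwo d) ξ) 2 volume := by
    refine ((Lp.memLp (𝓕 f : LTwo d)).norm.const_mul B).mono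
      (hm.mul (Lp.memLp (𝓕 f : LTwo d)).1) (Eventually.of_forall fun ξ => ?_)
    rw [norm_mul]
    refine le_trans (mul_le_mul_of_nonneg_right (hB ξ) (norm_nonneg _)) (le_abs_self _)
  rw [fourierMultiplier, dif_pos h, FourierTransform.fourier_fourierInv_eq]
  exact h.coeFn_toLp

/-- The gap `δ` makes `(T - z)⁻¹` bounded, so neither of the two multipliers takes its default value
`0`. -/
theorem fourier_localizedResolvent {χ : 𝔼 → ℂ} {T : 𝔼 → ℝ} (hχ : Continuous χ)
    (hχc : HasCompactSupport χ) (hT : Continuous T) {z : ℂ} {δ : ℝ} (hδ : 0 < δ)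
    (hz : ∀ ξ, δ ≤ ‖(T ξ : ℂ) - z‖) (f : LTwo d) :
    (𝓕 (localizedResolvent χ T z f) : LTwo d) =ᵐ[volume]
      fun ξ => cutoffResolvent χ T z ξ * (𝓕 f : LTwo d) ξ := by
  obtain ⟨B, hB⟩ := hχc.exists_bound_of_continuous hχ
  have hne : ∀ ξ, (T ξ : ℂ) - z ≠ 0 := fun ξ => norm_pos_iff.1 (hδ.trans_le (hz ξ))
  have hc : Continuous fun ξ => ((T ξ : ℂ) - z)⁻¹ := Continuous.inv₀ (by fun_prop) hne
  have h1 := fourier_fourierMultiplier hχ.aestronglyMeasurable hB (freeResolvent T z f)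
  have h2 := fourier_fourierMultiplier hc.aestronglyMeasurable (B := δ⁻¹)
    (fun ξ => by rw [norm_inv]; exact inv_anti₀ hδ (hz ξ)) f
  filter_upwards [h1, h2] with ξ h1 h2
  rw [localizedResolvent, h1, freeResolvent, h2, cutoffResolvent, mul_assoc]

theorem integral_mul_conj_eq_fourier (u φ : LTwo d) :
    ∫ x, u x * starRingEnd ℂ (φ x) =
      ∫ ξ, (𝓕 u : LTwo d) ξ * starRingEnd ℂ ((𝓕 φ : LTwo d) ξ) := by
  have h := (Lp.inner_fourier_eq φ u).symm
  rw [L2.inner_def, L2.inner_def] at h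
  simpa only [RCLike.inner_apply] using h

theorem integral_localizedResolvent_mul_conj {χ : 𝔼 → ℂ} {T : 𝔼 → ℝ} (hχ : Continuous χ)
    (hχc : HasCompactSupport χ) (hT : Continuous T) {z : ℂ} {δ : ℝ} (hδ : 0 < δ)
    (hz : ∀ ξ, δ ≤ ‖(T ξ : ℂ) - z‖) (f φ : LTwo d) :
    ∫ x, localizedResolvent χ T z f x * starRingEnd ℂ (φ x) =
      multiplierForm (cutoffResolvent χ T z) f φ := by
  rw [integral_mul_conj_eq_fourier, multiplierForm]
  refine integral_congr_ae ?_
  filter_upwards [fourier_localizedResolvent hχ hχc hT hδ hz f] with ξ hξ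
  rw [hξ, mul_assoc]

theorem FormBound.norm_multiplierForm_le {p : ℝ≥0∞} (hp0 : p ≠ 0) (hpt : p ≠ ⊤) {m : 𝔼 → ℂ} {D : ℝ}
    (h : FormBound p.toReal m D) {f g : LTwo d} (hf : MemLp f p volume) (hg : MemLp g p volume) :
    ‖multiplierForm m f g‖ ≤ D * ((eLpNorm f p volume).toReal * (eLpNorm g p volume).toReal) := by
  have h1 := norm_multiplierForm_le_of_unit_ball (ENNReal.toReal_pos hp0 hpt)
    (fun f g hf hg hf1 hg1 => h f g ⟨hf, hf1⟩ ⟨hg, hg1⟩) (hf.integrable_norm_rpow hp0 hpt)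
    (hg.integrable_norm_rpow hp0 hpt)
  rwa [hf.eLpNorm_eq_integral_rpow_norm hp0 hpt, hg.eLpNorm_eq_integral_rpow_norm hp0 hpt,
    ENNReal.toReal_ofReal (by positivity), ENNReal.toReal_ofReal (by positivity)]

theorem lpLqNormLE_of_formBound {χ : 𝔼 → ℂ} {T : 𝔼 → ℝ} (hχ : Continuous χ)
    (hχc : HasCompactSupport χ) (hT : Continuous T) {z : ℂ} {δ : ℝ} (hδ : 0 < δ)
    (hz : ∀ ξ, δ ≤ ‖(T ξ : ℂ) - z‖) {p q : ℝ≥0∞} (hpq : p.HolderConjugate q) (hp2 : p ≤ 2) {C : ℝ}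
    (hC : 0 ≤ C) (h : FormBound p.toReal (cutoffResolvent χ T z) C) :
    LpLqNormLE (localizedResolvent χ T z) p q C.toNNReal := by
  intro f hf
  have hp0 : p ≠ 0 := (zero_lt_one.trans_le hpq.one_le).ne'
  have hpt : p ≠ ⊤ := ne_top_of_le_ne_top (by norm_num) hp2
  refine (eLpNorm_le_of_forall_norm_integral_le hpq hp2 _
    (D := C * (eLpNorm f p volume).toReal) (by positivity) fun φ hφ => ?_).trans (le_of_eq ?_)
  · rw [integral_localizedResolvent_mul_conj hχ hχc hT hδ hz, mul_assoc]
    exact h.norm_multiplierForm_le hp0 hpt hf hφ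
  · rw [ENNReal.ofReal_mul hC, ENNReal.ofReal_toReal hf.2.ne]
    rfl

/-- The estimate extends to real spectral parameters in the resolvent set. -/
theorem FormBound.of_tendsto {χ : 𝔼 → ℂ} {T : 𝔼 → ℝ} (hχ : Continuous χ)
    (hχc : HasCompactSupport χ) (hT : Continuous T) {t δ : ℝ} (hδ : 0 < δ)
    (ht : ∀ ξ, δ ≤ ‖(T ξ : ℂ) - t‖) {p C : ℝ}
    (h : ∀ ε : ℝ, 0 < ε → FormBound p (cutoffResolvent χ T (t + ε * Complex.I)) C) :
    FormBound p (cutoffResolvent χ T t) C := by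
  intro f g hf hg
  obtain ⟨B, hB⟩ := hχc.exists_bound_of_continuous hχ
  have hle : ∀ ξ (ε : ℝ), δ ≤ ‖(T ξ : ℂ) - (t + ε * Complex.I)‖ := by
    intro ξ ε
    refine (ht ξ).trans ?_
    have h2 := Complex.abs_re_le_norm ((T ξ : ℂ) - (t + ε * Complex.I))
    rw [← Complex.ofReal_sub, Complex.norm_real, Real.norm_eq_abs]
    simpa using h2
  have hlim : Tendsto (fun ε : ℝ => multiplierForm (cutoffResolvent χ T (t + ε * Complex.I)) f g)
      (𝓝[>] 0) (𝓝 (multiplierForm (cutoffResolvent χ T t) f g)) := by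
    refine tendsto_integral_filter_of_dominated_convergence
      (fun ξ => B * δ⁻¹ * ‖(𝓕 f : LTwo d) ξ * starRingEnd ℂ ((𝓕 g : LTwo d) ξ)‖) ?_ ?_ ?_ ?_
    · refine Eventually.of_forall fun ε => ?_
      exact (continuous_cutoffResolvent hχ hT fun ξ =>
        norm_pos_iff.1 (hδ.trans_le (hle ξ ε))).aestronglyMeasurable.mul
          (integrable_fourier_mul_conj f g).1
    · refine Eventually.of_forall fun ε => Eventually.of_forall fun ξ => ?_
      rw [norm_mul, cutoffResolvent, norm_mul, norm_inv]
      have := hle ξ ε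
      gcongr
      · exact (norm_nonneg _).trans (hB 0)
      · exact hB ξ
    · exact (integrable_fourier_mul_conj f g).norm.const_mul _
    · refine Eventually.of_forall fun ξ => Tendsto.mul ?_ tendsto_const_nhds
      have hne : (T ξ : ℂ) - (t + ((0 : ℝ) : ℂ) * Complex.I) ≠ 0 :=
        norm_pos_iff.1 (hδ.trans_le (hle ξ 0))
      have h1 : ContinuousAt (fun ε : ℝ => χ ξ * ((T ξ : ℂ) - (t + ε * Complex.I))⁻¹) 0 :=
        continuousAt_const.mul (ContinuousAt.inv₀ (by fun_prop) hne)
      simpa [cutoffResolvent] using h1.tendsto.mono_left nhdsWithin_le_nhds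
  refine le_of_tendsto hlim.norm ?_
  filter_upwards [self_mem_nhdsWithin] with ε hε using h ε hε f g hf hg

end MultiplierOperator

/-! ### Boundary values on `L² ∩ L^p` and the conclusion. -/

section BoundaryValues

variable {d : ℕ}

local notation "𝔼" => EuclideanSpace ℝ (Fin d)

/-- Modulation of a frequency cutoff, i.e. translation by `x` in physical space. -/
noncomputable def modulate (k : 𝔼 → ℂ) (x ξ : 𝔼) : ℂ :=
  Complex.exp (-((2 * Real.pi * inner ℝ ξ x : ℝ) : ℂ) * Complex.I) * k ξ

theorem contDiff_modulate {k : 𝔼 → ℂ} (hk : ContDiff ℝ ∞ k) (x : 𝔼) :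
    ContDiff ℝ ∞ (modulate k x) := by
  have h1 : ContDiff ℝ ∞ fun ξ : 𝔼 => ((2 * Real.pi * inner ℝ ξ x : ℝ) : ℂ) :=
    Complex.ofRealCLM.contDiff.comp (contDiff_const.mul (contDiff_id.inner ℝ contDiff_const))
  exact ((h1.neg.mul contDiff_const).cexp).mul hk

theorem hasCompactSupport_modulate {k : 𝔼 → ℂ} (hkc : HasCompactSupport k) (x : 𝔼) :
    HasCompactSupport (modulate k x) := hkc.mul_left

/-- The translate by `x` of the inverse Fourier transform of `k`. -/
noncomputable def waveTest {k : 𝔼 → ℂ} (hk : ContDiff ℝ ∞ k) (hkc : HasCompactSupport k) (x : 𝔼) :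
    LTwo d :=
  (bandlimited (contDiff_modulate hk x) (hasCompactSupport_modulate hkc x)).toLp 2

theorem fourier_waveTest {k : 𝔼 → ℂ} (hk : ContDiff ℝ ∞ k) (hkc : HasCompactSupport k) (x : 𝔼) :
    (𝓕 (waveTest hk hkc x) : LTwo d) =ᵐ[volume] modulate k x :=
  fourier_bandlimited _ _

theorem bandlimited_apply {k : 𝔼 → ℂ} (hk : ContDiff ℝ ∞ k) (hkc : HasCompactSupport k) (y : 𝔼) :
    bandlimited hk hkc y = 𝓕⁻ k y := by
  rw [bandlimited, SchwartzMap.fourierInv_coe]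
  rfl

/-- Modulation in frequency is translation in space. Independence of `x` yields a sup bound for the
localised resolvent, which serves as majorant in the limit `ε → 0`. -/
theorem eLpNorm_waveTest {k : 𝔼 → ℂ} (hk : ContDiff ℝ ∞ k) (hkc : HasCompactSupport k) (x : 𝔼)
    (p : ℝ≥0∞) :
    eLpNorm (waveTest hk hkc x) p volume = eLpNorm (bandlimited hk hkc) p volume := by
  rw [waveTest, eLpNorm_congr_ae (SchwartzMap.coeFn_toLp _ _ _)]
  have h1 : (bandlimited (contDiff_modulate hk x) (hasCompactSupport_modulate hkc x) : 𝔼 → ℂ) =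
      (bandlimited hk hkc : 𝔼 → ℂ) ∘ fun y => y - x := by
    ext y
    rw [Function.comp_apply, bandlimited_apply, bandlimited_apply, Real.fourierInv_eq',
      Real.fourierInv_eq']
    congr 1 with ξ
    rw [modulate, smul_eq_mul, smul_eq_mul, ← mul_assoc, ← Complex.exp_add, inner_sub_right]
    congr 2
    push_cast
    ring
  rw [h1, eLpNorm_comp_measurePreserving (bandlimited hk hkc).continuous.aestronglyMeasurable
    (measurePreserving_sub_right volume x)]

/-- Pointwise representation of the localised resolvent. -/
theorem localizedResolvent_ae_eq {χ : 𝔼 → ℂ} {T : 𝔼 → ℝ} (hχ : Continuous χ)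
    (hχc : HasCompactSupport χ) (hT : Continuous T) {k : 𝔼 → ℂ} (hk : ContDiff ℝ ∞ k)
    (hkc : HasCompactSupport k) (hk1 : ∀ ξ ∈ tsupport χ, k ξ = 1) {z : ℂ} {δ : ℝ} (hδ : 0 < δ)
    (hz : ∀ ξ, δ ≤ ‖(T ξ : ℂ) - z‖) (f : LTwo d) :
    localizedResolvent χ T z f =ᵐ[volume]
      fun x => multiplierForm (cutoffResolvent χ T z) f (waveTest hk hkc x) := by
  set u := localizedResolvent χ T z f with hu
  have hm := continuous_cutoffResolvent hχ hT fun ξ => norm_pos_iff.1 (hδ.trans_le (hz ξ))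
  have hmc : HasCompactSupport (cutoffResolvent χ T z) := hχc.mul_right
  have hFu := fourier_localizedResolvent hχ hχc hT hδ hz f
  have hi : Integrable (𝓕 u : LTwo d) := by
    refine (integrable_congr hFu).2 ?_
    exact (hm.memLp_of_hasCompactSupport (p := 2) hmc).integrable_mul (Lp.memLp (𝓕 f : LTwo d))
  have h1 := coeFn_fourierInv_ae_eq (𝓕 u) hi
  rw [FourierTransform.fourierInv_fourier_eq] at h1
  filter_upwards [h1] with x hx
  rw [hx, Real.fourierInv_eq', multiplierForm]
  refine integral_congr_ae ?_
  filter_upwards [hFu, fourier_waveTest hk hkc x] with ξ h2 h3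
  rw [h2, h3, smul_eq_mul, cutoffResolvent]
  by_cases hξ : ξ ∈ tsupport χ
  · rw [modulate, hk1 ξ hξ, mul_one, ← Complex.exp_conj, map_mul, map_neg, Complex.conj_ofReal,
      Complex.conj_I, neg_mul_neg]
    ring
  · simp [image_eq_zero_of_notMem_tsupport hξ]

/-- Boundary values of the form on smooth functions. -/
theorem exists_tendsto_multiplierForm_of_schwartz {T : 𝔼 → ℝ} (hT : ContDiff ℝ 2 T) {K : Set ℂ}
    (hK : IsCompact K) (hKc : ∀ t ∈ criticalValues T, (t : ℂ) ∉ K)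
    (hcurv : ∀ t : ℝ, (t : ℂ) ∈ K → ∀ ξ, T ξ = t → gaussianCurvature T ξ ≠ 0) {χ : 𝔼 → ℂ}
    (hχ : ContDiff ℝ ∞ χ) (hχc : HasCompactSupport χ) {k : 𝔼 → ℂ} (hk : ContDiff ℝ ∞ k)
    (hkc : HasCompactSupport k) {t : ℝ} (ht : (t : ℂ) ∈ K) {σ : ℝ} (hσ : σ = 1 ∨ σ = -1)
    (ψ : 𝓢(𝔼, ℂ)) (x : 𝔼) :
    ∃ L, Tendsto (fun ε : ℝ => multiplierForm (cutoffResolvent χ T (t + σ * ε * Complex.I))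
      (ψ.toLp 2) (waveTest hk hkc x)) (𝓝[>] 0) (𝓝 L) := by
  have hH : ContDiff ℝ 1 fun ξ => χ ξ * ((𝓕 ψ : 𝓢(𝔼, ℂ)) ξ * starRingEnd ℂ (modulate k x ξ)) :=
    (hχ.mul (((𝓕 ψ : 𝓢(𝔼, ℂ)).smooth ⊤).mul
      (Complex.conjCLE.contDiff.comp (contDiff_modulate hk x)))).of_le (by norm_num)
  obtain ⟨L, hL⟩ := exists_tendsto_integral_mul_inv hT hK hKc hcurv hH hχc.mul_right ht hσ
  refine ⟨L, hL.congr fun ε => ?_⟩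
  rw [multiplierForm]
  refine integral_congr_ae ?_
  have h1 : (𝓕 (ψ.toLp 2 : LTwo d) : LTwo d) =ᵐ[volume] (𝓕 ψ : 𝓢(𝔼, ℂ)) := by
    rw [SchwartzMap.toLp_fourier_eq]
    exact SchwartzMap.coeFn_toLp _ _ _
  filter_upwards [h1, fourier_waveTest hk hkc x] with ξ h1 h2
  rw [h1, h2, cutoffResolvent]
  ring

/-- Convergence passes to uniform limits by Cauchy's criterion; the approximants will come from
Schwartz data. -/
theorem exists_tendsto_of_approx {α : Type*} {l : Filter α} [NeBot l] {F : α → ℂ}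
    (h : ∀ η > 0, ∃ G : α → ℂ, (∃ L, Tendsto G l (𝓝 L)) ∧ ∀ᶠ a in l, ‖F a - G a‖ ≤ η) :
    ∃ L, Tendsto F l (𝓝 L) := by
  refine cauchy_map_iff_exists_tendsto.1 (Metric.cauchy_iff.2 ⟨inferInstance, fun η hη => ?_⟩)
  obtain ⟨G, ⟨L, hL⟩, hG⟩ := h (η / 8) (by positivity)
  have h1 := hL.eventually (Metric.ball_mem_nhds L (by positivity : 0 < η / 8))
  refine ⟨F '' {a | ‖F a - G a‖ ≤ η / 8 ∧ G a ∈ Metric.ball L (η / 8)},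
    image_mem_map (hG.and h1), ?_⟩
  have h2 : ∀ y ∈ F '' {a | ‖F a - G a‖ ≤ η / 8 ∧ G a ∈ Metric.ball L (η / 8)},
      dist y L < η / 2 := by
    rintro _ ⟨a, ⟨ha, hb⟩, rfl⟩
    rw [← dist_eq_norm] at ha
    linarith [dist_triangle (F a) (G a) L, Metric.mem_ball.1 hb]
  intro y hy y' hy'
  linarith [dist_triangle_right y y' L, h2 y hy, h2 y' hy']

theorem exists_schwartz_eLpNorm_sub_le {p : ℝ≥0∞} (hp1 : 1 ≤ p) (hpt : p ≠ ⊤) {f : LTwo d}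
    (hf : MemLp f p volume) {η : ℝ} (hη : 0 < η) :
    ∃ ψ : 𝓢(𝔼, ℂ), MemLp (f - ψ.toLp 2 volume : LTwo d) p volume ∧
      (eLpNorm (f - ψ.toLp 2 volume : LTwo d) p volume).toReal ≤ η := by
  obtain ⟨g, hgc, hg, hfg⟩ := hf.exist_eLpNorm_sub_le hpt hp1 hη
  have hcoe : ((f - (hgc.toSchwartzMap hg).toLp 2 volume : LTwo d) : 𝔼 → ℂ) =ᵐ[volume] f - g := by
    filter_upwards [Lp.coeFn_sub f ((hgc.toSchwartzMap hg).toLp 2 volume),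
      SchwartzMap.coeFn_toLp (hgc.toSchwartzMap hg) 2 (volume : Measure 𝔼)] with x h1 h2
    rw [h1, Pi.sub_apply, h2]
    rfl
  refine ⟨hgc.toSchwartzMap hg, (memLp_congr_ae hcoe).2
    (hf.sub (hg.continuous.memLp_of_hasCompactSupport hgc)), ?_⟩
  rw [eLpNorm_congr_ae hcoe]
  exact ENNReal.toReal_le_of_le_ofReal hη.le hfg

/-- Boundary values of the form on `L² ∩ L^p`. -/
theorem exists_tendsto_multiplierForm {T : 𝔼 → ℝ} (hT : ContDiff ℝ 2 T) {K : Set ℂ}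
    (hK : IsCompact K) (hKc : ∀ t ∈ criticalValues T, (t : ℂ) ∉ K)
    (hcurv : ∀ t : ℝ, (t : ℂ) ∈ K → ∀ ξ, T ξ = t → gaussianCurvature T ξ ≠ 0) {χ : 𝔼 → ℂ}
    (hχ : ContDiff ℝ ∞ χ) (hχc : HasCompactSupport χ) {k : 𝔼 → ℂ} (hk : ContDiff ℝ ∞ k)
    (hkc : HasCompactSupport k) {t : ℝ} (ht : (t : ℂ) ∈ K) {σ : ℝ} (hσ : σ = 1 ∨ σ = -1)
    {p : ℝ≥0∞} (hp1 : 1 ≤ p) (hpt : p ≠ ⊤) {C : ℝ} (hC : 0 ≤ C)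
    (hb : ∀ ε : ℝ, 0 < ε →
      FormBound p.toReal (cutoffResolvent χ T (t + σ * ε * Complex.I)) C)
    {f : LTwo d} (hf : MemLp f p volume) (x : 𝔼) :
    ∃ L, Tendsto (fun ε : ℝ => multiplierForm (cutoffResolvent χ T (t + σ * ε * Complex.I))
      f (waveTest hk hkc x)) (𝓝[>] 0) (𝓝 L) := by
  set N := (eLpNorm (waveTest hk hkc x) p volume).toReal with hN
  have hw : MemLp (waveTest hk hkc x) p volume :=
    (memLp_congr_ae (SchwartzMap.coeFn_toLp _ _ _)).2 (SchwartzMap.memLp _ _ _)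
  refine exists_tendsto_of_approx fun η hη => ?_
  -- The difference `f - ψ` is small in `L^p`, and the form bound, uniform in `ε`, turns this into
  -- an error at most `η`. The `1` in the denominator covers `C N = 0`.
  obtain ⟨ψ, hψ, hψn⟩ := exists_schwartz_eLpNorm_sub_le hp1 hpt hf
    (by positivity : 0 < η / (C * N + 1))
  refine ⟨_, exists_tendsto_multiplierForm_of_schwartz hT hK hKc hcurv hχ hχc hk hkc ht hσ ψ x, ?_⟩
  filter_upwards [self_mem_nhdsWithin] with ε hε
  have hne : ∀ ξ, (T ξ : ℂ) - (t + σ * ε * Complex.I) ≠ 0 := fun ξ =>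
    ofReal_sub_ne_zero (im_add_mul_I_ne_zero t (ne_of_gt hε) hσ) _
  obtain ⟨B, hB⟩ := exists_norm_cutoffResolvent_le hχ.continuous hχc hT.continuous hne
  have hm := (continuous_cutoffResolvent hχ.continuous hT.continuous hne).aestronglyMeasurable
    (μ := volume)
  have h1 := multiplierForm_add_left hm hB (f - ψ.toLp 2 volume) (ψ.toLp 2 volume) (waveTest hk hkc x)
  rw [sub_add_cancel] at h1
  rw [h1, add_sub_cancel_right]
  have hN0 : 0 ≤ N := ENNReal.toReal_nonneg
  calc _ ≤ C * ((eLpNorm (f - ψ.toLp 2 volume : LTwo d) p volume).toReal * N) :=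
        (hb ε hε).norm_multiplierForm_le (zero_lt_one.trans_le hp1).ne' hpt hψ hw
    _ ≤ C * (η / (C * N + 1) * N) := by gcongr
    _ = η * (C * N / (C * N + 1)) := by ring
    _ ≤ η * 1 := by
        gcongr
        exact (div_le_one (by positivity)).2 (by linarith)
    _ = η := mul_one η

theorem exists_isBoundaryValue {T : 𝔼 → ℝ} (hT : ContDiff ℝ 2 T) {K : Set ℂ}
    (hK : IsCompact K) (hKc : ∀ t ∈ criticalValues T, (t : ℂ) ∉ K)
    (hcurv : ∀ t : ℝ, (t : ℂ) ∈ K → ∀ ξ, T ξ = t → gaussianCurvature T ξ ≠ 0) {χ : 𝔼 → ℂ}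
    (hχ : ContDiff ℝ ∞ χ) (hχc : HasCompactSupport χ) {t : ℝ} (ht : (t : ℂ) ∈ K) {σ : ℝ}
    (hσ : σ = 1 ∨ σ = -1) {p q : ℝ≥0∞} (hpq : p.HolderConjugate q) (hp2 : p ≤ 2) {C : ℝ}
    (hC : 0 ≤ C) (hb : ∀ ε : ℝ, 0 < ε →
      FormBound p.toReal (cutoffResolvent χ T (t + σ * ε * Complex.I)) C)
    {f : LTwo d} (hf : MemLp f p volume) :
    ∃ g : 𝔼 → ℂ, MemLp g q volume ∧ IsBoundaryValue χ T t σ f g ∧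
      eLpNorm g q volume ≤ C.toNNReal * eLpNorm f p volume := by
  have hp0 : p ≠ 0 := (zero_lt_one.trans_le hpq.one_le).ne'
  have hpt : p ≠ ⊤ := ne_top_of_le_ne_top (by norm_num) hp2
  obtain ⟨k, hk1, hk, hkc⟩ := exists_smooth_cutoff hχc.isCompact
  have hk' : ContDiff ℝ ∞ fun ξ => (k ξ : ℂ) := Complex.ofRealCLM.contDiff.comp hk
  have hkc' : HasCompactSupport fun ξ => (k ξ : ℂ) := hkc.comp_left Complex.ofReal_zero
  set v : ℝ → 𝔼 → ℂ := fun ε x => multiplierForm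
    (cutoffResolvent χ T (t + σ * ε * Complex.I)) f (waveTest hk' hkc' x) with hv
  -- The outputs are band-limited, hence given at each point by testing against a translate of one
  -- Schwartz function; the limit is constructed pointwise.
  choose g hg using fun x => exists_tendsto_multiplierForm hT hK hKc hcurv hχ hχc hk' hkc' ht hσ
    hpq.one_le hpt hC hb hf x
  have hz : ∀ ε : ℝ, 0 < ε → ∀ ξ, ε ≤ ‖(T ξ : ℂ) - (t + σ * ε * Complex.I)‖ := fun ε hε ξ =>
    le_norm_sub _ _ hε.le hσ
  have hae : ∀ ε : ℝ, 0 < ε →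
      localizedResolvent χ T (t + σ * ε * Complex.I) f =ᵐ[volume] v ε := fun ε hε =>
    localizedResolvent_ae_eq hχ.continuous hχc hT.continuous hk' hkc'
      (fun ξ hξ => by rw [hk1 ξ hξ, Complex.ofReal_one]) hε (hz ε hε) f
  have hvm : ∀ ε : ℝ, 0 < ε → AEStronglyMeasurable (v ε) volume := fun ε hε =>
    (Lp.aestronglyMeasurable _).congr (hae ε hε)
  have hvn : ∀ ε : ℝ, 0 < ε →
      eLpNorm (v ε) q volume ≤ C.toNNReal * eLpNorm f p volume := fun ε hε => by
    rw [← eLpNorm_congr_ae (hae ε hε)]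
    exact lpLqNormLE_of_formBound hχ.continuous hχc hT.continuous hε (hz ε hε) hpq hp2 hC
      (hb ε hε) f hf
  set M := C * ((eLpNorm f p volume).toReal *
    (eLpNorm (bandlimited hk' hkc') p volume).toReal) with hM
  have hvM : ∀ ε : ℝ, 0 < ε → ∀ x, ‖v ε x‖ ≤ M := fun ε hε x => by
    have hw : MemLp (waveTest hk' hkc' x) p volume :=
      (memLp_congr_ae (SchwartzMap.coeFn_toLp _ _ _)).2 (SchwartzMap.memLp _ _ _)
    have h1 := (hb ε hε).norm_multiplierForm_le hp0 hpt hf hw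
    rwa [eLpNorm_waveTest] at h1
  -- Measurability of the limit and Fatou's lemma are applied along a sequence.
  set s : ℕ → ℝ := fun n => 1 / ((n : ℝ) + 1) with hs
  have hs0 : ∀ n, 0 < s n := fun n => by positivity
  have hslim : Tendsto s atTop (𝓝[>] 0) := tendsto_nhdsWithin_iff.2
    ⟨tendsto_one_div_add_atTop_nhds_zero_nat, Eventually.of_forall hs0⟩
  have hgm : AEStronglyMeasurable g volume :=
    aestronglyMeasurable_of_tendsto_ae atTop (f := fun n => v (s n)) (fun n => hvm _ (hs0 n))
      (Eventually.of_forall fun x => (hg x).comp hslim)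
  have hgn : eLpNorm g q volume ≤ C.toNNReal * eLpNorm f p volume :=
    Lp.eLpNorm_le_of_ae_tendsto (u := atTop) (f := fun n => v (s n))
      (Eventually.of_forall fun n => hvn _ (hs0 n)) (fun n => hvm _ (hs0 n))
      (Eventually.of_forall fun x => (hg x).comp hslim)
  refine ⟨g, ⟨hgm, hgn.trans_lt (ENNReal.mul_lt_top ENNReal.coe_lt_top hf.2)⟩, fun φ => ?_, hgn⟩
  have h1 : Tendsto (fun ε : ℝ => ∫ x, v ε x * φ x) (𝓝[>] 0) (𝓝 (∫ x, g x * φ x)) := by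
    refine tendsto_integral_filter_of_dominated_convergence (fun x => M * ‖φ x‖) ?_ ?_ ?_ ?_
    · filter_upwards [self_mem_nhdsWithin] with ε hε
      exact (hvm ε hε).mul φ.continuous.aestronglyMeasurable
    · filter_upwards [self_mem_nhdsWithin] with ε hε
      refine Eventually.of_forall fun x => ?_
      rw [norm_mul]
      exact mul_le_mul_of_nonneg_right (hvM ε hε x) (norm_nonneg _)
    · exact (φ.integrable (μ := volume)).norm.const_mul M
    · exact Eventually.of_forall fun x => (hg x).mul_const _
  refine h1.congr' ?_
  filter_upwards [self_mem_nhdsWithin] with ε hε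
  refine integral_congr_ae ?_
  filter_upwards [hae ε hε] with x hx
  rw [hx]

theorem exists_le_norm_sub_of_notMem_multiplierSpectrum {T : 𝔼 → ℝ} {z : ℂ}
    (hz : z ∉ multiplierSpectrum T) : ∃ δ > 0, ∀ ξ, δ ≤ ‖(T ξ : ℂ) - z‖ := by
  obtain ⟨δ, hδ, h⟩ := Metric.isOpen_iff.1 (isClosed_closure (s := Set.range fun ξ => (T ξ : ℂ))).isOpen_compl z hz
  refine ⟨δ, hδ, fun ξ => ?_⟩
  by_contra! h1
  exact h (Metric.mem_ball.2 (by rwa [dist_eq_norm])) (subset_closure ⟨ξ, rfl⟩)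

end BoundaryValues

theorem lemma3p3 {d : ℕ} (T : EuclideanSpace ℝ (Fin d) → ℝ) (hT : ContDiff ℝ 2 T)
    (K : Set ℂ) (hK : IsCompact K)
    (hKc : ∀ t ∈ criticalValues T, (t : ℂ) ∉ K)
    (hcurv : ∀ t : ℝ, (t : ℂ) ∈ K → ∀ ξ, T ξ = t → gaussianCurvature T ξ ≠ 0)
    (χ : EuclideanSpace ℝ (Fin d) → ℂ) (hχ : ContDiff ℝ ∞ χ) (hχc : HasCompactSupport χ)
    (p q : ℝ≥0∞) (hp1 : 1 ≤ p) (hp : p ≤ ENNReal.ofReal (2 * (d + 1) / (d + 3)))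
    (hpq : p.HolderConjugate q) :
    ∃ C : ℝ≥0,
      (∀ z ∈ K, z ∉ multiplierSpectrum T → LpLqNormLE (localizedResolvent χ T z) p q C) ∧
      (∀ t : ℝ, (t : ℂ) ∈ K → ∀ σ : ℝ, σ = 1 ∨ σ = -1 →
        ∀ f : Lp ℂ 2 (volume : Measure (EuclideanSpace ℝ (Fin d))), MemLp f p volume →
          ∃ g : EuclideanSpace ℝ (Fin d) → ℂ, MemLp g q volume ∧ IsBoundaryValue χ T t σ f g ∧
            eLpNorm g q volume ≤ C * eLpNorm f p volume) := by
  have hpt : p ≠ ⊤ := ne_top_of_le_ne_top ENNReal.ofReal_ne_top hp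
  have hpS : p.toReal ≤ steinTomas d := ENNReal.toReal_le_of_le_ofReal steinTomas_pos.le hp
  have hpr1 : 1 ≤ p.toReal := by simpa using (ENNReal.toReal_le_toReal ENNReal.one_ne_top hpt).2 hp1
  have hp2 : p ≤ 2 := hp.trans (by
    rw [← ENNReal.ofReal_ofNat]
    exact ENNReal.ofReal_le_ofReal steinTomas_le_two)
  obtain ⟨C, hC, hb⟩ := exists_formBound_cutoffResolvent hT hK hKc hcurv hχ hχc hpr1 hpS
  refine ⟨C.toNNReal, fun z hzK hz => ?_, fun t ht σ hσ f hf => ?_⟩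
  · obtain ⟨δ, hδ, hle⟩ := exists_le_norm_sub_of_notMem_multiplierSpectrum hz
    refine lpLqNormLE_of_formBound hχ.continuous hχc hT.continuous hδ hle hpq hp2 hC ?_
    by_cases him : z.im = 0
    · have hzr : z = (z.re : ℂ) := Complex.ext rfl (by simpa using him)
      rw [hzr] at hle hzK ⊢
      refine FormBound.of_tendsto hχ.continuous hχc hT.continuous hδ hle fun ε hε => ?_
      exact hb _ (by simpa using hε.ne') (Or.inr (by simpa using hzK))
    · exact hb z him (Or.inl hzK)
  · exact exists_isBoundaryValue hT hK hKc hcurv hχ hχc ht hσ hpq hp2 hC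
      (fun ε hε => hb _ (im_add_mul_I_ne_zero t hε.ne' hσ) (Or.inr (by simpa using ht))) hf
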